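/- **Diagrams.** A *knotted 4-valent graph diagram* $D$ is an immersion in $\mathbb R^2$ of a finite 4-valent graph (closed loops without vertices, several components and the empty graph are allowed) whose only singularities are finitely many transversal double points away from the vertices, called crossings, each with a specified upper and lower branch. Diagrams are taken in general position with respect to the height function: cut by horizontal lines into layers containing vertical strands and exactly one minimum, maximum, crossing or vertex; every diagram is planar isotopic to one of this form. *Regular rigid vertex isotopy* is generated by planar isotopy, the Reidemeister moves II and III, passing a strand over or under a vertex, and turning a vertex rigidly over (which moves a crossing of two adjacent edges from one side of the vertex to the other side). $D$ is *oriented* if its strands are oriented so that at every crossing and every vertex both strands run straight through (each edge at a vertex continues as the opposite edge). Compass directions label the four ends of a crossing or vertex drawn as an X; pictures are taken up to rotation of the plane. Write $\times$ for a vertex, $X_+$ for the crossing whose SW–NE strand is the upper one, $X_-$ for the crossing whose SE–NW strand is the upper one, $)($ for two arcs joining SW with NW and SE with NE, and $\asymp$ for two arcs joining SW with SE and NW with NE. Diagrams in one relation agree outside the part shown. Let $$\Lambda=\mathbb Z[q^{\pm1},a^{\pm1},(q-q^{-1})^{-1}],\qquad \Lambda_1=\mathbb Z[q^{\pm1},(q-q^{-1})^{-1}].$$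 **The Kauffman–Vogel polynomial** is the function $D\mapsto P(D)=P(D)(q,a)\in\Lambda$ on unoriented diagrams which is invariant under regular rigid vertex isotopy and satisfies $P(\emptyset)=1$, $P(\bigcirc)=\frac{a-a^{-1}}{q-q^{-1}}+1$, $$P(X_+)-P(X_-)=(q-q^{-1})\bigl(P()()-P(\asymp)\bigr),$$ $P(\text{strand with a positive kink})=a\,P(\text{strand})$ (in a positive kink, the NE and SE ends of an $X_+$ are joined by an arc), and $$P(\times)=-P(X_+)+q\,P()()+q^{-1}P(\asymp)=-P(X_-)+q^{-1}P()()+q\,P(\asymp).$$ **The Murakami–Ohtsuki–Yamada (MOY) polynomial** is the function $D\mapsto R(D)=R(D)(q,a)\in\Lambda$ on oriented diagrams which is invariant under regular rigid vertex isotopy and satisfies $R(\emptyset)=1$, $R(\bigcirc)=\frac{a-a^{-1}}{q-q^{-1}}$ and $R(\text{strand with a positive kink})=a\,R(\text{strand})$ for both orientations, and, with all strands oriented from south to north, $$R(X_+)-R(X_-)=(q-q^{-1})R()(),\qquad R(\times)=-R(X_+)+q\,R()()=-R(X_-)+q^{-1}R()().$$ Put $P_M(D)(q)=P(D)(q,q^{M-1})$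 (the $\mathfrak{so}(M)$ Kauffman–Vogel polynomial) and $R_N(D)(q)=R(D)(q,q^N)$ (the $\mathfrak{sl}(N)$ MOY polynomial), elements of $\Lambda_1$. **States.** An edge of a diagram $D$ is a segment between adjacent crossings or vertices, or a closed component without crossings and vertices. An orientation $\varrho$ of all edges is *balanced* if at each crossing and each vertex two edges point inward and two outward. It is *admissible* if moreover there is no crossing at which both ends of the upper strand point inward. Let $\mathcal O(D)$ be the finite set of admissible balanced edge orientations. A crossing is *top outward* if both ends of its upper strand point outward; a vertex is *non-crossing-like* if two opposite edges point outward. A *resolution* $\varsigma\in\Sigma(D_\varrho)$ chooses, at each top outward crossing and each non-crossing-like vertex, one of the two smoothings compatible with $\varrho$: the one in which both incoming strands turn left, or the one in which both turn right. The weight $[D_\varrho,\varsigma]$ is the product of the local weights, which are - at a top outward crossing: $q-q^{-1}$ for turning right (resolution $A$), $-q+q^{-1}$ for turning left (resolution $B$); - at a non-crossing-like vertex: $q$ for turning left (resolution $L$), $q^{-1}$ for turning right (resolution $R$). Let $D_{\varrho,\varsigma}$ be the resulting oriented knotted 4-valent graph diagram, and $\mathrm{rot}(D_{\varrho,\varsigma})\in\mathbb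 Z$ its rotation number as an immersed curve (the degree of its Gauss map; a counterclockwise circle has rotation number $1$). **Theorem (generalized Jaeger formula).** The functions $P$ and $R$ exist and are uniquely determined by the above properties, and for every unoriented knotted 4-valent graph diagram $D$, in $\Lambda$, $$P(D)(q,a^2q^{-1})=\sum_{\varrho\in\mathcal O(D)}\ \sum_{\varsigma\in\Sigma(D_\varrho)}(a^{-1}q)^{\mathrm{rot}(D_{\varrho,\varsigma})}\,[D_\varrho,\varsigma]\,R(D_{\varrho,\varsigma})(q,a).$$ Consequently, for every integer $N\ge 1$, in $\Lambda_1$, $$P_{2N}(D)(q)=\sum_{\varrho\in\mathcal O(D)}\ \sum_{\varsigma\in\Sigma(D_\varrho)}q^{-(N-1)\,\mathrm{rot}(D_{\varrho,\varsigma})}\,[D_\varrho,\varsigma]\,R_N(D_{\varrho,\varsigma})(q).$$ -/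

import Mathlib

/-!
# Knotted 4-valent graph diagrams and their polynomials

Diagrams in the plane are taken in general position with respect to the height function, that is, cut
by horizontal lines into layers which contain one elementary piece each: a minimum (`cup`), a maximum
(`cap`), a crossing or a 4-valent vertex.  Every diagram of a knotted 4-valent graph is planar isotopic
to such a layered diagram, and regular rigid vertex isotopy is generated by the local moves below.
-/

namespace KnottedGraph

/-! ### Layered diagrams -/

/-- A kind of elementary pieces.  `dom g` and `cod g` list, from left to right, the labels of the
strands at the bottom and at the top of the piece `g`. -/
class Pieces (G : Type) (C : outParam Type) where
  dom : G → List C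
  cod : G → List C

/-- A layered tangle diagram, read from bottom to top.  A layer `(i, g)` is the piece `g` with exactly
`i` vertical strands to its left (and any number of vertical strands to its right). -/
abbrev Layers (G : Type) := List (ℕ × G)

/-- The layer `x` leads from the row of strands `s` to the row of strands `t`. -/
def Step {G C : Type} [Pieces G C] (x : ℕ × G) (s t : List C) : Prop :=
  ∃ l r : List C, l.length = x.1 ∧
    s = l ++ Pieces.dom x.2 ++ r ∧ t = l ++ Pieces.cod x.2 ++ r

/-- The layers fit together to a diagram from the row of strands `s` to the row of strands `t`. -/
def Runs {G C : Type} [Pieces G C] : Layers G → List C → List C → Prop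
  | [], s, t => s = t
  | x :: w, s, t => ∃ r, Step x s r ∧ Runs w r t

/-- Closed diagrams: no strand ends at the bottom or at the top. -/
def ClosedDiagram (G : Type) {C : Type} [Pieces G C] := {w : Layers G // Runs w [] []}

/-- The two kinds of crossings: in `slash` the strand from the south-west to the north-east is the
upper one, in `backslash` the strand from the south-east to the north-west is. -/
inductive Crossing
  | slash | backslash
  deriving DecidableEq

instance : Fintype Crossing := ⟨{.slash, .backslash}, by rintro (_ | _) <;> simp⟩

/-- The mirror image of a crossing. -/
def Crossing.flip : Crossing → Crossing
  | .slash => .backslash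
  | .backslash => .slash

/-! ### Unoriented diagrams -/

/-- Elementary pieces of unoriented diagrams. -/
inductive Piece
  | cup | cap | cross (c : Crossing) | vert
  deriving DecidableEq

instance : Pieces Piece Unit where
  dom
    | .cup => []
    | .cap => [(), ()]
    | .cross _ => [(), ()]
    | .vert => [(), ()]
  cod
    | .cup => [(), ()]
    | .cap => []
    | .cross _ => [(), ()]
    | .vert => [(), ()]

/-- Diagrams of unoriented knotted 4-valent graphs. -/
abbrev Diagram := ClosedDiagram Piece

open Piece in
/-- The local moves which generate regular rigid vertex isotopy of layered diagrams. -/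
inductive Move : Layers Piece → Layers Piece → Prop
  /-- Planar isotopy: two pieces beside each other exchange their heights. -/
  | exchange (g h : Piece) (i k : ℕ) :
      Move [(i, g), (i + (Pieces.cod g).length + k, h)]
        [(i + (Pieces.dom g).length + k, h), (i, g)]
  /-- Planar isotopy: a minimum cancels with an adjacent maximum. -/
  | zigzag (i : ℕ) : Move [(i + 1, cup), (i, cap)] []
  | zagzig (i : ℕ) : Move [(i, cup), (i + 1, cap)] []
  /-- Planar isotopy: a crossing or a vertex turns by a right angle past a minimum or a maximum. -/
  | crossCup (c : Crossing) (i : ℕ) :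
      Move [(i, cup), (i + 1, cross c)] [(i + 1, cup), (i, cross c.flip)]
  | crossCap (c : Crossing) (i : ℕ) :
      Move [(i + 1, cross c), (i, cap)] [(i, cross c.flip), (i + 1, cap)]
  | vertCup (i : ℕ) : Move [(i, cup), (i + 1, vert)] [(i + 1, cup), (i, vert)]
  | vertCap (i : ℕ) : Move [(i + 1, vert), (i, cap)] [(i, vert), (i + 1, cap)]
  /-- The second Reidemeister move. -/
  | reidemeisterTwo (c : Crossing) (i : ℕ) : Move [(i, cross c), (i, cross c.flip)] []
  /-- The third Reidemeister move. -/
  | reidemeisterThree (c : Crossing) (i : ℕ) :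
      Move [(i, cross c), (i + 1, cross c), (i, cross c)]
        [(i + 1, cross c), (i, cross c), (i + 1, cross c)]
  /-- A strand passes over or under a vertex. -/
  | vertexPass (c : Crossing) (i : ℕ) :
      Move [(i, vert), (i + 1, cross c), (i, cross c)]
        [(i + 1, cross c), (i, cross c), (i + 1, vert)]
  /-- A rigid vertex is turned over by half a revolution. -/
  | vertexFlip (c : Crossing) (i : ℕ) :
      Move [(i, cross c), (i, vert)] [(i, vert), (i, cross c)]

/-! ### Oriented diagrams -/

/-- Elementary pieces of diagrams of oriented knotted 4-valent graphs.  Strands are labelled by `true`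
if they point upward, and by `false` if they point downward.  The label of a minimum or maximum is that
of its left leg, and the labels of a crossing or vertex are those of the strands which enter the picture
at the south-west and at the south-east; both run straight through the crossing or vertex. -/
inductive OPiece
  | cup (o : Bool) | cap (o : Bool) | cross (c : Crossing) (sw se : Bool) | vert (sw se : Bool)
  deriving DecidableEq

instance : Pieces OPiece Bool where
  dom
    | .cup _ => []
    | .cap o => [o, !o]
    | .cross _ sw se => [sw, se]
    | .vert sw se => [sw, se]
  cod
    | .cup o => [o, !o]
    | .cap _ => []
    | .cross _ sw se => [se, sw]
    | .vert sw se => [se, sw]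

/-- Diagrams of oriented knotted 4-valent graphs. -/
abbrev ODiagram := ClosedDiagram OPiece

def OPiece.forget : OPiece → Piece
  | .cup _ => .cup
  | .cap _ => .cap
  | .cross c _ _ => .cross c
  | .vert _ _ => .vert

/-- The underlying unoriented layers. -/
def forgetO (w : Layers OPiece) : Layers Piece := w.map fun x => (x.1, x.2.forget)

/-- The contribution of a piece to the degree of the Gauss map, counted over the direction pointing to
the right: `+1` for a minimum and `-1` for a maximum that is traversed from left to right. -/
def OPiece.turning : OPiece → ℤ
  | .cup o => if o = false then 1 else 0
  | .cap o => if o = true then -1 else 0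
  | .cross _ _ _ => 0
  | .vert _ _ => 0

/-- The rotation number of an oriented diagram, as an immersed curve in the plane: the degree of its
Gauss map.  A counterclockwise circle has rotation number `1`. -/
def rot (D : ODiagram) : ℤ := (D.1.map fun x => x.2.turning).sum

/-! ### The coefficient rings -/

/-- The ring `ℤ[q, q⁻¹, a, a⁻¹, (q - q⁻¹)⁻¹]`. -/
abbrev Coeff :=
  Localization.Away
    (MvPolynomial.X 0 * MvPolynomial.X 1 * (MvPolynomial.X 0 ^ 2 - 1) : MvPolynomial (Fin 2) ℤ)

/-- The ring `ℤ[q, q⁻¹, (q - q⁻¹)⁻¹]`. -/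
abbrev CoeffOne :=
  Localization.Away (Polynomial.X * (Polynomial.X ^ 2 - 1) : Polynomial ℤ)

theorem isUnit_coeff :
    IsUnit (algebraMap (MvPolynomial (Fin 2) ℤ) Coeff
      (MvPolynomial.X 0 * MvPolynomial.X 1 * (MvPolynomial.X 0 ^ 2 - 1))) :=
  IsLocalization.Away.algebraMap_isUnit _

theorem isUnit_coeffOne :
    IsUnit (algebraMap (Polynomial ℤ) CoeffOne (Polynomial.X * (Polynomial.X ^ 2 - 1))) :=
  IsLocalization.Away.algebraMap_isUnit _

theorem isUnit_q : IsUnit (algebraMap (MvPolynomial (Fin 2) ℤ) Coeff (MvPolynomial.X 0)) := by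
  have h := isUnit_coeff
  rw [map_mul, map_mul, IsUnit.mul_iff, IsUnit.mul_iff] at h
  exact h.1.1

theorem isUnit_a : IsUnit (algebraMap (MvPolynomial (Fin 2) ℤ) Coeff (MvPolynomial.X 1)) := by
  have h := isUnit_coeff
  rw [map_mul, map_mul, IsUnit.mul_iff, IsUnit.mul_iff] at h
  exact h.1.2

theorem isUnit_qOne : IsUnit (algebraMap (Polynomial ℤ) CoeffOne Polynomial.X) := by
  have h := isUnit_coeffOne
  rw [map_mul, IsUnit.mul_iff] at h
  exact h.1

/-- The variable `q` of `Coeff`. -/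
noncomputable def q : Coeffˣ := isUnit_q.unit

/-- The variable `a` of `Coeff`. -/
noncomputable def a : Coeffˣ := isUnit_a.unit

/-- The variable `q` of `CoeffOne`. -/
noncomputable def qOne : CoeffOneˣ := isUnit_qOne.unit

theorem isUnit_sub_inv_iff {S : Type*} [CommRing S] (x : Sˣ) :
    IsUnit ((x : S) - ↑x⁻¹) ↔ IsUnit ((x : S) ^ 2 - 1) := by
  have h : (x : S) ^ 2 - 1 = x * ((x : S) - ↑x⁻¹) := by
    rw [mul_sub, Units.mul_inv, sq]
  rw [h, IsUnit.mul_iff]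
  simp

theorem isUnit_q_sub : IsUnit ((q : Coeff) - ↑q⁻¹) := by
  rw [isUnit_sub_inv_iff]
  have h := isUnit_coeff
  rw [map_mul, IsUnit.mul_iff] at h
  simpa [q] using h.2

theorem isUnit_qOne_sub : IsUnit ((qOne : CoeffOne) - ↑qOne⁻¹) := by
  rw [isUnit_sub_inv_iff]
  have h := isUnit_coeffOne
  rw [map_mul, IsUnit.mul_iff] at h
  simpa [qOne] using h.2

/-- The element `q - q⁻¹` of `Coeff`, as a unit. -/
noncomputable def z : Coeffˣ := isUnit_q_sub.unit

/-- The substitution `f ↦ f(x, y)`, that is, `q ↦ x` and `a ↦ y`. -/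
noncomputable def substitute {S : Type} [CommRing S] (x y : Sˣ) (h : IsUnit ((x : S) - ↑x⁻¹)) :
    Coeff →+* S :=
  IsLocalization.Away.lift
    (MvPolynomial.X 0 * MvPolynomial.X 1 * (MvPolynomial.X 0 ^ 2 - 1) : MvPolynomial (Fin 2) ℤ)
    (g := MvPolynomial.eval₂Hom (Int.castRingHom S) ![(x : S), (y : S)]) (by
      have h2 := (isUnit_sub_inv_iff x).1 h
      have h3 := (x.isUnit.mul y.isUnit).mul h2
      simpa using h3)

/-! ### The Kauffman–Vogel and the Murakami–Ohtsuki–Yamada polynomials -/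

section
open Piece

/-- `P` is invariant under regular rigid vertex isotopy, satisfies the skein relations of the Kauffman
polynomial and the vertex relations of Kauffman and Vogel, and is `1` on the empty diagram.  In each
relation the diagrams agree except for the consecutive layers shown between `u` and `v`. -/
structure IsKauffmanVogel (P : Diagram → Coeff) : Prop where
  isotopy : ∀ (u v x y : Layers Piece) (D E : Diagram), Move x y →
    D.1 = u ++ x ++ v → E.1 = u ++ y ++ v → P D = P E
  empty : ∀ D : Diagram, D.1 = [] → P D = 1
  circle : ∀ D : Diagram, D.1 = [(0, cup), (0, cap)] →
    P D = ((a : Coeff) - ↑a⁻¹) * ↑z⁻¹ + 1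
  skein : ∀ (u v : Layers Piece) (i : ℕ) (D₁ D₂ D₃ D₄ : Diagram),
    D₁.1 = u ++ [(i, cross .slash)] ++ v →
    D₂.1 = u ++ [(i, cross .backslash)] ++ v →
    D₃.1 = u ++ v →
    D₄.1 = u ++ [(i, cap), (i, cup)] ++ v →
    P D₁ - P D₂ = ((q : Coeff) - ↑q⁻¹) * (P D₃ - P D₄)
  kink : ∀ (u v : Layers Piece) (i : ℕ) (D E : Diagram),
    D.1 = u ++ [(i + 1, cup), (i, cross .slash), (i + 1, cap)] ++ v →
    E.1 = u ++ v → P D = a * P E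
  vertexSlash : ∀ (u v : Layers Piece) (i : ℕ) (D D₁ D₃ D₄ : Diagram),
    D.1 = u ++ [(i, vert)] ++ v →
    D₁.1 = u ++ [(i, cross .slash)] ++ v →
    D₃.1 = u ++ v →
    D₄.1 = u ++ [(i, cap), (i, cup)] ++ v →
    P D = - P D₁ + q * P D₃ + ↑q⁻¹ * P D₄
  vertexBackslash : ∀ (u v : Layers Piece) (i : ℕ) (D D₂ D₃ D₄ : Diagram),
    D.1 = u ++ [(i, vert)] ++ v →
    D₂.1 = u ++ [(i, cross .backslash)] ++ v →
    D₃.1 = u ++ v →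
    D₄.1 = u ++ [(i, cap), (i, cup)] ++ v →
    P D = - P D₂ + ↑q⁻¹ * P D₃ + q * P D₄

end

section
open OPiece

/-- `R` is invariant under regular rigid vertex isotopy, satisfies the skein relations of the framed
HOMFLY-PT polynomial and the vertex relations of the MOY polynomial, and is `1` on the empty diagram.
As invariants of framed links in the 3-sphere do, `R` takes the same value on both orientations of the
circle, and the kink relation holds for both orientations of the strand. -/
structure IsMOY (R : ODiagram → Coeff) : Prop where
  isotopy : ∀ (u v x y : Layers OPiece) (D E : ODiagram), Move (forgetO x) (forgetO y) →
    D.1 = u ++ x ++ v → E.1 = u ++ y ++ v → R D = R E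
  empty : ∀ D : ODiagram, D.1 = [] → R D = 1
  circle : ∀ (o : Bool) (D : ODiagram), D.1 = [(0, cup o), (0, cap o)] →
    R D = ((a : Coeff) - ↑a⁻¹) * ↑z⁻¹
  skein : ∀ (u v : Layers OPiece) (i : ℕ) (D₁ D₂ D₃ : ODiagram),
    D₁.1 = u ++ [(i, cross .slash true true)] ++ v →
    D₂.1 = u ++ [(i, cross .backslash true true)] ++ v →
    D₃.1 = u ++ v →
    R D₁ - R D₂ = ((q : Coeff) - ↑q⁻¹) * R D₃
  kink : ∀ (u v : Layers OPiece) (i : ℕ) (o : Bool) (D E : ODiagram),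
    D.1 = u ++ [(i + 1, cup o), (i, cross .slash o o), (i + 1, cap o)] ++ v →
    E.1 = u ++ v → R D = a * R E
  vertexSlash : ∀ (u v : Layers OPiece) (i : ℕ) (D D₁ D₃ : ODiagram),
    D.1 = u ++ [(i, vert true true)] ++ v →
    D₁.1 = u ++ [(i, cross .slash true true)] ++ v →
    D₃.1 = u ++ v →
    R D = - R D₁ + q * R D₃
  vertexBackslash : ∀ (u v : Layers OPiece) (i : ℕ) (D D₂ D₃ : ODiagram),
    D.1 = u ++ [(i, vert true true)] ++ v →
    D₂.1 = u ++ [(i, cross .backslash true true)] ++ v →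
    D₃.1 = u ++ v →
    R D = - R D₂ + ↑q⁻¹ * R D₃

end

/-- The Kauffman–Vogel polynomial `P(D)(q, a)`: the function determined by `IsKauffmanVogel`. -/
noncomputable def kauffmanVogel : Diagram → Coeff := Classical.epsilon IsKauffmanVogel

/-- The Murakami–Ohtsuki–Yamada polynomial `R(D)(q, a)`: the function determined by `IsMOY`. -/
noncomputable def moy : ODiagram → Coeff := Classical.epsilon IsMOY

/-- The `𝔰𝔬(M)` Kauffman–Vogel polynomial `P_M(D)(q) = P(D)(q, q ^ (M - 1))`. -/
noncomputable def soKauffmanVogel (M : ℕ) (D : Diagram) : CoeffOne :=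
  substitute qOne (qOne ^ ((M : ℤ) - 1)) isUnit_qOne_sub (kauffmanVogel D)

/-- The `𝔰𝔩(N)` MOY polynomial `R_N(D)(q) = R(D)(q, q ^ N)`. -/
noncomputable def slMOY (N : ℕ) (D : ODiagram) : CoeffOne :=
  substitute qOne (qOne ^ N) isUnit_qOne_sub (moy D)

/-! ### Edge orientations -/

/-- Elementary pieces of edge-oriented diagrams.  As above, `true` means upward and `false` downward;
the four edges at a crossing or vertex carry their orientations independently. -/
inductive EPiece
  | cup (o : Bool) | cap (o : Bool)
  | cross (c : Crossing) (sw se nw ne : Bool)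
  | vert (sw se nw ne : Bool)
  deriving DecidableEq, Fintype

instance : Pieces EPiece Bool where
  dom
    | .cup _ => []
    | .cap o => [o, !o]
    | .cross _ sw se _ _ => [sw, se]
    | .vert sw se _ _ => [sw, se]
  cod
    | .cup o => [o, !o]
    | .cap _ => []
    | .cross _ _ _ nw ne => [nw, ne]
    | .vert _ _ nw ne => [nw, ne]

namespace EPiece

def forget : EPiece → Piece
  | .cup _ => .cup
  | .cap _ => .cap
  | .cross c _ _ _ _ => .cross c
  | .vert _ _ _ _ => .vert

/-- Two of the four edges at a crossing or vertex point outward, and two point inward. -/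
def Balanced : EPiece → Prop
  | .cup _ => True
  | .cap _ => True
  | .cross _ sw se nw ne => [!sw, !se, nw, ne].count true = 2
  | .vert sw se nw ne => [!sw, !se, nw, ne].count true = 2

/-- A crossing whose upper strand has both ends pointing inward. -/
def TopInward : EPiece → Prop
  | .cross .slash sw _ _ ne => sw = true ∧ ne = false
  | .cross .backslash _ se nw _ => se = true ∧ nw = false
  | _ => False

/-- A crossing whose upper strand has both ends pointing outward. -/
def TopOutward : EPiece → Prop
  | .cross .slash sw _ _ ne => sw = false ∧ ne = true
  | .cross .backslash _ se nw _ => se = false ∧ nw = true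
  | _ => False

/-- A vertex at which two opposite edges point outward (and, if balanced, the other two inward). -/
def NonCrossingLike : EPiece → Prop
  | .vert sw se nw ne => (sw = false ∧ ne = true) ∨ (se = false ∧ nw = true)
  | _ => False

/-- The pieces which are to be resolved. -/
def Resolvable (e : EPiece) : Prop := e.TopOutward ∨ e.NonCrossingLike

instance : DecidablePred Resolvable := by
  rintro (_ | _ | ⟨_ | _, _, _, _, _⟩ | _) <;>
    · simp only [Resolvable, TopOutward, NonCrossingLike]
      infer_instance

end EPiece

/-- Admissible balanced edge orientations of `D`: edge-oriented diagrams with underlying diagram `D`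
which are balanced at every crossing and vertex and have no top inward crossing.  (Orientations of
the strands in each row which fit together through the layers are the same as orientations of the
edges of `D`, where a closed component without crossings and vertices counts as an edge.) -/
structure AdmissibleOrientation (D : Diagram) where
  layers : Layers EPiece
  closed : Runs layers [] []
  forget_eq : (layers.map fun x => (x.1, x.2.forget)) = D.1
  balanced : ∀ x ∈ layers, x.2.Balanced
  admissible : ∀ x ∈ layers, ¬ x.2.TopInward

theorem finite_lifts (w : Layers Piece) :
    {l : Layers EPiece | (l.map fun x => (x.1, x.2.forget)) = w}.Finite := by
  induction w with
  | nil => simp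
  | cons y w ih =>
    refine Set.Finite.subset (((Set.finite_univ (α := EPiece)).prod ih).image
      fun p => (y.1, p.1) :: p.2) ?_
    rintro l hl
    cases l with
    | nil => simp at hl
    | cons x l =>
      simp only [Set.mem_ofPred_eq, List.map_cons, List.cons.injEq] at hl
      refine ⟨(x.2, l), ⟨Set.mem_univ _, hl.2⟩, ?_⟩
      simp [← hl.1]

instance (D : Diagram) : Finite (AdmissibleOrientation D) := by
  have := (finite_lifts D.1).to_subtype
  refine Finite.of_injective
    (fun ρ : AdmissibleOrientation D =>
      (⟨ρ.layers, ρ.forget_eq⟩ :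
        {l : Layers EPiece | (l.map fun x => (x.1, x.2.forget)) = D.1})) ?_
  rintro ⟨⟩ ⟨⟩ h
  simpa using h

noncomputable instance (D : Diagram) : Fintype (AdmissibleOrientation D) := Fintype.ofFinite _

/-! ### Resolutions -/

/-- A resolved crossing or vertex makes both incoming strands turn left, or both turn right.  At a top
outward crossing, `right` is the resolution `A` and `left` is the resolution `B`; at a
non-crossing-like vertex, `left` is the resolution `L` and `right` is the resolution `R`. -/
inductive Turn
  | left | right
  deriving DecidableEq

instance : Fintype Turn := ⟨{.left, .right}, by rintro (_ | _) <;> simp⟩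

/-- The result of resolving, at position `i`, a crossing or vertex whose western ends have the
orientations `sw` and `nw`.  If the south-western end points inward, then turning left from there leads
to the north-western end, and otherwise turning left leads from the south-eastern end to the
south-western one; correspondingly the piece is replaced by two vertical strands, or by a maximum
below a minimum. -/
def smooth (i : ℕ) (sw nw : Bool) (t : Turn) : Layers OPiece :=
  if (t = .left ↔ sw = true) then [] else [(i, .cap sw), (i, .cup nw)]

/-- The layers which replace the piece `e` at position `i`: a resolvable piece is resolved according to
`c`, and all other pieces stay as they are. -/
def resolvePiece (i : ℕ) (e : EPiece) (c : e.Resolvable → Turn) : Layers OPiece :=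
  match e with
  | .cup o => [(i, .cup o)]
  | .cap o => [(i, .cap o)]
  | .cross k sw se nw ne =>
      if h : (EPiece.cross k sw se nw ne).Resolvable then smooth i sw nw (c h)
      else [(i, .cross k sw se)]
  | .vert sw se nw ne =>
      if h : (EPiece.vert sw se nw ne).Resolvable then smooth i sw nw (c h)
      else [(i, .vert sw se)]

/-- The local weight of a resolution, with value `1` at the pieces which are not resolved. -/
def localWeight {S : Type} [CommRing S] (x : Sˣ) (e : EPiece) (c : e.Resolvable → Turn) : S :=
  match e with
  | .cup _ => 1
  | .cap _ => 1
  | .cross k sw se nw ne =>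
      if h : (EPiece.cross k sw se nw ne).Resolvable then
        match c h with
        | .right => (x : S) - ↑x⁻¹
        | .left => -(x : S) + ↑x⁻¹
      else 1
  | .vert sw se nw ne =>
      if h : (EPiece.vert sw se nw ne).Resolvable then
        match c h with
        | .left => (x : S)
        | .right => ↑x⁻¹
      else 1

namespace AdmissibleOrientation

variable {D : Diagram}

/-- A resolution: a choice of one of the two resolutions at every top outward crossing and at every
non-crossing-like vertex. -/
abbrev Resolution (ρ : AdmissibleOrientation D) :=
  (k : Fin ρ.layers.length) → (ρ.layers.get k).2.Resolvable → Turn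

/-- The total weight `[D_ρ, ς]`, with the value `x` for the variable `q`. -/
def weight {S : Type} [CommRing S] (x : Sˣ) (ρ : AdmissibleOrientation D) (ς : ρ.Resolution) : S :=
  ∏ k, localWeight x (ρ.layers.get k).2 (ς k)

/-- The layers of `D_{ρ,ς}`. -/
def resolveLayers (w : Layers EPiece)
    (ς : (k : Fin w.length) → (w.get k).2.Resolvable → Turn) : Layers OPiece :=
  (List.ofFn fun k => resolvePiece (w.get k).1 (w.get k).2 (ς k)).flatten

end AdmissibleOrientation

theorem runs_append {G C : Type} [Pieces G C] {w₁ w₂ : Layers G} {s t : List C} :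
    Runs (w₁ ++ w₂) s t ↔ ∃ r, Runs w₁ s r ∧ Runs w₂ r t := by
  induction w₁ generalizing s with
  | nil => simp [Runs]
  | cons x w ih =>
    simp only [List.cons_append, Runs, ih]
    constructor
    · rintro ⟨r, h, r', h1, h2⟩
      exact ⟨r', ⟨r, h, h1⟩, h2⟩
    · rintro ⟨r', ⟨r, h, h1⟩, h2⟩
      exact ⟨r, h, r', h1, h2⟩

theorem runs_singleton {G C : Type} [Pieces G C] {i : ℕ} {g : G} {l r s t : List C}
    (hl : l.length = i) (hs : s = l ++ Pieces.dom g ++ r) (ht : t = l ++ Pieces.cod g ++ r) :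
    Runs [(i, g)] s t :=
  ⟨t, ⟨l, r, hl, hs, ht⟩, rfl⟩

theorem runs_smooth {i : ℕ} {sw nw : Bool} {l r : List Bool} (hl : l.length = i) (t : Turn)
    (h : sw = nw) : Runs (smooth i sw nw t) (l ++ [sw, !sw] ++ r) (l ++ [nw, !nw] ++ r) := by
  subst h
  unfold smooth
  split
  · rfl
  · refine ⟨l ++ r, ⟨l, r, hl, rfl, by simp [Pieces.cod]⟩, ?_⟩
    exact runs_singleton hl (by simp [Pieces.dom]) rfl

theorem runs_resolvePiece {i : ℕ} {e : EPiece} {s t : List Bool} (h : Step (i, e) s t)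
    (hb : e.Balanced) (ha : ¬ e.TopInward) (c : e.Resolvable → Turn) :
    Runs (resolvePiece i e c) s t := by
  obtain ⟨l, r, hl, rfl, rfl⟩ := h
  cases e with
  | cup o => exact runs_singleton hl rfl rfl
  | cap o => exact runs_singleton hl rfl rfl
  | cross k sw se nw ne =>
    have hcases : ((EPiece.cross k sw se nw ne).Resolvable → se = !sw ∧ sw = nw ∧ ne = !nw) ∧
        (¬ (EPiece.cross k sw se nw ne).Resolvable → nw = se ∧ ne = sw) := by
      clear c
      cases k <;> cases sw <;> cases se <;> cases nw <;> cases ne <;>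
        simp_all [EPiece.Resolvable, EPiece.TopOutward, EPiece.TopInward, EPiece.Balanced,
          EPiece.NonCrossingLike]
    by_cases h : (EPiece.cross k sw se nw ne).Resolvable
    · simp only [resolvePiece, dif_pos h]
      obtain ⟨rfl, h2, rfl⟩ := hcases.1 h
      exact runs_smooth hl _ h2
    · simp only [resolvePiece, dif_neg h]
      obtain ⟨rfl, rfl⟩ := hcases.2 h
      exact runs_singleton hl rfl rfl
  | vert sw se nw ne =>
    have hcases : ((EPiece.vert sw se nw ne).Resolvable → se = !sw ∧ sw = nw ∧ ne = !nw) ∧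
        (¬ (EPiece.vert sw se nw ne).Resolvable → nw = se ∧ ne = sw) := by
      clear c
      cases sw <;> cases se <;> cases nw <;> cases ne <;>
        simp_all [EPiece.Resolvable, EPiece.TopOutward, EPiece.Balanced, EPiece.NonCrossingLike]
    by_cases h : (EPiece.vert sw se nw ne).Resolvable
    · simp only [resolvePiece, dif_pos h]
      obtain ⟨rfl, h2, rfl⟩ := hcases.1 h
      exact runs_smooth hl _ h2
    · simp only [resolvePiece, dif_neg h]
      obtain ⟨rfl, rfl⟩ := hcases.2 h
      exact runs_singleton hl rfl rfl

theorem runs_resolveLayers (w : Layers EPiece)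
    (ς : (k : Fin w.length) → (w.get k).2.Resolvable → Turn) {s t : List Bool}
    (h : Runs w s t) (hb : ∀ x ∈ w, x.2.Balanced) (ha : ∀ x ∈ w, ¬ x.2.TopInward) :
    Runs (AdmissibleOrientation.resolveLayers w ς) s t := by
  induction w generalizing s with
  | nil => simpa [AdmissibleOrientation.resolveLayers, Runs] using h
  | cons x w ih =>
    obtain ⟨r, h1, h2⟩ := h
    have h3 := ih (fun k => ς k.succ) h2 (fun y hy => hb y (List.mem_cons_of_mem _ hy))
      (fun y hy => ha y (List.mem_cons_of_mem _ hy))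
    unfold AdmissibleOrientation.resolveLayers
    simp only [List.length_cons, List.ofFn_succ, List.flatten_cons]
    exact runs_append.2 ⟨r, runs_resolvePiece h1 (hb x List.mem_cons_self)
      (ha x List.mem_cons_self) (ς 0), h3⟩

/-- The oriented diagram `D_{ρ,ς}`. -/
def AdmissibleOrientation.resolve {D : Diagram} (ρ : AdmissibleOrientation D)
    (ς : ρ.Resolution) : ODiagram :=
  ⟨AdmissibleOrientation.resolveLayers ρ.layers ς,
    runs_resolveLayers ρ.layers ς ρ.closed ρ.balanced ρ.admissible⟩

end KnottedGraph

open KnottedGraph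

set_option linter.unusedSectionVars false

/-! The weighted sum over orientations and resolutions satisfies the axioms of the Kauffman–Vogel
polynomial with `a` replaced by `a ^ 2 * q⁻¹`, and these axioms have only one solution. To make the
verification local, tangles act as linear operators: a `TangleRep` assigns operators to minima,
maxima and crossings on a module graded by rows of labelled strands, and `IsSkein` collects the
relations of isotopy, skein and kinks. With one label this is the calculus of the Kauffman
polynomial, with two labels that of the framed HOMFLY-PT polynomial, so both are treated at once.
Vertices are the combinations of a crossing and smoothings dictated by the vertex relations
(`vert`), and their isotopies are consequences (`IsSkein.isotopy`). An invariant of closed diagrams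
becomes a representation by regarding a tangle as a functional of its closures (`functionalRep`);
conversely a representation yields an invariant by a matrix coefficient
(`TangleRep.IsSkein.isInvariant`).

Uniqueness: the standard tangles, built by laying arcs over what is already there, span everything.
Their span over a subring `A` which contains the parameters is stable under all pieces (`closedAt`),
so closed diagrams have values in `A` (`mem_of_mem`). With the diagonal of a product ring as `A`
this is `unique`. With the image of an injective homomorphism it is `descend`: an invariant whose
parameters come from a smaller ring takes its values there.

Existence of the MOY polynomial: for `a = q ^ N` there is a state model with `N` colours
(`VertexModel.isSkein`). The models for all `N` form one invariant over a product of rings into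
which `Coeff` embeds, by Kronecker substitution, and `descend` produces an invariant over `Coeff`.

Jaeger's formula: `jaeger` replaces each piece by the sum of its oriented versions, where a top
outward crossing stands for a multiple of the difference of its two smoothings. The relations are
checked on rows with fixed orientations. The skein relation holds since the top outward crossings
supply the smoothings which the oriented relation lacks. The second and third Reidemeister moves and
the kink relation use that a downward strand has kink factor `q`. Multiplication by `(a⁻¹ * q) ^
rot` achieves this: it preserves all other relations and changes the kink factors `a` into `q` for
downward and `a ^ 2 * q⁻¹` for upward strands, and the latter is the kink factor of the unoriented
invariant. Expanding the product of sums gives the state sum (`jaeger_word`, `stateOp_eq`). Since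
the substitution of `a ^ 2 * q⁻¹` for `a` is injective, `descend` yields the existence of the
Kauffman–Vogel polynomial and the formula together. The formula for `N` is the specialization `a = q
^ N`. -/

namespace KnottedGraph

/-! ### Labelled pieces -/

/-- Labels of strands, with the involution which exchanges the labels of the two legs of an arc. -/
class Labels (C : Type) where
  bar : C → C
  bar_bar (c : C) : bar (bar c) = c
  eq_or_eq_bar (c d : C) : c = d ∨ c = bar d

open Labels

/-- A single label, fixed by `bar`, describes unoriented strands; the two labels of `Bool`,
exchanged by `bar`, describe the two directions. -/
instance : Labels Unit := ⟨id, fun _ => rfl, fun _ _ => Or.inl rfl⟩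

instance : Labels Bool := ⟨not, Bool.not_not, by decide⟩

theorem Crossing.flip_flip (k : Crossing) : k.flip.flip = k := by cases k <;> rfl

/-- Elementary pieces of knot diagrams without vertices, with labelled strands. -/
inductive TanglePiece (C : Type)
  | cup (c : C) | cap (c : C) | cross (k : Crossing) (s t : C)

instance {C : Type} [Labels C] : Pieces (TanglePiece C) C where
  dom
    | .cup _ => []
    | .cap c => [c, bar c]
    | .cross _ s t => [s, t]
  cod
    | .cup c => [c, bar c]
    | .cap _ => []
    | .cross _ s t => [t, s]

/-! ### Representations of tangles -/

/-- A module `V` graded by rows of labelled strands, on which the elementary pieces operate. -/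
structure TangleRep (K V C : Type) [CommRing K] [AddCommGroup V] [Module K V] where
  deg : List C → Submodule K V
  op : ℕ → TanglePiece C → Module.End K V

namespace TangleRep

variable {K V C : Type} [CommRing K] [AddCommGroup V] [Module K V]

abbrev cup (X : TangleRep K V C) (i : ℕ) (c : C) : Module.End K V := X.op i (.cup c)

abbrev cap (X : TangleRep K V C) (i : ℕ) (c : C) : Module.End K V := X.op i (.cap c)

abbrev cross (X : TangleRep K V C) (i : ℕ) (k : Crossing) (s t : C) : Module.End K V :=
  X.op i (.cross k s t)

variable [Labels C]

/-- The operations are compatible with the grading and invariant under planar isotopy. -/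
structure IsPlanar (X : TangleRep K V C) : Prop where
  op_mem : ∀ (g : TanglePiece C) (l r : List C) {f : V}, f ∈ X.deg (l ++ (Pieces.dom g ++ r)) →
    X.op l.length g f ∈ X.deg (l ++ (Pieces.cod g ++ r))
  -- Operations are extended by zero to rows whose labels do not fit, so that in a sum over all
  -- labels only the fitting term survives.
  cap_zero : ∀ (l r : List C) (c s t : C) {f : V}, f ∈ X.deg (l ++ s :: t :: r) →
    ¬ (s = c ∧ t = bar c) → X.cap l.length c f = 0
  cross_zero : ∀ (l r : List C) (k : Crossing) (c d s t : C) {f : V},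
    f ∈ X.deg (l ++ s :: t :: r) → ¬ (s = c ∧ t = d) → X.cross l.length k c d f = 0
  -- The rows enter through equations, so that a row may be written as `[c, d]` when `d` is only
  -- propositionally equal to `bar c`.
  exchange : ∀ (g h : TanglePiece C) (l m r : List C) {x y : List C} {f : V},
    Pieces.dom g = x → Pieces.dom h = y → f ∈ X.deg (l ++ (x ++ (m ++ (y ++ r)))) →
    X.op (l.length + (Pieces.cod g).length + m.length) h (X.op l.length g f) =
      X.op l.length g (X.op (l.length + x.length + m.length) h f)
  zigzag : ∀ (l r : List C) (c d : C) {f : V}, d = bar c → f ∈ X.deg (l ++ c :: r) →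
    X.cap l.length c (X.cup (l.length + 1) d f) = f
  zagzig : ∀ (l r : List C) (c d : C) {f : V}, c = bar d → f ∈ X.deg (l ++ c :: r) →
    X.cap (l.length + 1) d (X.cup l.length c f) = f
  crossCup : ∀ (l r : List C) (k : Crossing) (c d s : C) {f : V}, d = bar c →
    f ∈ X.deg (l ++ s :: r) →
    X.cross (l.length + 1) k d s (X.cup l.length c f) =
      X.cross l.length k.flip s c (X.cup (l.length + 1) c f)

/-- The rotation of crossings past maxima. -/
def RotatesCap (X : TangleRep K V C) : Prop :=
  ∀ (l r : List C) (k : Crossing) (c d s : C) {f : V}, d = bar c →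
    f ∈ X.deg (l ++ c :: s :: d :: r) →
    X.cap l.length c (X.cross (l.length + 1) k s d f) =
      X.cap (l.length + 1) c (X.cross l.length k.flip c s f)

def Inverse (X : TangleRep K V C) (k : Crossing) (s t : C) : Prop :=
  ∀ (l r : List C) {f : V}, f ∈ X.deg (l ++ s :: t :: r) →
    X.cross l.length k.flip t s (X.cross l.length k s t f) = f

def Braid (X : TangleRep K V C) (k : Crossing) (s t u : C) : Prop :=
  ∀ (l r : List C) {f : V}, f ∈ X.deg (l ++ s :: t :: u :: r) →
    X.cross l.length k t u (X.cross (l.length + 1) k s u (X.cross l.length k s t f)) =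
      X.cross (l.length + 1) k s t (X.cross l.length k s u (X.cross (l.length + 1) k t u f))

/-- The representation on the tangles between fixed strands `l` on the left and `r` on the right. -/
def shift (X : TangleRep K V C) (l r : List C) : TangleRep K V C where
  deg s := X.deg (l ++ (s ++ r))
  op i g := X.op (l.length + i) g

/-- All relations are local. After passing to `shift l r` a verification takes place with no further
strands, where rows are literal lists and positions are numerals. -/
theorem IsPlanar.shift {X : TangleRep K V C} (hX : X.IsPlanar) (l r : List C) :
    (X.shift l r).IsPlanar where
  op_mem g l' r' f hf := by
    have := hX.op_mem g (l ++ l') (r' ++ r) (f := f) (by simpa [TangleRep.shift] using hf)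
    simpa [TangleRep.shift] using this
  cap_zero l' r' c s t f hf := by
    have := hX.cap_zero (l ++ l') (r' ++ r) c s t (f := f) (by simpa [TangleRep.shift] using hf)
    simpa [TangleRep.shift] using this
  cross_zero l' r' k c d s t f hf := by
    have := hX.cross_zero (l ++ l') (r' ++ r) k c d s t (f := f)
      (by simpa [TangleRep.shift] using hf)
    simpa [TangleRep.shift] using this
  exchange g h l' m r' x y f hx hy hf := by
    have := hX.exchange g h (l ++ l') m (r' ++ r) hx hy (f := f)
      (by simpa [TangleRep.shift] using hf)
    simpa [TangleRep.shift, add_assoc] using this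
  zigzag l' r' c d f h hf := by
    have := hX.zigzag (l ++ l') (r' ++ r) c d h (f := f) (by simpa [TangleRep.shift] using hf)
    simpa [TangleRep.shift, add_assoc] using this
  zagzig l' r' c d f h hf := by
    have := hX.zagzig (l ++ l') (r' ++ r) c d h (f := f) (by simpa [TangleRep.shift] using hf)
    simpa [TangleRep.shift, add_assoc] using this
  crossCup l' r' k c d s f h hf := by
    have := hX.crossCup (l ++ l') (r' ++ r) k c d s h (f := f)
      (by simpa [TangleRep.shift] using hf)
    simpa [TangleRep.shift, add_assoc] using this

variable [DecidableEq C]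

/-- The skein relation for the crossing of strands with labels `s` and `t`. -/
def Skein (X : TangleRep K V C) (q : Kˣ) (s t : C) : Prop :=
  ∀ (l r : List C) {f : V}, f ∈ X.deg (l ++ s :: t :: r) →
    X.cross l.length .slash s t f - X.cross l.length .backslash s t f =
      -- With one label both smoothings occur, as in the Kauffman relation; with two labels exactly
      -- one of them is compatible with the orientations.
      ((q : K) - ↑q⁻¹) • ((if s = t then f else 0) -
        (if t = bar s then X.cup l.length t (X.cap l.length s f) else 0))

/-- The operations are invariant under regular isotopy, and satisfy the skein relations with parameter
`q` and kink factors `κ`. -/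
structure IsSkein (X : TangleRep K V C) (q : Kˣ) (κ : C → Kˣ) : Prop extends IsPlanar X where
  crossCap : X.RotatesCap
  inverse : ∀ k s t, X.Inverse k s t
  braid : ∀ s t u, X.Braid .slash s t u
  skein : ∀ s t, X.Skein q s t
  -- The kink factor may depend on the label: scaling by the rotation number distinguishes the two
  -- orientations of a kink.
  kink : ∀ (l r : List C) (c : C) {f : V}, f ∈ X.deg (l ++ c :: r) →
    X.cap (l.length + 1) c (X.cross l.length .slash c c (X.cup (l.length + 1) c f)) = (κ c : K) • f

theorem IsSkein.shift {X : TangleRep K V C} {q : Kˣ} {κ : C → Kˣ} (hX : X.IsSkein q κ)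
    (l r : List C) : (X.shift l r).IsSkein q κ where
  toIsPlanar := hX.toIsPlanar.shift l r
  crossCap l' r' k c d s f h hf := by
    have := hX.crossCap (l ++ l') (r' ++ r) k c d s h (f := f)
      (by simpa [TangleRep.shift] using hf)
    simpa [TangleRep.shift, add_assoc] using this
  inverse k s t l' r' f hf := by
    have := hX.inverse k s t (l ++ l') (r' ++ r) (f := f) (by simpa [TangleRep.shift] using hf)
    simpa [TangleRep.shift, add_assoc] using this
  braid s t u l' r' f hf := by
    have := hX.braid s t u (l ++ l') (r' ++ r) (f := f) (by simpa [TangleRep.shift] using hf)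
    simpa [TangleRep.shift, add_assoc] using this
  skein s t l' r' f hf := by
    have := hX.skein s t (l ++ l') (r' ++ r) (f := f) (by simpa [TangleRep.shift] using hf)
    simpa [TangleRep.shift, add_assoc] using this
  kink l' r' c f hf := by
    have := hX.kink (l ++ l') (r' ++ r) c (f := f) (by simpa [TangleRep.shift] using hf)
    simpa [TangleRep.shift, add_assoc] using this

end TangleRep
end KnottedGraph

/-! ### Kinks at maxima and minima, and circles beside a strand. -/

namespace KnottedGraph
open Labels
namespace TangleRep
variable {K V C : Type} [CommRing K] [AddCommGroup V] [Module K V] [Labels C]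
  {X : TangleRep K V C} {f : V}

theorem bar_eq_comm {c d : C} : d = bar c ↔ c = bar d := by
  constructor <;> (rintro rfl; rw [bar_bar])

theorem IsPlanar.cup_mem (hX : X.IsPlanar) (l r : List C) {c d : C} (h : d = bar c)
    (hf : f ∈ X.deg (l ++ r)) : X.cup l.length c f ∈ X.deg (l ++ c :: d :: r) := by
  subst h; exact hX.op_mem (.cup c) l r hf

theorem IsPlanar.cap_mem (hX : X.IsPlanar) (l r : List C) {c d : C} (h : d = bar c)
    (hf : f ∈ X.deg (l ++ c :: d :: r)) : X.cap l.length c f ∈ X.deg (l ++ r) := by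
  subst h; exact hX.op_mem (.cap c) l r hf

theorem IsPlanar.cross_mem (hX : X.IsPlanar) (l r : List C) {k : Crossing} {s t : C}
    (hf : f ∈ X.deg (l ++ s :: t :: r)) : X.cross l.length k s t f ∈ X.deg (l ++ t :: s :: r) :=
  hX.op_mem (.cross k s t) l r hf

theorem dom_cap {c d : C} (h : d = bar c) : Pieces.dom (TanglePiece.cap c) = [c, d] := by
  subst h; rfl

variable [DecidableEq C] {q : Kˣ} {κ : C → Kˣ}

namespace IsSkein

theorem inverse_slash (hX : X.IsSkein q κ) (l r : List C) (s t : C)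
    (hf : f ∈ X.deg (l ++ s :: t :: r)) :
    X.cross l.length .backslash t s (X.cross l.length .slash s t f) = f :=
  hX.inverse .slash s t l r hf

theorem inverse_backslash (hX : X.IsSkein q κ) (l r : List C) (s t : C)
    (hf : f ∈ X.deg (l ++ s :: t :: r)) :
    X.cross l.length .slash t s (X.cross l.length .backslash s t f) = f :=
  hX.inverse .backslash s t l r hf

/-- A strand closed by a maximum with a crossing of the two legs. -/
theorem cap_backslash (hX : X.IsSkein q κ) (l r : List C) {c d : C} (h : d = bar c)
    (hf : f ∈ X.deg (l ++ d :: c :: r)) :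
    X.cap l.length c (X.cross l.length .backslash d c f) = (κ c : K) • X.cap l.length d f := by
  have hY := hX.shift l r
  replace hf : f ∈ (X.shift l r).deg [d, c] := hf
  change (X.shift l r).cap 0 c ((X.shift l r).cross 0 .backslash d c f) =
    (κ c : K) • (X.shift l r).cap 0 d f
  generalize X.shift l r = Y at *
  have h' : c = bar d := bar_eq_comm.1 h
  have m1 : Y.cup 2 c f ∈ Y.deg [d, c, c, d] := hY.cup_mem [d, c] [] h hf
  have m2 : Y.cross 1 .slash c c (Y.cup 2 c f) ∈ Y.deg [d, c, c, d] := hY.cross_mem [d] [d] m1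
  have m3 : Y.cross 0 .backslash d c f ∈ Y.deg [c, d] := hY.cross_mem [] [] hf
  symm
  -- The factor is written as a kink on the right leg. Its crossing then turns past the outer
  -- maximum, and what remains of the kink is a zigzag.
  calc (κ c : K) • Y.cap 0 d f
      = Y.cap 0 d (Y.cap 2 c (Y.cross 1 .slash c c (Y.cup 2 c f))) := by
        rw [← map_smul]; exact congrArg _ (hY.kink [d] [] c hf).symm
    _ = Y.cap 0 c (Y.cap 0 d (Y.cross 1 .slash c c (Y.cup 2 c f))) :=
        (hY.exchange (.cap d) (.cap c) [] [] [] (dom_cap h') (dom_cap h) m2).symm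
    _ = Y.cap 0 c (Y.cap 1 d (Y.cross 0 .backslash d c (Y.cup 2 c f))) :=
        congrArg _ (hY.crossCap [] [d] .slash d c c h' m1)
    _ = Y.cap 0 c (Y.cap 1 d (Y.cup 2 c (Y.cross 0 .backslash d c f))) := by
        have := hY.exchange (.cross .backslash d c) (.cup c) [] [] [] (x := [d, c]) (y := [])
          rfl rfl hf
        exact congrArg (fun v => Y.cap 0 c (Y.cap 1 d v)) this.symm
    _ = Y.cap 0 c (Y.cross 0 .backslash d c f) :=
        congrArg _ (hY.zigzag [c] [] d c h' m3)

/-- Apply `cap_backslash`, with the labels exchanged, to the strands already crossed; the two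
crossings cancel. Hence the inverse, and the other label. -/
theorem cap_slash (hX : X.IsSkein q κ) (l r : List C) {c d : C} (h : d = bar c)
    (hf : f ∈ X.deg (l ++ d :: c :: r)) :
    X.cap l.length c (X.cross l.length .slash d c f) =
      ((κ d)⁻¹ : Kˣ) • X.cap l.length d f := by
  have m : X.cross l.length .slash d c f ∈ X.deg (l ++ c :: d :: r) := hX.cross_mem l r hf
  have := hX.cap_backslash l r (bar_eq_comm.1 h) m
  rw [hX.inverse_slash l r d c hf] at this
  rw [this, Units.smul_def, smul_smul, Units.inv_mul, one_smul]

/-- As for `cap_backslash`, the factor is inserted as a kink on the right leg, now of the minimum,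
and its crossing is turned past a second minimum. -/
theorem cup_backslash (hX : X.IsSkein q κ) (l r : List C) {c d : C} (h : d = bar c)
    (hf : f ∈ X.deg (l ++ r)) :
    X.cross l.length .backslash c d (X.cup l.length c f) = (κ c : K) • X.cup l.length d f := by
  have hY := hX.shift l r
  replace hf : f ∈ (X.shift l r).deg [] := hf
  change (X.shift l r).cross 0 .backslash c d ((X.shift l r).cup 0 c f) =
    (κ c : K) • (X.shift l r).cup 0 d f
  generalize X.shift l r = Y at *
  have h' : c = bar d := bar_eq_comm.1 h
  have m1 : Y.cup 0 d f ∈ Y.deg [d, c] := hY.cup_mem [] [] h' hf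
  have m2 : Y.cup 0 c f ∈ Y.deg [c, d] := hY.cup_mem [] [] h hf
  have m3 : Y.cup 1 d (Y.cup 0 c f) ∈ Y.deg [c, d, c, d] := hY.cup_mem [c] [d] h' m2
  symm
  calc (κ c : K) • Y.cup 0 d f
      = Y.cap 2 c (Y.cross 1 .slash c c (Y.cup 2 c (Y.cup 0 d f))) :=
        (hY.kink [d] [] c m1).symm
    _ = Y.cap 2 c (Y.cross 1 .slash c c (Y.cup 0 d (Y.cup 0 c f))) := by
        have := hY.exchange (.cup d) (.cup c) [] [] [] (x := []) (y := []) rfl rfl hf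
        exact congrArg (fun v => Y.cap 2 c (Y.cross 1 .slash c c v)) this
    _ = Y.cap 2 c (Y.cross 0 .backslash c d (Y.cup 1 d (Y.cup 0 c f))) :=
        congrArg _ (hY.crossCup [] [d] .slash d c c h' m2)
    _ = Y.cross 0 .backslash c d (Y.cap 2 c (Y.cup 1 d (Y.cup 0 c f))) :=
        hY.exchange (.cross .backslash c d) (.cap c) [] [] [] (x := [c, d]) (y := [c, d])
          rfl (dom_cap h) m3
    _ = Y.cross 0 .backslash c d (Y.cup 0 c f) :=
        congrArg _ (hY.zagzig [c] [] d c h m2)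

theorem cup_slash (hX : X.IsSkein q κ) (l r : List C) {c d : C} (h : d = bar c)
    (hf : f ∈ X.deg (l ++ r)) :
    X.cross l.length .slash c d (X.cup l.length c f) = ((κ d)⁻¹ : Kˣ) • X.cup l.length d f := by
  have h' : c = bar d := bar_eq_comm.1 h
  have m : X.cup l.length d f ∈ X.deg (l ++ d :: c :: r) := hX.cup_mem l r h' hf
  have := hX.cup_backslash l r h' hf
  have h2 := hX.inverse_backslash l r d c m
  rw [this, map_smul] at h2
  rw [← h2, Units.smul_def, smul_smul, Units.inv_mul, one_smul]

/-- Turned past the minimum, the crossing of the kink becomes a crossing of the two legs of the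
maximum, which `cap_slash` evaluates. The factor belongs to the opposite label. -/
theorem kink_backslash (hX : X.IsSkein q κ) (l r : List C) {c d : C} (h : d = bar c)
    (hf : f ∈ X.deg (l ++ c :: r)) :
    X.cap (l.length + 1) c (X.cross l.length .backslash c c (X.cup (l.length + 1) c f)) =
      ((κ d)⁻¹ : Kˣ) • f := by
  have hY := hX.shift l r
  replace hf : f ∈ (X.shift l r).deg [c] := hf
  change (X.shift l r).cap 1 c ((X.shift l r).cross 0 .backslash c c ((X.shift l r).cup 1 c f)) = _
  generalize X.shift l r = Y at *
  have m1 : Y.cup 0 c f ∈ Y.deg [c, d, c] := hY.cup_mem [] [c] h hf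
  calc Y.cap 1 c (Y.cross 0 .backslash c c (Y.cup 1 c f))
      = Y.cap 1 c (Y.cross 1 .slash d c (Y.cup 0 c f)) :=
        congrArg _ (hY.crossCup [] [] .slash c d c h hf).symm
    _ = ((κ d)⁻¹ : Kˣ) • Y.cap 1 d (Y.cup 0 c f) := hY.cap_slash [c] [] h m1
    _ = _ := congrArg _ (hY.zagzig [] [] c d (bar_eq_comm.1 h) hf)

/-- Turning the crossing past the minimum reduces kinks on the left of the strand to crossings below
a maximum as well. -/
theorem kink_left_slash (hX : X.IsSkein q κ) (l r : List C) {c d : C} (h : d = bar c)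
    (hf : f ∈ X.deg (l ++ d :: r)) :
    X.cap l.length c (X.cross (l.length + 1) .slash d d (X.cup l.length c f)) =
      (κ c : K) • f := by
  have hY := hX.shift l r
  replace hf : f ∈ (X.shift l r).deg [d] := hf
  change (X.shift l r).cap 0 c ((X.shift l r).cross 1 .slash d d ((X.shift l r).cup 0 c f)) = _
  generalize X.shift l r = Y at *
  have m1 : Y.cup 1 c f ∈ Y.deg [d, c, d] := hY.cup_mem [d] [] h hf
  calc Y.cap 0 c (Y.cross 1 .slash d d (Y.cup 0 c f))
      = Y.cap 0 c (Y.cross 0 .backslash d c (Y.cup 1 c f)) :=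
        congrArg _ (hY.crossCup [] [] .slash c d d h hf)
    _ = (κ c : K) • Y.cap 0 d (Y.cup 1 c f) := hY.cap_backslash [] [d] h m1
    _ = _ := congrArg _ (hY.zigzag [] [] d c (bar_eq_comm.1 h) hf)

theorem kink_left_backslash (hX : X.IsSkein q κ) (l r : List C) {c d : C} (h : d = bar c)
    (hf : f ∈ X.deg (l ++ d :: r)) :
    X.cap l.length c (X.cross (l.length + 1) .backslash d d (X.cup l.length c f)) =
      ((κ d)⁻¹ : Kˣ) • f := by
  have hY := hX.shift l r
  replace hf : f ∈ (X.shift l r).deg [d] := hf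
  change (X.shift l r).cap 0 c
    ((X.shift l r).cross 1 .backslash d d ((X.shift l r).cup 0 c f)) = _
  generalize X.shift l r = Y at *
  have m1 : Y.cup 1 c f ∈ Y.deg [d, c, d] := hY.cup_mem [d] [] h hf
  calc Y.cap 0 c (Y.cross 1 .backslash d d (Y.cup 0 c f))
      = Y.cap 0 c (Y.cross 0 .slash d c (Y.cup 1 c f)) :=
        congrArg _ (hY.crossCup [] [] .backslash c d d h hf)
    _ = ((κ d)⁻¹ : Kˣ) • Y.cap 0 d (Y.cup 1 c f) := hY.cap_slash [] [d] h m1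
    _ = _ := congrArg _ (hY.zigzag [] [] d c (bar_eq_comm.1 h) hf)

/-- A circle on the left of a strand. -/
theorem circle_left (hX : X.IsSkein q κ) (l r : List C) {c d : C} (h : d = bar c)
    (hf : f ∈ X.deg (l ++ d :: r)) :
    ((q : K) - ↑q⁻¹) • X.cap l.length c (X.cup l.length c f) =
      ((κ c : K) - ↑(κ d)⁻¹ + if c = d then (q : K) - ↑q⁻¹ else 0) • f := by
  have hY := hX.shift l r
  have h' := bar_eq_comm.1 h
  have e1 := hX.kink_left_slash l r h hf
  have e2 := hX.kink_left_backslash l r h hf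
  have m : X.cup l.length c f ∈ X.deg ((l ++ [c]) ++ d :: d :: r) := by
    simpa using hX.cup_mem l (d :: r) h hf
  -- The skein relation is applied between the strand and the near leg of the circle. Both crossings
  -- close to kinks, one smoothing to the circle, and for `c = d` the other one to the bare strand;
  -- this forces the value of the circle.
  have e3 := hX.skein d d (l ++ [c]) r m
  rw [List.length_append, List.length_singleton, if_pos rfl, ← h'] at e3
  have e4 := congrArg (X.cap l.length c) e3
  rw [map_sub, e1, e2, Units.smul_def, ← sub_smul, map_smul, map_sub] at e4
  rw [add_smul, e4, smul_sub]
  by_cases hcd : c = d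
  · subst hcd
    rw [if_pos rfl, if_pos rfl, hX.zagzig l r c c h hf, hX.zigzag l r c c h hf]
    abel
  · rw [if_neg hcd, if_neg (Ne.symm hcd)]
    simp

theorem circle_right (hX : X.IsSkein q κ) (l r : List C) {c d : C} (h : d = bar c)
    (hf : f ∈ X.deg (l ++ c :: r)) :
    ((q : K) - ↑q⁻¹) • X.cap (l.length + 1) c (X.cup (l.length + 1) c f) =
      ((κ c : K) - ↑(κ d)⁻¹ + if c = d then (q : K) - ↑q⁻¹ else 0) • f := by
  have h' := bar_eq_comm.1 h
  have e1 := hX.kink l r c hf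
  have e2 := hX.kink_backslash l r h hf
  have m : X.cup (l.length + 1) c f ∈ X.deg (l ++ c :: c :: d :: r) := by
    simpa using hX.cup_mem (l ++ [c]) r h (by simpa using hf)
  have e3 := hX.skein c c l (d :: r) m
  rw [if_pos rfl, ← h] at e3
  have e4 := congrArg (X.cap (l.length + 1) c) e3
  rw [map_sub, e1, e2, Units.smul_def, ← sub_smul, map_smul, map_sub] at e4
  rw [add_smul, e4, smul_sub]
  by_cases hcd : c = d
  · subst hcd
    rw [if_pos rfl, if_pos rfl, hX.zigzag l r c c h hf, hX.zagzig l r c c h hf]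
    abel
  · rw [if_neg hcd, if_neg hcd]
    simp

end IsSkein
end TangleRep
end KnottedGraph

/-! ### Strands and arcs which pass over other pieces. -/

namespace KnottedGraph
open Labels
namespace TangleRep
variable {K V C : Type} [CommRing K] [AddCommGroup V] [Module K V]
  {X : TangleRep K V C} {f : V}

/-- The strand with label `c` at position `i` passes to the right over the strands `p`. -/
def pass (X : TangleRep K V C) : ℕ → C → List C → Module.End K V
  | _, _, [] => 1
  | i, c, d :: p => pass X (i + 1) c p * X.cross i .slash c d

theorem pass_append (i : ℕ) (c : C) (p p' : List C) :
    X.pass i c (p ++ p') = X.pass (i + p.length) c p' * X.pass i c p := by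
  induction p generalizing i with
  | nil => simp [pass]
  | cons d p ih =>
    rw [List.cons_append, pass, ih, pass, List.length_cons, mul_assoc]
    congr 2
    omega

variable [Labels C]

theorem IsPlanar.pass_mem (hX : X.IsPlanar) (l : List C) (c : C) (p r : List C)
    (hf : f ∈ X.deg (l ++ c :: (p ++ r))) :
    X.pass l.length c p f ∈ X.deg (l ++ (p ++ c :: r)) := by
  induction p generalizing l f with
  | nil => exact hf
  | cons d p ih =>
    have h := hX.cross_mem (k := .slash) l (p ++ r) hf
    have := ih (l ++ [d]) (f := X.cross l.length .slash c d f) (by simpa using h)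
    simpa [pass] using this

theorem IsPlanar.exchange_at (hX : X.IsPlanar) (g h : TanglePiece C) (l m r : List C)
    {i j j' : ℕ} {s : List C} (hf : f ∈ X.deg s)
    (hs : s = l ++ (Pieces.dom g ++ (m ++ (Pieces.dom h ++ r)))) (hi : i = l.length)
    (hj : j = l.length + (Pieces.cod g).length + m.length)
    (hj' : j' = l.length + (Pieces.dom g).length + m.length) :
    X.op j h (X.op i g f) = X.op i g (X.op j' h f) := by
  subst hs hi hj hj'
  exact hX.exchange g h l m r rfl rfl hf

/-- Every crossing of the pass is far from `g`, so this is repeated exchange of heights. -/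
theorem IsPlanar.pass_exchange_right (hX : X.IsPlanar) (g : TanglePiece C) (l : List C) (c : C)
    (p m r : List C) (hf : f ∈ X.deg (l ++ c :: (p ++ (m ++ (Pieces.dom g ++ r))))) :
    X.op (l.length + 1 + p.length + m.length) g (X.pass l.length c p f) =
      X.pass l.length c p (X.op (l.length + 1 + p.length + m.length) g f) := by
  induction p generalizing l f with
  | nil => rfl
  | cons d p ih =>
    have h := hX.cross_mem (k := .slash) l (p ++ (m ++ (Pieces.dom g ++ r))) hf
    have := ih (l ++ [d]) (f := X.cross l.length .slash c d f) (by simpa using h)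
    simp only [List.length_append, List.length_singleton] at this
    simp only [pass, Module.End.mul_apply, List.length_cons]
    rw [show l.length + 1 + (p.length + 1) + m.length = l.length + 1 + 1 + p.length + m.length by
      omega, this]
    congr 1
    exact hX.exchange_at (.cross .slash c d) g l (p ++ m) r hf (by simp [Pieces.dom]) rfl
      (by simp [Pieces.cod]; omega) (by simp [Pieces.dom]; omega)

theorem IsPlanar.pass_exchange_left (hX : X.IsPlanar) (g : TanglePiece C) (l m : List C) (c : C)
    (p r : List C) (hf : f ∈ X.deg (l ++ (Pieces.dom g ++ (m ++ c :: (p ++ r))))) :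
    X.pass (l.length + (Pieces.cod g).length + m.length) c p (X.op l.length g f) =
      X.op l.length g (X.pass (l.length + (Pieces.dom g).length + m.length) c p f) := by
  induction p generalizing m f with
  | nil => rfl
  | cons d p ih =>
    have h := hX.cross_mem (k := .slash) (l ++ (Pieces.dom g ++ m)) (p ++ r) (s := c) (t := d)
      (f := f) (by simpa using hf)
    have := ih (m ++ [d])
      (f := X.cross (l.length + (Pieces.dom g).length + m.length) .slash c d f)
      (by simpa [add_assoc] using h)
    simp only [List.length_append, List.length_singleton, ← add_assoc] at this
    simp only [pass, Module.End.mul_apply]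
    rw [← this]
    congr 1
    exact hX.exchange_at g (.cross .slash c d) l m (p ++ r) hf (by simp [Pieces.dom]) rfl
      rfl rfl

/-- An arc starts at the leftmost end, and passes over the strands `p`. -/
def arc (X : TangleRep K V C) (d : C) (p : List C) : Module.End K V :=
  X.pass 1 (bar d) p * X.cup 0 d

theorem IsPlanar.arc_mem (hX : X.IsPlanar) (d : C) (p r : List C) (hf : f ∈ X.deg (p ++ r)) :
    X.arc d p f ∈ X.deg (d :: (p ++ bar d :: r)) :=
  hX.pass_mem [d] (bar d) p r (hX.cup_mem [] (p ++ r) rfl hf)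

theorem IsPlanar.arc_right (hX : X.IsPlanar) (g : TanglePiece C) (d : C) (p m r : List C)
    (hf : f ∈ X.deg (p ++ (m ++ (Pieces.dom g ++ r)))) :
    X.op (p.length + m.length + 2) g (X.arc d p f) =
      X.arc d p (X.op (p.length + m.length) g f) := by
  have m1 := hX.cup_mem [] (p ++ (m ++ (Pieces.dom g ++ r))) (c := d) rfl hf
  have h1 := hX.pass_exchange_right g [d] (bar d) p m r m1
  have h2 := hX.exchange_at (.cup d) g [] (p ++ m) r (f := f) hf (by simp [Pieces.dom]) rfl
    rfl rfl
  have e : p.length + m.length + 2 = 2 + p.length + m.length := by omega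
  simp only [List.length_singleton, List.length_nil, zero_add] at h1 h2
  simp only [arc, Module.End.mul_apply]
  rw [e]
  refine h1.trans (congrArg _ ?_)
  simpa [Pieces.cod, Pieces.dom, add_assoc, add_comm, add_left_comm] using h2

variable [DecidableEq C] {q : Kˣ} {κ : C → Kˣ}

namespace IsSkein

/-- Apply `braid` to the tangle in which `s` and `t` have already been crossed the other way; the
second Reidemeister move then shifts that crossing to the other side. -/
theorem braid_backslash (hX : X.IsSkein q κ) (l r : List C) (c s t : C)
    (hf : f ∈ X.deg (l ++ c :: s :: t :: r)) :
    X.cross (l.length + 1) .slash c s (X.cross l.length .slash c t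
      (X.cross (l.length + 1) .backslash s t f)) =
    X.cross l.length .backslash s t (X.cross (l.length + 1) .slash c t
      (X.cross l.length .slash c s f)) := by
  have hY := hX.shift l r
  replace hf : f ∈ (X.shift l r).deg [c, s, t] := hf
  change (X.shift l r).cross 1 .slash c s ((X.shift l r).cross 0 .slash c t
      ((X.shift l r).cross 1 .backslash s t f)) = (X.shift l r).cross 0 .backslash s t
      ((X.shift l r).cross 1 .slash c t ((X.shift l r).cross 0 .slash c s f))
  generalize X.shift l r = Y at *
  have m1 : Y.cross 1 .backslash s t f ∈ Y.deg [c, t, s] := hY.cross_mem [c] [] hf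
  have m2 : Y.cross 0 .slash c t (Y.cross 1 .backslash s t f) ∈ Y.deg [t, c, s] :=
    hY.cross_mem [] [s] m1
  have m3 : Y.cross 1 .slash c s (Y.cross 0 .slash c t (Y.cross 1 .backslash s t f)) ∈
    Y.deg [t, s, c] := hY.cross_mem [t] [] m2
  have e := hY.braid c t s [] [] m1
  have e2 : Y.cross 1 .slash t s (Y.cross 1 .backslash s t f) = f :=
    hY.inverse_backslash [c] [] s t hf
  have e3 := hY.inverse_slash [] [c] t s m3
  simp only [List.length_nil, zero_add] at e e3
  rw [e2] at e
  rw [← e, e3]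

/-- A strand passes over an elementary piece. -/
theorem pass_piece (hX : X.IsSkein q κ) (g : TanglePiece C) (l : List C) (c : C) (r : List C)
    (hf : f ∈ X.deg (l ++ c :: (Pieces.dom g ++ r))) :
    X.pass l.length c (Pieces.cod g) (X.op (l.length + 1) g f) =
      X.op l.length g (X.pass l.length c (Pieces.dom g) f) := by
  have hY := hX.shift l r
  match g with
  | .cup d =>
    replace hf : f ∈ (X.shift l r).deg [c] := hf
    change (X.shift l r).cross 1 .slash c (bar d) ((X.shift l r).cross 0 .slash c d
      ((X.shift l r).cup 1 d f)) = (X.shift l r).cup 0 d f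
    generalize X.shift l r = Y at *
    have m1 : Y.cup 0 d f ∈ Y.deg [d, bar d, c] := hY.cup_mem [] [c] rfl hf
    have e : Y.cross 0 .slash c d (Y.cup 1 d f) = _ :=
      (hY.crossCup [] [] .backslash d (bar d) c rfl hf).symm
    rw [e]
    exact hY.inverse_backslash [d] [] (bar d) c m1
  | .cap d =>
    replace hf : f ∈ (X.shift l r).deg [c, d, bar d] := hf
    change (X.shift l r).cap 1 d f = (X.shift l r).cap 0 d ((X.shift l r).cross 1 .slash c (bar d)
      ((X.shift l r).cross 0 .slash c d f))
    generalize X.shift l r = Y at *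
    have m1 : Y.cross 0 .slash c d f ∈ Y.deg [d, c, bar d] := hY.cross_mem [] [bar d] hf
    have e := hY.crossCap [] [] .slash d (bar d) c rfl m1
    simp only [List.length_nil, zero_add] at e
    rw [e]
    exact congrArg _ (hY.inverse_slash [] [bar d] c d hf).symm
  | .cross .slash s t =>
    exact (hX.braid c s t l r hf).symm
  | .cross .backslash s t =>
    exact hX.braid_backslash l r c s t hf

/-- Only the part of the pass over the strands of `g` itself needs an isotopy, namely `pass_piece`;
the parts before and after are far from `g`. -/
theorem pass_natural (hX : X.IsSkein q κ) (g : TanglePiece C) (l : List C) (c : C)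
    (p p' r : List C) (hf : f ∈ X.deg (l ++ c :: (p ++ (Pieces.dom g ++ (p' ++ r))))) :
    X.pass l.length c (p ++ (Pieces.cod g ++ p')) (X.op (l.length + 1 + p.length) g f) =
      X.op (l.length + p.length) g (X.pass l.length c (p ++ (Pieces.dom g ++ p')) f) := by
  have h1 := hX.pass_exchange_right g l c p [] (p' ++ r) (f := f) (by simpa using hf)
  have m1 : X.pass l.length c p f ∈ X.deg ((l ++ p) ++ c :: (Pieces.dom g ++ (p' ++ r))) := by
    simpa using hX.pass_mem l c p _ hf
  have h2 := hX.pass_piece g (l ++ p) c (p' ++ r) m1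
  have m2 : X.pass (l ++ p).length c (Pieces.dom g) (X.pass l.length c p f) ∈
      X.deg ((l ++ p) ++ (Pieces.dom g ++ c :: (p' ++ r))) := hX.pass_mem _ _ _ _ m1
  have h3 := hX.pass_exchange_left g (l ++ p) [] c p' r m2
  simp only [List.length_append, List.length_nil, add_zero] at h1 h2 h3
  simp only [pass_append, Module.End.mul_apply]
  rw [← h1, show l.length + 1 + p.length = l.length + p.length + 1 by omega, h2, h3]

end IsSkein

/-- Since the arc lies over everything, a piece between its ends slides below it. Together with
`arc_right`, this replaces an operation in the presence of an arc by one on two strands fewer. -/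
theorem IsSkein.arc_inside (hX : X.IsSkein q κ) (g : TanglePiece C) (d : C) (p p' r : List C)
    (hf : f ∈ X.deg (p ++ (Pieces.dom g ++ (p' ++ r)))) :
    X.op (p.length + 1) g (X.arc d (p ++ (Pieces.dom g ++ p')) f) =
      X.arc d (p ++ (Pieces.cod g ++ p')) (X.op p.length g f) := by
  have m := hX.cup_mem [] (p ++ (Pieces.dom g ++ (p' ++ r))) (c := d) rfl hf
  have h1 := hX.pass_natural g [d] (bar d) p p' r m
  have h2 := hX.exchange_at (.cup d) g [] p (p' ++ r) (f := f) hf rfl rfl rfl rfl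
  simp only [List.length_singleton, List.length_nil, zero_add] at h1 h2
  simp only [arc, Module.End.mul_apply]
  rw [add_comm p.length 1, ← h1]
  congr 1
  simpa [Pieces.cod, Pieces.dom, add_assoc, add_comm] using h2

end TangleRep
end KnottedGraph

/-! ### The span of the standard tangles is stable under all operations. -/

namespace KnottedGraph
open Labels
namespace TangleRep
theorem append_cons_cases {C : Type} {l r p r' : List C} {e : C} (h : l ++ r = p ++ e :: r') :
    (∃ a, p = l ++ a ∧ r = a ++ e :: r') ∨ ∃ b, l = p ++ e :: b ∧ r' = b ++ r := by
  rcases List.append_eq_append_iff.1 h with ⟨a, rfl, rfl⟩ | ⟨b, rfl, hb⟩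
  · exact Or.inl ⟨a, rfl, rfl⟩
  · cases b with
    | nil => exact Or.inl ⟨[], by simp, by simpa using hb.symm⟩
    | cons x b =>
      simp only [List.cons_append, List.cons.injEq] at hb
      obtain ⟨rfl, rfl⟩ := hb
      exact Or.inr ⟨b, rfl, rfl⟩

/-- The positions of the second end `e` of an arc relative to a piece with two strands: it is the
left strand, the right strand, lies to the right, or lies to the left. -/
theorem append_cons_cons_cases {C : Type} {l r p r' : List C} {x y e : C}
    (h : l ++ x :: y :: r = p ++ e :: r') :
    (p = l ∧ x = e ∧ r' = y :: r) ∨ (p = l ++ [x] ∧ y = e ∧ r' = r) ∨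
      (∃ a, p = l ++ x :: y :: a ∧ r = a ++ e :: r') ∨
      ∃ b, l = p ++ e :: b ∧ r' = b ++ x :: y :: r := by
  rcases append_cons_cases h with ⟨a, rfl, ha⟩ | ⟨b, rfl, rfl⟩
  · match a with
    | [] => simp_all
    | [x'] => simp_all
    | x' :: y' :: a =>
      simp only [List.cons_append, List.cons.injEq] at ha
      obtain ⟨rfl, rfl, rfl⟩ := ha
      exact Or.inr (Or.inr (Or.inl ⟨a, rfl, rfl⟩))
  · exact Or.inr (Or.inr (Or.inr ⟨b, rfl, rfl⟩))

variable {K V C : Type} [CommRing K] [AddCommGroup V] [Module K V] [Labels C]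
  {X : TangleRep K V C} {f : V} {A : Subring K} {v₀ : V}

/-- The tangles which are spanned, with coefficients in `A`, by the standard ones: a standard tangle
consists of an arc over a standard tangle with fewer strands. -/
inductive InSpan (X : TangleRep K V C) (A : Subring K) (v₀ : V) : List C → V → Prop
  | base : InSpan X A v₀ [] v₀
  | arc (c : C) (p r : List C) {f : V} : InSpan X A v₀ (p ++ r) f →
      InSpan X A v₀ (c :: (p ++ bar c :: r)) (X.arc c p f)
  | zero (s : List C) : InSpan X A v₀ s 0
  | add {s : List C} {f g : V} : InSpan X A v₀ s f → InSpan X A v₀ s g → InSpan X A v₀ s (f + g)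
  | smul {s : List C} {f : V} (b : K) : b ∈ A → InSpan X A v₀ s f → InSpan X A v₀ s (b • f)

namespace InSpan

theorem mem (hX : X.IsPlanar) (h₀ : v₀ ∈ X.deg []) {s : List C} (h : X.InSpan A v₀ s f) :
    f ∈ X.deg s := by
  induction h with
  | base => exact h₀
  | arc c p r _ ih => exact hX.arc_mem c p r ih
  | zero s => exact zero_mem _
  | add _ _ h1 h2 => exact add_mem h1 h2
  | smul b _ _ h => exact Submodule.smul_mem _ _ h

theorem sub {s : List C} {g : V} (hf : X.InSpan A v₀ s f) (hg : X.InSpan A v₀ s g) :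
    X.InSpan A v₀ s (f - g) := by
  have := hf.add (hg.smul (-1) (neg_mem (one_mem A)))
  simpa [sub_eq_add_neg] using this

/-- By linearity, membership of an image in the span needs to be tested on tangles with an outermost
arc only, and on `v₀` when the row is empty. -/
theorem map_arc {T : Module.End K V} {s t : List C} (h : X.InSpan A v₀ s f)
    (hbase : s = [] → X.InSpan A v₀ t (T v₀))
    (harc : ∀ c p r f', s = c :: (p ++ bar c :: r) → X.InSpan A v₀ (p ++ r) f' →
      X.InSpan A v₀ t (T (X.arc c p f'))) :
    X.InSpan A v₀ t (T f) := by
  induction h with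
  | base => exact hbase rfl
  | arc c p r h => exact harc c p r _ rfl h
  | zero s => rw [map_zero]; exact zero t
  | add _ _ h1 h2 => rw [map_add]; exact (h1 hbase harc).add (h2 hbase harc)
  | smul b hb _ h => rw [map_smul]; exact (h hbase harc).smul b hb

end InSpan

/-- The row `l₀` bounds the positions of the crossings from below: in the proof of `closedAt`,
crossings at position `0` are not yet available for rows of the length at hand. -/
theorem inSpan_pass (n : ℕ) (l₀ : List C)
    (hc : ∀ (l r : List C) (s t : C) {f : V}, l₀.length ≤ l.length → l.length + r.length + 2 = n →
      X.InSpan A v₀ (l ++ s :: t :: r) f →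
      X.InSpan A v₀ (l ++ t :: s :: r) (X.cross l.length .slash s t f))
    (l : List C) (c : C) (p r : List C) (hl : l₀.length ≤ l.length)
    (hn : l.length + p.length + r.length + 1 = n)
    (hf : X.InSpan A v₀ (l ++ c :: (p ++ r)) f) :
    X.InSpan A v₀ (l ++ (p ++ c :: r)) (X.pass l.length c p f) := by
  induction p generalizing l f with
  | nil => exact hf
  | cons d p ih =>
    have h := hc l (p ++ r) c d hl (by simp at hn ⊢; omega) hf
    have := ih (l ++ [d]) (f := X.cross l.length .slash c d f) (by simp; omega)
      (by simp at hn ⊢; omega) (by simpa using h)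
    simpa [pass] using this

theorem arc_append_singleton (d b : C) (p : List C) :
    X.arc d (p ++ [b]) f = X.cross (p.length + 1) .slash (bar d) b (X.arc d p f) := by
  simp [arc, pass_append, pass, add_comm]

variable [DecidableEq C] {q : Kˣ} {κ : C → Kˣ}

namespace IsSkein

/-- At the left edge a minimum is an arc over nothing. Elsewhere it slides below the outermost arc,
either inside it or to its right, and its position decreases. -/
theorem inSpan_cup (hX : X.IsSkein q κ) (h₀ : v₀ ∈ X.deg []) (c : C) (l r : List C)
    (hf : X.InSpan A v₀ (l ++ r) f) :
    X.InSpan A v₀ (l ++ c :: bar c :: r) (X.cup l.length c f) := by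
  induction hn : l.length using Nat.strong_induction_on generalizing l r f with
  | _ n ih' =>
    rw [← hn]
    have ih : ∀ (l r : List C) {f : V}, l.length < n → X.InSpan A v₀ (l ++ r) f →
        X.InSpan A v₀ (l ++ c :: bar c :: r) (X.cup l.length c f) :=
      fun l r f hl hf => ih' _ hl l r hf rfl
    match l, hn with
    | [], _ => exact InSpan.arc c [] r hf
    | d :: l, hn =>
    refine hf.map_arc (by simp) ?_
    rintro d' p r' f' hs hf'
    obtain ⟨rfl, hs⟩ := List.cons.inj hs
    rcases append_cons_cases hs with ⟨a, rfl, rfl⟩ | ⟨b, rfl, rfl⟩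
    · have e := hX.arc_inside (.cup c) d l a r' (f := f')
        (by simpa [Pieces.dom] using hf'.mem hX.toIsPlanar h₀)
      have h1 := ih l (a ++ r') (f := f') (by simpa using hn.le) (by simpa using hf')
      have h2 := InSpan.arc d (l ++ (Pieces.cod (TanglePiece.cup c) ++ a)) r'
        (f := X.cup l.length c f') (by simpa [Pieces.cod] using h1)
      rw [← e] at h2
      simpa [Pieces.cod, Pieces.dom] using h2
    · have e := hX.arc_right (.cup c) d p b r (f := f')
        (by simpa [Pieces.dom] using hf'.mem hX.toIsPlanar h₀)
      have h1 := ih (p ++ b) r (f := f') (by simp at hn ⊢; omega) (by simpa using hf')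
      have h2 := InSpan.arc d p (b ++ c :: bar c :: r)
        (f := X.cup (p.length + b.length) c f') (by simpa using h1)
      rw [← e] at h2
      simpa [add_assoc] using h2


/-- The span contains the crossing of the other kind as well. -/
theorem inSpan_flip (hX : X.IsSkein q κ) (h₀ : v₀ ∈ X.deg []) (hq : (q : K) ∈ A)
    (hq' : (↑q⁻¹ : K) ∈ A) (l r : List C) (k : Crossing) {s t : C}
    (hf : X.InSpan A v₀ (l ++ s :: t :: r) f)
    (hk : X.InSpan A v₀ (l ++ t :: s :: r) (X.cross l.length k s t f))
    (hcap : t = bar s → X.InSpan A v₀ (l ++ r) (X.cap l.length s f)) :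
    X.InSpan A v₀ (l ++ t :: s :: r) (X.cross l.length k.flip s t f) := by
  have hz : (q : K) - ↑q⁻¹ ∈ A := sub_mem hq hq'
  have h1 : X.InSpan A v₀ (l ++ t :: s :: r) (if s = t then f else 0) := by
    split
    · next h => subst h; exact hf
    · exact InSpan.zero _
  have h2 : X.InSpan A v₀ (l ++ t :: s :: r)
      (if t = bar s then X.cup l.length t (X.cap l.length s f) else 0) := by
    split
    · next h =>
      have := hX.inSpan_cup h₀ t l r (hcap h)
      rwa [← bar_eq_comm.1 h] at this
    · exact InSpan.zero _
  have h3 := (h1.sub h2).smul _ hz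
  have e := hX.skein s t l r (hf.mem hX.toIsPlanar h₀)
  cases k with
  | slash =>
    have := hk.sub h3
    rwa [← e, sub_sub_cancel] at this
  | backslash =>
    have := h3.add hk
    rwa [← e, sub_add_cancel] at this

/-- The span is closed under the operations with rows of `n` strands. -/
def ClosedAt (X : TangleRep K V C) (A : Subring K) (v₀ : V) (n : ℕ) : Prop :=
  ∀ (g : TanglePiece C) (l r : List C) {f : V},
    l.length + (Pieces.dom g).length + r.length = n →
    X.InSpan A v₀ (l ++ (Pieces.dom g ++ r)) f →
    X.InSpan A v₀ (l ++ (Pieces.cod g ++ r)) (X.op l.length g f)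

/-- Joining the end of an arc with the next strand pulls this strand to the left over the strands
`l`. The last crossing of the arc turns past the maximum into a crossing of `f` itself, hence of a
row with `n` strands, where `H` applies; induct on `l` from its right end. -/
theorem inSpan_pull (hX : X.IsSkein q κ) (h₀ : v₀ ∈ X.deg []) (n : ℕ)
    (H : ClosedAt X A v₀ n) (d : C) (l r : List C) (hn : l.length + r.length + 1 = n)
    (hf : X.InSpan A v₀ (l ++ d :: r) f) :
    X.InSpan A v₀ (d :: (l ++ r)) (X.cap (l.length + 1) (bar d) (X.arc d l f)) := by
  induction l using List.reverseRecOn generalizing r f with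
  | nil =>
    have := hX.zagzig [] r d (bar d) (bar_bar d).symm (hf.mem hX.toIsPlanar h₀)
    change X.InSpan A v₀ (d :: r) (X.cap 1 (bar d) (X.cup 0 d f))
    change X.cap 1 (bar d) (X.cup 0 d f) = f at this
    rw [this]
    exact hf
  | append_singleton l b ih =>
    simp only [List.length_append, List.length_singleton] at hn ⊢
    have h1 := H (.cross .backslash b d) l r (f := f) (by simp [Pieces.dom]; omega)
      (by simpa [Pieces.dom] using hf)
    have h2 := ih (b :: r) (by simp; omega) h1
    have hm := hf.mem hX.toIsPlanar h₀
    rw [List.append_assoc] at hm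
    have m := hX.arc_mem d l (b :: d :: r) hm
    have e := hX.crossCap (d :: l) r .backslash (bar d) d b (bar_bar d).symm m
    have e2 := hX.arc_right (.cross .backslash b d) d l [] r hm
    simp only [List.length_nil, add_zero] at e2
    simp only [List.length_cons] at e
    rw [arc_append_singleton]
    change X.InSpan A v₀ _ (X.cap (l.length + 1 + 1) (bar d)
      (X.cross (l.length + 1) Crossing.backslash.flip (bar d) b (X.arc d l f)))
    rw [← e]
    change X.InSpan A v₀ _ (X.cap (l.length + 1) (bar d)
      (X.op (l.length + 2) (.cross .backslash b d) (X.arc d l f)))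
    rw [e2]
    simpa using h2

/-- If the left leg is the end of the outermost arc, the next strand is pulled over (`inSpan_pull`).
If the right leg is, the last crossing of the arc is between the legs of the maximum and contributes
a kink factor, which reduces to the first situation. Otherwise the maximum slides below the arc, to
rows of `n` strands. -/
theorem inSpan_cap_pos (hX : X.IsSkein q κ) (h₀ : v₀ ∈ X.deg [])
    (hκ' : ∀ c, (↑(κ c)⁻¹ : K) ∈ A) (n : ℕ) (H : ClosedAt X A v₀ n)
    (d c : C) (l r : List C) (hn : l.length + r.length + 1 = n)
    (hf : X.InSpan A v₀ (d :: (l ++ c :: bar c :: r)) f) :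
    X.InSpan A v₀ (d :: (l ++ r)) (X.cap (l.length + 1) c f) := by
  refine hf.map_arc (by simp) ?_
  rintro d' p r' f' hs hf'
  obtain ⟨rfl, hs⟩ := List.cons.inj hs
  have hm := hf'.mem hX.toIsPlanar h₀
  rcases append_cons_cons_cases hs with ⟨rfl, rfl, rfl⟩ | ⟨rfl, hc, rfl⟩ | ⟨a, rfl, rfl⟩ |
    ⟨b, rfl, rfl⟩
  · rw [bar_bar] at hf'
    exact hX.inSpan_pull h₀ n H d p r hn hf'
  · obtain rfl : c = d := by rw [← bar_bar c, hc, bar_bar]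
    rw [List.append_assoc] at hf' hm
    have m := hX.arc_mem c l (c :: r') hm
    have e := hX.cap_slash (c :: l) r' (c := c) (d := bar c) rfl m
    simp only [List.length_cons] at e
    rw [arc_append_singleton]
    change X.InSpan A v₀ _ (X.cap (l.length + 1) c (X.cross (l.length + 1) .slash (bar c) c _))
    rw [e, Units.smul_def]
    exact (hX.inSpan_pull h₀ n H c l r' hn hf').smul _ (hκ' _)
  · have e := hX.arc_inside (.cap c) d l a r' (f := f') (by simpa [Pieces.dom] using hm)
    have h1 := H (.cap c) l (a ++ r') (f := f') (by simp [Pieces.dom] at hn ⊢; omega)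
      (by simpa [Pieces.dom] using hf')
    have h2 := InSpan.arc d (l ++ a) r' (f := X.cap l.length c f')
      (by simpa [Pieces.cod] using h1)
    simp only [Pieces.dom, Pieces.cod, List.cons_append, List.nil_append] at e
    rw [e]
    simpa using h2
  · have e := hX.arc_right (.cap c) d p b r (f := f') (by simpa [Pieces.dom] using hm)
    have h1 := H (.cap c) (p ++ b) r (f := f') (by simp [Pieces.dom] at hn ⊢; omega)
      (by simpa [Pieces.dom] using hf')
    have h2 := InSpan.arc d p (b ++ r) (f := X.cap (p.length + b.length) c f')
      (by simpa [Pieces.cod] using h1)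
    rw [← e] at h2
    simpa [add_assoc] using h2

/-- A crossing with the end of the outermost arc lengthens or shortens the arc by one strand,
provided it is of the right kind; the other kind differs from it by smoothings (`inSpan_flip`),
which need only `inSpan_cap_pos`. Any other crossing slides below the arc. -/
theorem inSpan_cross_pos (hX : X.IsSkein q κ) (h₀ : v₀ ∈ X.deg []) (hq : (q : K) ∈ A)
    (hq' : (↑q⁻¹ : K) ∈ A) (hκ' : ∀ c, (↑(κ c)⁻¹ : K) ∈ A) (n : ℕ) (H : ClosedAt X A v₀ n)
    (k : Crossing)
    (d s t : C) (l r : List C) (hn : l.length + r.length + 1 = n)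
    (hf : X.InSpan A v₀ (d :: (l ++ s :: t :: r)) f) :
    X.InSpan A v₀ (d :: (l ++ t :: s :: r)) (X.cross (l.length + 1) k s t f) := by
  refine hf.map_arc (by simp) ?_
  clear hf
  rintro d' p r' f' hs hf'
  obtain ⟨rfl, hs⟩ := List.cons.inj hs
  have hm := hf'.mem hX.toIsPlanar h₀
  have hf := InSpan.arc d p r' hf'
  rw [← hs] at hf
  have hflip : ∀ k : Crossing, X.InSpan A v₀ (d :: (l ++ t :: s :: r))
      (X.cross (l.length + 1) k.flip s t (X.arc d p f')) →
      X.InSpan A v₀ (d :: (l ++ t :: s :: r))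
        (X.cross (l.length + 1) k s t (X.arc d p f')) := by
    intro k' h
    have := hX.inSpan_flip h₀ hq hq' (d :: l) r k'.flip hf h
      fun h => by subst h; exact hX.inSpan_cap_pos h₀ hκ' n H d s l r hn hf
    rwa [Crossing.flip_flip] at this
  rcases append_cons_cons_cases hs with ⟨rfl, rfl, rfl⟩ | ⟨rfl, rfl, rfl⟩ | ⟨a, rfl, rfl⟩ |
    ⟨b, rfl, rfl⟩
  · have h : X.InSpan A v₀ (d :: (p ++ t :: bar d :: r))
        (X.cross (p.length + 1) .slash (bar d) t (X.arc d p f')) := by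
      rw [← arc_append_singleton]
      simpa using InSpan.arc d (p ++ [t]) r (f := f') (by simpa using hf')
    cases k with
    | slash => exact h
    | backslash => exact hflip _ h
  · have h : X.InSpan A v₀ (d :: (l ++ bar d :: s :: r'))
        (X.cross (l.length + 1) .backslash s (bar d) (X.arc d (l ++ [s]) f')) := by
      rw [List.append_assoc] at hf' hm
      rw [arc_append_singleton]
      have m := hX.arc_mem d l (s :: r') hm
      have e := hX.inverse_slash (d :: l) r' (bar d) s m
      simp only [List.length_cons] at e
      rw [e]
      exact InSpan.arc d l (s :: r') hf'
    cases k with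
    | slash => exact hflip _ h
    | backslash => exact h
  · have e := hX.arc_inside (.cross k s t) d l a r' (f := f') (by simpa [Pieces.dom] using hm)
    have h1 := H (.cross k s t) l (a ++ r') (f := f') (by simp [Pieces.dom] at hn ⊢; omega)
      (by simpa [Pieces.dom] using hf')
    have h2 := InSpan.arc d (l ++ t :: s :: a) r' (f := X.cross l.length k s t f')
      (by simpa [Pieces.cod] using h1)
    simp only [Pieces.dom, Pieces.cod, List.cons_append, List.nil_append] at e
    rw [e]
    simpa using h2
  · have e := hX.arc_right (.cross k s t) d p b r (f := f') (by simpa [Pieces.dom] using hm)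
    have h1 := H (.cross k s t) (p ++ b) r (f := f') (by simp [Pieces.dom] at hn ⊢; omega)
      (by simpa [Pieces.dom] using hf')
    have h2 := InSpan.arc d p (b ++ t :: s :: r) (f := X.cross (p.length + b.length) k s t f')
      (by simpa [Pieces.cod] using h1)
    rw [← e] at h2
    simpa [add_assoc] using h2


/-- When the near leg of the circle is parallel to the strand, `circle_left` applies. Otherwise the
strand is passed over the whole circle, which then appears on the other side, and `circle_right`
applies. -/
theorem circle_eq (hX : X.IsSkein q κ) (hz : IsUnit ((q : K) - ↑q⁻¹)) {δ : C → K}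
    (hδ : ∀ c, ((q : K) - ↑q⁻¹) * δ c =
      (κ c : K) - ↑(κ (bar c))⁻¹ + if c = bar c then (q : K) - ↑q⁻¹ else 0)
    (c b : C) (r : List C) (hf : f ∈ X.deg (b :: r)) : X.cap 0 c (X.cup 0 c f) = δ c • f := by
  have hz' : ∀ v w : V, ((q : K) - ↑q⁻¹) • v = ((q : K) - ↑q⁻¹) • w → v = w :=
    fun v w h => hz.smul_left_cancel.1 h
  rcases eq_or_eq_bar b c with rfl | rfl
  · have m : X.cup 1 b f ∈ X.deg (b :: b :: bar b :: r) := hX.cup_mem [b] r rfl hf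
    have e1 := hX.pass_piece (.cup b) [] b r hf
    have e2 := hX.pass_piece (.cap b) [] b r m
    change X.pass 0 b [b, bar b] (X.cup 1 b f) = X.cup 0 b f at e1
    change X.cap 1 b (X.cup 1 b f) = X.cap 0 b (X.pass 0 b [b, bar b] (X.cup 1 b f)) at e2
    rw [← e1, ← e2]
    apply hz'
    rw [smul_smul, hδ]
    exact hX.circle_right [] r rfl hf
  · apply hz'
    rw [smul_smul, hδ]
    exact hX.circle_left [] r rfl hf

/-- Strong induction on the number of strands. Away from the left edge `inSpan_cap_pos` and
`inSpan_cross_pos` suffice. At the left edge the piece meets the beginning of the outermost arc, and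
one looks at the first strand which this arc crosses. -/
theorem closedAt (hX : X.IsSkein q κ) (h₀ : v₀ ∈ X.deg []) (hq : (q : K) ∈ A)
    (hq' : (↑q⁻¹ : K) ∈ A) (hκ : ∀ c, (κ c : K) ∈ A) (hκ' : ∀ c, (↑(κ c)⁻¹ : K) ∈ A)
    (hz : IsUnit ((q : K) - ↑q⁻¹)) {δ : C → K}
    (hδ : ∀ c, ((q : K) - ↑q⁻¹) * δ c =
      (κ c : K) - ↑(κ (bar c))⁻¹ + if c = bar c then (q : K) - ↑q⁻¹ else 0)
    (hδA : ∀ c, δ c ∈ A) (hcircle : ∀ c, X.cap 0 c (X.cup 0 c v₀) = δ c • v₀) (n : ℕ) :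
    ClosedAt X A v₀ n := by
  induction n using Nat.strong_induction_on with
  | _ n ih =>
    have hcap : ∀ (c : C) (l r : List C) {f : V}, l.length + 2 + r.length = n →
        X.InSpan A v₀ (l ++ c :: bar c :: r) f →
        X.InSpan A v₀ (l ++ r) (X.cap l.length c f) := by
      intro c l r f hn hf
      match l with
      | d :: l =>
        simp only [List.length_cons] at hn
        exact hX.inSpan_cap_pos h₀ hκ' (l.length + r.length + 1) (ih _ (by omega)) d c l r rfl hf
      | [] =>
        refine hf.map_arc (by simp) ?_
        rintro d p r' f' hs hf'
        obtain ⟨rfl, hs⟩ := List.cons.inj hs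
        match p with
        | [] =>
          obtain ⟨-, rfl⟩ := List.cons.inj hs
          -- The maximum closes the arc to a circle. Beside a strand its value is forced; on the
          -- empty row it has to be given by `hcircle`.
          change X.InSpan A v₀ r (X.cap 0 c (X.cup 0 c f'))
          match r with
          | b :: r =>
            rw [hX.circle_eq hz hδ c b r (hf'.mem hX.toIsPlanar h₀)]
            exact hf'.smul _ (hδA c)
          | [] =>
            refine (hf'.map_arc (T := X.cap 0 c * X.cup 0 c) (fun _ => ?_) (by simp))
            rw [Module.End.mul_apply, hcircle]
            exact InSpan.base.smul _ (hδA c)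
        | b :: p =>
          obtain ⟨rfl, hr⟩ := List.cons.inj hs
          replace hr : r = p ++ bar c :: r' := hr
          subst hr
          have hm := hf'.mem hX.toIsPlanar h₀
          have m1 : X.cup 0 c f' ∈ X.deg (c :: bar c :: bar c :: (p ++ r')) :=
            hX.cup_mem [] _ rfl hm
          have m2 : X.cross 1 .slash (bar c) (bar c) (X.cup 0 c f') ∈
            X.deg (c :: bar c :: bar c :: (p ++ r')) := hX.cross_mem [c] _ m1
          -- The first crossing of the arc is with the right leg of the maximum. It becomes a kink,
          -- and the rest is a strand passing over `p` in rows of `n - 2` strands.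
          have e1 := hX.pass_exchange_left (.cap c) [] [] (bar c) p r' m2
          have e2 := hX.kink_left_slash [] (p ++ r') (c := c) rfl hm
          change X.pass 0 (bar c) p (X.cap 0 c _) = X.cap 0 c (X.arc c (bar c :: p) f') at e1
          change X.cap 0 c (X.cross 1 .slash (bar c) (bar c) (X.cup 0 c f')) = _ at e2
          rw [List.length_nil, ← e1, e2, map_smul]
          refine InSpan.smul _ (hκ c) ?_
          simp only [List.length_nil, List.length_append, List.length_cons] at hn
          refine inSpan_pass (n - 2) [] ?_ [] (bar c) p r' le_rfl (by simp; omega) hf'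
          intro l r s t f _ hl hf
          exact ih (n - 2) (by omega) (.cross .slash s t) l r (by simp [Pieces.dom]; omega) hf
    have hpos : ∀ (d : C) (k : Crossing) (s t : C) (l r : List C) {f : V},
        l.length + r.length + 3 = n → X.InSpan A v₀ (d :: (l ++ s :: t :: r)) f →
        X.InSpan A v₀ (d :: (l ++ t :: s :: r)) (X.cross (l.length + 1) k s t f) :=
      fun d k s t l r f hn hf => hX.inSpan_cross_pos h₀ hq hq' hκ' (l.length + r.length + 1)
        (ih _ (by omega)) k d s t l r rfl hf
    intro g l r f hn hf
    match g with
    | .cup c => exact hX.inSpan_cup h₀ c l r hf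
    | .cap c => exact hcap c l r (by simpa [Pieces.dom] using hn) hf
    | .cross k s t =>
      simp only [Pieces.dom, List.length_cons, List.length_nil, zero_add, Nat.reduceAdd] at hn
      match l with
      | d :: l =>
        simp only [List.length_cons] at hn
        exact hpos d k s t l r (by omega) hf
      | [] =>
        simp only [List.length_nil, zero_add] at hn ⊢
        refine hf.map_arc (by simp) ?_
        clear hf
        rintro d p r' f' hs hf'
        have hf := InSpan.arc d p r' hf'
        rw [← hs] at hf
        obtain ⟨rfl, hs⟩ := List.cons.inj hs
        have hm := hf'.mem hX.toIsPlanar h₀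
        match p with
        | [] =>
          obtain ⟨rfl, rfl⟩ := List.cons.inj hs
          have h : X.InSpan A v₀ (bar s :: s :: r) (X.cup 0 (bar s) f') := by
            have := InSpan.arc (bar s) [] r hf'
            rwa [bar_bar] at this
          cases k with
          | slash =>
            have e := hX.cup_slash [] r (c := s) rfl hm
            change X.InSpan A v₀ (bar s :: s :: r) (X.cross 0 .slash s (bar s) (X.cup 0 s f'))
            simp only [List.length_nil] at e
            rw [e, Units.smul_def]
            exact h.smul _ (hκ' _)
          | backslash =>
            have e := hX.cup_backslash [] r (c := s) rfl hm
            change X.InSpan A v₀ (bar s :: s :: r)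
              (X.cross 0 .backslash s (bar s) (X.cup 0 s f'))
            simp only [List.length_nil] at e
            rw [e]
            exact h.smul _ (hκ _)
        | b :: p =>
          obtain ⟨rfl, hr⟩ := List.cons.inj hs
          replace hr : r = p ++ bar s :: r' := hr
          subst hr
          have m1 : X.cup 0 s f' ∈ X.deg (s :: bar s :: t :: (p ++ r')) :=
            hX.cup_mem [] _ rfl hm
          have m2 : X.cup 1 s f' ∈ X.deg (t :: s :: bar s :: (p ++ r')) :=
            hX.cup_mem [t] (p ++ r') rfl hm
          have m3 : X.cross 1 .slash (bar s) t (X.cup 0 s f') ∈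
            X.deg (s :: t :: bar s :: (p ++ r')) := hX.cross_mem [s] _ m1
          -- Turned past the minimum, the first crossing of the arc cancels the new crossing. This
          -- leaves a minimum at position `1` whose right leg passes over `p`, so that only
          -- crossings at positive positions remain.
          have e1 := hX.crossCup [] (p ++ r') .slash s (bar s) t rfl hm
          have e2 := hX.inverse_backslash [] _ t s m2
          have e3 := hX.pass_exchange_left (.cross .slash s t) [] [] (bar s) p r' m3
          simp only [List.length_nil, zero_add] at e1 e2
          change X.pass 2 (bar s) p (X.cross 0 .slash s t _) =
            X.cross 0 .slash s t (X.arc s (t :: p) f') at e3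
          have h : X.InSpan A v₀ (t :: s :: (p ++ bar s :: r'))
              (X.cross 0 .slash s t (X.arc s (t :: p) f')) := by
            rw [← e3, e1]
            change X.InSpan A v₀ _ (X.pass 2 (bar s) p
              (X.cross 0 .slash s t (X.cross 0 .backslash t s (X.cup 1 s f'))))
            rw [e2]
            have h1 := hX.inSpan_cup h₀ s [t] (p ++ r') hf'
            simp only [List.length_append, List.length_cons] at hn
            refine inSpan_pass n [t] ?_ [t, s] (bar s) p r' (by simp) (by simp; omega) h1
            intro l r' s t f hl hn' hf
            match l with
            | d :: l => exact hpos d .slash s t l r' (by simp at hn'; omega) hf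
          cases k with
          | slash => exact h
          | backslash =>
            refine hX.inSpan_flip h₀ hq hq' [] _ .slash hf h ?_
            rintro rfl
            exact hcap s [] _ (by simp at hn ⊢; omega) hf

end IsSkein
end TangleRep
end KnottedGraph

/-! ### Pieces with vertices, and the isotopies of a vertex. -/

namespace KnottedGraph
open Labels

/-- Elementary pieces of diagrams of knotted 4-valent graphs, with labelled strands. -/
inductive LPiece (C : Type)
  | elem (g : TanglePiece C) | vert (s t : C)

instance {C : Type} [Labels C] : Pieces (LPiece C) C where
  dom
    | .elem g => Pieces.dom g
    | .vert s t => [s, t]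
  cod
    | .elem g => Pieces.cod g
    | .vert s t => [t, s]

def LPiece.forget {C : Type} : LPiece C → Piece
  | .elem (.cup _) => .cup
  | .elem (.cap _) => .cap
  | .elem (.cross k _ _) => .cross k
  | .vert _ _ => .vert

namespace TangleRep
variable {K V C : Type} [CommRing K] [AddCommGroup V] [Module K V]

/-! ### Operations far from each other -/

section Far
variable {X : TangleRep K V C}

/-- The rows with `e` strands between `l` and `r`. -/
def degSup (X : TangleRep K V C) (l : List C) (e : ℕ) (r : List C) : Submodule K V :=
  ⨆ y : {y : List C // y.length = e}, X.deg (l ++ (y.1 ++ r))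

/-- `A i` replaces `d` strands, from position `i` on, by `e` strands. -/
def IsLocal (X : TangleRep K V C) (A : ℕ → Module.End K V) (d e : ℕ) : Prop :=
  ∀ (l x r : List C) {f : V}, x.length = d → f ∈ X.deg (l ++ (x ++ r)) →
    A l.length f ∈ X.degSup l e r

/-- Exchange of heights of the local operations `A` and `B`. -/
def Far (X : TangleRep K V C) (A : ℕ → Module.End K V) (d e : ℕ) (B : ℕ → Module.End K V)
    (d' : ℕ) : Prop :=
  ∀ (l x m y r : List C) {f : V}, x.length = d → y.length = d' →
    f ∈ X.deg (l ++ (x ++ (m ++ (y ++ r)))) →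
    B (l.length + e + m.length) (A l.length f) = A l.length (B (l.length + d + m.length) f)

theorem degSup_induction {l r : List C} {e : ℕ} {S T : Module.End K V}
    (h : ∀ y : List C, y.length = e → ∀ f ∈ X.deg (l ++ (y ++ r)), S f = T f) {f : V}
    (hf : f ∈ X.degSup l e r) : S f = T f := by
  have : X.degSup l e r ≤ LinearMap.eqLocus S T :=
    iSup_le fun y v hv => h y.1 y.2 v hv
  exact this hf

theorem mem_degSup {l r y : List C} {f : V} (hf : f ∈ X.deg (l ++ (y ++ r))) :
    f ∈ X.degSup l y.length r :=
  Submodule.mem_iSup_of_mem (⟨y, rfl⟩ : {z : List C // z.length = y.length}) hf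

variable {A A' B B' : ℕ → Module.End K V} {d d' e e' d₁ : ℕ}

/-- Locality and exchange of heights are stable under linear combinations and composition. Thus they
extend from the elementary pieces to vertices and, later, to sums over orientations. -/
theorem IsLocal.add (hA : X.IsLocal A d e) (hA' : X.IsLocal A' d e) :
    X.IsLocal (fun i => A i + A' i) d e :=
  fun l x r _ hx hf => add_mem (hA l x r hx hf) (hA' l x r hx hf)

theorem IsLocal.smul (hA : X.IsLocal A d e) (b : K) : X.IsLocal (fun i => b • A i) d e :=
  fun l x r _ hx hf => Submodule.smul_mem _ _ (hA l x r hx hf)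

theorem IsLocal.mul (hA : X.IsLocal A d d₁) (hA' : X.IsLocal A' d₁ e) :
    X.IsLocal (fun i => A' i * A i) d e := by
  intro l x r f hx hf
  have h := hA l x r hx hf
  have : X.degSup l d₁ r ≤ (X.degSup l e r).comap (A' l.length) :=
    iSup_le fun y v hv => hA' l y.1 r y.2 hv
  exact this h

theorem Far.add_left (h : X.Far A d e B d') (h' : X.Far A' d e B d') :
    X.Far (fun i => A i + A' i) d e B d' := by
  intro l x m y r f hx hy hf
  simp only [LinearMap.add_apply, map_add]
  rw [h l x m y r hx hy hf, h' l x m y r hx hy hf]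

theorem Far.smul_left (h : X.Far A d e B d') (b : K) : X.Far (fun i => b • A i) d e B d' := by
  intro l x m y r f hx hy hf
  simp only [LinearMap.smul_apply, map_smul]
  rw [h l x m y r hx hy hf]

theorem far_zero_left : X.Far (fun _ => 0) d e B d' := by
  intro l x m y r f _ _ _
  simp

theorem far_one_left : X.Far (fun _ => 1) d d B d' := by
  intro l x m y r f _ _ _
  simp

/-- Locality of the first operation is needed since the row between the two operations is known only
up to labels: the tangle there lies in a sum over rows of `d₁` strands. -/
theorem Far.mul_left (h : X.Far A d d₁ B d') (h' : X.Far A' d₁ e B d') (hA : X.IsLocal A d d₁) :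
    X.Far (fun i => A' i * A i) d e B d' := by
  intro l x m y r f hx hy hf
  have h1 := hA l x (m ++ (y ++ r)) hx hf
  have h2 := degSup_induction (S := B (l.length + e + m.length) * A' l.length)
    (T := A' l.length * B (l.length + d₁ + m.length))
    (fun z hz v hv => h' l z m y r hz hy hv) h1
  simp only [Module.End.mul_apply] at h2 ⊢
  rw [h2, h l x m y r hx hy hf]

theorem Far.add_right (h : X.Far A d e B d') (h' : X.Far A d e B' d') :
    X.Far A d e (fun i => B i + B' i) d' := by
  intro l x m y r f hx hy hf
  simp only [LinearMap.add_apply, map_add]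
  rw [h l x m y r hx hy hf, h' l x m y r hx hy hf]

theorem Far.smul_right (h : X.Far A d e B d') (b : K) :
    X.Far A d e (fun i => b • B i) d' := by
  intro l x m y r f hx hy hf
  simp only [LinearMap.smul_apply, map_smul]
  rw [h l x m y r hx hy hf]

theorem far_zero_right : X.Far A d e (fun _ => 0) d' := by
  intro l x m y r f _ _ _
  simp

theorem far_one_right : X.Far A d e (fun _ => 1) d' := by
  intro l x m y r f _ _ _
  simp

theorem Far.mul_right (h : X.Far A d e B d') (h' : X.Far A d e B' d₁)
    (hB : X.IsLocal B d' d₁) : X.Far A d e (fun i => B' i * B i) d' := by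
  intro l x m y r f hx hy hf
  have h1 := hB (l ++ (x ++ m)) y r (f := f) hy (by simpa using hf)
  have h2 := degSup_induction (S := B' (l.length + e + m.length) * A l.length)
    (T := A l.length * B' (l.length + d + m.length))
    (fun z hz v hv => h' l x m z r hx hz (by simpa using hv)) h1
  simp only [Module.End.mul_apply] at h2 ⊢
  rw [h l x m y r hx hy hf]
  simpa [hx, add_assoc] using h2

theorem mem_deg_cast {s t : List C} {f : V} (hf : f ∈ X.deg s) (h : s = t) : f ∈ X.deg t :=
  h ▸ hf

variable [Labels C]

theorem IsPlanar.op_eq_zero (hX : X.IsPlanar) (g : TanglePiece C) (l x r : List C) {f : V}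
    (hx : x.length = (Pieces.dom g).length) (hf : f ∈ X.deg (l ++ (x ++ r)))
    (h : x ≠ Pieces.dom g) : X.op l.length g f = 0 := by
  match g, x with
  | .cup c, [] => exact absurd rfl h
  | .cap c, [s, t] => exact hX.cap_zero l r c s t hf (by rintro ⟨rfl, rfl⟩; exact h rfl)
  | .cross k c d, [s, t] =>
    exact hX.cross_zero l r k c d s t hf (by rintro ⟨rfl, rfl⟩; exact h rfl)

theorem IsPlanar.isLocal_op (hX : X.IsPlanar) (g : TanglePiece C) :
    X.IsLocal (fun i => X.op i g) (Pieces.dom g).length (Pieces.cod g).length := by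
  intro l x r f hx hf
  by_cases h : x = Pieces.dom g
  · subst h
    exact mem_degSup (hX.op_mem g l r hf)
  · simp only [hX.op_eq_zero g l x r hx hf h, zero_mem]

theorem IsPlanar.far_op (hX : X.IsPlanar) (g h : TanglePiece C) :
    X.Far (fun i => X.op i g) (Pieces.dom g).length (Pieces.cod g).length
      (fun i => X.op i h) (Pieces.dom h).length := by
  intro l x m y r f hx hy hf
  have e : l ++ (x ++ (m ++ (y ++ r))) = (l ++ (x ++ m)) ++ (y ++ r) := by simp
  have hlen : l.length + (Pieces.dom g).length + m.length = (l ++ (x ++ m)).length := by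
    simp [hx, add_assoc]
  by_cases hg : x = Pieces.dom g
  · subst hg
    by_cases hh : y = Pieces.dom h
    · subst hh
      exact hX.exchange g h l m r rfl rfl hf
    · have m1 := hX.op_mem g l (m ++ (y ++ r)) hf
      have z1 := hX.op_eq_zero h (l ++ (Pieces.cod g ++ m)) y r hy (mem_deg_cast m1 (by simp)) hh
      have z2 := hX.op_eq_zero h _ y r hy (mem_deg_cast hf e) hh
      dsimp only
      rw [hlen, z2, map_zero]
      simpa [add_assoc] using z1
  · dsimp only
    rw [hX.op_eq_zero g l x _ hx hf hg, map_zero, hlen]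
    symm
    by_cases hh : y = Pieces.dom h
    · subst hh
      have m1 := hX.op_mem h _ r (mem_deg_cast hf e)
      exact hX.op_eq_zero g l x (m ++ (Pieces.cod h ++ r)) hx (mem_deg_cast m1 (by simp)) hg
    · rw [hX.op_eq_zero h _ y r hy (mem_deg_cast hf e) hh, map_zero]

end Far

variable {X : TangleRep K V C} {f : V} [Labels C] [DecidableEq C] {q : Kˣ} {κ : C → Kˣ}

/-- The operation of a vertex. -/
def vert (X : TangleRep K V C) (q : Kˣ) (i : ℕ) (s t : C) : Module.End K V :=
  (-1 : K) • X.cross i .slash s t + ((q : K) • (if s = t then 1 else 0) +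
    (↑q⁻¹ : K) • (if t = bar s then X.cup i t * X.cap i s else 0))

def opL (X : TangleRep K V C) (q : Kˣ) (i : ℕ) : LPiece C → Module.End K V
  | .elem g => X.op i g
  | .vert s t => X.vert q i s t

/-- The operation of a word. -/
def word (X : TangleRep K V C) (q : Kˣ) : Layers (LPiece C) → Module.End K V
  | [] => 1
  | x :: w => word X q w * X.opL q x.1 x.2

theorem word_append (u v : Layers (LPiece C)) : X.word q (u ++ v) = X.word q v * X.word q u := by
  induction u with
  | nil => simp [word]
  | cons x u ih => simp [word, ih, mul_assoc]

theorem vert_apply (i : ℕ) (s t : C) :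
    X.vert q i s t f = - X.cross i .slash s t f + (q : K) • (if s = t then f else 0) +
      (↑q⁻¹ : K) • (if t = bar s then X.cup i t (X.cap i s f) else 0) := by
  simp only [vert]
  split_ifs <;> simp [add_assoc]

namespace IsSkein

/-- The two expansions of a vertex differ by the skein relation. The isotopies of a vertex become
termwise when a suitable expansion is used on each side. -/
theorem vert_apply_backslash (hX : X.IsSkein q κ) (l r : List C) {s t : C}
    (hf : f ∈ X.deg (l ++ s :: t :: r)) :
    X.vert q l.length s t f = - X.cross l.length .backslash s t f +
      (↑q⁻¹ : K) • (if s = t then f else 0) +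
      (q : K) • (if t = bar s then X.cup l.length t (X.cap l.length s f) else 0) := by
  have h := hX.skein s t l r hf
  rw [sub_eq_iff_eq_add] at h
  rw [vert_apply, h]
  module

theorem far_vert_left (hX : X.IsPlanar) (s t : C) {B : ℕ → Module.End K V} {d' : ℕ}
    (h : ∀ g : TanglePiece C, X.Far (fun i => X.op i g) (Pieces.dom g).length
      (Pieces.cod g).length B d') :
    X.Far (fun i => X.vert q i s t) 2 2 B d' := by
  refine ((h (.cross .slash s t)).smul_left _).add_left
    (Far.add_left (Far.smul_left ?_ _) (Far.smul_left ?_ _))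
  · by_cases h : s = t
    · simp only [if_pos h]; exact far_one_left
    · simp only [if_neg h]; exact far_zero_left
  · by_cases h' : t = bar s
    · simp only [if_pos h']
      exact (h (.cap s)).mul_left (h (.cup t)) (hX.isLocal_op (.cap s))
    · simp only [if_neg h']; exact far_zero_left

theorem far_vert_right (hX : X.IsPlanar) (s t : C) {A : ℕ → Module.End K V} {d e : ℕ}
    (h : ∀ g : TanglePiece C, X.Far A d e (fun i => X.op i g) (Pieces.dom g).length) :
    X.Far A d e (fun i => X.vert q i s t) 2 := by
  refine ((h (.cross .slash s t)).smul_right _).add_right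
    (Far.add_right (Far.smul_right ?_ _) (Far.smul_right ?_ _))
  · by_cases h : s = t
    · simp only [if_pos h]; exact far_one_right
    · simp only [if_neg h]; exact far_zero_right
  · by_cases h' : t = bar s
    · simp only [if_pos h']
      exact (h (.cap s)).mul_right (h (.cup t)) (hX.isLocal_op (.cap s))
    · simp only [if_neg h']; exact far_zero_right

theorem far_opL (hX : X.IsPlanar) (g h : LPiece C) :
    X.Far (fun i => X.opL q i g) (Pieces.dom g).length (Pieces.cod g).length
      (fun i => X.opL q i h) (Pieces.dom h).length := by
  match g, h with
  | .elem g, .elem h => exact hX.far_op g h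
  | .elem g, .vert s t => exact far_vert_right hX s t fun h => hX.far_op g h
  | .vert s t, .elem h => exact far_vert_left hX s t fun g => hX.far_op g h
  | .vert s t, .vert s' t' =>
    exact far_vert_left hX s t fun g => far_vert_right hX s' t' fun h => hX.far_op g h

theorem opL_mem (hX : X.IsPlanar) (g : LPiece C) (l r : List C)
    (hf : f ∈ X.deg (l ++ (Pieces.dom g ++ r))) :
    X.opL q l.length g f ∈ X.deg (l ++ (Pieces.cod g ++ r)) := by
  match g with
  | .elem g => exact hX.op_mem g l r hf
  | .vert s t =>
    replace hf : f ∈ X.deg (l ++ s :: t :: r) := hf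
    change X.vert q l.length s t f ∈ X.deg (l ++ t :: s :: r)
    rw [vert_apply]
    refine add_mem (add_mem (neg_mem (hX.cross_mem l r hf)) (Submodule.smul_mem _ _ ?_))
      (Submodule.smul_mem _ _ ?_)
    · split
      · next h => subst h; exact hf
      · exact zero_mem _
    · split
      · next h => exact hX.cup_mem l r (bar_eq_comm.1 h) (hX.cap_mem l r h hf)
      · exact zero_mem _

theorem word_mem (hX : X.IsPlanar) {w : Layers (LPiece C)} {s t : List C} (h : Runs w s t)
    (hf : f ∈ X.deg s) : X.word q w f ∈ X.deg t := by
  induction w generalizing s f with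
  | nil => obtain rfl : s = t := h; exact hf
  | cons x w ih =>
    obtain ⟨r, ⟨l, r', hl, rfl, rfl⟩, h2⟩ := h
    refine ih h2 ?_
    rw [List.append_assoc] at hf ⊢
    rw [← hl]
    exact opL_mem hX x.2 l r' hf

/-- The relation for the other kind of crossings is obtained by inverting both sides of the given
one, with the order of the strands reversed. -/
theorem braid_all (hX : X.IsSkein q κ) (k : Crossing) (s t u : C) : X.Braid k s t u := by
  cases k with
  | slash => exact hX.braid s t u
  | backslash =>
    intro l r f hf
    have hY := hX.shift l r
    replace hf : f ∈ (X.shift l r).deg [s, t, u] := hf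
    change (X.shift l r).cross 0 .backslash t u ((X.shift l r).cross 1 .backslash s u
        ((X.shift l r).cross 0 .backslash s t f)) =
      (X.shift l r).cross 1 .backslash s t ((X.shift l r).cross 0 .backslash s u
        ((X.shift l r).cross 1 .backslash t u f))
    generalize X.shift l r = Y at *
    have m1 : Y.cross 0 .backslash s t f ∈ Y.deg [t, s, u] := hY.cross_mem [] [u] hf
    have m2 : Y.cross 1 .backslash s u _ ∈ Y.deg [t, u, s] := hY.cross_mem [t] [] m1
    have m3 : Y.cross 0 .backslash t u _ ∈ Y.deg [u, t, s] := hY.cross_mem [] [s] m2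
    have e := hY.braid u t s [] [] m3
    have e1 := hY.inverse_backslash [] [s] t u m2
    have e2 := hY.inverse_backslash [t] [] s u m1
    have e3 := hY.inverse_backslash [] [u] s t hf
    have n1 : Y.cross 1 .slash t s _ ∈ Y.deg [u, s, t] := hY.cross_mem [u] [] m3
    have n2 : Y.cross 0 .slash u s _ ∈ Y.deg [s, u, t] := hY.cross_mem [] [t] n1
    have e4 := hY.inverse_slash [s] [] u t n2
    have e5 := hY.inverse_slash [] [t] u s n1
    have e6 := hY.inverse_slash [u] [] t s m3
    simp only [List.length_nil, List.length_singleton, zero_add] at e e1 e2 e3 e4 e5 e6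
    rw [e1, e2, e3] at e
    rw [← e] at e4
    rw [e4, e5, e6]

/-- A quarter turn exchanges the two kinds of crossings as well as the two smoothings. With one side
expanded by `slash` and the other by `backslash`, the coefficients `q` and `q⁻¹` match too. -/
theorem vert_cup (hX : X.IsSkein q κ) (l r : List C) {c d p : C} (h : d = bar c)
    (hf : f ∈ X.deg (l ++ p :: r)) :
    X.vert q (l.length + 1) d p (X.cup l.length c f) =
      X.vert q l.length p c (X.cup (l.length + 1) c f) := by
  have hY := hX.shift l r
  replace hf : f ∈ (X.shift l r).deg [p] := hf
  change (X.shift l r).vert q 1 d p ((X.shift l r).cup 0 c f) =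
      (X.shift l r).vert q 0 p c ((X.shift l r).cup 1 c f)
  generalize X.shift l r = Y at *
  have m1 : Y.cup 1 c f ∈ Y.deg [p, c, d] := hY.cup_mem [p] [] h hf
  have e1 := hY.crossCup [] [] .slash c d p h hf
  have e2 := hY.vert_apply_backslash [] [d] m1
  simp only [List.length_nil, zero_add] at e1 e2
  rw [e2, vert_apply, e1]
  have h3 : (if d = p then Y.cup 0 c f else 0) =
      (if c = bar p then Y.cup 0 c (Y.cap 0 p (Y.cup 1 c f)) else 0) := by
    by_cases hp : d = p
    · subst hp
      have := hY.zigzag [] [] d c (bar_eq_comm.1 h) hf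
      simp only [List.length_nil, zero_add] at this
      rw [if_pos rfl, if_pos (bar_eq_comm.1 h), this]
    · rw [if_neg hp, if_neg]
      rintro rfl
      exact hp (by rw [h, bar_bar])
  have h4 : (if p = bar d then Y.cup 1 p (Y.cap 1 d (Y.cup 0 c f)) else 0) =
      (if p = c then Y.cup 1 c f else 0) := by
    rw [← bar_eq_comm.1 h]
    by_cases hp : p = c
    · subst hp
      have := hY.zagzig [] [] p d (bar_eq_comm.1 h) hf
      simp only [List.length_nil, zero_add] at this
      rw [if_pos rfl, if_pos rfl, this]
    · rw [if_neg hp, if_neg hp]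
  rw [h3, h4]
  change - Y.cross 0 .backslash p c _ + _ + _ = _
  abel

theorem vert_cap (hX : X.IsSkein q κ) (l r : List C) {c d s : C} (h : d = bar c)
    (hf : f ∈ X.deg (l ++ c :: s :: d :: r)) :
    X.cap l.length c (X.vert q (l.length + 1) s d f) =
      X.cap (l.length + 1) c (X.vert q l.length c s f) := by
  have hY := hX.shift l r
  replace hf : f ∈ (X.shift l r).deg [c, s, d] := hf
  change (X.shift l r).cap 0 c ((X.shift l r).vert q 1 s d f) =
      (X.shift l r).cap 1 c ((X.shift l r).vert q 0 c s f)
  generalize X.shift l r = Y at *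
  have e1 := hY.crossCap [] [] .slash c d s h hf
  have e2 := hY.vert_apply_backslash [] [d] hf
  simp only [List.length_nil, zero_add] at e1 e2
  rw [e2, vert_apply]
  simp only [map_add, map_smul, map_neg, e1]
  have h3 : Y.cap 0 c (if s = d then f else 0) =
      Y.cap 1 c (if s = bar c then Y.cup 0 s (Y.cap 0 c f) else 0) := by
    rw [← h]
    by_cases hs : s = d
    · subst hs
      have := hY.zagzig [] [] s c h (hY.cap_mem [] [s] h hf)
      simp only [List.length_nil, zero_add] at this
      rw [if_pos rfl, if_pos rfl, this]
    · rw [if_neg hs, if_neg hs, map_zero, map_zero]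
  have h4 : Y.cap 0 c (if d = bar s then Y.cup 1 d (Y.cap 1 s f) else 0) =
      Y.cap 1 c (if c = s then f else 0) := by
    by_cases hs : c = s
    · subst hs
      have := hY.zigzag [] [] c d h (hY.cap_mem [c] [] h hf)
      simp only [List.length_nil, zero_add, List.length_singleton] at this
      rw [if_pos rfl, if_pos h, this]
    · rw [if_neg hs, if_neg, map_zero, map_zero]
      intro h'
      exact hs (by rw [← bar_bar c, ← h, h', bar_bar])
  rw [h3, h4]
  change - Y.cap 1 c (Y.cross 0 .backslash c s f) + _ + _ = _
  abel

/-- One crossing turns past the minimum and then cancels the other one. -/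
theorem cross_cross_cup (hX : X.IsSkein q κ) (l r : List C) (k : Crossing) {s t u : C}
    (h : s = bar t) (hf : f ∈ X.deg (l ++ u :: r)) :
    X.cross l.length k t u (X.cross (l.length + 1) k s u (X.cup l.length t f)) =
      X.cup (l.length + 1) t f := by
  have m : X.cup (l.length + 1) t f ∈ X.deg (l ++ u :: t :: s :: r) := by
    have := hX.cup_mem (l ++ [u]) r h (f := f) (by simpa using hf)
    simpa using this
  have e := hX.inverse k.flip u t l (s :: r) m
  rw [hX.crossCup l r k t s u h hf]
  rwa [Crossing.flip_flip] at e

theorem cap_cross_cross (hX : X.IsSkein q κ) (l r : List C) (k : Crossing) {s t u : C}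
    (h : t = bar s) (hf : f ∈ X.deg (l ++ s :: t :: u :: r)) :
    X.cap (l.length + 1) s (X.cross l.length k s u (X.cross (l.length + 1) k t u f)) =
      X.cap l.length s f := by
  have hf' : f ∈ X.deg ((l ++ [s]) ++ t :: u :: r) := by simpa using hf
  have m : X.cross (l.length + 1) k t u f ∈ X.deg (l ++ s :: u :: t :: r) := by
    simpa using hX.cross_mem (k := k) _ _ hf'
  have e := hX.crossCap l r k.flip s t u h m
  rw [Crossing.flip_flip] at e
  rw [← e]
  have := hX.inverse k t u (l ++ [s]) r hf'
  simp only [List.length_append, List.length_singleton] at this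
  rw [this]

/-- The vertex is expanded with the kind of crossing that the passing strand has. Then the term with
three crossings is `braid_all`, and in the other terms the strand passes the smoothing. -/
theorem vert_pass (hX : X.IsSkein q κ) (l r : List C) (k : Crossing) (s t u : C)
    (hf : f ∈ X.deg (l ++ s :: t :: u :: r)) :
    X.cross l.length k t u (X.cross (l.length + 1) k s u (X.vert q l.length s t f)) =
      X.vert q (l.length + 1) s t (X.cross l.length k s u (X.cross (l.length + 1) k t u f)) := by
  have hf' : f ∈ X.deg ((l ++ [s]) ++ t :: u :: r) := by simpa using hf
  have m : X.cross (l.length + 1) k t u f ∈ X.deg (l ++ s :: u :: t :: r) := by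
    simpa using hX.cross_mem (k := k) _ _ hf'
  have m2 : X.cross l.length k s u (X.cross (l.length + 1) k t u f) ∈
      X.deg ((l ++ [u]) ++ s :: t :: r) := by
    simpa using hX.cross_mem (k := k) l _ m
  have h1 : X.cross l.length k t u (X.cross (l.length + 1) k s u (if s = t then f else 0)) =
      if s = t then X.cross l.length k s u (X.cross (l.length + 1) k t u f) else 0 := by
    by_cases h : s = t
    · subst h; simp
    · simp [h]
  have h2 : X.cross l.length k t u (X.cross (l.length + 1) k s u
      (if t = bar s then X.cup l.length t (X.cap l.length s f) else 0)) =
      if t = bar s then X.cup (l.length + 1) t (X.cap (l.length + 1) s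
        (X.cross l.length k s u (X.cross (l.length + 1) k t u f))) else 0 := by
    by_cases h : t = bar s
    · rw [if_pos h, if_pos h, hX.cross_cross_cup l r k (bar_eq_comm.1 h)
        (hX.cap_mem l (u :: r) h hf), hX.cap_cross_cross l r k h hf]
    · rw [if_neg h, if_neg h, map_zero, map_zero]
  have e := hX.braid_all k s t u l r hf
  cases k with
  | slash =>
    rw [vert_apply, vert_apply]
    simp only [map_add, map_smul, map_neg, h1, h2, e]
  | backslash =>
    have e1 := hX.vert_apply_backslash l (u :: r) hf
    have e2 := hX.vert_apply_backslash (l ++ [u]) r m2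
    simp only [List.length_append, List.length_singleton] at e2
    rw [e1, e2]
    simp only [map_add, map_smul, map_neg, h1, h2, e]

/-- In the term with a maximum and a minimum the crossing acts by a kink factor, and this factor is
the same below the maximum as above the minimum. -/
theorem vert_flip (hX : X.IsSkein q κ) (l r : List C) (k : Crossing) (s t : C)
    (hf : f ∈ X.deg (l ++ s :: t :: r)) :
    X.vert q l.length t s (X.cross l.length k s t f) =
      X.cross l.length k t s (X.vert q l.length s t f) := by
  rw [vert_apply, vert_apply]
  simp only [map_add, map_smul, map_neg]
  have h1 : (if t = s then X.cross l.length k s t f else 0) =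
      X.cross l.length k t s (if s = t then f else 0) := by
    by_cases h : s = t
    · subst h; simp
    · simp [h, Ne.symm h]
  have h2 : (if s = bar t then X.cup l.length s (X.cap l.length t (X.cross l.length k s t f))
      else 0) = X.cross l.length k t s
        (if t = bar s then X.cup l.length t (X.cap l.length s f) else 0) := by
    by_cases h : s = bar t
    · have h' := bar_eq_comm.1 h
      have m := hX.cap_mem l r h' hf
      rw [if_pos h, if_pos h']
      cases k with
      | slash => rw [hX.cap_slash l r h hf, hX.cup_slash l r h m, Units.smul_def, map_smul,
          Units.smul_def]
      | backslash => rw [hX.cap_backslash l r h hf, hX.cup_backslash l r h m, map_smul]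
    · rw [if_neg h, if_neg (fun h' => h (bar_eq_comm.1 h')), map_zero]
  have h3 : X.cross l.length .slash t s (X.cross l.length k s t f) =
      X.cross l.length k t s (X.cross l.length .slash s t f) := by
    cases k with
    | slash => rfl
    | backslash => rw [hX.inverse_backslash l r s t hf, hX.inverse_slash l r s t hf]
  rw [h1, h2, h3]

end IsSkein
end TangleRep
end KnottedGraph

/-! ### Isotopy invariance of words with labels. -/

namespace KnottedGraph
open Labels

theorem step_append {G C : Type} [Pieces G C] {i : ℕ} {g : G} {l m t : List C}
    (hi : l.length = i) : Step (i, g) (l ++ m) t ↔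
      ∃ r, m = Pieces.dom g ++ r ∧ t = l ++ (Pieces.cod g ++ r) := by
  constructor
  · rintro ⟨l', r, hl, hs, rfl⟩
    rw [List.append_assoc] at hs
    obtain ⟨rfl, rfl⟩ := List.append_inj hs (hi.trans hl.symm)
    exact ⟨r, rfl, by simp⟩
  · rintro ⟨r, rfl, rfl⟩
    exact ⟨l, r, hi, by simp, by simp⟩

theorem Step.exists_append {G C : Type} [Pieces G C] {i : ℕ} {g : G} {s t : List C}
    (h : Step (i, g) s t) : ∃ l r, l.length = i ∧ s = l ++ (Pieces.dom g ++ r) ∧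
      t = l ++ (Pieces.cod g ++ r) := by
  obtain ⟨l, r, h1, h2, h3⟩ := h
  exact ⟨l, r, h1, by simpa using h2, by simpa using h3⟩

/-- The underlying unoriented layers. -/
def forgetL {C : Type} (w : Layers (LPiece C)) : Layers Piece := w.map fun x => (x.1, x.2.forget)

namespace LPiece
variable {C : Type}

theorem forget_eq_cup {g : LPiece C} : g.forget = .cup ↔ ∃ c, g = .elem (.cup c) := by
  rcases g with (_ | _ | _) | _ <;> simp [forget]

theorem forget_eq_cap {g : LPiece C} : g.forget = .cap ↔ ∃ c, g = .elem (.cap c) := by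
  rcases g with (_ | _ | _) | _ <;> simp [forget]

theorem forget_eq_cross {g : LPiece C} {k : Crossing} :
    g.forget = .cross k ↔ ∃ s t, g = .elem (.cross k s t) := by
  rcases g with (_ | _ | _) | _ <;> simp [forget]

theorem forget_eq_vert {g : LPiece C} : g.forget = .vert ↔ ∃ s t, g = .vert s t := by
  rcases g with (_ | _ | _) | _ <;> simp [forget]

variable [Labels C]

theorem length_dom (g : LPiece C) : (Pieces.dom g).length = (Pieces.dom g.forget).length := by
  rcases g with (_ | _ | _) | _ <;> rfl

theorem length_cod (g : LPiece C) : (Pieces.cod g).length = (Pieces.cod g.forget).length := by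
  rcases g with (_ | _ | _) | _ <;> rfl

theorem ext_of_forget {g h : LPiece C} (h1 : g.forget = h.forget)
    (h2 : Pieces.dom g = Pieces.dom h) (h3 : Pieces.cod g = Pieces.cod h) : g = h := by
  rcases g with (_ | _ | _) | _ <;> rcases h with (_ | _ | _) | _ <;>
    simp_all [forget, Pieces.dom, Pieces.cod]

end LPiece

theorem forgetL_eq_nil {C : Type} {w : Layers (LPiece C)} : forgetL w = [] ↔ w = [] :=
  List.map_eq_nil_iff

theorem forgetL_eq_cons {C : Type} {w : Layers (LPiece C)} {i : ℕ} {g : Piece}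
    {v : Layers Piece} : forgetL w = (i, g) :: v ↔
      ∃ (g' : LPiece C) (w' : Layers (LPiece C)), w = (i, g') :: w' ∧ g'.forget = g ∧
        forgetL w' = v := by
  cases w with
  | nil => simp [forgetL]
  | cons x w =>
    obtain ⟨j, g'⟩ := x
    simp only [forgetL, List.map_cons, List.cons.injEq, Prod.mk.injEq]
    constructor
    · rintro ⟨⟨rfl, rfl⟩, rfl⟩
      exact ⟨g', w, ⟨⟨rfl, rfl⟩, rfl⟩, rfl, rfl⟩
    · rintro ⟨g'', w', ⟨⟨rfl, rfl⟩, rfl⟩, rfl, rfl⟩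
      exact ⟨⟨rfl, rfl⟩, rfl⟩

theorem exists_append_singleton {C : Type} {l : List C} {i : ℕ} (h : l.length = i + 1) :
    ∃ l' c, l = l' ++ [c] ∧ l'.length = i := by
  rcases List.eq_nil_or_concat l with rfl | ⟨l', c, rfl⟩
  · simp at h
  · exact ⟨l', c, by simp, by simpa using h⟩

namespace TangleRep
variable {K V C : Type} [CommRing K] [AddCommGroup V] [Module K V] [Labels C] [DecidableEq C]
  {X : TangleRep K V C} {f : V} {q : Kˣ} {κ : C → Kˣ}

/-- Equality of the first and of the last rows forces the labels of corresponding pieces to agree;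
what is left is exchange of heights. -/
theorem IsSkein.isotopy_exchange (hX : X.IsSkein q κ) {g g' h h' : LPiece C} {i j j' : ℕ}
    (k : ℕ) (hg : g.forget = g'.forget) (hh : h.forget = h'.forget)
    (hj : j = i + (Pieces.cod g).length + k) (hj' : j' = i + (Pieces.dom g).length + k)
    {s t : List C} (hf : f ∈ X.deg s) (hx : Runs [(i, g), (j, h)] s t)
    (hy : Runs [(j', h'), (i, g')] s t) :
    X.word q [(i, g), (j, h)] f = X.word q [(j', h'), (i, g')] f := by
  obtain ⟨m, h1, m', h2, rfl⟩ := hx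
  obtain ⟨n, h3, n', h4, h5⟩ := hy
  obtain rfl : n' = m' := h5
  obtain ⟨l, r, rfl, rfl, rfl⟩ := h1.exists_append
  have hr : ∃ m r', r = m ++ (Pieces.dom h ++ r') ∧ m.length = k := by
    obtain ⟨l', r', e1, e2, -⟩ := h2.exists_append
    rw [← List.append_assoc] at e2
    obtain ⟨m, rfl, e4⟩ | ⟨m, e3, e4⟩ := List.append_eq_append_iff.1 e2
    · exact ⟨m, r', by simpa using e4, by simp at e1; omega⟩
    · have : m = [] := by
        have := congrArg List.length e3
        simp at this
        exact List.length_eq_zero_iff.1 (by omega)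
      subst this
      exact ⟨[], r', by simpa using e4.symm, by
        have := congrArg List.length e3
        simp at this ⊢; omega⟩
  obtain ⟨m, r', rfl, rfl⟩ := hr
  rw [show l ++ (Pieces.cod g ++ (m ++ (Pieces.dom h ++ r'))) =
    (l ++ (Pieces.cod g ++ m)) ++ (Pieces.dom h ++ r') by simp, step_append
    (by simp [hj, add_assoc])] at h2
  obtain ⟨r, e1, rfl⟩ := h2
  obtain rfl := List.append_cancel_left e1
  have h3' := h3
  rw [show l ++ (Pieces.dom g ++ (m ++ (Pieces.dom h ++ r'))) =
    (l ++ (Pieces.dom g ++ m)) ++ (Pieces.dom h ++ r') by simp, step_append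
    (by simp [hj', add_assoc])] at h3'
  obtain ⟨r, e1, rfl⟩ := h3'
  obtain ⟨d1, rfl⟩ := List.append_inj e1 (by rw [LPiece.length_dom, LPiece.length_dom, hh])
  rw [show l ++ (Pieces.dom g ++ m) ++ (Pieces.cod h' ++ r') =
    l ++ (Pieces.dom g ++ (m ++ (Pieces.cod h' ++ r'))) by simp, step_append rfl] at h4
  obtain ⟨r, e2, e3⟩ := h4
  obtain ⟨d2, rfl⟩ := List.append_inj e2 (by rw [LPiece.length_dom, LPiece.length_dom, hg])
  simp only [List.append_assoc] at e3
  have e4 := List.append_cancel_left e3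
  obtain ⟨d3, e5⟩ := List.append_inj e4 (by rw [LPiece.length_cod, LPiece.length_cod, hg])
  have e6 := List.append_cancel_left e5
  obtain ⟨d4, -⟩ := List.append_inj e6 (by rw [LPiece.length_cod, LPiece.length_cod, hh])
  obtain rfl := LPiece.ext_of_forget hg d2 d3
  obtain rfl := LPiece.ext_of_forget hh d1 d4
  subst hj hj'
  have := far_opL (q := q) hX.toIsPlanar g h l _ m _ r' rfl rfl hf
  simpa [word] using this

/-- `Move` sees only the unlabelled pieces. As both words lead from `s` to `t`, comparing the rows
layer by layer identifies the labels, and then each move is one of the relations of `IsSkein` or one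
of the isotopies of `vert`. -/
theorem IsSkein.isotopy (hX : X.IsSkein q κ) {x y : Layers (LPiece C)}
    (h : Move (forgetL x) (forgetL y)) {s t : List C} (hx : Runs x s t) (hy : Runs y s t)
    (hf : f ∈ X.deg s) : X.word q x f = X.word q y f := by
  generalize hx' : forgetL x = x' at h
  generalize hy' : forgetL y = y' at h
  induction h with
  | exchange g h i k =>
    simp only [forgetL_eq_cons, forgetL_eq_nil] at hx' hy'
    obtain ⟨g, _, rfl, rfl, h, _, rfl, rfl, rfl⟩ := hx'
    obtain ⟨h', _, rfl, hh, g', _, rfl, hg, rfl⟩ := hy'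
    exact hX.isotopy_exchange k hg.symm hh.symm (by rw [LPiece.length_cod])
      (by rw [LPiece.length_dom]) hf hx hy
  | zigzag i =>
    simp only [forgetL_eq_cons, forgetL_eq_nil, LPiece.forget_eq_cup,
      LPiece.forget_eq_cap] at hx' hy'
    obtain ⟨_, _, rfl, ⟨o, rfl⟩, _, _, rfl, ⟨o', rfl⟩, rfl⟩ := hx'
    subst hy'
    obtain ⟨m, h1, m', h2, rfl⟩ := hx
    obtain ⟨l, r, hl, rfl, rfl⟩ := h1.exists_append
    obtain ⟨l, c, rfl, rfl⟩ := exists_append_singleton hl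
    rw [List.append_assoc, step_append rfl] at h2
    obtain ⟨r', e1, -⟩ := h2
    simp only [Pieces.dom, Pieces.cod, List.cons_append, List.nil_append, List.cons.injEq] at e1
    obtain ⟨rfl, rfl, -⟩ := e1
    rw [List.append_assoc] at hf
    exact hX.zigzag l r _ _ rfl hf
  | zagzig i =>
    simp only [forgetL_eq_cons, forgetL_eq_nil, LPiece.forget_eq_cup,
      LPiece.forget_eq_cap] at hx' hy'
    obtain ⟨_, _, rfl, ⟨o, rfl⟩, _, _, rfl, ⟨o', rfl⟩, rfl⟩ := hx'
    subst hy'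
    obtain ⟨m, h1, m', h2, h3⟩ := hx
    obtain rfl : m' = t := h3
    obtain rfl : s = m' := hy
    obtain ⟨l, r, rfl, rfl, rfl⟩ := h1.exists_append
    rw [show l ++ (Pieces.cod (LPiece.elem (TanglePiece.cup o)) ++ r) =
      (l ++ [o]) ++ (bar o :: r) by simp [Pieces.cod], step_append (by simp)] at h2
    obtain ⟨r', e1, e2⟩ := h2
    simp only [Pieces.dom, Pieces.cod, List.cons_append, List.nil_append, List.append_assoc,
      List.append_cancel_left_eq, List.cons.injEq] at e1 e2
    obtain ⟨rfl, rfl⟩ := e1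
    rw [bar_bar] at hf
    exact hX.zagzig l r' _ _ (bar_bar o).symm hf
  | crossCup c i =>
    simp only [forgetL_eq_cons, forgetL_eq_nil, LPiece.forget_eq_cup,
      LPiece.forget_eq_cross] at hx' hy'
    obtain ⟨_, _, rfl, ⟨o, rfl⟩, _, _, rfl, ⟨s₁, s₂, rfl⟩, rfl⟩ := hx'
    obtain ⟨_, _, rfl, ⟨o', rfl⟩, _, _, rfl, ⟨s₃, s₄, rfl⟩, rfl⟩ := hy'
    obtain ⟨m, h1, m', h2, rfl⟩ := hx
    obtain ⟨n, h3, n', h4, h5⟩ := hy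
    obtain rfl : n' = m' := h5
    obtain ⟨l, r, hl, rfl, rfl⟩ := h3.exists_append
    obtain ⟨l, p, rfl, rfl⟩ := exists_append_singleton hl
    rw [List.append_assoc, step_append rfl] at h4
    obtain ⟨r', e1, rfl⟩ := h4
    rw [List.append_assoc] at h1
    rw [step_append rfl] at h1
    obtain ⟨r'', e2, rfl⟩ := h1
    rw [show l ++ (Pieces.cod (LPiece.elem (TanglePiece.cup o)) ++ r'') =
      (l ++ [o]) ++ (bar o :: r'') by simp [Pieces.cod], step_append (by simp)] at h2
    obtain ⟨r''', e3, e4⟩ := h2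
    simp only [Pieces.dom, Pieces.cod, List.cons_append, List.nil_append, List.append_assoc,
      List.append_cancel_left_eq, List.cons.injEq] at e1 e2 e3 e4
    obtain ⟨rfl, rfl, rfl⟩ := e1
    subst e2
    simp only [List.cons.injEq] at e3 e4
    obtain ⟨rfl, rfl, rfl⟩ := e3
    obtain ⟨rfl, -⟩ := e4
    rw [List.append_assoc] at hf
    exact hX.crossCup l r c _ _ _ rfl hf
  | vertCup i =>
    simp only [forgetL_eq_cons, forgetL_eq_nil, LPiece.forget_eq_cup,
      LPiece.forget_eq_vert] at hx' hy'
    obtain ⟨_, _, rfl, ⟨o, rfl⟩, _, _, rfl, ⟨s₁, s₂, rfl⟩, rfl⟩ := hx'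
    obtain ⟨_, _, rfl, ⟨o', rfl⟩, _, _, rfl, ⟨s₃, s₄, rfl⟩, rfl⟩ := hy'
    obtain ⟨m, h1, m', h2, rfl⟩ := hx
    obtain ⟨n, h3, n', h4, h5⟩ := hy
    obtain rfl : n' = m' := h5
    obtain ⟨l, r, hl, rfl, rfl⟩ := h3.exists_append
    obtain ⟨l, p, rfl, rfl⟩ := exists_append_singleton hl
    rw [List.append_assoc, step_append rfl] at h4
    obtain ⟨r', e1, rfl⟩ := h4
    rw [List.append_assoc] at h1
    rw [step_append rfl] at h1
    obtain ⟨r'', e2, rfl⟩ := h1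
    rw [show l ++ (Pieces.cod (LPiece.elem (TanglePiece.cup o)) ++ r'') =
      (l ++ [o]) ++ (bar o :: r'') by simp [Pieces.cod], step_append (by simp)] at h2
    obtain ⟨r''', e3, e4⟩ := h2
    simp only [Pieces.dom, Pieces.cod, List.cons_append, List.nil_append, List.append_assoc,
      List.append_cancel_left_eq, List.cons.injEq] at e1 e2 e3 e4
    obtain ⟨rfl, rfl, rfl⟩ := e1
    subst e2
    simp only [List.cons.injEq] at e3 e4
    obtain ⟨rfl, rfl, rfl⟩ := e3
    obtain ⟨rfl, -⟩ := e4
    rw [List.append_assoc] at hf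
    exact hX.vert_cup l r rfl hf
  | crossCap c i =>
    simp only [forgetL_eq_cons, forgetL_eq_nil, LPiece.forget_eq_cap,
      LPiece.forget_eq_cross] at hx' hy'
    obtain ⟨_, _, rfl, ⟨s₁, s₂, rfl⟩, _, _, rfl, ⟨o, rfl⟩, rfl⟩ := hx'
    obtain ⟨_, _, rfl, ⟨s₃, s₄, rfl⟩, _, _, rfl, ⟨o', rfl⟩, rfl⟩ := hy'
    obtain ⟨m, h1, m', h2, rfl⟩ := hx
    obtain ⟨n, h3, n', h4, h5⟩ := hy
    obtain ⟨l, r, hl, rfl, rfl⟩ := h1.exists_append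
    obtain ⟨l, p, rfl, rfl⟩ := exists_append_singleton hl
    rw [List.append_assoc, step_append rfl] at h2
    obtain ⟨r', e1, rfl⟩ := h2
    rw [List.append_assoc] at h3
    rw [step_append rfl] at h3
    obtain ⟨r'', e2, rfl⟩ := h3
    rw [show l ++ (Pieces.cod (LPiece.elem (TanglePiece.cross c.flip s₃ s₄)) ++ r'') =
      (l ++ [s₄]) ++ (s₃ :: r'') by simp [Pieces.cod], step_append (by simp)] at h4
    obtain ⟨r''', e3, e4⟩ := h4
    simp only [Pieces.dom, Pieces.cod, List.cons_append, List.nil_append, List.cons.injEq] at e1 e2 e3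
    obtain ⟨rfl, rfl, rfl⟩ := e1
    obtain ⟨rfl, rfl, rfl⟩ := e2
    obtain ⟨rfl, -⟩ := e3
    rw [List.append_assoc] at hf
    exact hX.crossCap l r c _ _ _ rfl hf
  | vertCap i =>
    simp only [forgetL_eq_cons, forgetL_eq_nil, LPiece.forget_eq_cap,
      LPiece.forget_eq_vert] at hx' hy'
    obtain ⟨_, _, rfl, ⟨s₁, s₂, rfl⟩, _, _, rfl, ⟨o, rfl⟩, rfl⟩ := hx'
    obtain ⟨_, _, rfl, ⟨s₃, s₄, rfl⟩, _, _, rfl, ⟨o', rfl⟩, rfl⟩ := hy'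
    obtain ⟨m, h1, m', h2, rfl⟩ := hx
    obtain ⟨n, h3, n', h4, h5⟩ := hy
    obtain ⟨l, r, hl, rfl, rfl⟩ := h1.exists_append
    obtain ⟨l, p, rfl, rfl⟩ := exists_append_singleton hl
    rw [List.append_assoc, step_append rfl] at h2
    obtain ⟨r', e1, rfl⟩ := h2
    rw [List.append_assoc] at h3
    rw [step_append rfl] at h3
    obtain ⟨r'', e2, rfl⟩ := h3
    rw [show l ++ (Pieces.cod (LPiece.vert s₃ s₄) ++ r'') =
      (l ++ [s₄]) ++ (s₃ :: r'') by simp [Pieces.cod], step_append (by simp)] at h4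
    obtain ⟨r''', e3, e4⟩ := h4
    simp only [Pieces.dom, Pieces.cod, List.cons_append, List.nil_append, List.cons.injEq] at e1 e2 e3
    obtain ⟨rfl, rfl, rfl⟩ := e1
    obtain ⟨rfl, rfl, rfl⟩ := e2
    obtain ⟨rfl, -⟩ := e3
    rw [List.append_assoc] at hf
    exact hX.vert_cap l r rfl hf
  | reidemeisterTwo c i =>
    simp only [forgetL_eq_cons, forgetL_eq_nil, LPiece.forget_eq_cross] at hx' hy'
    obtain ⟨_, _, rfl, ⟨s₁, s₂, rfl⟩, _, _, rfl, ⟨s₃, s₄, rfl⟩, rfl⟩ := hx'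
    subst hy'
    obtain ⟨m, h1, m', h2, rfl⟩ := hx
    obtain ⟨l, r, rfl, rfl, rfl⟩ := h1.exists_append
    rw [step_append rfl] at h2
    obtain ⟨r', e1, -⟩ := h2
    simp only [Pieces.dom, Pieces.cod, List.cons_append, List.nil_append, List.cons.injEq] at e1
    obtain ⟨rfl, rfl, -⟩ := e1
    exact hX.inverse c _ _ l r hf
  | reidemeisterThree c i =>
    simp only [forgetL_eq_cons, forgetL_eq_nil, LPiece.forget_eq_cross] at hx' hy'
    obtain ⟨_, _, rfl, ⟨s₁, s₂, rfl⟩, _, _, rfl, ⟨s₃, s₄, rfl⟩, _, _, rfl, ⟨s₅, s₆, rfl⟩, rfl⟩ :=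
      hx'
    obtain ⟨_, _, rfl, ⟨t₁, t₂, rfl⟩, _, _, rfl, ⟨t₃, t₄, rfl⟩, _, _, rfl, ⟨t₅, t₆, rfl⟩, rfl⟩ :=
      hy'
    obtain ⟨m, h1, m', h2, m'', h3, rfl⟩ := hx
    obtain ⟨n, h4, n', h5, n'', h6, -⟩ := hy
    obtain ⟨l, r, hl, rfl, rfl⟩ := h4.exists_append
    obtain ⟨l, p, rfl, rfl⟩ := exists_append_singleton hl
    rw [List.append_assoc, step_append rfl] at h1 h5
    obtain ⟨r1, e1, rfl⟩ := h1
    obtain ⟨r2, e2, rfl⟩ := h5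
    rw [show l ++ (Pieces.cod (LPiece.elem (TanglePiece.cross c s₁ s₂)) ++ r1) =
      (l ++ [s₂]) ++ (s₁ :: r1) by simp [Pieces.cod], step_append (by simp)] at h2
    rw [show l ++ (Pieces.cod (LPiece.elem (TanglePiece.cross c t₃ t₄)) ++ r2) =
      (l ++ [t₄]) ++ (t₃ :: r2) by simp [Pieces.cod], step_append (by simp)] at h6
    obtain ⟨r3, e3, rfl⟩ := h2
    obtain ⟨r4, e4, -⟩ := h6
    rw [List.append_assoc, step_append rfl] at h3
    obtain ⟨r5, e5, -⟩ := h3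
    simp only [Pieces.dom, Pieces.cod, List.cons_append, List.nil_append,
      List.cons.injEq] at e1 e2 e3 e4 e5
    obtain ⟨rfl, rfl, rfl⟩ := e1
    obtain ⟨rfl, rfl, rfl⟩ := e2
    obtain ⟨rfl, rfl, rfl⟩ := e3
    obtain ⟨rfl, rfl, -⟩ := e4
    obtain ⟨rfl, rfl, -⟩ := e5
    rw [List.append_assoc] at hf
    exact hX.braid_all c _ _ _ l r hf
  | vertexPass c i =>
    simp only [forgetL_eq_cons, forgetL_eq_nil, LPiece.forget_eq_cross,
      LPiece.forget_eq_vert] at hx' hy'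
    obtain ⟨_, _, rfl, ⟨s₁, s₂, rfl⟩, _, _, rfl, ⟨s₃, s₄, rfl⟩, _, _, rfl, ⟨s₅, s₆, rfl⟩, rfl⟩ :=
      hx'
    obtain ⟨_, _, rfl, ⟨t₁, t₂, rfl⟩, _, _, rfl, ⟨t₃, t₄, rfl⟩, _, _, rfl, ⟨t₅, t₆, rfl⟩, rfl⟩ :=
      hy'
    obtain ⟨m, h1, m', h2, m'', h3, rfl⟩ := hx
    obtain ⟨n, h4, n', h5, n'', h6, -⟩ := hy
    obtain ⟨l, r, hl, rfl, rfl⟩ := h4.exists_append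
    obtain ⟨l, p, rfl, rfl⟩ := exists_append_singleton hl
    rw [List.append_assoc, step_append rfl] at h1 h5
    obtain ⟨r1, e1, rfl⟩ := h1
    obtain ⟨r2, e2, rfl⟩ := h5
    rw [show l ++ (Pieces.cod (LPiece.vert s₁ s₂) ++ r1) =
      (l ++ [s₂]) ++ (s₁ :: r1) by simp [Pieces.cod], step_append (by simp)] at h2
    rw [show l ++ (Pieces.cod (LPiece.elem (TanglePiece.cross c t₃ t₄)) ++ r2) =
      (l ++ [t₄]) ++ (t₃ :: r2) by simp [Pieces.cod], step_append (by simp)] at h6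
    obtain ⟨r3, e3, rfl⟩ := h2
    obtain ⟨r4, e4, -⟩ := h6
    rw [List.append_assoc, step_append rfl] at h3
    obtain ⟨r5, e5, -⟩ := h3
    simp only [Pieces.dom, Pieces.cod, List.cons_append, List.nil_append,
      List.cons.injEq] at e1 e2 e3 e4 e5
    obtain ⟨rfl, rfl, rfl⟩ := e1
    obtain ⟨rfl, rfl, rfl⟩ := e2
    obtain ⟨rfl, rfl, rfl⟩ := e3
    obtain ⟨rfl, rfl, -⟩ := e4
    obtain ⟨rfl, rfl, -⟩ := e5
    rw [List.append_assoc] at hf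
    exact hX.vert_pass l r c _ _ _ hf
  | vertexFlip c i =>
    simp only [forgetL_eq_cons, forgetL_eq_nil, LPiece.forget_eq_cross,
      LPiece.forget_eq_vert] at hx' hy'
    obtain ⟨_, _, rfl, ⟨s₁, s₂, rfl⟩, _, _, rfl, ⟨s₃, s₄, rfl⟩, rfl⟩ := hx'
    obtain ⟨_, _, rfl, ⟨t₁, t₂, rfl⟩, _, _, rfl, ⟨t₃, t₄, rfl⟩, rfl⟩ := hy'
    obtain ⟨m, h1, m', h2, rfl⟩ := hx
    obtain ⟨n, h3, n', h4, -⟩ := hy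
    obtain ⟨l, r, rfl, rfl, rfl⟩ := h1.exists_append
    rw [step_append rfl] at h2 h3
    obtain ⟨r', e1, -⟩ := h2
    obtain ⟨r'', e2, rfl⟩ := h3
    rw [step_append rfl] at h4
    obtain ⟨r3, e3, -⟩ := h4
    simp only [Pieces.dom, Pieces.cod, List.cons_append, List.nil_append,
      List.cons.injEq] at e1 e2 e3
    obtain ⟨rfl, rfl, -⟩ := e1
    obtain ⟨rfl, rfl, rfl⟩ := e2
    obtain ⟨rfl, rfl, -⟩ := e3
    exact hX.vert_flip l r c _ _ hf

end TangleRep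
end KnottedGraph

/-! ### Invariants of closed diagrams and the representations they define. -/

namespace KnottedGraph
open Labels

theorem Step.right_unique {G C : Type} [Pieces G C] {x : ℕ × G} {s t t' : List C}
    (h : Step x s t) (h' : Step x s t') : t = t' := by
  obtain ⟨l, r, h1, rfl, rfl⟩ := h
  obtain ⟨l', r', h1', h2, rfl⟩ := h'
  rw [List.append_assoc, List.append_assoc] at h2
  obtain ⟨rfl, h3⟩ := List.append_inj h2 (h1.trans h1'.symm)
  rw [List.append_cancel_left h3]

theorem Runs.right_unique {G C : Type} [Pieces G C] {w : Layers G} {s t t' : List C}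
    (h : Runs w s t) (h' : Runs w s t') : t = t' := by
  induction w generalizing s with
  | nil => exact Eq.trans (Eq.symm h) h'
  | cons x w ih =>
    obtain ⟨r, h1, h2⟩ := h
    obtain ⟨r', h1', h2'⟩ := h'
    obtain rfl := h1.right_unique h1'
    exact ih h2 h2'

theorem runs_append_iff {G C : Type} [Pieces G C] {u v : Layers G} {s t r : List C}
    (h : Runs u s r) : Runs (u ++ v) s t ↔ Runs v r t := by
  rw [runs_append]
  exact ⟨fun ⟨r', h1, h2⟩ => h.right_unique h1 ▸ h2, fun h2 => ⟨r, h, h2⟩⟩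

variable {K C : Type} [CommRing K] [Labels C] [DecidableEq C]

/-- `F` is an invariant of closed diagrams under regular rigid vertex isotopy, which satisfies the skein
relations with parameter `q`, kink factors `κ` and values `δ` of the circles; the relations of
crossings and vertices are required for strands with label `c₀` only. -/
structure IsInvariant (F : Layers (LPiece C) → K) (q : Kˣ) (κ : C → Kˣ) (δ : C → K) (c₀ : C) :
    Prop where
  -- Extension by zero makes an invariant a function of all words, so that linear algebra does not
  -- involve proofs of closedness.
  support : ∀ w, ¬ Runs w [] [] → F w = 0
  isotopy : ∀ u v x y : Layers (LPiece C), Move (forgetL x) (forgetL y) →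
    Runs (u ++ (x ++ v)) [] [] → Runs (u ++ (y ++ v)) [] [] → F (u ++ (x ++ v)) = F (u ++ (y ++ v))
  empty : F [] = 1
  circle : ∀ c, F [(0, .elem (.cup c)), (0, .elem (.cap c))] = δ c
  skein : ∀ (u v : Layers (LPiece C)) (i : ℕ),
    Runs (u ++ (i, .elem (.cross .slash c₀ c₀)) :: v) [] [] →
    F (u ++ (i, .elem (.cross .slash c₀ c₀)) :: v) -
      F (u ++ (i, .elem (.cross .backslash c₀ c₀)) :: v) =
    ((q : K) - ↑q⁻¹) * (F (u ++ v) -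
      if c₀ = bar c₀ then F (u ++ (i, .elem (.cap c₀)) :: (i, .elem (.cup c₀)) :: v) else 0)
  kink : ∀ (u v : Layers (LPiece C)) (i : ℕ) (c : C),
    Runs (u ++ (i + 1, .elem (.cup c)) :: (i, .elem (.cross .slash c c)) ::
      (i + 1, .elem (.cap c)) :: v) [] [] →
    F (u ++ (i + 1, .elem (.cup c)) :: (i, .elem (.cross .slash c c)) ::
      (i + 1, .elem (.cap c)) :: v) = κ c * F (u ++ v)
  vert : ∀ (u v : Layers (LPiece C)) (i : ℕ),
    Runs (u ++ (i, .vert c₀ c₀) :: v) [] [] →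
    F (u ++ (i, .vert c₀ c₀) :: v) = - F (u ++ (i, .elem (.cross .slash c₀ c₀)) :: v) +
      q * F (u ++ v) + ↑q⁻¹ *
      if c₀ = bar c₀ then F (u ++ (i, .elem (.cap c₀)) :: (i, .elem (.cup c₀)) :: v) else 0

/-! ### Rotation of the skein relation -/

namespace TangleRep
variable {V : Type} [AddCommGroup V] [Module K V] {X : TangleRep K V C} {f : V} {q : Kˣ}

/-- A family of operations on two adjacent strands which rotates past minima. -/
theorem IsPlanar.eq_rotate (hX : X.IsPlanar) {S T : ℕ → Module.End K V} {s t u : C} (hu : u = bar t)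
    (h : ∀ (l r : List C) {f : V}, f ∈ X.deg (l ++ s :: r) →
      S (l.length + 1) (X.cup l.length t f) = T l.length (X.cup (l.length + 1) t f))
    (hT : ∀ (l r : List C) {f : V}, f ∈ X.deg (l ++ s :: t :: u :: t :: r) →
      X.cap (l.length + 2) u (T l.length f) = T l.length (X.cap (l.length + 2) u f))
    (l r : List C) (hf : f ∈ X.deg (l ++ s :: t :: r)) :
    X.cap (l.length + 2) u (S (l.length + 1) (X.cup l.length t f)) = T l.length f := by
  have hf' : f ∈ X.deg ((l ++ [s]) ++ t :: r) := by simpa using hf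
  rw [h l (t :: r) hf]
  have m : X.cup (l.length + 1) t f ∈ X.deg (l ++ s :: t :: u :: t :: r) := by
    have := hX.cup_mem (l ++ [s]) (t :: r) hu hf'
    simpa using this
  rw [hT l r m]
  have := hX.zagzig (l ++ [s]) r t u (bar_eq_comm.1 hu) hf'
  simp only [List.length_append, List.length_singleton] at this
  rw [this]

theorem IsPlanar.cross_rotate (hX : X.IsPlanar) (k : Crossing) {s t u : C} (hu : u = bar t)
    (l r : List C) (hf : f ∈ X.deg (l ++ s :: t :: r)) :
    X.cap (l.length + 2) u (X.cross (l.length + 1) k.flip u s (X.cup l.length t f)) =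
      X.cross l.length k s t f := by
  refine hX.eq_rotate (S := fun i => X.cross i k.flip u s) (T := fun i => X.cross i k s t) hu ?_
    (fun l r f hf => hX.far_op (.cross k s t) (.cap u) l [s, t] [] [u, t] r rfl rfl hf) l r hf
  intro l r f hf
  have := hX.crossCup l r k.flip t u s hu hf
  rwa [Crossing.flip_flip] at this

/-- Bending the strand `t` turns the picture by a right angle. This exchanges the two crossings and
also the two smoothings, so both sides of the relation change sign. -/
theorem IsPlanar.skein_rotate (hX : X.IsPlanar) {s t u : C} (hu : u = bar t)
    (h : X.Skein q u s) : X.Skein q s t := by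
  intro l r f hf
  have hu' := bar_eq_comm.1 hu
  have hf' : f ∈ X.deg ((l ++ [s]) ++ t :: r) := by simpa using hf
  have m : X.cup l.length t f ∈ X.deg ((l ++ [t]) ++ u :: s :: t :: r) := by
    simpa using hX.cup_mem l (s :: t :: r) hu hf
  have e := h (l ++ [t]) (t :: r) m
  simp only [List.length_append, List.length_singleton] at e
  have e' := congrArg (X.cap (l.length + 2) u) e
  have e1 := hX.cross_rotate .backslash hu l r hf
  have e2 := hX.cross_rotate .slash hu l r hf
  simp only [Crossing.flip] at e1 e2
  rw [map_sub, e1, e2, map_smul, map_sub] at e'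
  have h1 : X.cap (l.length + 2) u (if u = s then X.cup l.length t f else 0) =
      if t = bar s then X.cup l.length t (X.cap l.length s f) else 0 := by
    by_cases hs : u = s
    · subst hs
      have := hX.exchange_at (.cup t) (.cap u) l [] r hf (by simp [Pieces.dom, hu'])
        rfl (i := l.length) (j := l.length + 2) (j' := l.length) rfl rfl
      rw [if_pos rfl, if_pos hu']
      exact this
    · rw [if_neg hs, if_neg, map_zero]
      rintro rfl
      exact hs (by rw [hu, bar_bar])
  have h2 : X.cap (l.length + 2) u (if s = bar u then
      X.cup (l.length + 1) s (X.cap (l.length + 1) u (X.cup l.length t f)) else 0) =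
      if s = t then f else 0 := by
    rw [← hu']
    by_cases hs : s = t
    · subst hs
      rw [if_pos rfl, if_pos rfl, hX.zagzig l (s :: r) s u hu' hf]
      have := hX.zagzig (l ++ [s]) r s u hu' hf'
      simp only [List.length_append, List.length_singleton] at this
      rw [this]
    · rw [if_neg hs, if_neg hs, map_zero]
  rw [h1, h2] at e'
  rw [← neg_inj, neg_sub, e']
  module

/-- Three quarter turns lead from the labels `c`, `c` through all pairs of labels, so a relation
which rotates is needed for one orientation of a crossing only. -/
theorem forall_of_rotate {p : C → C → Prop} (c : C) (h : p c c)
    (hp : ∀ s t u, u = bar t → p u s → p s t) (s t : C) : p s t := by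
  have h1 : p c (bar c) := hp _ _ _ (bar_bar c).symm h
  have h2 : p (bar c) (bar c) := hp _ _ _ (bar_bar c).symm h1
  have h3 : p (bar c) c := hp _ _ _ rfl h2
  rcases eq_or_eq_bar s c with rfl | rfl
  · rcases eq_or_eq_bar t s with rfl | rfl
    exacts [h, h1]
  · rcases eq_or_eq_bar t c with rfl | rfl
    exacts [h3, h2]

end TangleRep

/-! ### The representation given by an invariant -/

/-- The operation of a word on functions of the word which follows. -/
def precompose (w : Layers (LPiece C)) : Module.End K (Layers (LPiece C) → K) where
  toFun f v := f (w ++ v)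
  map_add' _ _ := rfl
  map_smul' _ _ := rfl

/-- The tangles, regarded as functions of the tangles by which they are closed. -/
def functionalRep (F : Layers (LPiece C) → K) : TangleRep K (Layers (LPiece C) → K) C where
  deg s := Submodule.span K {f | ∃ u, Runs u [] s ∧ f = precompose u F}
  op i g := precompose [(i, .elem g)]

variable {F : Layers (LPiece C) → K} {q : Kˣ} {κ : C → Kˣ} {δ : C → K} {c₀ : C}
  {f : Layers (LPiece C) → K}

theorem functionalRep_ext {s : List C} {S T : Module.End K (Layers (LPiece C) → K)}
    (h : ∀ u, Runs u [] s → S (precompose u F) = T (precompose u F))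
    (hf : f ∈ (functionalRep F).deg s) : S f = T f := by
  have : (functionalRep F).deg s ≤ LinearMap.eqLocus S T := by
    refine Submodule.span_le.2 ?_
    rintro _ ⟨u, hu, rfl⟩
    exact h u hu
  exact this hf

theorem precompose_mem {s t : List C} {w : Layers (LPiece C)} (h : Runs w s t)
    (hf : f ∈ (functionalRep F).deg s) : precompose w f ∈ (functionalRep F).deg t := by
  have : (functionalRep F).deg s ≤ ((functionalRep F).deg t).comap (precompose w) := by
    refine Submodule.span_le.2 ?_
    rintro _ ⟨u, hu, rfl⟩
    refine Submodule.subset_span ⟨u ++ w, (runs_append_iff hu).2 h, ?_⟩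
    ext v
    simp [precompose]
  exact this hf

theorem mem_functionalRep_nil : F ∈ (functionalRep F).deg [] :=
  Submodule.subset_span ⟨[], rfl, rfl⟩

theorem Step.intro {G C : Type} [Pieces G C] {i : ℕ} {g : G} {s t : List C} (l r : List C)
    (hi : l.length = i := by simp) (hs : s = l ++ (Pieces.dom g ++ r) := by simp [Pieces.dom])
    (ht : t = l ++ (Pieces.cod g ++ r) := by simp [Pieces.cod]) : Step (i, g) s t :=
  ⟨l, r, hi, by rw [hs, List.append_assoc], by rw [ht, List.append_assoc]⟩

/-- If `v` does not close the tangle, both sides vanish by `hsupp`, so only closed diagrams have to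
be compared. The scalar `b` is `1` for an isotopy and the kink factor for a kink. -/
theorem precompose_eq {s t : List C} {x y : Layers (LPiece C)} {b : K}
    (hsupp : ∀ w, ¬ Runs w [] [] → F w = 0) (hx : Runs x s t) (hy : Runs y s t)
    (h : ∀ u v, Runs u [] s → Runs v t [] → F (u ++ (x ++ v)) = b * F (u ++ (y ++ v)))
    (hf : f ∈ (functionalRep F).deg s) : precompose x f = b • precompose y f := by
  refine functionalRep_ext (S := precompose x) (T := b • precompose y) (fun u hu => ?_) hf
  ext v
  change F (u ++ (x ++ v)) = b * F (u ++ (y ++ v))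
  by_cases hv : Runs v t []
  · exact h u v hu hv
  · rw [hsupp _ (by rwa [runs_append_iff hu, runs_append_iff hx]),
      hsupp _ (by rwa [runs_append_iff hu, runs_append_iff hy]), mul_zero]

namespace IsInvariant

theorem precompose_isotopy (hF : IsInvariant F q κ δ c₀) {s t : List C} {x y : Layers (LPiece C)}
    (hx : Runs x s t) (hy : Runs y s t) (h : Move (forgetL x) (forgetL y))
    (hf : f ∈ (functionalRep F).deg s) : precompose x f = precompose y f := by
  have := precompose_eq (b := 1) hF.support hx hy (fun u v hu hv => ?_) hf
  · rwa [one_smul] at this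
  · rw [one_mul]
    exact hF.isotopy u v x y h (by rwa [runs_append_iff hu, runs_append_iff hx])
      (by rwa [runs_append_iff hu, runs_append_iff hy])

theorem op_eq_zero (hF : IsInvariant F q κ δ c₀) {i : ℕ} {g : TanglePiece C} {s : List C}
    (hf : f ∈ (functionalRep F).deg s) (h : ∀ t, ¬ Step (i, g) s t) :
    (functionalRep F).op i g f = 0 := by
  refine functionalRep_ext (S := (functionalRep F).op i g) (T := 0) (fun u hu => ?_) hf
  ext v
  refine hF.support _ ?_
  rw [runs_append_iff hu]
  rintro ⟨t, h1, -⟩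
  exact h t h1

theorem isPlanar (hF : IsInvariant F q κ δ c₀) : (functionalRep F).IsPlanar where
  op_mem g l r f hf := by
    refine precompose_mem ⟨_, ?_, rfl⟩ hf
    exact Step.intro l r rfl rfl rfl
  cap_zero l r c s t f hf h := by
    refine hF.op_eq_zero hf fun t' h' => h ?_
    obtain ⟨r', h1, -⟩ := (step_append rfl).1 h'
    simp only [Pieces.dom, List.cons_append, List.cons.injEq] at h1
    exact ⟨h1.1, h1.2.1⟩
  cross_zero l r k c d s t f hf h := by
    refine hF.op_eq_zero hf fun t' h' => h ?_
    obtain ⟨r', h1, -⟩ := (step_append rfl).1 h'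
    simp only [Pieces.dom, List.cons_append, List.cons.injEq] at h1
    exact ⟨h1.1, h1.2.1⟩
  exchange g h l m r x y f hx hy hf := by
    subst hx hy
    refine hF.precompose_isotopy (t := l ++ (Pieces.cod g ++ (m ++ (Pieces.cod h ++ r))))
      (x := [(l.length, .elem g), (l.length + (Pieces.cod g).length + m.length, .elem h)])
      (y := [(l.length + (Pieces.dom g).length + m.length, .elem h), (l.length, .elem g)])
      ⟨_, Step.intro l (m ++ (Pieces.dom h ++ r)) rfl rfl rfl, _,
        Step.intro (l ++ (Pieces.cod g ++ m)) r (by simp [add_assoc]) (by simp; rfl) rfl,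
        by simp; rfl⟩
      ⟨_, Step.intro (l ++ (Pieces.dom g ++ m)) r (by simp [add_assoc]) (by simp; rfl) rfl, _,
        Step.intro l (m ++ (Pieces.cod h ++ r)) rfl (by simp; rfl) rfl, rfl⟩ ?_ hf
    have := Move.exchange (LPiece.elem g).forget (LPiece.elem h).forget l.length m.length
    rw [← LPiece.length_dom, ← LPiece.length_cod] at this
    exact this
  zigzag l r c d f h hf := by
    subst h
    exact hF.precompose_isotopy (t := l ++ c :: r) (y := [])
      (x := [(l.length + 1, .elem (.cup (bar c))), (l.length, .elem (.cap c))])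
      ⟨l ++ c :: bar c :: c :: r, Step.intro (l ++ [c]) r (by simp) (by simp [Pieces.dom])
        (by simp [Pieces.cod, bar_bar]), _, Step.intro l (c :: r), rfl⟩ rfl (Move.zigzag _) hf
  zagzig l r c d f h hf := by
    obtain rfl := TangleRep.bar_eq_comm.1 h
    exact hF.precompose_isotopy (t := l ++ c :: r) (y := [])
      (x := [(l.length, .elem (.cup c)), (l.length + 1, .elem (.cap (bar c)))])
      ⟨l ++ c :: bar c :: c :: r, Step.intro l (c :: r) , _, Step.intro (l ++ [c]) r (by simp)
        (by simp [Pieces.dom, bar_bar]) rfl, by simp [Runs, Pieces.cod]⟩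
      rfl (Move.zagzig _) hf
  crossCup l r k c d s f h hf := by
    subst h
    exact hF.precompose_isotopy (t := l ++ c :: s :: bar c :: r)
      (x := [(l.length, .elem (.cup c)), (l.length + 1, .elem (.cross k (bar c) s))])
      (y := [(l.length + 1, .elem (.cup c)), (l.length, .elem (.cross k.flip s c))])
      ⟨l ++ c :: bar c :: s :: r, Step.intro l (s :: r), _, Step.intro (l ++ [c]) r (by simp)
        (by simp [Pieces.dom]) rfl, by simp [Runs, Pieces.cod]⟩
      ⟨l ++ s :: c :: bar c :: r, Step.intro (l ++ [s]) r, _, Step.intro l (bar c :: r) rfl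
        (by simp [Pieces.dom]) rfl, rfl⟩ (Move.crossCup k _) hf

theorem runs_kink (l r : List C) (c : C) : Runs [(l.length + 1, LPiece.elem (.cup c)),
    (l.length, .elem (.cross .slash c c)), (l.length + 1, .elem (.cap c))]
    (l ++ c :: r) (l ++ c :: r) :=
  ⟨l ++ c :: c :: bar c :: r, Step.intro (l ++ [c]) r, l ++ c :: c :: bar c :: r,
    Step.intro l (bar c :: r), _, Step.intro (l ++ [c]) r (by simp) (by simp [Pieces.dom]) rfl,
    by simp [Runs, Pieces.cod]⟩

theorem runs_cross (l r : List C) (k : Crossing) (s t : C) :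
    Runs [(l.length, LPiece.elem (.cross k s t))] (l ++ s :: t :: r) (l ++ t :: s :: r) :=
  ⟨_, Step.intro l r rfl rfl rfl, rfl⟩

theorem runs_cap_cup (l r : List C) {s t : C} (h : t = bar s) :
    Runs [(l.length, LPiece.elem (.cap s)), (l.length, .elem (.cup t))]
      (l ++ s :: t :: r) (l ++ t :: s :: r) := by
  subst h
  exact ⟨l ++ r, Step.intro l r, _, Step.intro l r rfl rfl rfl, by
    simp [Runs, Pieces.cod, bar_bar]⟩

/-- Each relation is that of `F` for an arbitrary completion of the diagram. The skein relation is
given for `c₀` only and spreads to all labels by rotation. -/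
theorem isSkein (hF : IsInvariant F q κ δ c₀) : (functionalRep F).IsSkein q κ where
  toIsPlanar := hF.isPlanar
  crossCap l r k c d s f h hf := by
    subst h
    exact hF.precompose_isotopy (t := l ++ s :: r)
      (x := [(l.length + 1, .elem (.cross k s (bar c))), (l.length, .elem (.cap c))])
      (y := [(l.length, .elem (.cross k.flip c s)), (l.length + 1, .elem (.cap c))])
      ⟨l ++ c :: bar c :: s :: r, Step.intro (l ++ [c]) r, _, Step.intro l (s :: r), rfl⟩
      ⟨l ++ s :: c :: bar c :: r, Step.intro l (bar c :: r), _, Step.intro (l ++ [s]) r (by simp)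
        (by simp [Pieces.dom]) rfl, by simp [Runs, Pieces.cod]⟩ (Move.crossCap k _) hf
  inverse k s t l r f hf := hF.precompose_isotopy (t := l ++ s :: t :: r) (y := [])
    (x := [(l.length, .elem (.cross k s t)), (l.length, .elem (.cross k.flip t s))])
    ⟨_, Step.intro l r rfl rfl rfl, _, Step.intro l r rfl rfl rfl, rfl⟩ rfl
    (Move.reidemeisterTwo k _) hf
  braid s t u l r f hf := hF.precompose_isotopy (t := l ++ u :: t :: s :: r)
    (x := [(l.length, .elem (.cross .slash s t)), (l.length + 1, .elem (.cross .slash s u)),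
      (l.length, .elem (.cross .slash t u))])
    (y := [(l.length + 1, .elem (.cross .slash t u)), (l.length, .elem (.cross .slash s u)),
      (l.length + 1, .elem (.cross .slash s t))])
    ⟨l ++ t :: s :: u :: r, Step.intro l (u :: r), l ++ t :: u :: s :: r, Step.intro (l ++ [t]) r,
      _, Step.intro l (s :: r), rfl⟩
    ⟨l ++ s :: u :: t :: r, Step.intro (l ++ [s]) r, l ++ u :: s :: t :: r,
      Step.intro l (t :: r), l ++ u :: t :: s :: r, Step.intro (l ++ [u]) r, rfl⟩
    (Move.reidemeisterThree .slash _) hf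
  skein := by
    refine TangleRep.forall_of_rotate c₀ ?_
      fun s t u hu h => hF.isPlanar.skein_rotate hu h
    intro l r f hf
    have e : ((functionalRep F).cross l.length .slash c₀ c₀ -
        (functionalRep F).cross l.length .backslash c₀ c₀) f =
        (((q : K) - ↑q⁻¹) • (1 - if c₀ = bar c₀ then
          (functionalRep F).cup l.length c₀ * (functionalRep F).cap l.length c₀ else 0) :
          Module.End K (Layers (LPiece C) → K)) f := by
      refine functionalRep_ext (fun u hu => ?_) hf
      ext v
      have h1 := hF.skein u v l.length
      have hr1 := runs_cross l r .slash c₀ c₀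
      have hr2 := runs_cross l r .backslash c₀ c₀
      by_cases hv : Runs v (l ++ c₀ :: c₀ :: r) []
      · have h2 := h1 (by
          rw [runs_append_iff hu]
          exact (runs_append_iff (v := v) hr1).2 hv)
        by_cases hc : c₀ = bar c₀
        · simp only [if_pos hc] at h2 ⊢
          exact h2
        · simp only [if_neg hc] at h2 ⊢
          exact h2
      · have z1 : F (u ++ (l.length, .elem (.cross .slash c₀ c₀)) :: v) = 0 := hF.support _ (by
          rw [runs_append_iff hu]
          exact fun h => hv ((runs_append_iff (v := v) hr1).1 h))
        have z2 : F (u ++ (l.length, .elem (.cross .backslash c₀ c₀)) :: v) = 0 :=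
          hF.support _ (by
            rw [runs_append_iff hu]
            exact fun h => hv ((runs_append_iff (v := v) hr2).1 h))
        have z3 : F (u ++ v) = 0 := hF.support _ (by rwa [runs_append_iff hu])
        have z4 : c₀ = bar c₀ →
            F (u ++ (l.length, .elem (.cap c₀)) :: (l.length, .elem (.cup c₀)) :: v) = 0 := by
          intro hc
          refine hF.support _ ?_
          rw [runs_append_iff hu]
          exact fun h => hv ((runs_append_iff (v := v) (runs_cap_cup l r hc)).1 h)
        by_cases hc : c₀ = bar c₀
        · simp only [if_pos hc]
          change F (u ++ (l.length, .elem (.cross .slash c₀ c₀)) :: v) -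
            F (u ++ (l.length, .elem (.cross .backslash c₀ c₀)) :: v) =
            ((q : K) - ↑q⁻¹) * (F (u ++ v) -
              F (u ++ (l.length, .elem (.cap c₀)) :: (l.length, .elem (.cup c₀)) :: v))
          rw [z1, z2, z3, z4 hc]
          simp
        · simp only [if_neg hc]
          change F (u ++ (l.length, .elem (.cross .slash c₀ c₀)) :: v) -
            F (u ++ (l.length, .elem (.cross .backslash c₀ c₀)) :: v) =
            ((q : K) - ↑q⁻¹) * (F (u ++ v) - 0)
          rw [z1, z2, z3]
          simp
    rw [LinearMap.sub_apply, LinearMap.smul_apply, LinearMap.sub_apply] at e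
    rw [e, if_pos rfl]
    by_cases hc : c₀ = bar c₀
    · simp only [if_pos hc]
      rfl
    · simp only [if_neg hc]
      rfl
  kink l r c f hf := precompose_eq hF.support (x := [(l.length + 1, .elem (.cup c)),
      (l.length, .elem (.cross .slash c c)), (l.length + 1, .elem (.cap c))]) (y := [])
    (runs_kink l r c) rfl (fun u v hu hv => hF.kink u v l.length c (by
      rw [runs_append_iff hu]
      exact (runs_append_iff (v := v) (runs_kink l r c)).2 hv)) hf


theorem runs_vert (l r : List C) (s t : C) :
    Runs [(l.length, LPiece.vert s t)] (l ++ s :: t :: r) (l ++ t :: s :: r) :=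
  ⟨_, Step.intro l r rfl rfl rfl, rfl⟩

/-- For `c₀` this is the vertex relation of `F`. Both sides turn past minima in the same way, the
left one by the move `vertCup` and the right one by `vert_cup`, so rotation reaches the other
labels. -/
theorem precompose_vert (hF : IsInvariant F q κ δ c₀) (s t : C) (l r : List C)
    (hf : f ∈ (functionalRep F).deg (l ++ s :: t :: r)) :
    precompose [(l.length, .vert s t)] f = (functionalRep F).vert q l.length s t f := by
  revert s t l r f
  have := TangleRep.forall_of_rotate (p := fun s t => ∀ (l r : List C) {f}, f ∈
    (functionalRep F).deg (l ++ s :: t :: r) → precompose [(l.length, .vert s t)] f =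
      (functionalRep F).vert q l.length s t f) c₀ ?_ ?_
  · exact fun f s t l r hf => this s t l r hf
  · intro l r f hf
    refine functionalRep_ext (fun u hu => ?_) hf
    ext v
    rw [TangleRep.vert_apply]
    have h1 := hF.vert u v l.length
    have hr1 := runs_vert l r c₀ c₀
    have hr2 := runs_cross l r .slash c₀ c₀
    by_cases hv : Runs v (l ++ c₀ :: c₀ :: r) []
    · have h2 := h1 (by
        rw [runs_append_iff hu]
        exact (runs_append_iff (v := v) hr1).2 hv)
      by_cases hc : c₀ = bar c₀
      · simp only [if_pos hc] at h2 ⊢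
        exact h2
      · simp only [if_neg hc] at h2 ⊢
        exact h2
    · have z1 : F (u ++ (l.length, .vert c₀ c₀) :: v) = 0 := hF.support _ (by
        rw [runs_append_iff hu]
        exact fun h => hv ((runs_append_iff (v := v) hr1).1 h))
      have z2 : F (u ++ (l.length, .elem (.cross .slash c₀ c₀)) :: v) = 0 :=
        hF.support _ (by
          rw [runs_append_iff hu]
          exact fun h => hv ((runs_append_iff (v := v) hr2).1 h))
      have z3 : F (u ++ v) = 0 := hF.support _ (by rwa [runs_append_iff hu])
      have z4 : c₀ = bar c₀ →
          F (u ++ (l.length, .elem (.cap c₀)) :: (l.length, .elem (.cup c₀)) :: v) = 0 := by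
        intro hc
        refine hF.support _ ?_
        rw [runs_append_iff hu]
        exact fun h => hv ((runs_append_iff (v := v) (runs_cap_cup l r hc)).1 h)
      by_cases hc : c₀ = bar c₀
      · simp only [if_pos hc]
        change F (u ++ (l.length, .vert c₀ c₀) :: v) =
          - F (u ++ (l.length, .elem (.cross .slash c₀ c₀)) :: v) + q * F (u ++ v) +
          ↑q⁻¹ * F (u ++ (l.length, .elem (.cap c₀)) :: (l.length, .elem (.cup c₀)) :: v)
        rw [z1, z2, z3, z4 hc]
        simp
      · simp only [if_neg hc]
        change F (u ++ (l.length, .vert c₀ c₀) :: v) =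
          - F (u ++ (l.length, .elem (.cross .slash c₀ c₀)) :: v) + q * F (u ++ v) + ↑q⁻¹ * 0
        rw [z1, z2, z3]
        simp
  · intro s t u hu h l r f hf
    have hp := hF.isPlanar
    have m : (functionalRep F).cup l.length t f ∈
        (functionalRep F).deg ((l ++ [t]) ++ u :: s :: t :: r) := by
      simpa using hp.cup_mem l (s :: t :: r) hu hf
    have e0 := h (l ++ [t]) (t :: r) m
    simp only [List.length_append, List.length_singleton] at e0
    have e1 := hp.eq_rotate (S := fun i => precompose [(i, .vert u s)])
      (T := fun i => precompose [(i, .vert s t)]) hu ?_ ?_ l r hf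
    · have e2 := hp.eq_rotate (S := fun i => (functionalRep F).vert q i u s)
        (T := fun i => (functionalRep F).vert q i s t) hu
        (fun l r f hf => hF.isSkein.vert_cup l r hu hf)
        (fun l r f hf => TangleRep.IsSkein.far_opL (q := q) hp (.vert s t) (.elem (.cap u)) l
          [s, t] [] [u, t] r rfl rfl hf) l r hf
      rw [← e1, ← e2]
      exact congrArg _ e0
    · intro l r f hf
      subst hu
      exact hF.precompose_isotopy (t := l ++ t :: s :: bar t :: r)
        (x := [(l.length, .elem (.cup t)), (l.length + 1, .vert (bar t) s)])
        (y := [(l.length + 1, .elem (.cup t)), (l.length, .vert s t)])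
        ⟨l ++ t :: bar t :: s :: r, Step.intro l (s :: r), _, Step.intro (l ++ [t]) r (by simp)
          (by simp [Pieces.dom]) rfl, by simp [Runs, Pieces.cod]⟩
        ⟨l ++ s :: t :: bar t :: r, Step.intro (l ++ [s]) r, _, Step.intro l (bar t :: r) rfl
          (by simp [Pieces.dom]) rfl, rfl⟩ (Move.vertCup _) hf
    · intro l r f hf
      obtain rfl := TangleRep.bar_eq_comm.1 hu
      refine hF.precompose_isotopy (t := l ++ bar u :: s :: r)
        (x := [(l.length, .vert s (bar u)), (l.length + 2, .elem (.cap u))])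
        (y := [(l.length + 2, .elem (.cap u)), (l.length, .vert s (bar u))])
        ⟨l ++ bar u :: s :: u :: bar u :: r, Step.intro l (u :: bar u :: r), _,
          Step.intro (l ++ [bar u, s]) r (by simp) (by simp [Pieces.dom]) rfl,
          by simp [Runs, Pieces.cod]⟩
        ⟨l ++ s :: bar u :: r, Step.intro (l ++ [s, bar u]) r, _, Step.intro l r rfl
          (by simp [Pieces.dom]) rfl, by simp [Runs, Pieces.cod]⟩ ?_ hf
      exact Move.exchange .vert .cap l.length 0

/-- This is what makes the spanning theorem for operators a statement about the values of `F`. -/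
theorem word_eq_precompose (hF : IsInvariant F q κ δ c₀) {w : Layers (LPiece C)} {s t : List C}
    (h : Runs w s t) (hf : f ∈ (functionalRep F).deg s) :
    (functionalRep F).word q w f = precompose w f := by
  induction w generalizing s f with
  | nil => rfl
  | cons x w ih =>
    obtain ⟨r, h1, h2⟩ := h
    obtain ⟨i, g⟩ := x
    have h3 : (functionalRep F).opL q i g f = precompose [(i, g)] f := by
      match g with
      | .elem g => rfl
      | .vert s' t' =>
        obtain ⟨l, r', rfl, rfl, -⟩ := h1.exists_append
        exact (hF.precompose_vert s' t' l r' hf).symm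
    have m : precompose [(i, g)] f ∈ (functionalRep F).deg r := precompose_mem ⟨r, h1, rfl⟩ hf
    change (functionalRep F).word q w ((functionalRep F).opL q i g f) = _
    rw [h3, ih h2 m]
    rfl

theorem step_nil {g : LPiece C} {i : ℕ} {t : List C} (h : Step (i, g) [] t) :
    i = 0 ∧ ∃ c, g = .elem (.cup c) ∧ t = [c, bar c] := by
  obtain ⟨l, r, rfl, h1, rfl⟩ := h.exists_append
  have h2 := h1.symm
  rw [List.append_eq_nil_iff, List.append_eq_nil_iff] at h2
  obtain ⟨rfl, h3, rfl⟩ := h2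
  refine ⟨rfl, ?_⟩
  rcases g with (c | c | _) | _
  · exact ⟨c, rfl, rfl⟩
  all_goals simp [Pieces.dom] at h3

/-- Followed by nothing, the circle has the prescribed value. Any other closed completion starts
with a minimum; the circle can be moved above it, beside a strand, where `circle_eq` evaluates it.
-/
theorem circle_op (hF : IsInvariant F q κ δ c₀) (hz : IsUnit ((q : K) - ↑q⁻¹))
    (hδ : ∀ c, ((q : K) - ↑q⁻¹) * δ c =
      (κ c : K) - ↑(κ (bar c))⁻¹ + if c = bar c then (q : K) - ↑q⁻¹ else 0) (c : C) :
    (functionalRep F).cap 0 c ((functionalRep F).cup 0 c F) = δ c • F := by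
  have hX := hF.isSkein
  have h₀ := mem_functionalRep_nil (F := F)
  have hc : Runs [(0, LPiece.elem (.cup c)), (0, .elem (.cap c))] [] [] :=
    ⟨[c, bar c], Step.intro [] [], [], Step.intro [] [], rfl⟩
  ext v
  change F ([(0, .elem (.cup c)), (0, .elem (.cap c))] ++ v) = δ c * F v
  match v with
  | [] => rw [List.append_nil, hF.circle, hF.empty, mul_one]
  | (i, g) :: v =>
    by_cases hv : Runs ((i, g) :: v) [] []
    · obtain ⟨t, h1, -⟩ := hv
      obtain ⟨rfl, d, rfl, -⟩ := step_nil h1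
      have m : (functionalRep F).cup 0 c F ∈ (functionalRep F).deg [c, bar c] :=
        hX.cup_mem [] [] rfl h₀
      have m' : (functionalRep F).cup 0 d F ∈ (functionalRep F).deg [d, bar d] :=
        hX.cup_mem [] [] rfl h₀
      have e1 := hX.circle_eq hz hδ c d [bar d] m'
      have e2 := hX.exchange (.cap c) (.cup d) [] [] [] (x := [c, bar c]) (y := []) rfl rfl m
      have e3 := hX.exchange (.cup c) (.cup d) [] [] [] (x := []) (y := []) rfl rfl h₀
      change (functionalRep F).cup 0 d ((functionalRep F).cap 0 c ((functionalRep F).cup 0 c F)) =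
        (functionalRep F).cap 0 c ((functionalRep F).cup 2 d ((functionalRep F).cup 0 c F)) at e2
      change (functionalRep F).cup 2 d ((functionalRep F).cup 0 c F) =
        (functionalRep F).cup 0 c ((functionalRep F).cup 0 d F) at e3
      rw [e3, e1] at e2
      exact congrFun e2 v
    · rw [hF.support _ hv, hF.support _ (by rwa [runs_append_iff hc]), mul_zero]

/-- The values of an invariant are polynomials in the parameters. -/
theorem mem_of_mem (hF : IsInvariant F q κ δ c₀) (hz : IsUnit ((q : K) - ↑q⁻¹))
    (hδ : ∀ c, ((q : K) - ↑q⁻¹) * δ c =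
      (κ c : K) - ↑(κ (bar c))⁻¹ + if c = bar c then (q : K) - ↑q⁻¹ else 0)
    {A : Subring K} (hq : (q : K) ∈ A) (hq' : (↑q⁻¹ : K) ∈ A) (hκ : ∀ c, (κ c : K) ∈ A)
    (hκ' : ∀ c, (↑(κ c)⁻¹ : K) ∈ A) (hδA : ∀ c, δ c ∈ A) (w : Layers (LPiece C)) :
    F w ∈ A := by
  by_cases hw : Runs w [] []
  swap
  · rw [hF.support w hw]; exact zero_mem A
  have hX := hF.isSkein
  have h₀ := mem_functionalRep_nil (F := F)
  have h1 : ∀ {w : Layers (LPiece C)} {s t : List C} {f}, Runs w s t →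
      (functionalRep F).InSpan A F s f →
      (functionalRep F).InSpan A F t ((functionalRep F).word q w f) := by
    intro w
    induction w with
    | nil =>
      intro s t f h hf
      obtain rfl : s = t := h
      exact hf
    | cons x w ih =>
      intro s t f h hf
      obtain ⟨r, h1, h2⟩ := h
      obtain ⟨i, g⟩ := x
      refine ih h2 ?_
      have hc := fun n => hX.closedAt h₀ hq hq' hκ hκ' hz hδ hδA (hF.circle_op hz hδ) n
      obtain ⟨l, r', rfl, rfl, rfl⟩ := h1.exists_append
      match g with
      | .elem g => exact hc _ g l r' rfl hf
      | .vert s' t' =>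
        change (functionalRep F).InSpan A F _ ((functionalRep F).vert q l.length s' t' f)
        replace hf : (functionalRep F).InSpan A F (l ++ s' :: t' :: r') f := hf
        rw [TangleRep.vert_apply]
        have i1 := hc _ (.cross .slash s' t') l r' rfl hf
        have i2 : (functionalRep F).InSpan A F (l ++ t' :: s' :: r')
            (if s' = t' then f else 0) := by
          split
          · next h => subst h; exact hf
          · exact .zero _
        have i3 : (functionalRep F).InSpan A F (l ++ t' :: s' :: r') (if t' = bar s' then
            (functionalRep F).cup l.length t' ((functionalRep F).cap l.length s' f) else 0) := by
          split
          · next h =>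
            subst h
            have := hc _ (.cup (bar s')) l r' rfl (hc _ (.cap s') l r' rfl hf)
            simpa [Pieces.cod, bar_bar] using this
          · exact .zero _
        have := ((i1.smul (-1) (neg_mem (one_mem A))).add (i2.smul _ hq)).add (i3.smul _ hq')
        rwa [neg_one_smul] at this
  have h2 := h1 hw .base
  rw [hF.word_eq_precompose hw h₀] at h2
  -- Over the empty row there are no arcs, so the span consists of the multiples of `F` by elements
  -- of `A`, and `F` is `1` on the empty word.
  have h3 : ∀ {f : Layers (LPiece C) → K}, (functionalRep F).InSpan A F [] f → f [] ∈ A := by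
    intro f hf
    generalize hs : ([] : List C) = s at hf
    induction hf with
    | base => rw [hF.empty]; exact one_mem A
    | arc => simp at hs
    | zero => exact zero_mem A
    | add _ _ h h' => exact add_mem (h hs) (h' hs)
    | smul b hb _ h => exact mul_mem hb (h hs)
  have h4 := h3 h2
  simpa [precompose] using h4

end IsInvariant
end KnottedGraph

/-! ### From representations to invariants; uniqueness and descent of invariants. -/

namespace KnottedGraph
open Labels

section
variable {K C : Type} [CommRing K] [Labels C] [DecidableEq C]

open Classical in
/-- The values of a representation on closed diagrams. -/
noncomputable def TangleRep.closedValue {V : Type} [AddCommGroup V] [Module K V]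
    (X : TangleRep K V C) (q : Kˣ) (v₀ : V) (ε : V →ₗ[K] K) (w : Layers (LPiece C)) : K :=
  if Runs w [] [] then ε (X.word q w v₀) else 0

theorem TangleRep.closedValue_of_runs {V : Type} [AddCommGroup V] [Module K V]
    {X : TangleRep K V C} {q : Kˣ} {v₀ : V} {ε : V →ₗ[K] K} {w : Layers (LPiece C)}
    (h : Runs w [] []) : X.closedValue q v₀ ε w = ε (X.word q w v₀) := if_pos h

theorem Runs.replace {G D : Type} [Pieces G D] {u v : Layers G} {i : ℕ} {g : G} (g' : G) {s t : List D}
    (h : Runs (u ++ (i, g) :: v) s t) (hd : Pieces.dom g = Pieces.dom g')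
    (hc : Pieces.cod g = Pieces.cod g') : Runs (u ++ (i, g') :: v) s t := by
  obtain ⟨r, h1, r', ⟨l, m, h2, h3, h4⟩, h5⟩ := runs_append.1 h
  exact runs_append.2 ⟨r, h1, r', ⟨l, m, h2, h3.trans (by rw [hd]), h4.trans (by rw [hc])⟩, h5⟩

theorem runs_nil (G D : Type) [Pieces G D] : Runs ([] : Layers G) ([] : List D) [] := rfl

theorem runs_circle (c : C) :
    Runs [(0, LPiece.elem (.cup c)), (0, LPiece.elem (.cap c))] ([] : List C) [] :=
  ⟨[c, bar c], Step.intro [] [] rfl rfl rfl, [], Step.intro [] [] rfl rfl rfl, rfl⟩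

theorem runs_cap_cup_append {c : C} {u v : Layers (LPiece C)} {l r s t : List C} (hc : c = bar c)
    (h1 : Runs u s (l ++ c :: c :: r)) (h2 : Runs v (l ++ c :: c :: r) t) :
    Runs (u ++ (l.length, LPiece.elem (.cap c)) :: (l.length, LPiece.elem (.cup c)) :: v) s t :=
  (runs_append_iff h1).2 ((runs_append_iff (v := v) (IsInvariant.runs_cap_cup l r hc)).2 h2)

/-- Converse of `IsInvariant.isSkein`: an operator identity in the middle of a word survives the
operators around it and the functional `ε`. -/
theorem TangleRep.IsSkein.isInvariant {V : Type} [AddCommGroup V] [Module K V]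
    {X : TangleRep K V C} {q : Kˣ} {κ : C → Kˣ} {δ : C → K} (hX : X.IsSkein q κ) {v₀ : V}
    (h₀ : v₀ ∈ X.deg []) {ε : V →ₗ[K] K} (hε : ε v₀ = 1)
    (hδ : ∀ c, ε (X.cap 0 c (X.cup 0 c v₀)) = δ c) (c₀ : C) :
    IsInvariant (X.closedValue q v₀ ε) q κ δ c₀ where
  support w h := if_neg h
  isotopy u v x y h hx hy := by
    rw [closedValue_of_runs hx, closedValue_of_runs hy]
    obtain ⟨s, h1, h2⟩ := runs_append.1 hx
    rw [runs_append_iff h1] at hy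
    have m := IsSkein.word_mem (q := q) hX.toIsPlanar h1 h₀
    simp only [word_append, Module.End.mul_apply]
    obtain ⟨t, h3, h4⟩ := runs_append.1 h2
    obtain ⟨t', h3', h4'⟩ := runs_append.1 hy
    -- Rows are determined backwards as well: both `t` and `t'` lead through `v` to the empty row.
    have ht : t = t' := by
      clear * - h4 h4'
      have key : ∀ (v : Layers (LPiece C)) {t t' r : List C}, Runs v t r → Runs v t' r → t = t' := by
        intro v
        induction v with
        | nil => intro t t' r h h'; exact Eq.trans h (Eq.symm h')
        | cons x v ih =>
          rintro t t' r ⟨s, h1, h2⟩ ⟨s', h1', h2'⟩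
          obtain rfl := ih h2 h2'
          obtain ⟨l, a, hl, rfl, rfl⟩ := h1.exists_append
          obtain ⟨l', a', hl', rfl, e⟩ := h1'.exists_append
          obtain ⟨rfl, e'⟩ := List.append_inj e (hl.trans hl'.symm)
          rw [List.append_cancel_left e']
      exact key v h4 h4'
    subst ht
    rw [hX.isotopy h h3 h3' m]
  empty := by
    rw [closedValue_of_runs (runs_nil _ _)]
    exact hε
  circle c := by
    rw [closedValue_of_runs (runs_circle c)]
    exact hδ c
  skein u v i h := by
    obtain ⟨s, h1, t, h2, h3⟩ := runs_append.1 h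
    obtain ⟨l, r, rfl, rfl, rfl⟩ := h2.exists_append
    have m := IsSkein.word_mem (q := q) hX.toIsPlanar h1 h₀
    have e := hX.skein c₀ c₀ l r m
    rw [if_pos rfl] at e
    have e' := congrArg (fun f => ε (X.word q v f)) e
    simp only [map_sub, map_smul] at e'
    rw [closedValue_of_runs h,
      closedValue_of_runs (h.replace (.elem (.cross .backslash c₀ c₀)) rfl rfl),
      closedValue_of_runs ((runs_append_iff h1).2 h3)]
    simp only [word_append, Module.End.mul_apply, word]
    refine e'.trans (congrArg (fun b => ((q : K) - ↑q⁻¹) * (_ - b)) ?_)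
    by_cases hc : c₀ = bar c₀
    · rw [if_pos hc, if_pos hc, closedValue_of_runs (runs_cap_cup_append hc h1 h3)]
      simp only [word_append, Module.End.mul_apply, word]
      rfl
    · rw [if_neg hc, if_neg hc, map_zero, map_zero]
  kink u v i c h := by
    obtain ⟨s, h1, t, h2, t', h3, t'', h4, h5⟩ := runs_append.1 h
    obtain ⟨l, r, hl, rfl, rfl⟩ := h2.exists_append
    obtain ⟨l, d, rfl, rfl⟩ := exists_append_singleton hl
    rw [List.append_assoc, step_append rfl] at h3
    obtain ⟨r', e1, rfl⟩ := h3
    simp only [Pieces.dom, Pieces.cod, List.cons_append, List.nil_append,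
      List.cons.injEq] at e1
    obtain ⟨rfl, -, rfl⟩ := e1
    have hk := (runs_append_iff (IsInvariant.runs_kink l r d)).1
      ((runs_append_iff (by simpa [Pieces.dom] using h1)).1 h)
    have m := IsSkein.word_mem (q := q) hX.toIsPlanar h1 h₀
    have e := hX.kink l r d (by simpa [Pieces.dom] using m)
    have e' := congrArg (fun f => ε (X.word q v f)) e
    simp only [map_smul] at e'
    rw [closedValue_of_runs h, closedValue_of_runs ((runs_append_iff
      (by simpa [Pieces.dom] using h1)).2 hk)]
    simp only [word_append, Module.End.mul_apply, word]
    exact e'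
  vert u v i h := by
    obtain ⟨s, h1, t, h2, h3⟩ := runs_append.1 h
    obtain ⟨l, r, rfl, rfl, rfl⟩ := h2.exists_append
    rw [closedValue_of_runs h,
      closedValue_of_runs (h.replace (.elem (.cross .slash c₀ c₀)) rfl rfl),
      closedValue_of_runs ((runs_append_iff h1).2 h3)]
    simp only [word_append, Module.End.mul_apply, word, opL, vert_apply, map_add, map_neg, map_smul, if_true]
    by_cases hc : c₀ = bar c₀
    · simp only [if_pos hc, smul_eq_mul]
      rw [closedValue_of_runs (runs_cap_cup_append hc h1 h3)]
      simp only [word_append, Module.End.mul_apply, word]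
      rfl
    · simp only [if_neg hc, map_zero, mul_zero, smul_eq_mul]

namespace IsInvariant

/-- Several invariants form one over the product ring; a subring of the product which contains the
parameters then imposes relations between their values. -/
theorem pi {ι : Type} {F : ι → Layers (LPiece C) → K} {q : ι → Kˣ} {κ : ι → C → Kˣ}
    {δ : ι → C → K} {c₀ : C} (hF : ∀ i, IsInvariant (F i) (q i) (κ i) (δ i) c₀) :
    IsInvariant (fun w i => F i w) (MulEquiv.piUnits.symm q)
      (fun c => MulEquiv.piUnits.symm fun i => κ i c) (fun c i => δ i c) c₀ where
  support w h := funext fun i => (hF i).support w h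
  isotopy u v x y h hx hy := funext fun i => (hF i).isotopy u v x y h hx hy
  empty := funext fun i => (hF i).empty
  circle c := funext fun i => (hF i).circle c
  skein u v j h := funext fun i => by
    refine ((hF i).skein u v j h).trans ?_
    by_cases hc : c₀ = bar c₀
    · simp only [if_pos hc]; rfl
    · simp only [if_neg hc]; rfl
  kink u v j c h := funext fun i => (hF i).kink u v j c h
  vert u v j h := funext fun i => by
    refine ((hF i).vert u v j h).trans ?_
    by_cases hc : c₀ = bar c₀
    · simp only [if_pos hc]; rfl
    · simp only [if_neg hc]; rfl

variable {q : Kˣ} {κ : C → Kˣ} {δ : C → K} {c₀ : C}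

/-- An invariant is determined by its parameters. -/
theorem unique {F G : Layers (LPiece C) → K} (hF : IsInvariant F q κ δ c₀)
    (hG : IsInvariant G q κ δ c₀) (hz : IsUnit ((q : K) - ↑q⁻¹))
    (hδ : ∀ c, ((q : K) - ↑q⁻¹) * δ c =
      (κ c : K) - ↑(κ (bar c))⁻¹ + if c = bar c then (q : K) - ↑q⁻¹ else 0) : F = G := by
  -- The pair of `F` and `G` has its parameters in the diagonal of `Bool → K`, hence its values too.
  have h := IsInvariant.pi (ι := Bool) (F := fun b => cond b F G) (q := fun _ => q)
    (κ := fun _ => κ) (δ := fun _ => δ) (c₀ := c₀) (by rintro (_ | _); exacts [hG, hF])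
  let ψ : K →+* (Bool → K) := Pi.constRingHom Bool K
  have hz' : IsUnit (((MulEquiv.piUnits.symm fun _ : Bool => q : (Bool → K)ˣ) : Bool → K) -
      ↑(MulEquiv.piUnits.symm fun _ : Bool => q : (Bool → K)ˣ)⁻¹) := hz.map ψ
  have hmem := h.mem_of_mem hz' (fun c => funext fun b => by
    refine (hδ c).trans ?_
    by_cases hc : c = bar c
    · simp only [if_pos hc]; rfl
    · simp only [if_neg hc]; rfl) (A := ψ.range) ⟨q, rfl⟩ ⟨(↑q⁻¹ : K), rfl⟩ (fun c => ⟨κ c, rfl⟩)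
    (fun c => ⟨(↑(κ c)⁻¹ : K), rfl⟩) (fun c => ⟨δ c, rfl⟩)
  funext w
  obtain ⟨b, hb⟩ := hmem w
  exact (congrFun hb true).symm.trans (congrFun hb false)

/-- An invariant whose parameters are in a subring has values in this subring. -/
theorem descend {L : Type} [CommRing L] (ψ : K →+* L) (hψ : Function.Injective ψ)
    {F : Layers (LPiece C) → L} (hF : IsInvariant F (Units.map ψ q) (fun c => Units.map ψ (κ c))
      (fun c => ψ (δ c)) c₀) (hz : IsUnit ((q : K) - ↑q⁻¹))
    (hδ : ∀ c, ((q : K) - ↑q⁻¹) * δ c =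
      (κ c : K) - ↑(κ (bar c))⁻¹ + if c = bar c then (q : K) - ↑q⁻¹ else 0) :
    ∃ G : Layers (LPiece C) → K, IsInvariant G q κ δ c₀ ∧ ∀ w, ψ (G w) = F w := by
  have hu : ∀ x : Kˣ, ((Units.map (ψ : K →* L) x)⁻¹ : Lˣ) = ψ (↑x⁻¹ : K) := fun x => rfl
  -- The parameters lie in the range of `ψ`, hence so do the values; by injectivity each axiom can
  -- be verified after applying `ψ`.
  have hmem := hF.mem_of_mem (A := ψ.range) (by
      have := hz.map ψ
      rwa [map_sub] at this) (fun c => by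
      have := congrArg ψ (hδ c)
      rw [map_mul, map_sub, map_add, map_sub] at this
      refine this.trans ?_
      by_cases hc : c = bar c
      · simp only [if_pos hc, map_sub]; rfl
      · simp only [if_neg hc, map_zero]; rfl) ⟨q, rfl⟩ ⟨(↑q⁻¹ : K), rfl⟩ (fun c => ⟨κ c, rfl⟩)
    (fun c => ⟨(↑(κ c)⁻¹ : K), rfl⟩) (fun c => ⟨δ c, rfl⟩)
  choose G hG using hmem
  refine ⟨G, ?_, hG⟩
  constructor
  · intro w h
    apply hψ
    rw [hG, hF.support w h, map_zero]
  · intro u v x y h hx hy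
    apply hψ
    rw [hG, hG, hF.isotopy u v x y h hx hy]
  · apply hψ
    rw [hG, hF.empty, map_one]
  · intro c
    apply hψ
    rw [hG, hF.circle c]
  · intro u v i h
    apply hψ
    rw [map_sub, hG, hG, hF.skein u v i h, map_mul, map_sub, map_sub, hG]
    by_cases hc : c₀ = bar c₀
    · simp only [if_pos hc, hG]; rfl
    · simp only [if_neg hc, map_zero]; rfl
  · intro u v i c h
    apply hψ
    rw [hG, hF.kink u v i c h, map_mul, hG]
    rfl
  · intro u v i h
    apply hψ
    rw [hG, hF.vert u v i h, map_add, map_add, map_neg, map_mul, map_mul, hG, hG]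
    by_cases hc : c₀ = bar c₀
    · simp only [if_pos hc, hG]; rfl
    · simp only [if_neg hc, map_zero]; rfl

end IsInvariant
end

/-! ### Invariants of unoriented and of oriented diagrams -/

theorem runs_map {G G' C : Type} [Pieces G C] [Pieces G' C] (φ : G → G')
    (hd : ∀ g, Pieces.dom (φ g) = Pieces.dom g) (hc : ∀ g, Pieces.cod (φ g) = Pieces.cod g)
    {w : Layers G} {s t : List C} :
    Runs (w.map (Prod.map id φ)) s t ↔ Runs w s t := by
  induction w generalizing s with
  | nil => rfl
  | cons x w ih => simp only [List.map_cons, Runs, ih, Step, Prod.map_fst, Prod.map_snd, hd, hc, id]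

def Piece.label : Piece → LPiece Unit
  | .cup => .elem (.cup ())
  | .cap => .elem (.cap ())
  | .cross k => .elem (.cross k () ())
  | .vert => .vert () ()

theorem forget_label (g : Piece) : g.label.forget = g := by cases g <;> rfl

def OPiece.label : OPiece → LPiece Bool
  | .cup o => .elem (.cup o)
  | .cap o => .elem (.cap o)
  | .cross k s t => .elem (.cross k s t)
  | .vert s t => .vert s t

def LPiece.unlabel : LPiece Bool → OPiece
  | .elem (.cup o) => .cup o
  | .elem (.cap o) => .cap o
  | .elem (.cross k s t) => .cross k s t
  | .vert s t => .vert s t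

def labelU (w : Layers Piece) : Layers (LPiece Unit) := w.map (Prod.map id Piece.label)

def labelO (w : Layers OPiece) : Layers (LPiece Bool) := w.map (Prod.map id OPiece.label)

def unlabelO (w : Layers (LPiece Bool)) : Layers OPiece := w.map (Prod.map id LPiece.unlabel)

theorem runs_labelU {w : Layers Piece} {s t : List Unit} : Runs (labelU w) s t ↔ Runs w s t :=
  runs_map _ (by rintro (_ | _ | _ | _) <;> rfl) (by rintro (_ | _ | _ | _) <;> rfl)

theorem runs_forgetL {w : Layers (LPiece Unit)} {s t : List Unit} :
    Runs (forgetL w) s t ↔ Runs w s t :=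
  runs_map LPiece.forget (by rintro ((_ | _ | _) | _) <;> rfl)
    (by rintro ((_ | _ | _) | _) <;> rfl)

theorem runs_labelO {w : Layers OPiece} {s t : List Bool} : Runs (labelO w) s t ↔ Runs w s t :=
  runs_map _ (by rintro (_ | _ | _ | _) <;> rfl) (by rintro (_ | _ | _ | _) <;> rfl)

theorem runs_unlabelO {w : Layers (LPiece Bool)} {s t : List Bool} :
    Runs (unlabelO w) s t ↔ Runs w s t :=
  runs_map _ (by rintro ((_ | _ | _) | _) <;> rfl) (by rintro ((_ | _ | _) | _) <;> rfl)

theorem forgetL_labelU (w : Layers Piece) : forgetL (labelU w) = w := by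
  simp only [forgetL, labelU, List.map_map]
  refine (List.map_congr_left fun x _ => ?_).trans w.map_id
  exact Prod.ext rfl (forget_label x.2)

theorem forgetL_labelO (w : Layers OPiece) : forgetL (labelO w) = forgetO w := by
  simp only [forgetL, labelO, forgetO, List.map_map]
  refine List.map_congr_left fun x _ => Prod.ext rfl ?_
  cases h : x.2 <;> simp [OPiece.label, LPiece.forget, OPiece.forget, h]

theorem unlabelO_labelO (w : Layers OPiece) : unlabelO (labelO w) = w := by
  simp only [unlabelO, labelO, List.map_map]
  conv_rhs => rw [← w.map_id]
  refine List.map_congr_left fun x _ => Prod.ext rfl ?_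
  cases h : x.2 <;> simp [OPiece.label, LPiece.unlabel, h]

theorem labelO_unlabelO (w : Layers (LPiece Bool)) : labelO (unlabelO w) = w := by
  simp only [unlabelO, labelO, List.map_map]
  conv_rhs => rw [← w.map_id]
  refine List.map_congr_left fun x _ => Prod.ext rfl ?_
  rcases h : x.2 with (_ | _ | _) | _ <;> simp [OPiece.label, LPiece.unlabel, h]

theorem labelU_append (u v : Layers Piece) : labelU (u ++ v) = labelU u ++ labelU v :=
  List.map_append

theorem labelO_append (u v : Layers OPiece) : labelO (u ++ v) = labelO u ++ labelO v :=
  List.map_append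

theorem forgetL_append {C : Type} (u v : Layers (LPiece C)) :
    forgetL (u ++ v) = forgetL u ++ forgetL v :=
  List.map_append

theorem unlabelO_append (u v : Layers (LPiece Bool)) :
    unlabelO (u ++ v) = unlabelO u ++ unlabelO v :=
  List.map_append

open Classical in
/-- A function of closed unoriented diagrams, extended by zero. -/
noncomputable def extendU (P : Diagram → Coeff) (w : Layers (LPiece Unit)) : Coeff :=
  if h : Runs w [] [] then P ⟨forgetL w, runs_forgetL.2 h⟩ else 0

open Classical in
/-- A function of closed oriented diagrams, extended by zero. -/
noncomputable def extendO (R : ODiagram → Coeff) (w : Layers (LPiece Bool)) : Coeff :=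
  if h : Runs w [] [] then R ⟨unlabelO w, runs_unlabelO.2 h⟩ else 0

theorem extendU_labelU (P : Diagram → Coeff) (D : Diagram) : extendU P (labelU D.1) = P D := by
  rw [extendU, dif_pos (runs_labelU.2 D.2)]
  congr
  exact forgetL_labelU D.1

theorem extendO_labelO (R : ODiagram → Coeff) (D : ODiagram) : extendO R (labelO D.1) = R D := by
  rw [extendO, dif_pos (runs_labelO.2 D.2)]
  congr
  exact unlabelO_labelO D.1

theorem coe_z : (z : Coeff) = (q : Coeff) - ↑q⁻¹ := rfl

/-- Only the vertex relation with `slash` is kept; the one with `backslash` is recovered from the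
skein relation in `IsInvariant.isKauffmanVogel`. -/
theorem IsKauffmanVogel.isInvariant {P : Diagram → Coeff} (hP : IsKauffmanVogel P) :
    IsInvariant (extendU P) q (fun _ => a) (fun _ => ((a : Coeff) - ↑a⁻¹) * ↑z⁻¹ + 1) () where
  support w h := dif_neg h
  isotopy u v x y h hx hy := by
    rw [extendU, extendU, dif_pos hx, dif_pos hy]
    refine hP.isotopy (forgetL u) (forgetL v) (forgetL x) (forgetL y) _ _ h ?_ ?_ <;>
      simp [forgetL_append]
  empty := by
    rw [extendU, dif_pos (runs_nil _ _)]
    exact hP.empty _ rfl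
  circle c := by
    rw [extendU, dif_pos (runs_circle c)]
    exact hP.circle _ rfl
  skein u v i h := by
    obtain ⟨s, h1, t, h2, h3⟩ := runs_append.1 h
    obtain ⟨l, r, rfl, rfl, rfl⟩ := h2.exists_append
    rw [if_pos rfl, extendU, extendU, extendU, extendU, dif_pos h,
      dif_pos (h.replace (.elem (.cross .backslash () ())) rfl rfl), dif_pos ((runs_append_iff h1).2 h3),
      dif_pos (runs_cap_cup_append rfl h1 h3)]
    refine hP.skein (forgetL u) (forgetL v) l.length _ _ _ _ ?_ ?_ ?_ ?_ <;>
      simp [forgetL, LPiece.forget]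
  kink u v i c h := by
    obtain ⟨s, h1, t, h2, t', h3, t'', h4, h5⟩ := runs_append.1 h
    obtain ⟨l, r, hl, rfl, rfl⟩ := h2.exists_append
    obtain ⟨l, d, rfl, rfl⟩ := exists_append_singleton hl
    have h1' : Runs u [] (l ++ () :: r) := by simpa [Pieces.dom] using h1
    have hk := (runs_append_iff (IsInvariant.runs_kink l r d)).1 ((runs_append_iff h1').1 h)
    rw [extendU, extendU, dif_pos h, dif_pos ((runs_append_iff h1').2 hk)]
    refine hP.kink (forgetL u) (forgetL v) l.length _ _ ?_ ?_ <;>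
      simp [forgetL, LPiece.forget]
  vert u v i h := by
    obtain ⟨s, h1, t, h2, h3⟩ := runs_append.1 h
    obtain ⟨l, r, rfl, rfl, rfl⟩ := h2.exists_append
    rw [if_pos rfl, extendU, extendU, extendU, extendU, dif_pos h,
      dif_pos (h.replace (.elem (.cross .slash () ())) rfl rfl), dif_pos ((runs_append_iff h1).2 h3),
      dif_pos (runs_cap_cup_append rfl h1 h3)]
    refine hP.vertexSlash (forgetL u) (forgetL v) l.length _ _ _ _ ?_ ?_ ?_ ?_ <;>
      simp [forgetL, LPiece.forget]

theorem IsMOY.isInvariant {R : ODiagram → Coeff} (hR : IsMOY R) :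
    IsInvariant (extendO R) q (fun _ => a) (fun _ => ((a : Coeff) - ↑a⁻¹) * ↑z⁻¹) true where
  support w h := dif_neg h
  isotopy u v x y h hx hy := by
    rw [extendO, extendO, dif_pos hx, dif_pos hy]
    refine hR.isotopy (unlabelO u) (unlabelO v) (unlabelO x) (unlabelO y) _ _ ?_ ?_ ?_
    · rwa [← forgetL_labelO, ← forgetL_labelO, labelO_unlabelO, labelO_unlabelO]
    all_goals simp [unlabelO_append]
  empty := by
    rw [extendO, dif_pos (runs_nil _ _)]
    exact hR.empty _ rfl
  circle c := by
    rw [extendO, dif_pos (runs_circle c)]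
    exact hR.circle c _ rfl
  skein u v i h := by
    obtain ⟨s, h1, t, h2, h3⟩ := runs_append.1 h
    obtain ⟨l, r, rfl, rfl, rfl⟩ := h2.exists_append
    rw [if_neg (by decide), sub_zero, extendO, extendO, extendO, dif_pos h,
      dif_pos (h.replace (.elem (.cross .backslash true true)) rfl rfl),
      dif_pos ((runs_append_iff h1).2 h3)]
    refine hR.skein (unlabelO u) (unlabelO v) l.length _ _ _ ?_ ?_ ?_ <;>
      simp [unlabelO, LPiece.unlabel]
  kink u v i c h := by
    obtain ⟨s, h1, t, h2, t', h3, t'', h4, h5⟩ := runs_append.1 h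
    obtain ⟨l, r, hl, rfl, rfl⟩ := h2.exists_append
    obtain ⟨l, d, rfl, rfl⟩ := exists_append_singleton hl
    rw [List.append_assoc, step_append rfl] at h3
    obtain ⟨r', e1, rfl⟩ := h3
    simp only [Pieces.dom, Pieces.cod, List.cons_append, List.nil_append,
      List.cons.injEq] at e1
    obtain ⟨rfl, -, rfl⟩ := e1
    have h1' : Runs u [] (l ++ d :: r) := by simpa [Pieces.dom] using h1
    have hk := (runs_append_iff (IsInvariant.runs_kink l r d)).1 ((runs_append_iff h1').1 h)
    rw [extendO, extendO, dif_pos h, dif_pos ((runs_append_iff h1').2 hk)]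
    refine hR.kink (unlabelO u) (unlabelO v) l.length d _ _ ?_ ?_ <;>
      simp [unlabelO, LPiece.unlabel]
  vert u v i h := by
    obtain ⟨s, h1, t, h2, h3⟩ := runs_append.1 h
    obtain ⟨l, r, rfl, rfl, rfl⟩ := h2.exists_append
    rw [if_neg (by decide), mul_zero, add_zero, extendO, extendO, extendO, dif_pos h,
      dif_pos (h.replace (.elem (.cross .slash true true)) rfl rfl),
      dif_pos ((runs_append_iff h1).2 h3)]
    refine hR.vertexSlash (unlabelO u) (unlabelO v) l.length _ _ _ ?_ ?_ ?_ <;>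
      simp [unlabelO, LPiece.unlabel]

theorem IsInvariant.isKauffmanVogel {F : Layers (LPiece Unit) → Coeff}
    (hF : IsInvariant F q (fun _ => a) (fun _ => ((a : Coeff) - ↑a⁻¹) * ↑z⁻¹ + 1) ()) :
    IsKauffmanVogel fun D => F (labelU D.1) where
  isotopy u v x y D E h hD hE := by
    have h1 := runs_labelU.2 D.2
    have h2 := runs_labelU.2 E.2
    simp only [hD, hE, labelU_append, List.append_assoc] at h1 h2 ⊢
    exact hF.isotopy _ _ _ _ (by rwa [forgetL_labelU, forgetL_labelU]) h1 h2
  empty D h := by simpa [h, labelU] using hF.empty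
  circle D h := by simpa [h, labelU, Piece.label] using hF.circle ()
  skein u v i D₁ D₂ D₃ D₄ h1 h2 h3 h4 := by
    have h := runs_labelU.2 D₁.2
    have e := hF.skein (labelU u) (labelU v) i (by simpa [h1, labelU, Piece.label] using h)
    rw [if_pos rfl] at e
    simpa [h1, h2, h3, h4, labelU, Piece.label] using e
  kink u v i D E h1 h2 := by
    have h := runs_labelU.2 D.2
    have e := hF.kink (labelU u) (labelU v) i () (by simpa [h1, labelU, Piece.label] using h)
    simpa [h1, h2, labelU, Piece.label] using e
  vertexSlash u v i D D₁ D₃ D₄ h0 h1 h3 h4 := by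
    have h := runs_labelU.2 D.2
    have e := hF.vert (labelU u) (labelU v) i (by simpa [h0, labelU, Piece.label] using h)
    rw [if_pos rfl] at e
    simpa [h0, h1, h3, h4, labelU, Piece.label] using e
  vertexBackslash u v i D D₂ D₃ D₄ h0 h2 h3 h4 := by
    have h := runs_labelU.2 D.2
    have h' := runs_labelU.2 D₂.2
    have hs : Runs (labelU u ++ (i, .elem (.cross .slash () ())) :: labelU v) [] [] := by
      have h'' : Runs (labelU u ++ (i, .elem (.cross .backslash () ())) :: labelU v) [] [] := by
        simpa [h2, labelU, Piece.label] using h'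
      obtain ⟨s, e1, t, ⟨l, r, e2⟩, e3⟩ := runs_append.1 h''
      exact (runs_append_iff e1).2 ⟨t, ⟨l, r, e2⟩, e3⟩
    have e := hF.vert (labelU u) (labelU v) i (by simpa [h0, labelU, Piece.label] using h)
    have e' := hF.skein (labelU u) (labelU v) i hs
    rw [if_pos rfl] at e e'
    simp only [h0, h2, h3, h4, labelU, Piece.label, List.map_append, List.map_cons,
      List.append_assoc, List.cons_append, List.nil_append, Prod.map_apply, id] at e e' ⊢
    -- The two vertex relations differ exactly by the skein relation `e'`.
    rw [e, ← sub_eq_zero]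
    linear_combination -e'

theorem IsInvariant.isMOY {F : Layers (LPiece Bool) → Coeff}
    (hF : IsInvariant F q (fun _ => a) (fun _ => ((a : Coeff) - ↑a⁻¹) * ↑z⁻¹) true) :
    IsMOY fun D => F (labelO D.1) where
  isotopy u v x y D E h hD hE := by
    have h1 := runs_labelO.2 D.2
    have h2 := runs_labelO.2 E.2
    simp only [hD, hE, labelO_append, List.append_assoc] at h1 h2 ⊢
    exact hF.isotopy _ _ _ _ (by rwa [forgetL_labelO, forgetL_labelO]) h1 h2
  empty D h := by simpa [h, labelO] using hF.empty
  circle c D h := by simpa [h, labelO, OPiece.label] using hF.circle c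
  skein u v i D₁ D₂ D₃ h1 h2 h3 := by
    have h := runs_labelO.2 D₁.2
    have e := hF.skein (labelO u) (labelO v) i (by simpa [h1, labelO, OPiece.label] using h)
    rw [if_neg (by decide), sub_zero] at e
    simpa [h1, h2, h3, labelO, OPiece.label] using e
  kink u v i c D E h1 h2 := by
    have h := runs_labelO.2 D.2
    have e := hF.kink (labelO u) (labelO v) i c (by simpa [h1, labelO, OPiece.label] using h)
    simpa [h1, h2, labelO, OPiece.label] using e
  vertexSlash u v i D D₁ D₃ h0 h1 h3 := by
    have h := runs_labelO.2 D.2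
    have e := hF.vert (labelO u) (labelO v) i (by simpa [h0, labelO, OPiece.label] using h)
    rw [if_neg (by decide), mul_zero, add_zero] at e
    simpa [h0, h1, h3, labelO, OPiece.label] using e
  vertexBackslash u v i D D₂ D₃ h0 h2 h3 := by
    have h := runs_labelO.2 D.2
    have h' := runs_labelO.2 D₂.2
    have hs : Runs (labelO u ++ (i, .elem (.cross .slash true true)) :: labelO v) [] [] := by
      have h'' : Runs (labelO u ++ (i, .elem (.cross .backslash true true)) :: labelO v) [] [] := by
        simpa [h2, labelO, OPiece.label] using h'
      obtain ⟨s, e1, t, ⟨l, r, e2⟩, e3⟩ := runs_append.1 h''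
      exact (runs_append_iff e1).2 ⟨t, ⟨l, r, e2⟩, e3⟩
    have e := hF.vert (labelO u) (labelO v) i (by simpa [h0, labelO, OPiece.label] using h)
    have e' := hF.skein (labelO u) (labelO v) i hs
    rw [if_neg (by decide)] at e e'
    simp only [h0, h2, h3, labelO, OPiece.label, List.map_append, List.map_cons,
      List.append_assoc, List.cons_append, List.nil_append, Prod.map_apply, id] at e e' ⊢
    rw [e, ← sub_eq_zero]
    linear_combination -e'

end KnottedGraph

namespace KnottedGraph
open Labels
namespace TangleRep
variable {K V C : Type} [CommRing K] [AddCommGroup V] [Module K V] [Labels C]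
  [DecidableEq C]
  {X : TangleRep K V C} {f : V}

/-! ### Reduction of the relations -/

theorem Inverse.shift {k : Crossing} {s t : C} (h : X.Inverse k s t) (l r : List C) :
    (X.shift l r).Inverse k s t := by
  intro l' r' f hf
  have := h (l ++ l') (r' ++ r) (f := f) (by simpa [TangleRep.shift] using hf)
  simpa [TangleRep.shift] using this

/-- Turning past maxima follows from turning past minima: write the crossing as a bent one by
`cross_rotate`, exchange heights, and straighten the zigzag that arises. -/
theorem IsPlanar.rotatesCap (hX : X.IsPlanar) : X.RotatesCap := by
  intro l r k c d s f h hf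
  have hY := hX.shift l r
  replace hf : f ∈ (X.shift l r).deg [c, s, d] := hf
  change (X.shift l r).cap 0 c ((X.shift l r).cross 1 k s d f) =
    (X.shift l r).cap 1 c ((X.shift l r).cross 0 k.flip c s f)
  generalize X.shift l r = Y at *
  have h' := bar_eq_comm.1 h
  have m1 : Y.cup 1 d f ∈ Y.deg [c, d, c, s, d] := hY.cup_mem [c] [s, d] h' hf
  have m2 : Y.cross 2 k.flip c s (Y.cup 1 d f) ∈ Y.deg [c, d, s, c, d] :=
    hY.cross_mem [c, d] [d] m1
  calc Y.cap 0 c (Y.cross 1 k s d f)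
      = Y.cap 0 c (Y.cap 3 c (Y.cross 2 k.flip c s (Y.cup 1 d f))) :=
        congrArg _ (hY.cross_rotate k h' [c] [] hf).symm
    _ = Y.cap 1 c (Y.cap 0 c (Y.cross 2 k.flip c s (Y.cup 1 d f))) :=
        (hY.exchange (.cap c) (.cap c) [] [s] [] (dom_cap h) (dom_cap h) m2).symm
    _ = Y.cap 1 c (Y.cross 0 k.flip c s (Y.cap 0 c (Y.cup 1 d f))) :=
        congrArg _ (hY.exchange (.cap c) (.cross k.flip c s) [] [] [d] (x := [c, d])
          (y := [c, s]) (dom_cap h) rfl m1).symm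
    _ = Y.cap 1 c (Y.cross 0 k.flip c s f) := by
        rw [show Y.cap 0 c (Y.cup 1 d f) = f from hY.zigzag [] [s, d] c d h hf]

/-- The strand with label `c` passes the crossing `k` of the strands `t` and `u`, from left to right,
with crossings `k₁` and `k₂` respectively. -/
def MixedBraid (X : TangleRep K V C) (k₁ k₂ k : Crossing) (c t u : C) : Prop :=
  ∀ (l r : List C) {f : V}, f ∈ X.deg (l ++ c :: t :: u :: r) →
    X.cross l.length k t u (X.cross (l.length + 1) k₂ c u (X.cross l.length k₁ c t f)) =
      X.cross (l.length + 1) k₁ c t (X.cross l.length k₂ c u (X.cross (l.length + 1) k t u f))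

theorem MixedBraid.shift {k₁ k₂ k : Crossing} {c t u : C} (h : X.MixedBraid k₁ k₂ k c t u)
    (l r : List C) : (X.shift l r).MixedBraid k₁ k₂ k c t u := by
  intro l' r' f hf
  have := h (l ++ l') (r' ++ r) (f := f) (by simpa [TangleRep.shift] using hf)
  simpa [TangleRep.shift, add_assoc] using this

/-- Multiplying by the inverse of the crossing of `c` and `t` on both sides changes the order in
which the strands enter, at the price of crossings of different kinds. -/
theorem MixedBraid.swap_left (hX : X.IsPlanar) (hi : ∀ k s t, X.Inverse k s t)
    {k₁ k₂ k : Crossing} {c t u : C} (h : X.MixedBraid k₁ k₂ k c t u) :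
    X.MixedBraid k₁.flip k k₂ t c u := by
  intro l r f hf
  have hY := hX.shift l r
  have hj := fun k s t => (hi k s t).shift l r
  have hb := h.shift l r
  replace hf : f ∈ (X.shift l r).deg [t, c, u] := hf
  change (X.shift l r).cross 0 k₂ c u ((X.shift l r).cross 1 k t u
      ((X.shift l r).cross 0 k₁.flip t c f)) =
    (X.shift l r).cross 1 k₁.flip t c ((X.shift l r).cross 0 k t u ((X.shift l r).cross 1 k₂ c u f))
  generalize X.shift l r = Y at *
  have m : Y.cross 0 k₁.flip t c f ∈ Y.deg [c, t, u] := hY.cross_mem [] [u] hf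
  have m1 : Y.cross 1 k t u (Y.cross 0 k₁.flip t c f) ∈ Y.deg [c, u, t] := hY.cross_mem [c] [] m
  have m2 : Y.cross 0 k₂ c u (Y.cross 1 k t u (Y.cross 0 k₁.flip t c f)) ∈ Y.deg [u, c, t] :=
    hY.cross_mem [] [t] m1
  have e := hb [] [] m
  have e1 := hj k₁.flip t c [] [u] hf
  rw [Crossing.flip_flip] at e1
  have e2 := hj k₁ c t [u] [] m2
  simp only [List.length_nil, List.length_singleton, zero_add] at e e1 e2
  rw [← e2, ← e, e1]

theorem MixedBraid.swap_right (hX : X.IsPlanar) (hi : ∀ k s t, X.Inverse k s t)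
    {k₁ k₂ k : Crossing} {c t u : C} (h : X.MixedBraid k₁ k₂ k c t u) :
    X.MixedBraid k₂ k₁ k.flip c u t := by
  intro l r f hf
  have hY := hX.shift l r
  have hj := fun k s t => (hi k s t).shift l r
  have hb := h.shift l r
  replace hf : f ∈ (X.shift l r).deg [c, u, t] := hf
  change (X.shift l r).cross 0 k.flip u t ((X.shift l r).cross 1 k₁ c t
      ((X.shift l r).cross 0 k₂ c u f)) =
    (X.shift l r).cross 1 k₂ c u ((X.shift l r).cross 0 k₁ c t
      ((X.shift l r).cross 1 k.flip u t f))
  generalize X.shift l r = Y at *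
  have m : Y.cross 1 k.flip u t f ∈ Y.deg [c, t, u] := hY.cross_mem [c] [] hf
  have m1 : Y.cross 0 k₁ c t (Y.cross 1 k.flip u t f) ∈ Y.deg [t, c, u] := hY.cross_mem [] [u] m
  have m2 : Y.cross 1 k₂ c u (Y.cross 0 k₁ c t (Y.cross 1 k.flip u t f)) ∈ Y.deg [t, u, c] :=
    hY.cross_mem [t] [] m1
  have e := hb [] [] m
  have e1 := hj k.flip u t [c] [] hf
  rw [Crossing.flip_flip] at e1
  have e2 := hj k t u [] [c] m2
  simp only [List.length_nil, List.length_singleton, zero_add] at e e1 e2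
  rw [← e2, e, e1]

/-- A strand which passes two strands from left to right is turned around. -/
theorem IsPlanar.pass_bend (hX : X.IsPlanar) (k₁ k₂ : Crossing) {c d : C} (h : d = bar c) (t u : C)
    (hf : f ∈ X.deg [d, t, u]) :
    X.cap 0 d (X.cross 1 k₁.flip t c (X.cross 2 k₂.flip u c (X.cup 3 c f))) =
      X.cross 1 k₂ d u (X.cross 0 k₁ d t f) := by
  have h' := bar_eq_comm.1 h
  have m1 : X.cup 3 c f ∈ X.deg [d, t, u, c, d] := hX.cup_mem [d, t, u] [] h hf
  have m2 : X.cross 2 k₂.flip u c (X.cup 3 c f) ∈ X.deg [d, t, c, u, d] :=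
    hX.cross_mem [d, t] [d] m1
  have m3 : X.cross 0 k₁ d t f ∈ X.deg [t, d, u] := hX.cross_mem [] [u] hf
  have m4 : X.cup 3 c (X.cross 0 k₁ d t f) ∈ X.deg [t, d, u, c, d] :=
    hX.cup_mem [t, d, u] [] h m3
  have m5 : X.cross 1 k₂ d u (X.cross 0 k₁ d t f) ∈ X.deg [t, u, d] := hX.cross_mem [t] [] m3
  have e1 := hX.rotatesCap [] [u, d] k₁.flip d c t h' m2
  have e2 := hX.rotatesCap [t] [d] k₂.flip d c u h' m4
  rw [Crossing.flip_flip] at e1 e2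
  simp only [List.length_nil, List.length_singleton, zero_add] at e1 e2
  rw [e1]
  calc X.cap 1 d (X.cross 0 k₁ d t (X.cross 2 k₂.flip u c (X.cup 3 c f)))
      = X.cap 1 d (X.cross 2 k₂.flip u c (X.cross 0 k₁ d t (X.cup 3 c f))) :=
        congrArg _ (hX.exchange (.cross k₁ d t) (.cross k₂.flip u c) [] [] [d] (x := [d, t])
          (y := [u, c]) rfl rfl m1).symm
    _ = X.cap 1 d (X.cross 2 k₂.flip u c (X.cup 3 c (X.cross 0 k₁ d t f))) := by
        have := hX.exchange (.cross k₁ d t) (.cup c) [] [u] [] (x := [d, t]) (y := []) rfl rfl hf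
        exact congrArg (fun v => X.cap 1 d (X.cross 2 k₂.flip u c v)) this.symm
    _ = X.cap 2 d (X.cross 1 k₂ d u (X.cup 3 c (X.cross 0 k₁ d t f))) := e2
    _ = X.cap 2 d (X.cup 3 c (X.cross 1 k₂ d u (X.cross 0 k₁ d t f))) :=
        congrArg _ (hX.exchange (.cross k₂ d u) (.cup c) [t] [] [] (x := [d, u]) (y := [])
          rfl rfl m3).symm
    _ = _ := hX.zigzag [t, u] [] d c h' m5

/-- By `pass_bend`, the strand `bar c` going from left to right is a bent strand `c` going back from
right to left. For the latter the relation is the given one, solved for the inverse crossings. -/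
theorem MixedBraid.bar_left (hX : X.IsPlanar) (hi : ∀ k s t, X.Inverse k s t)
    {k₁ k₂ k : Crossing} {c t u : C} (h : X.MixedBraid k₁ k₂ k c t u) :
    X.MixedBraid k₁ k₂ k (bar c) t u := by
  intro l r f hf
  have hY := hX.shift l r
  have hj := fun k s t => (hi k s t).shift l r
  have hb := h.shift l r
  replace hf : f ∈ (X.shift l r).deg [bar c, t, u] := hf
  change (X.shift l r).cross 0 k t u ((X.shift l r).cross 1 k₂ (bar c) u
      ((X.shift l r).cross 0 k₁ (bar c) t f)) =
    (X.shift l r).cross 1 k₁ (bar c) t ((X.shift l r).cross 0 k₂ (bar c) u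
      ((X.shift l r).cross 1 k t u f))
  generalize X.shift l r = Y at *
  generalize hd : bar c = d at *
  replace hd := hd.symm
  have hd' := bar_eq_comm.1 hd
  have m1 : Y.cup 3 c f ∈ Y.deg [d, t, u, c, d] := hY.cup_mem [d, t, u] [] hd hf
  have m2 : Y.cross 2 k₂.flip u c (Y.cup 3 c f) ∈ Y.deg [d, t, c, u, d] :=
    hY.cross_mem [d, t] [d] m1
  have m3 : Y.cross 1 k₁.flip t c (Y.cross 2 k₂.flip u c (Y.cup 3 c f)) ∈ Y.deg [d, c, t, u, d] :=
    hY.cross_mem [d] [u, d] m2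
  have m4 : Y.cross 1 k t u (Y.cup 3 c f) ∈ Y.deg [d, u, t, c, d] := hY.cross_mem [d] [c, d] m1
  have m5 : Y.cross 2 k t u (Y.cross 1 k₁.flip t c (Y.cross 2 k₂.flip u c (Y.cup 3 c f))) ∈
    Y.deg [d, c, u, t, d] := hY.cross_mem [d, c] [d] m3
  have m6 : Y.cross 1 k₂ c u (Y.cross 2 k t u (Y.cross 1 k₁.flip t c (Y.cross 2 k₂.flip u c
    (Y.cup 3 c f)))) ∈ Y.deg [d, u, c, t, d] := hY.cross_mem [d] [t, d] m5
  -- The given relation, with the crossings of `c` on both sides replaced by their inverses.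
  have key : Y.cross 1 k₂.flip u c (Y.cross 2 k₁.flip t c (Y.cross 1 k t u (Y.cup 3 c f))) =
      Y.cross 2 k t u (Y.cross 1 k₁.flip t c (Y.cross 2 k₂.flip u c (Y.cup 3 c f))) := by
    have e := hb [d] [d] m3
    have e1 := hj k₁.flip t c [d] [u, d] m2
    have e2 := hj k₂.flip u c [d, t] [d] m1
    have e3 := hj k₁ c t [d, u] [d] m6
    have e4 := hj k₂ c u [d] [t, d] m5
    simp only [List.length_cons, List.length_nil, zero_add,
      Crossing.flip_flip, Nat.reduceAdd] at e e1 e2 e3 e4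
    rw [e1, e2] at e
    rw [e, e3, e4]
  have mf : Y.cross 1 k t u f ∈ Y.deg [d, u, t] := hY.cross_mem [d] [] hf
  rw [← hY.pass_bend k₁ k₂ hd t u hf, ← hY.pass_bend k₂ k₁ hd u t mf]
  have e5 := hY.exchange (.cross k t u) (.cup c) [d] [] [] (x := [t, u]) (y := []) rfl rfl hf
  have e6 := hY.exchange (.cap d) (.cross k t u) [] [] [d] (x := [d, c]) (y := [t, u])
    (dom_cap hd') rfl m3
  have e5' : Y.cup 3 c (Y.cross 1 k t u f) = Y.cross 1 k t u (Y.cup 3 c f) := e5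
  rw [e5', key]
  exact e6

theorem Braid.bar_left (hX : X.IsPlanar) (hi : ∀ k s t, X.Inverse k s t) {k : Crossing} {s t u : C}
    (h : X.Braid k s t u) : X.Braid k (bar s) t u :=
  MixedBraid.bar_left hX hi (k₁ := k) (k₂ := k) h

/-- Bring the strand to the left, reverse it there, and bring it back. The intermediate relation has
crossings of both kinds, whence `MixedBraid`. -/
theorem Braid.bar_middle (hX : X.IsPlanar) (hi : ∀ k s t, X.Inverse k s t) {k : Crossing}
    {s t u : C} (h : X.Braid k s t u) : X.Braid k s (bar t) u := by
  have h1 := MixedBraid.bar_left hX hi (MixedBraid.swap_left hX hi (k₁ := k) (k₂ := k) h)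
  have h2 := h1.swap_left hX hi
  rwa [Crossing.flip_flip] at h2

theorem Braid.bar_right (hX : X.IsPlanar) (hi : ∀ k s t, X.Inverse k s t) {k : Crossing}
    {s t u : C} (h : X.Braid k s t u) : X.Braid k s t (bar u) := by
  have h1 := (MixedBraid.swap_right hX hi (k₁ := k) (k₂ := k) h).swap_left hX hi
  have h2 := ((h1.bar_left hX hi).swap_left hX hi).swap_right hX hi
  rw [Crossing.flip_flip] at h2
  exact h2

theorem IsPlanar.braid_of (hX : X.IsPlanar) (hi : ∀ k s t, X.Inverse k s t) {k : Crossing} {c : C}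
    (h : X.Braid k c c c) (s t u : C) : X.Braid k s t u := by
  have key : ∀ {p : C → Prop}, p c → (∀ s, p s → p (bar s)) → ∀ s, p s := by
    intro p h1 h2 s
    rcases eq_or_eq_bar s c with rfl | rfl
    exacts [h1, h2 _ h1]
  refine key (p := fun s => X.Braid k s t u) ?_ (fun s h => h.bar_left hX hi) s
  refine key (p := fun t => X.Braid k c t u) ?_ (fun s h => h.bar_middle hX hi) t
  exact key (p := fun u => X.Braid k c c u) h (fun s h => h.bar_right hX hi) u

/-- The list of checks for a concrete representation: bending strands reduces the third Reidemeister
move and the skein relation to the single label `c₀`. -/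
theorem IsPlanar.isSkein (hX : X.IsPlanar) {q : Kˣ} {κ : C → Kˣ} (c₀ : C)
    (hi : ∀ k s t, X.Inverse k s t) (hb : X.Braid .slash c₀ c₀ c₀) (hs : X.Skein q c₀ c₀)
    (hk : ∀ (l r : List C) (c : C) {f : V}, f ∈ X.deg (l ++ c :: r) →
      X.cap (l.length + 1) c (X.cross l.length .slash c c (X.cup (l.length + 1) c f)) =
        (κ c : K) • f) : X.IsSkein q κ where
  toIsPlanar := hX
  crossCap := hX.rotatesCap
  inverse := hi
  braid := hX.braid_of hi hb
  skein := forall_of_rotate c₀ hs fun _ _ _ hu h => hX.skein_rotate hu h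
  kink := hk

end TangleRep
end KnottedGraph

namespace KnottedGraph
open Labels

/-! ### The vertex model of the `𝔰𝔩(N)` polynomial -/

namespace VertexModel
variable {K : Type} [CommRing K] (q : Kˣ) (N : ℕ)

/-- A strand with a label and a colour. -/
abbrev Strand := Bool × ℕ

/-- The weight of a colour. -/
def mu (i : ℕ) : Kˣ := q ^ ((N : ℤ) - 1 - 2 * i)

/-- The weight sits on strands labelled `true` only. The weights of a minimum and a maximum then
cancel in a zigzag, while a circle of colour `i` contributes `mu q N i` or its inverse. -/
def weight (c : Bool) (i : ℕ) : Kˣ := if c then mu q N i else 1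

def cupWeight (c : Bool) (i : ℕ) : Kˣ := weight q N (!c) i

def capWeight (c : Bool) (i : ℕ) : Kˣ := (weight q N c i)⁻¹

def qCross (k : Crossing) : Kˣ := if k = .slash then q else q⁻¹

def zCross (k : Crossing) : K := (qCross q k : K) - ↑(qCross q k)⁻¹

/-- The order of the colours, or the opposite order. -/
def Lower (b : Bool) (i j : ℕ) : Prop := if b then i < j else j < i

instance (b : Bool) (i j : ℕ) : Decidable (Lower b i j) := by unfold Lower; infer_instance

/-- Which of the two orders is used at a crossing. -/
def order (k : Crossing) (s : Bool) : Bool := (k = .slash) == s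

/-- The operation of a piece at the left end of a row. -/
def act : TanglePiece Bool → (List Strand → K) → List Strand → K
  | .cup c, f, x :: y :: w =>
    if x.1 = c ∧ y.1 = !c ∧ x.2 = y.2 ∧ x.2 < N then cupWeight q N c x.2 * f w else 0
  | .cap c, f, w => ∑ i ∈ Finset.range N, capWeight q N c i * f ((c, i) :: (!c, i) :: w)
  | .cross k s t, f, x :: y :: w =>
    if x.1 = t ∧ y.1 = s then
      -- The value at an output row is a sum over input rows. In the first term the colours follow
      -- the strands. In the second, parallel strands exchange their colours, and an antiparallel
      -- pair of one colour turns back and emerges in another, with the ratio of weights that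
      -- bending a strand produces.
      (if x.2 = y.2 then if s = t then (qCross q k : K) else ↑(qCross q k)⁻¹ else 1) *
          f ((s, y.2) :: (t, x.2) :: w) +
        if s = t then (if Lower (order k s) x.2 y.2 then zCross q k else 0) *
          f ((s, x.2) :: (t, y.2) :: w)
        else if x.2 = y.2 ∧ x.2 < N then
          ∑ i ∈ Finset.range N with Lower (order k s) i x.2,
            (-zCross q k * (weight q N s x.2 * (weight q N s i)⁻¹ : Kˣ)) * f ((s, i) :: (t, i) :: w)
        else 0
    else 0
  | _, _, _ => 0

/-- The operation of a piece at position `i`. -/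
def opFun : ℕ → TanglePiece Bool → (List Strand → K) → List Strand → K
  | 0, g, f, w => act q N g f w
  | _ + 1, _, _, [] => 0
  | i + 1, g, f, x :: w => opFun i g (fun v => f (x :: v)) w

theorem opFun_add (i : ℕ) (g : TanglePiece Bool) (f f' : List Strand → K) (w : List Strand) :
    opFun q N i g (f + f') w = opFun q N i g f w + opFun q N i g f' w := by
  induction i generalizing f f' w with
  | zero =>
    unfold opFun
    match g, w with
    | .cup c, x :: y :: w =>
      simp only [act]; split_ifs <;> simp [mul_add]
    | .cap c, w => simp [act, mul_add, Finset.sum_add_distrib]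
    | .cross k s t, x :: y :: w =>
      simp only [act, Pi.add_apply, mul_add, Finset.sum_add_distrib]
      split_ifs <;> ring
    | .cup c, [x] | .cup c, [] | .cross k s t, [x] | .cross k s t, [] => simp [act]
  | succ i ih =>
    match w with
    | [] => simp [opFun]
    | x :: w => exact ih _ _ w

theorem opFun_smul (i : ℕ) (g : TanglePiece Bool) (b : K) (f : List Strand → K) (w : List Strand) :
    opFun q N i g (b • f) w = b * opFun q N i g f w := by
  induction i generalizing f w with
  | zero =>
    unfold opFun
    match g, w with
    | .cup c, x :: y :: w =>
      simp only [act, Pi.smul_apply, smul_eq_mul]; split_ifs <;> ring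
    | .cap c, w =>
      simp only [act, Pi.smul_apply, smul_eq_mul, Finset.mul_sum]
      exact Finset.sum_congr rfl fun _ _ => by ring
    | .cross k s t, x :: y :: w =>
      simp only [act, Pi.smul_apply, smul_eq_mul]
      have : ∀ (T : Finset ℕ) (g h : ℕ → K),
          ∑ i ∈ T, g i * (b * h i) = b * ∑ i ∈ T, g i * h i := by
        intro T g h
        rw [Finset.mul_sum]
        exact Finset.sum_congr rfl fun _ _ => mul_left_comm _ _ _
      rw [this]
      split_ifs <;> ring
    | .cup c, [x] | .cup c, [] | .cross k s t, [x] | .cross k s t, [] => simp [act]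
  | succ i ih =>
    match w with
    | [] => simp [opFun]
    | x :: w => exact ih _ w

/-- The functions which vanish off the rows with labels `s` and colours less than `N`. -/
def Supp : List Bool → (List Strand → K) → Prop
  | [], f => ∀ x w, f (x :: w) = 0
  | b :: s, f => f [] = 0 ∧ ∀ x : Strand, Supp s (fun w => f (x :: w)) ∧
      (¬ (x.1 = b ∧ x.2 < N) → (fun w => f (x :: w)) = 0)

variable {N}

theorem supp_zero (s : List Bool) : Supp (K := K) N s 0 := by
  induction s with
  | nil => intro x w; rfl
  | cons b s ih => exact ⟨rfl, fun x => ⟨ih, fun _ => rfl⟩⟩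

theorem Supp.add {s : List Bool} {f f' : List Strand → K} (h : Supp N s f) (h' : Supp N s f') :
    Supp N s (f + f') := by
  induction s generalizing f f' with
  | nil => intro x w; simp [h x w, h' x w]
  | cons b s ih =>
    refine ⟨by simp [h.1, h'.1], fun x => ⟨ih (h.2 x).1 (h'.2 x).1, fun hx => ?_⟩⟩
    exact (congrArg₂ (· + ·) ((h.2 x).2 hx) ((h'.2 x).2 hx)).trans (add_zero _)

theorem Supp.smul {s : List Bool} {f : List Strand → K} (b : K) (h : Supp N s f) :
    Supp N s (b • f) := by
  induction s generalizing f with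
  | nil => intro x w; simp [h x w]
  | cons c s ih =>
    refine ⟨by simp [h.1], fun x => ⟨ih (h.2 x).1, fun hx => ?_⟩⟩
    exact (congrArg (b • ·) ((h.2 x).2 hx)).trans (smul_zero _)

variable (N)

/-- The representation of tangles given by the vertex model. -/
def rep : TangleRep K (List Strand → K) Bool where
  deg s :=
    { carrier := {f | Supp N s f}
      add_mem' := fun h h' => h.add h'
      zero_mem' := supp_zero s
      smul_mem' := fun b _ h => h.smul b }
  op i g :=
    { toFun := opFun q N i g
      map_add' := fun f f' => funext (opFun_add q N i g f f')
      map_smul' := fun b f => funext (opFun_smul q N i g b f) }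

variable {q N} {f : List Strand → K}

theorem op_cons (i : ℕ) (g : TanglePiece Bool) (x : Strand) (w : List Strand) :
    (rep q N).op (i + 1) g f (x :: w) = (rep q N).op i g (fun v => f (x :: v)) w := rfl

theorem op_zero (g : TanglePiece Bool) : (rep q N).op 0 g f = act q N g f := rfl

theorem op_mem (g : TanglePiece Bool) (l r : List Bool)
    (hf : f ∈ (rep q N).deg (l ++ (Pieces.dom g ++ r))) :
    (rep q N).op l.length g f ∈ (rep q N).deg (l ++ (Pieces.cod g ++ r)) := by
  induction l generalizing f with
  | nil =>
    match g with
    | .cup c =>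
      refine ⟨rfl, fun x => ⟨⟨rfl, fun y => ⟨?_, fun hy => ?_⟩⟩, fun hx => ?_⟩⟩
      · change (fun w => act q N (.cup c) f (x :: y :: w)) ∈ (rep q N).deg r
        by_cases h : x.1 = c ∧ y.1 = !c ∧ x.2 = y.2 ∧ x.2 < N
        · simp only [act, if_pos h]
          exact Supp.smul (cupWeight q N c x.2 : K) hf
        · simp only [act, if_neg h]
          exact zero_mem _
      · funext w
        refine if_neg fun h => hy ⟨h.2.1, ?_⟩
        rw [← h.2.2.1]; exact h.2.2.2
      · funext w
        match w with
        | [] => rfl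
        | y :: w => exact if_neg fun h => hx ⟨h.1, h.2.2.2⟩
    | .cap c =>
      change act q N (.cap c) f ∈ (rep q N).deg r
      have : act q N (.cap c) f = ∑ i ∈ Finset.range N, (capWeight q N c i : K) •
          fun w => f ((c, i) :: (!c, i) :: w) := by
        funext w; simp [act]
      rw [this]
      exact Submodule.sum_mem _ fun i _ => Submodule.smul_mem _ _ ((hf.2 (c, i)).1.2 (!c, i)).1
    | .cross k s t =>
      have hz : ∀ x y : Strand, ¬ ((x.1 = t ∧ x.2 < N) ∧ y.1 = s ∧ y.2 < N) →
          ∀ w, act q N (.cross k s t) f (x :: y :: w) = 0 := by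
        intro x y h w
        by_cases h1 : x.1 = t ∧ y.1 = s
        · simp only [act, if_pos h1]
          have e1 : f ((s, y.2) :: (t, x.2) :: w) = 0 := by
            by_cases hy : y.2 < N
            · exact congrFun (((hf.2 (s, y.2)).1.2 (t, x.2)).2 fun h2 => h ⟨⟨h1.1, h2.2⟩, h1.2, hy⟩) w
            · exact congrFun ((hf.2 (s, y.2)).2 fun h2 => hy h2.2) _
          have e2 : f ((s, x.2) :: (t, y.2) :: w) = 0 := by
            by_cases hx : x.2 < N
            · exact congrFun (((hf.2 (s, x.2)).1.2 (t, y.2)).2 fun h2 => h ⟨⟨h1.1, hx⟩, h1.2, h2.2⟩) w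
            · exact congrFun ((hf.2 (s, x.2)).2 fun h2 => hx h2.2) _
          rw [e1, e2, mul_zero, mul_zero, zero_add]
          split_ifs with h2 h3
          · rfl
          · exact absurd ⟨⟨h1.1, h3.2⟩, h1.2, h3.1 ▸ h3.2⟩ h
          · rfl
        · exact if_neg h1
      refine ⟨rfl, fun x => ⟨⟨rfl, fun y => ⟨?_, fun hy => ?_⟩⟩, fun hx => ?_⟩⟩
      · change (fun w => act q N (.cross k s t) f (x :: y :: w)) ∈ (rep q N).deg r
        have hm : ∀ i j, (fun w => f ((s, i) :: (t, j) :: w)) ∈ (rep q N).deg r :=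
          fun i j => ((hf.2 (s, i)).1.2 (t, j)).1
        have hs : ∀ (T : Finset ℕ) (b : ℕ → K),
            (fun w => ∑ i ∈ T, b i * f ((s, i) :: (t, i) :: w)) ∈ (rep q N).deg r := by
          intro T b
          have : (fun w => ∑ i ∈ T, b i * f ((s, i) :: (t, i) :: w)) =
              ∑ i ∈ T, b i • fun w => f ((s, i) :: (t, i) :: w) := by
            funext w; simp
          rw [this]
          exact Submodule.sum_mem _ fun i _ => Submodule.smul_mem _ _ (hm i i)
        simp only [act]
        by_cases h1 : x.1 = t ∧ y.1 = s
        · simp only [if_pos h1]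
          refine add_mem (Submodule.smul_mem _ _ (hm _ _)) ?_
          by_cases h2 : s = t
          · simp only [if_pos h2]
            exact Submodule.smul_mem _ _ (hm _ _)
          · simp only [if_neg h2]
            by_cases h3 : x.2 = y.2 ∧ x.2 < N
            · simp only [if_pos h3]
              exact hs _ _
            · simp only [if_neg h3]
              exact zero_mem _
        · simp only [if_neg h1]
          exact zero_mem _
      · exact funext (hz x y fun h => hy h.2)
      · funext w
        match w with
        | [] => rfl
        | y :: w => exact hz x y (fun h => hx h.1) w
  | cons b l ih =>
    refine ⟨rfl, fun x => ⟨ih (hf.2 x).1, fun hx => ?_⟩⟩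
    funext w
    have := (hf.2 x).2 hx
    rw [List.length_cons, op_cons, this, map_zero]

theorem tail_mem {b : Bool} {s : List Bool} (hf : f ∈ (rep q N).deg (b :: s)) (x : Strand) :
    (fun w => f (x :: w)) ∈ (rep q N).deg s := (hf.2 x).1

theorem eq_zero_of_label {b : Bool} {s : List Bool} (hf : f ∈ (rep q N).deg (b :: s)) {x : Strand}
    (hx : x.1 ≠ b) (w : List Strand) : f (x :: w) = 0 :=
  congrFun ((hf.2 x).2 fun h => hx h.1) w

theorem eq_zero_of_color {b : Bool} {s : List Bool} (hf : f ∈ (rep q N).deg (b :: s)) {x : Strand}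
    (hx : ¬ x.2 < N) (w : List Strand) : f (x :: w) = 0 :=
  congrFun ((hf.2 x).2 fun h => hx h.2) w

theorem cap_zero (l r : List Bool) (c s t : Bool) (hf : f ∈ (rep q N).deg (l ++ s :: t :: r))
    (h : ¬ (s = c ∧ t = !c)) : (rep q N).cap l.length c f = 0 := by
  induction l generalizing f with
  | nil =>
    funext w
    change ∑ i ∈ Finset.range N, (capWeight q N c i : K) * f ((c, i) :: (!c, i) :: w) = 0
    refine Finset.sum_eq_zero fun i _ => ?_
    by_cases hs : c = s
    · rw [eq_zero_of_label (tail_mem hf (c, i)) (x := (!c, i)) fun ht => h ⟨hs.symm, ht.symm⟩,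
        mul_zero]
    · rw [eq_zero_of_label hf hs, mul_zero]
  | cons b l ih =>
    funext w
    match w with
    | [] => rfl
    | x :: w => exact congrFun (ih (tail_mem hf x)) w

theorem cross_zero (l r : List Bool) (k : Crossing) (c d s t : Bool)
    (hf : f ∈ (rep q N).deg (l ++ s :: t :: r)) (h : ¬ (s = c ∧ t = d)) :
    (rep q N).cross l.length k c d f = 0 := by
  induction l generalizing f with
  | nil =>
    have key : ∀ i j w, f ((c, i) :: (d, j) :: w) = 0 := by
      intro i j w
      by_cases hs : c = s
      · exact eq_zero_of_label (tail_mem hf (c, i)) (x := (d, j)) (fun ht => h ⟨hs.symm, ht.symm⟩) w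
      · exact eq_zero_of_label hf hs _
    funext w
    match w with
    | [] | [x] => rfl
    | x :: y :: w =>
      change act q N (.cross k c d) f (x :: y :: w) = 0
      simp only [act, key, mul_zero, Finset.sum_const_zero, ite_self, add_zero]
  | cons b l ih =>
    funext w
    match w with
    | [] => rfl
    | x :: w => exact congrFun (ih (tail_mem hf x)) w

theorem exchange_left (g h : TanglePiece Bool) (n : ℕ) (f : List Strand → K) :
    (rep q N).op ((Pieces.cod g).length + n) h ((rep q N).op 0 g f) =
      (rep q N).op 0 g ((rep q N).op ((Pieces.dom g).length + n) h f) := by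
  funext w
  match g with
  | .cup c =>
    change (rep q N).op (2 + n) h _ w = _
    rw [Nat.add_comm]
    match w with
    | [] => rfl
    | [x] => rfl
    | x :: y :: w =>
      change (rep q N).op n h (fun v => act q N (.cup c) f (x :: y :: v)) w =
        act q N (.cup c) ((rep q N).op (0 + n) h f) (x :: y :: w)
      rw [Nat.zero_add]
      simp only [act]
      by_cases hc : x.1 = c ∧ y.1 = !c ∧ x.2 = y.2 ∧ x.2 < N
      · simp only [if_pos hc]
        exact congrFun (map_smul ((rep q N).op n h) (cupWeight q N c x.2 : K) f) w
      · simp only [if_neg hc]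
        exact congrFun (map_zero ((rep q N).op n h)) w
  | .cap c =>
    change (rep q N).op (0 + n) h _ w = act q N (.cap c) ((rep q N).op (2 + n) h f) w
    rw [Nat.zero_add, Nat.add_comm]
    change _ = ∑ i ∈ Finset.range N, (capWeight q N c i : K) *
      (rep q N).op n h (fun v => f ((c, i) :: (!c, i) :: v)) w
    have : (rep q N).op 0 (.cap c) f = ∑ i ∈ Finset.range N, (capWeight q N c i : K) •
        fun v => f ((c, i) :: (!c, i) :: v) := by
      funext v; simp [op_zero, act]
    rw [this, map_sum, Finset.sum_apply]
    exact Finset.sum_congr rfl fun i _ => congrFun (map_smul ((rep q N).op n h) _ _) w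
  | .cross k s t =>
    change (rep q N).op (2 + n) h _ w = act q N (.cross k s t) ((rep q N).op (2 + n) h f) w
    rw [Nat.add_comm]
    match w with
    | [] => rfl
    | [x] => rfl
    | x :: y :: w =>
      change (rep q N).op n h (fun v => act q N (.cross k s t) f (x :: y :: v)) w = _
      have hop : ∀ i j, (rep q N).op (n + 2) h f ((s, i) :: (t, j) :: w) =
        (rep q N).op n h (fun v => f ((s, i) :: (t, j) :: v)) w := fun i j => rfl
      have hsum : ∀ (T : Finset ℕ) (b : ℕ → K),
          (rep q N).op n h (fun v => ∑ i ∈ T, b i * f ((s, i) :: (t, i) :: v)) w =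
            ∑ i ∈ T, b i * (rep q N).op n h (fun v => f ((s, i) :: (t, i) :: v)) w := by
        intro T b
        have : (fun v => ∑ i ∈ T, b i * f ((s, i) :: (t, i) :: v)) =
            ∑ i ∈ T, b i • fun v => f ((s, i) :: (t, i) :: v) := by
          funext v; simp
        rw [this, map_sum, Finset.sum_apply]
        exact Finset.sum_congr rfl fun i _ => congrFun (map_smul ((rep q N).op n h) _ _) w
      have hadd : ∀ (b : K) (f₁ f₂ : List Strand → K),
          (rep q N).op n h (fun v => b * f₁ v + f₂ v) w =
            b * (rep q N).op n h f₁ w + (rep q N).op n h f₂ w := by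
        intro b f₁ f₂
        exact congrFun ((map_add ((rep q N).op n h) (b • f₁) f₂).trans
          (congrArg (· + _) (map_smul ((rep q N).op n h) b f₁))) w
      have hz : (rep q N).op n h (fun _ => 0) w = 0 := congrFun (map_zero ((rep q N).op n h)) w
      simp only [act, hop]
      by_cases h1 : x.1 = t ∧ y.1 = s
      · simp only [if_pos h1]
        rw [hadd]
        refine congrArg₂ (· + ·) rfl ?_
        by_cases h2 : s = t
        · simp only [if_pos h2]
          exact congrFun (map_smul ((rep q N).op n h) _ _) w
        · simp only [if_neg h2]
          by_cases h3 : x.2 = y.2 ∧ x.2 < N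
          · simp only [if_pos h3]
            exact hsum _ _
          · simp only [if_neg h3, hz]
      · simp only [if_neg h1, hz]

theorem zigzag_left (r : List Bool) (c d : Bool) (h : d = !c) (hf : f ∈ (rep q N).deg (c :: r)) :
    (rep q N).cap 0 c ((rep q N).cup 1 d f) = f := by
  subst h
  funext w
  change ∑ i ∈ Finset.range N, (capWeight q N c i : K) *
    act q N (.cup (!c)) (fun v => f ((c, i) :: v)) ((!c, i) :: w) = f w
  match w with
  | [] => simp [act, hf.1]
  | y :: w =>
    by_cases hy : y.1 = c ∧ y.2 < N
    · obtain ⟨b, j⟩ := y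
      obtain ⟨rfl, hj⟩ := hy
      replace hj : j < N := hj
      rw [Finset.sum_eq_single_of_mem j (Finset.mem_range.2 hj)]
      · simp [act, hj, capWeight, cupWeight]
      · intro i _ hi
        simp [act, hi]
    · rw [congrFun ((hf.2 y).2 hy) w]
      refine Finset.sum_eq_zero fun i _ => ?_
      rw [act, if_neg, mul_zero]
      rintro ⟨-, h2, h3, h4⟩
      exact hy ⟨by simpa using h2, h3 ▸ h4⟩

theorem zagzig_left (r : List Bool) (c d : Bool) (h : c = !d) (hf : f ∈ (rep q N).deg (c :: r)) :
    (rep q N).cap 1 d ((rep q N).cup 0 c f) = f := by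
  subst h
  funext w
  match w with
  | [] => exact hf.1.symm
  | y :: w =>
    change ∑ i ∈ Finset.range N, (capWeight q N d i : K) *
      act q N (.cup (!d)) f (y :: (d, i) :: (!d, i) :: w) = f (y :: w)
    by_cases hy : y.1 = (!d) ∧ y.2 < N
    · obtain ⟨b, j⟩ := y
      obtain ⟨rfl, hj⟩ := hy
      replace hj : j < N := hj
      rw [Finset.sum_eq_single_of_mem j (Finset.mem_range.2 hj)]
      · simp [act, hj, capWeight, cupWeight]
      · intro i _ hi
        simp [act, hi.symm]
    · rw [congrFun ((hf.2 y).2 hy) w]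
      refine Finset.sum_eq_zero fun i _ => ?_
      rw [act, if_neg, mul_zero]
      rintro ⟨h1, -, -, h4⟩
      exact hy ⟨h1, h4⟩

theorem sum_eq_ite (b : Bool) (x j : ℕ) (g F : ℕ → K) (hF : ∀ i, i ≠ j → F i = 0) :
    ∑ i ∈ Finset.range N with Lower b i x, g i * F i =
      if j < N ∧ Lower b j x then g j * F j else 0 := by
  by_cases h : j < N ∧ Lower b j x
  · rw [if_pos h, Finset.sum_eq_single_of_mem j (by simpa using h)]
    intro i _ hi
    rw [hF i hi, mul_zero]
  · rw [if_neg h]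
    refine Finset.sum_eq_zero fun i hi => ?_
    rw [hF i, mul_zero]
    rintro rfl
    exact h (by simpa using hi)

theorem qCross_flip (k : Crossing) : qCross q k.flip = (qCross q k)⁻¹ := by
  cases k <;> simp [qCross, Crossing.flip]

theorem zCross_flip (k : Crossing) : (zCross q k.flip : K) = -zCross q k := by
  rw [zCross, zCross, qCross_flip, inv_inv, neg_sub]

theorem order_flip (k : Crossing) (s : Bool) : order k.flip s = !order k s := by
  cases k <;> cases s <;> rfl

theorem order_not (k : Crossing) (s : Bool) : order k (!s) = !order k s := by
  cases k <;> cases s <;> rfl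

theorem lower_not (b : Bool) (i j : ℕ) : Lower (!b) i j ↔ Lower b j i := by
  cases b <;> rfl

/-- The coefficients for antiparallel strands in `act` are the quarter turn of those for parallel
strands. After the cases of equal and distinct labels are separated, the minimum leaves at most one
term of the sum. -/
theorem crossCup_left (r : List Bool) (k : Crossing) (c d s : Bool) (h : d = !c)
    (hf : f ∈ (rep q N).deg (s :: r)) :
    (rep q N).cross 1 k d s ((rep q N).cup 0 c f) =
      (rep q N).cross 0 k.flip s c ((rep q N).cup 1 c f) := by
  subst h
  funext w
  match w with
  | [] | [x] => rfl
  | [x, y] =>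
    change 0 = act q N (.cross k.flip s c) ((rep q N).cup 1 c f) [x, y]
    have : ∀ u v : Strand, (rep q N).cup 1 c f [u, v] = 0 := fun u v => rfl
    simp [act, this]
  | (a, i) :: (b, j) :: (e, m) :: w =>
    change act q N (.cross k (!c) s) (fun v => act q N (.cup c) f ((a, i) :: v))
      ((b, j) :: (e, m) :: w) = act q N (.cross k.flip s c) (fun v => (rep q N).cup 1 c f v)
      ((a, i) :: (b, j) :: (e, m) :: w)
    have hcup : ∀ x y : Strand, (rep q N).cup 1 c f (x :: y :: (e, m) :: w) =
      act q N (.cup c) (fun v => f (x :: v)) (y :: (e, m) :: w) := fun _ _ => rfl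
    simp only [act, hcup, true_and]
    by_cases hl : a = c ∧ b = s ∧ e = !c
    · obtain ⟨rfl, rfl, rfl⟩ := hl
      simp only [and_self, if_true, true_and]
      by_cases hab : b = a
      · subst hab
        simp only [Bool.not_eq_self, if_true, if_false]
        rw [sum_eq_ite (j := i) _ _ _ _ fun t ht => if_neg fun h => ht h.1.symm]
        by_cases hi : i < N
        · simp only [hi, and_true, true_and, if_true, order_flip, order_not, lower_not, zCross_flip,
            qCross_flip]
          -- The ratio of weights in `act` converts the weight of a minimum of colour `i` into that
          -- of colour `j`.
          have hw : ((weight q N (!b) j * (weight q N (!b) i)⁻¹ : Kˣ) : K) * cupWeight q N b i =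
              cupWeight q N b j := by
            rw [← Units.val_mul]
            simp [cupWeight]
          by_cases him : i = m
          · subst him
            by_cases hji : j = i
            · subst hji
              simp [Lower, hi]
            · have hij := Ne.symm hji
              simp [hji, hij]
          · have hmi := Ne.symm him
            by_cases hjm : j = m
            · subst hjm
              by_cases hj : j < N
              · simp only [him, if_false, mul_zero, zero_add, hj, and_self, if_true]
                by_cases ho : Lower (order k b) j i
                · rw [if_pos ho, if_pos ho, ← hw]
                  ring
                · rw [if_neg ho, if_neg ho, zero_mul]
              · simp [him, hj]
            · simp [him, hjm]
        · have h0 : f ((b, i) :: w) = 0 := eq_zero_of_color hf hi w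
          simp [hi, h0]
      · obtain rfl : b = !a := by cases a <;> cases b <;> simp_all
        simp only [Bool.not_eq_self, if_true, if_false]
        rw [sum_eq_ite (j := m) _ _ _ _ fun t ht => if_neg fun h => ht h.1]
        have hw : ((weight q N (!a) i * (weight q N (!a) m)⁻¹ : Kˣ) : K) * cupWeight q N a m =
            cupWeight q N a i := by
          rw [← Units.val_mul]
          simp [cupWeight]
        simp only [order_flip, order_not, lower_not, Bool.not_not, zCross_flip, qCross_flip, inv_inv,
          neg_neg]
        by_cases hm : m < N
        · by_cases him : i = m
          · subst him
            by_cases hij : i = j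
            · subst hij
              simp [Lower, hm]
            · have hji := Ne.symm hij
              simp [hji, hij]
          · by_cases hij : i = j
            · subst hij
              by_cases hi : i < N
              · simp only [him, if_false, hi, hm, and_true, mul_zero, zero_add, if_true,
                  true_and, and_self]
                by_cases ho : Lower (order k a) m i
                · rw [if_pos ho, if_pos ho, ← hw]
                  ring
                · rw [if_neg ho, if_neg ho, zero_mul]
              · simp [him, hi]
            · simp [him, hij]
        · have h0 : f ((!a, m) :: w) = 0 := eq_zero_of_color hf hm w
          have hi : ¬ (i = m ∧ i < N) := fun h => hm (h.1 ▸ h.2)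
          simp [hm, h0, hi]
    · by_cases h1 : b = s ∧ e = !c
      · have h2 : a ≠ c := fun h => hl ⟨h, h1.1, h1.2⟩
        simp [h2]
      · rw [if_neg h1]
        by_cases h2 : a = c ∧ b = s
        · have h3 : e ≠ !c := fun h => h1 ⟨h2.2, h⟩
          simp [h3]
        · rw [if_neg h2]

end VertexModel
end KnottedGraph

/-! ### The skein relations in the vertex model. -/

namespace KnottedGraph
open Labels
namespace VertexModel
variable {K : Type} [CommRing K] {q : Kˣ} {N : ℕ} {f : List Strand → K}

theorem isPlanar : (rep q N).IsPlanar where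
  op_mem g l r _ hf := op_mem g l r hf
  cap_zero l r c s t _ hf h := cap_zero l r c s t hf h
  cross_zero l r k c d s t _ hf h := cross_zero l r k c d s t hf h
  exchange g h l m r x y f hx hy hf := by
    subst hx hy
    induction l generalizing f with
    | nil =>
      simp only [List.length_nil, zero_add]
      exact exchange_left g h m.length f
    | cons b l ih =>
      have e : ∀ n, (b :: l).length + n + m.length = l.length + n + m.length + 1 := by
        intro n; simp only [List.length_cons]; omega
      rw [e, e]
      funext w
      match w with
      | [] => rfl
      | x :: w => exact congrFun (ih _ (tail_mem hf x)) w
  zigzag l r c d f h hf := by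
    induction l generalizing f with
    | nil => exact zigzag_left r c d h hf
    | cons b l ih =>
      funext w
      match w with
      | [] => exact hf.1.symm
      | x :: w => exact congrFun (ih _ (tail_mem hf x)) w
  zagzig l r c d f h hf := by
    induction l generalizing f with
    | nil => exact zagzig_left r c d h hf
    | cons b l ih =>
      funext w
      match w with
      | [] => exact hf.1.symm
      | x :: w => exact congrFun (ih _ (tail_mem hf x)) w
  crossCup l r k c d s f h hf := by
    induction l generalizing f with
    | nil => exact crossCup_left r k c d s h hf
    | cons b l ih =>
      funext w
      match w with
      | [] => rfl
      | x :: w => exact congrFun (ih _ (tail_mem hf x)) w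

theorem cross_apply_self (k : Crossing) (s : Bool) (i j : ℕ) (w : List Strand) :
    (rep q N).cross 0 k s s f ((s, i) :: (s, j) :: w) =
      (if i = j then (qCross q k : K) else 1) * f ((s, j) :: (s, i) :: w) +
        (if Lower (order k s) i j then zCross q k else 0) * f ((s, i) :: (s, j) :: w) := by
  change act q N (.cross k s s) f ((s, i) :: (s, j) :: w) = _
  simp [act]

theorem cross_apply_ne (k : Crossing) {s t : Bool} (h : s ≠ t) (i j : ℕ) (w : List Strand) :
    (rep q N).cross 0 k s t f ((t, i) :: (s, j) :: w) =
      (if i = j then (↑(qCross q k)⁻¹ : K) else 1) * f ((s, j) :: (t, i) :: w) +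
        if i = j ∧ i < N then ∑ m ∈ Finset.range N with Lower (order k s) m i,
          (-zCross q k * (weight q N s i * (weight q N s m)⁻¹ : Kˣ)) * f ((s, m) :: (t, m) :: w)
        else 0 := by
  change act q N (.cross k s t) f ((t, i) :: (s, j) :: w) = _
  simp [act, h]

/-- A function which vanishes off the rows with labels `s :: t :: r` is determined by its values on
the rows which start with these two labels. -/
theorem ext_two {g : List Strand → K} {s t : Bool} {r r' : List Bool}
    (hf : f ∈ (rep q N).deg (s :: t :: r)) (hg : g ∈ (rep q N).deg (s :: t :: r'))
    (h : ∀ i j w, i < N → j < N → f ((s, i) :: (t, j) :: w) = g ((s, i) :: (t, j) :: w)) : f = g := by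
  funext w
  match w with
  | [] => exact hf.1.trans hg.1.symm
  | [x] => exact (hf.2 x).1.1.trans (hg.2 x).1.1.symm
  | x :: y :: w =>
    by_cases hx : x.1 = s ∧ x.2 < N
    · by_cases hy : y.1 = t ∧ y.2 < N
      · obtain ⟨a, i⟩ := x
        obtain ⟨b, j⟩ := y
        obtain ⟨rfl, hi⟩ := hx
        obtain ⟨rfl, hj⟩ := hy
        exact h i j w hi hj
      · exact (congrFun (((hf.2 x).1.2 y).2 hy) w).trans (congrFun (((hg.2 x).1.2 y).2 hy) w).symm
    · exact (congrFun ((hf.2 x).2 hx) _).trans (congrFun ((hg.2 x).2 hx) _).symm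

/-- The distance of a colour from the end of the order. -/
def rank (N : ℕ) (b : Bool) (i : ℕ) : ℕ := if b then i else N - 1 - i

theorem rank_rank (b : Bool) {i : ℕ} (h : i < N) : rank N b (rank N b i) = i := by
  cases b <;> simp [rank]
  omega

theorem rank_lt (b : Bool) {i : ℕ} (h : i < N) : rank N b i < N := by
  cases b <;> simp [rank] <;> omega

theorem lower_iff (b : Bool) {i j : ℕ} (hi : i < N) (hj : j < N) :
    Lower b i j ↔ rank N b i < rank N b j := by
  cases b <;> simp [rank, Lower]
  omega

/-- Counting colours by rank turns sums with respect to either order into sums over initial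
segments, so that `telescope` serves both. -/
theorem sum_lower (b : Bool) {x : ℕ} (hx : x < N) (g : ℕ → K) :
    ∑ i ∈ Finset.range N with Lower b i x, g i =
      ∑ j ∈ Finset.range (rank N b x), g (rank N b j) := by
  have hx' := rank_lt b hx
  refine Finset.sum_nbij' (rank N b) (rank N b) ?_ ?_ ?_ ?_ ?_
  · intro i hi
    simp only [Finset.mem_filter, Finset.mem_range] at hi ⊢
    exact (lower_iff b hi.1 hx).1 hi.2
  · intro j hj
    simp only [Finset.mem_filter, Finset.mem_range] at hj ⊢
    have hj' : j < N := hj.trans hx'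
    refine ⟨rank_lt b hj', (lower_iff b (rank_lt b hj') hx).2 ?_⟩
    rwa [rank_rank b hj']
  · intro i hi
    simp only [Finset.mem_filter, Finset.mem_range] at hi
    exact rank_rank b hi.1
  · intro j hj
    simp only [Finset.mem_range] at hj
    exact rank_rank b (hj.trans hx')
  · intro i hi
    simp only [Finset.mem_filter, Finset.mem_range] at hi
    rw [rank_rank b hi.1]

/-- The double sum in the second Reidemeister move of antiparallel strands collapses because the
ratio of the weights `u` and `v` is geometric with quotient `p ^ (-2)`; induction on `n`. -/
theorem telescope (p : Kˣ) (u v : ℕ → Kˣ) (φ : ℕ → K) (n : ℕ)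
    (h : ∀ j < n, u (j + 1) * (v (j + 1))⁻¹ * p ^ 2 = u j * (v j)⁻¹) :
    (p * (u n * (v n)⁻¹ : Kˣ) : K) * ∑ i ∈ Finset.range n, (↑(u i)⁻¹ : K) * φ i =
      ∑ j ∈ Finset.range n, (↑(v j)⁻¹ : K) * (↑p⁻¹ * φ j - ((p : K) - ↑p⁻¹) *
        (u j * ∑ i ∈ Finset.range j, (↑(u i)⁻¹ : K) * φ i)) := by
  induction n with
  | zero => simp
  | succ n ih =>
    rw [Finset.sum_range_succ (n := n), Finset.sum_range_succ (n := n),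
      ← ih fun j hj => h j (hj.trans n.lt_succ_self)]
    set T := ∑ i ∈ Finset.range n, (↑(u i)⁻¹ : K) * φ i
    -- The geometric ratio converts the prefactor for `n + 1` into the one for `n`, with `p⁻¹` in
    -- place of `p`.
    have e1 : ((p * (u (n + 1) * (v (n + 1))⁻¹) : Kˣ) : K) = (p⁻¹ * (u n * (v n)⁻¹) : Kˣ) := by
      rw [← h n n.lt_succ_self]
      congr 1
      rw [sq, mul_comm (u (n + 1) * _), mul_assoc p, inv_mul_cancel_left]
    have e2 : ((u n : Kˣ) : K) * ↑(u n)⁻¹ = 1 := Units.mul_inv _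
    simp only [Units.val_mul] at e1 ⊢
    linear_combination (T + ↑(u n)⁻¹ * φ n) * e1 + (↑p⁻¹ * ↑(v n)⁻¹ * φ n) * e2

theorem mu_succ (i : ℕ) : mu q N (i + 1) * q ^ 2 = mu q N i := by
  rw [mu, mu, ← zpow_natCast, ← zpow_add]
  congr 1
  push_cast
  ring

/-- Consecutive colours differ in weight by `q ^ 2`; the order chosen at a crossing depends on its
kind and label in such a way that the exponent has the sign required by `telescope`. -/
theorem weight_ratio (k : Crossing) (s : Bool) {j : ℕ} (hj : j + 1 < N) :
    weight q N s (rank N (order k s) (j + 1)) * (weight q N (!s) (rank N (order k s) (j + 1)))⁻¹ *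
      qCross q k ^ 2 =
    weight q N s (rank N (order k s) j) * (weight q N (!s) (rank N (order k s) j))⁻¹ := by
  have h1 := mu_succ (q := q) (N := N) j
  have h2 := mu_succ (q := q) (N := N) (N - 1 - (j + 1))
  rw [show N - 1 - (j + 1) + 1 = N - 1 - j by omega] at h2
  cases k <;> cases s <;>
    simp [weight, order, rank, qCross, ← h1, ← h2, mul_inv_rev, mul_comm]

theorem inverse_self (k : Crossing) (s : Bool) (r : List Bool)
    (hf : f ∈ (rep q N).deg (s :: s :: r)) :
    (rep q N).cross 0 k.flip s s ((rep q N).cross 0 k s s f) = f := by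
  have m := isPlanar.cross_mem (k := k.flip) [] r (isPlanar.cross_mem (k := k) [] r hf)
  refine ext_two m hf fun i j w hi hj => ?_
  rw [cross_apply_self, cross_apply_self, cross_apply_self]
  simp only [order_flip, lower_not, zCross_flip, qCross_flip]
  by_cases hij : i = j
  · subst hij
    simp [Lower]
  · have hji := Ne.symm hij
    simp only [hij, hji, if_false]
    have h : Lower (order k s) i j ↔ ¬ Lower (order k s) j i := by
      cases order k s <;> simp [Lower] <;> omega
    by_cases ho : Lower (order k s) j i
    · have h' : ¬ Lower (order k s) i j := fun h2 => h.1 h2 ho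
      simp only [ho, h', if_true, if_false]
      ring
    · simp only [ho, if_false]
      ring

/-- Different colours run straight through and nothing happens. For equal colours the composite
contains a double sum over lower colours, which `telescope` cancels against the single sums. -/
theorem inverse_ne (k : Crossing) {s t : Bool} (hst : s ≠ t) (r : List Bool)
    (hf : f ∈ (rep q N).deg (s :: t :: r)) :
    (rep q N).cross 0 k.flip t s ((rep q N).cross 0 k s t f) = f := by
  have m := isPlanar.cross_mem (k := k.flip) [] r (isPlanar.cross_mem (k := k) [] r hf)
  refine ext_two m hf fun i j w hi hj => ?_
  rw [cross_apply_ne k.flip hst.symm]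
  obtain rfl : t = !s := by cases s <;> cases t <;> simp_all
  by_cases hij : i = j
  · subst hij
    simp only [cross_apply_ne k hst, hi, and_self, if_true, order_flip, order_not, zCross_flip,
      qCross_flip, Bool.not_not, inv_inv, neg_neg]
    set o := order k s with ho
    set φ : ℕ → K := fun m => f ((s, m) :: (!s, m) :: w) with hφ
    have hf0 : ∀ m : ℕ, f ((s, m) :: (!s, m) :: w) = φ m := fun m => rfl
    simp only [hf0]
    have hn := rank_lt o hi
    have key := telescope (qCross q k) (fun j => weight q N s (rank N o j))
      (fun j => weight q N (!s) (rank N o j)) (fun j => φ (rank N o j)) (rank N o i)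
      fun j hj => weight_ratio k s (by omega)
    simp only [rank_rank o hi] at key
    have hsum : ∀ m < N, ∑ l ∈ Finset.range N with Lower o l m,
        -zCross q k * ((weight q N s m * (weight q N s l)⁻¹ : Kˣ) : K) * φ l =
        -zCross q k * (weight q N s m * ∑ l ∈ Finset.range (rank N o m),
          (↑(weight q N s (rank N o l))⁻¹ : K) * φ (rank N o l)) := by
      intro m hm
      rw [sum_lower o hm, Finset.mul_sum, Finset.mul_sum]
      refine Finset.sum_congr rfl fun l _ => ?_
      rw [Units.val_mul]
      ring
    rw [hsum i hi, sum_lower o hi]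
    have h2 : ∑ l ∈ Finset.range (rank N o i), zCross q k *
        ((weight q N (!s) i * (weight q N (!s) (rank N o l))⁻¹ : Kˣ) : K) *
        (↑(qCross q k)⁻¹ * φ (rank N o l) + if True ∧ rank N o l < N then
          ∑ x ∈ Finset.range N with Lower o x (rank N o l), -zCross q k *
            ((weight q N s (rank N o l) * (weight q N s x)⁻¹ : Kˣ) : K) * φ x else 0) =
        zCross q k * weight q N (!s) i * ∑ j ∈ Finset.range (rank N o i),
          (↑(weight q N (!s) (rank N o j))⁻¹ : K) * (↑(qCross q k)⁻¹ * φ (rank N o j) -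
          ((qCross q k : K) - ↑(qCross q k)⁻¹) *
        (weight q N s (rank N o j) * ∑ i ∈ Finset.range j,
          (↑(weight q N s (rank N o i))⁻¹ : K) * φ (rank N o i))) := by
      rw [Finset.mul_sum]
      refine Finset.sum_congr rfl fun l hl => ?_
      have hl' : l < N := (Finset.mem_range.1 hl).trans hn
      have hl2 := rank_lt o hl'
      rw [if_pos ⟨trivial, hl2⟩, hsum _ hl2, rank_rank o hl', Units.val_mul]
      simp only [zCross]
      ring
    have e1 : (qCross q k : K) * ↑(qCross q k)⁻¹ = 1 := Units.mul_inv _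
    have e2 : ((weight q N (!s) i : Kˣ) : K) * ↑(weight q N (!s) i)⁻¹ = 1 := Units.mul_inv _
    rw [h2, ← key, Units.val_mul]
    set T := ∑ l ∈ Finset.range (rank N o i), (↑(weight q N s (rank N o l))⁻¹ : K) * φ (rank N o l)
    linear_combination φ i * e1 + zCross q k * (qCross q k : K) * (weight q N s i : K) * T * e2
  · have hji := Ne.symm hij
    simp only [hij, if_false, false_and, add_zero, one_mul, cross_apply_ne k hst, hji]

/-- The Yang–Baxter equation. Its entries depend on the relative order of the three colours only; in
some of the cases where two colours coincide, `q * q⁻¹ = 1` enters. -/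
theorem braid_self (r : List Bool) (hf : f ∈ (rep q N).deg (true :: true :: true :: r)) :
    (rep q N).cross 0 .slash true true ((rep q N).cross 1 .slash true true ((rep q N).cross 0 .slash true true f)) =
      (rep q N).cross 1 .slash true true ((rep q N).cross 0 .slash true true
        ((rep q N).cross 1 .slash true true f)) := by
  have m1 := isPlanar.cross_mem (k := .slash) [] (true :: r) hf
  have m2 := isPlanar.cross_mem (k := .slash) [true] r m1
  have m3 := isPlanar.cross_mem (k := .slash) [] (true :: r) m2
  have n1 := isPlanar.cross_mem (k := .slash) [true] r hf
  have n2 := isPlanar.cross_mem (k := .slash) [] (true :: r) n1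
  have n3 := isPlanar.cross_mem (k := .slash) [true] r n2
  have hop : ∀ (g : List Strand → K) (x : Strand) (w : List Strand),
    (rep q N).cross 1 .slash true true g (x :: w) =
      (rep q N).cross 0 .slash true true (fun v => g (x :: v)) w := fun _ _ _ => rfl
  funext w
  match w with
  | [] => exact m3.1.trans n3.1.symm
  | x :: w =>
  refine congrFun (f := fun w => ((rep q N).cross 0 .slash true true ((rep q N).cross 1 .slash true true
    ((rep q N).cross 0 .slash true true f))) (x :: w)) (g := fun w => ((rep q N).cross 1 .slash true true
    ((rep q N).cross 0 .slash true true ((rep q N).cross 1 .slash true true f))) (x :: w)) ?_ w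
  by_cases hx : x.1 = true ∧ x.2 < N
  · obtain ⟨a, i⟩ := x
    obtain ⟨rfl, hi⟩ := hx
    refine ext_two (q := q) (m3.2 (true, i)).1 (n3.2 (true, i)).1 fun j m w hj hm => ?_
    have hc : order .slash true = true := rfl
    have e1 : (q : K) * ↑q⁻¹ = 1 := Units.mul_inv _
    simp only [hop, cross_apply_self, hc]
    rcases lt_trichotomy i j with h1 | h1 | h1 <;> rcases lt_trichotomy j m with h2 | h2 | h2 <;>
      rcases lt_trichotomy i m with h3 | h3 | h3 <;> first
      | omega
      | skip
    all_goals subst_vars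
    all_goals simp only [Lower, qCross, zCross, *, ne_of_gt, ne_of_lt, not_lt_of_gt, if_true,
      if_false, one_mul, zero_mul, add_zero, lt_irrefl]
    all_goals first
      | ring1
      | linear_combination (-((q : K) - ↑q⁻¹) * f ((true, i) :: (true, m) :: (true, m) :: w)) * e1
      | linear_combination (((q : K) - ↑q⁻¹) * f ((true, j) :: (true, j) :: (true, m) :: w)) * e1
  · exact ((m3.2 x).2 hx).trans ((n3.2 x).2 hx).symm

theorem skein_self (r : List Bool) (hf : f ∈ (rep q N).deg (true :: true :: r)) :
    (rep q N).cross 0 .slash true true f - (rep q N).cross 0 .backslash true true f =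
      ((q : K) - ↑q⁻¹) • f := by
  refine ext_two (sub_mem (isPlanar.cross_mem (k := .slash) [] r hf)
    (isPlanar.cross_mem (k := .backslash) [] r hf)) (Submodule.smul_mem _ _ hf)
    fun i j w hi hj => ?_
  simp only [Pi.sub_apply, Pi.smul_apply, smul_eq_mul, cross_apply_self]
  rcases lt_trichotomy i j with h | rfl | h
  · simp [Lower, qCross, zCross, order, h, h.ne, h.not_gt]
  · simp [Lower, qCross]
    ring
  · simp [Lower, qCross, zCross, order, h, h.ne', h.not_gt]
    ring

theorem mu_reflect {i : ℕ} (h : i < N) : (mu q N (N - 1 - i))⁻¹ = mu q N i := by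
  rw [mu, mu, ← zpow_neg]
  congr 1
  omega

/-- Partial sums of the weights, with the remainder that the kink requires: the colours below a
given one contribute the sum and the colour itself the last term. For `n = N` it also gives the
circle. -/
theorem sum_mu (n : ℕ) : ((q : K) - ↑q⁻¹) * ∑ i ∈ Finset.range n, (mu q N i : K) + q * mu q N n =
    (q ^ N : Kˣ) := by
  induction n with
  | zero =>
    rw [Finset.sum_range_zero, mul_zero, zero_add, ← Units.val_mul]
    congr 1
    rw [mu, ← zpow_natCast]
    nth_rw 1 [← zpow_one q]
    rw [← zpow_add]
    congr 1
    push_cast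
    ring
  | succ n ih =>
    rw [Finset.sum_range_succ, ← ih]
    have h : ((mu q N (n + 1) : Kˣ) : K) * q ^ 2 = mu q N n := by
      rw [← mu_succ n]; push_cast; ring
    have e : (q : K) * ↑q⁻¹ = 1 := Units.mul_inv _
    linear_combination (↑q⁻¹ : K) * h - ((mu q N (n + 1) : Kˣ) : K) * q * e

theorem capWeight_mul_cupWeight (c : Bool) {i : ℕ} (hi : i < N) :
    capWeight q N c i * cupWeight q N c i = mu q N (rank N (!c) i) := by
  cases c
  · simp [capWeight, cupWeight, weight, rank]
  · simp [capWeight, cupWeight, weight, rank]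
    rw [← mu_reflect (q := q) (by omega : N - 1 - i < N)]
    congr 2
    omega

/-- For a strand of colour `k` the loop may have colour `k`, with coefficient `q`, or a colour on
one side of `k`, with coefficient `q - q⁻¹`. By `sum_mu` the total does not depend on `k`. -/
theorem kink_left (r : List Bool) (c : Bool) (hf : f ∈ (rep q N).deg (c :: r)) :
    (rep q N).cap 1 c ((rep q N).cross 0 .slash c c ((rep q N).cup 1 c f)) =
      ((q ^ N : Kˣ) : K) • f := by
  have m1 : (rep q N).cup 1 c f ∈ (rep q N).deg (c :: c :: (!c) :: r) :=
    isPlanar.cup_mem [c] r rfl hf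
  have m2 : (rep q N).cross 0 .slash c c ((rep q N).cup 1 c f) ∈
    (rep q N).deg (c :: c :: (!c) :: r) := isPlanar.cross_mem [] ((!c) :: r) m1
  have m3 : (rep q N).cap 1 c ((rep q N).cross 0 .slash c c ((rep q N).cup 1 c f)) ∈
    (rep q N).deg (c :: r) := isPlanar.cap_mem [c] r rfl m2
  funext w
  match w with
  | [] => exact m3.1.trans ((mul_eq_zero_of_right _ hf.1).symm)
  | x :: w =>
    by_cases hx : x.1 = c ∧ x.2 < N
    · obtain ⟨a, k⟩ := x
      obtain ⟨rfl, hk⟩ := hx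
      replace hk : k < N := hk
      change ∑ j ∈ Finset.range N, (capWeight q N a j : K) *
        (rep q N).cross 0 .slash a a ((rep q N).cup 1 a f)
          ((a, k) :: (a, j) :: (!a, j) :: w) = ((q ^ N : Kˣ) : K) * f ((a, k) :: w)
      have hcup : ∀ i j m : ℕ, (rep q N).cup 1 a f ((a, i) :: (a, j) :: (!a, m) :: w) =
          if j = m ∧ j < N then cupWeight q N a j * f ((a, i) :: w) else 0 := by
        intro i j m
        change act q N (.cup a) (fun v => f ((a, i) :: v)) ((a, j) :: (!a, m) :: w) = _
        simp [act]
      have hterm : ∀ j ∈ Finset.range N, (capWeight q N a j : K) *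
          (rep q N).cross 0 .slash a a ((rep q N).cup 1 a f)
            ((a, k) :: (a, j) :: (!a, j) :: w) =
          (if k = j then q * (mu q N (rank N (!a) k) : K) * f ((a, k) :: w) else 0) +
          if Lower (!a) j k then ((q : K) - ↑q⁻¹) * mu q N (rank N (!a) j) * f ((a, k) :: w)
          else 0 := by
        intro j hj
        have hj' := Finset.mem_range.1 hj
        have ho : order .slash a = a := by cases a <;> rfl
        rw [cross_apply_self, hcup, hcup, ho, ← capWeight_mul_cupWeight a hj',
          ← capWeight_mul_cupWeight a hk]
        simp only [lower_not]
        by_cases hkj : k = j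
        · subst hkj
          simp [hk, Lower, qCross]
          ring
        · by_cases hl : Lower a k j
          · simp [hkj, hj', hl, zCross, qCross]
            ring
          · simp [hkj, hl]
      rw [Finset.sum_congr rfl hterm, Finset.sum_add_distrib, Finset.sum_ite_eq,
        if_pos (Finset.mem_range.2 hk), ← Finset.sum_filter, sum_lower (!a) hk, ← sum_mu
        (rank N (!a) k)]
      have e : ∀ j ∈ Finset.range (rank N (!a) k),
          ((q : K) - ↑q⁻¹) * mu q N (rank N (!a) (rank N (!a) j)) * f ((a, k) :: w) =
          ((q : K) - ↑q⁻¹) * mu q N j * f ((a, k) :: w) := by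
        intro j hj
        rw [rank_rank _ ((Finset.mem_range.1 hj).trans (rank_lt _ hk))]
      rw [Finset.sum_congr rfl e, ← Finset.sum_mul, ← Finset.mul_sum]
      ring
    · rw [congrFun ((m3.2 x).2 hx) w, Pi.smul_apply, congrFun ((hf.2 x).2 hx) w]
      exact (smul_zero _).symm

theorem isSkein : (rep q N).IsSkein q (fun _ => q ^ N) := by
  refine isPlanar.isSkein true ?_ ?_ ?_ ?_
  · intro k s t l r f hf
    induction l generalizing f with
    | nil =>
      by_cases hst : s = t
      · subst hst
        exact inverse_self k s r hf
      · exact inverse_ne k hst r hf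
    | cons b l ih =>
      funext w
      match w with
      | [] => exact hf.1.symm
      | x :: w => exact congrFun (ih (tail_mem hf x)) w
  · intro l r f hf
    induction l generalizing f with
    | nil => exact braid_self r hf
    | cons b l ih =>
      funext w
      match w with
      | [] => rfl
      | x :: w => exact congrFun (ih (tail_mem hf x)) w
  · intro l r f hf
    rw [if_pos rfl, if_neg (by decide), sub_zero]
    induction l generalizing f with
    | nil => exact skein_self r hf
    | cons b l ih =>
      funext w
      match w with
      | [] => exact (sub_zero (0 : K)).trans (mul_eq_zero_of_right _ hf.1).symm
      | x :: w => exact congrFun (ih (tail_mem hf x)) w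
  · intro l r c f hf
    induction l generalizing f with
    | nil => exact kink_left r c hf
    | cons b l ih =>
      funext w
      match w with
      | [] => exact (mul_eq_zero_of_right _ hf.1).symm
      | x :: w => exact congrFun (ih (tail_mem hf x)) w

/-- The value of a circle. -/
theorem circle (c : Bool) (v : List Strand → K) : (rep q N).cap 0 c ((rep q N).cup 0 c v) [] =
    (∑ i ∈ Finset.range N, (mu q N i : K)) * v [] := by
  change ∑ i ∈ Finset.range N, (capWeight q N c i : K) *
    act q N (.cup c) v [(c, i), (!c, i)] = _
  have h : ∀ i ∈ Finset.range N, (capWeight q N c i : K) *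
      act q N (.cup c) v [(c, i), (!c, i)] = mu q N (rank N (!c) i) * v [] := by
    intro i hi
    have hi' := Finset.mem_range.1 hi
    rw [← capWeight_mul_cupWeight c hi']
    simp [act, hi', mul_assoc]
  rw [Finset.sum_congr rfl h, ← Finset.sum_mul]
  congr 1
  cases c
  · rfl
  · exact Finset.sum_range_reflect (fun i => (mu q N i : K)) N

theorem sub_mul_sum_mu :
    ((q : K) - ↑q⁻¹) * ∑ i ∈ Finset.range N, (mu q N i : K) = (q ^ N : Kˣ) - ↑(q ^ N)⁻¹ := by
  rw [← sum_mu N (N := N), ← Units.val_mul q]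
  have : q * mu q N N = (q ^ N)⁻¹ := by
    rw [mu, ← zpow_natCast, ← zpow_neg]
    nth_rw 1 [← zpow_one q]
    rw [← zpow_add]
    congr 1
    ring
  rw [this]
  ring

end VertexModel
end KnottedGraph

namespace KnottedGraph
open Labels

/-! ### Substitutions in the coefficient rings -/

section
variable {S : Type} [CommRing S]

theorem substitute_algebraMap (x y : Sˣ) (h : IsUnit ((x : S) - ↑x⁻¹)) (p : MvPolynomial (Fin 2) ℤ) :
    substitute x y h (algebraMap _ Coeff p) =
      MvPolynomial.eval₂Hom (Int.castRingHom S) ![(x : S), (y : S)] p :=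
  IsLocalization.Away.lift_eq _ _ _

theorem substitute_q (x y : Sˣ) (h : IsUnit ((x : S) - ↑x⁻¹)) :
    Units.map (substitute x y h : Coeff →* S) q = x := by
  ext
  change substitute x y h (algebraMap _ Coeff (MvPolynomial.X 0)) = x
  rw [substitute_algebraMap]
  simp

theorem substitute_a (x y : Sˣ) (h : IsUnit ((x : S) - ↑x⁻¹)) :
    Units.map (substitute x y h : Coeff →* S) a = y := by
  ext
  change substitute x y h (algebraMap _ Coeff (MvPolynomial.X 1)) = y
  rw [substitute_algebraMap]
  simp

theorem coe_substitute_q (x y : Sˣ) (h : IsUnit ((x : S) - ↑x⁻¹)) :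
    substitute x y h (q : Coeff) = x := congrArg Units.val (substitute_q x y h)

theorem coe_substitute_q_inv (x y : Sˣ) (h : IsUnit ((x : S) - ↑x⁻¹)) :
    substitute x y h (↑q⁻¹ : Coeff) = (↑x⁻¹ : S) := by
  have e := congrArg (fun u : Sˣ => (↑u⁻¹ : S)) (substitute_q x y h)
  exact e

theorem coe_substitute_a (x y : Sˣ) (h : IsUnit ((x : S) - ↑x⁻¹)) :
    substitute x y h (a : Coeff) = y := congrArg Units.val (substitute_a x y h)

theorem coe_substitute_a_inv (x y : Sˣ) (h : IsUnit ((x : S) - ↑x⁻¹)) :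
    substitute x y h (↑a⁻¹ : Coeff) = (↑y⁻¹ : S) := by
  have e := congrArg (fun u : Sˣ => (↑u⁻¹ : S)) (substitute_a x y h)
  exact e

theorem substitute_z_mul (x y : Sˣ) (h : IsUnit ((x : S) - ↑x⁻¹)) :
    ((x : S) - ↑x⁻¹) * substitute x y h (↑z⁻¹ : Coeff) = 1 := by
  rw [← coe_substitute_q x y h, ← coe_substitute_q_inv x y h, ← map_sub, ← map_mul, ← coe_z,
    Units.mul_inv, map_one]

end

theorem coe_qOne : (qOne : CoeffOne) = algebraMap (Polynomial ℤ) CoeffOne Polynomial.X := rfl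

theorem algebraMap_coeffOne_injective :
    Function.Injective (algebraMap (Polynomial ℤ) CoeffOne) := by
  refine IsLocalization.injective (M := Submonoid.powers
    (Polynomial.X * (Polynomial.X ^ 2 - 1) : Polynomial ℤ)) _ ?_
  refine powers_le_nonZeroDivisors_of_noZeroDivisors ?_
  refine mul_ne_zero Polynomial.X_ne_zero ?_
  exact Polynomial.X_pow_sub_C_ne_zero (R := ℤ) (by norm_num) 1

/-- The Kronecker substitution is injective on polynomials of small degree. -/
theorem eq_zero_of_kronecker (p : MvPolynomial (Fin 2) ℤ) (n : ℕ) (hn : p.degreeOf 0 < n)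
    (h : MvPolynomial.eval₂Hom (Int.castRingHom (Polynomial ℤ))
      ![Polynomial.X, Polynomial.X ^ n] p = 0) : p = 0 := by
  ext d
  rw [MvPolynomial.coeff_zero]
  by_contra hd
  have hlt : ∀ e ∈ p.support, e 0 < n := fun e he =>
    (MvPolynomial.monomial_le_degreeOf 0 he).trans_lt hn
  have hds : d ∈ p.support := MvPolynomial.mem_support_iff.2 hd
  have h2 := congrArg (fun g => Polynomial.coeff g (d 0 + n * d 1)) h
  simp only [MvPolynomial.coe_eval₂Hom, MvPolynomial.eval₂_eq', Fin.prod_univ_two,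
    Matrix.cons_val_zero, Matrix.cons_val_one, Polynomial.finsetSum_coeff,
    Polynomial.coeff_zero, ← pow_mul, ← pow_add] at h2
  rw [Finset.sum_eq_single_of_mem d hds] at h2
  · refine hd ?_
    simpa using h2
  · intro e he hne
    have : (Int.castRingHom (Polynomial ℤ)) (p.coeff e) = Polynomial.C (p.coeff e) := by simp
    rw [this, Polynomial.coeff_C_mul_X_pow, if_neg]
    intro heq
    apply hne
    -- Both first exponents are less than `n`, so they are the residues of the total exponents
    -- modulo `n`.
    have h0 : e 0 = d 0 := by
      have := congrArg (· % n) heq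
      simpa [Nat.mod_eq_of_lt (hlt e he), Nat.mod_eq_of_lt (hlt d hds)] using this.symm
    have h1 : e 1 = d 1 := by
      rw [h0] at heq
      exact (Nat.eq_of_mul_eq_mul_left (by omega) (Nat.add_left_cancel heq)).symm
    ext i
    fin_cases i
    exacts [h0, h1]

/-- Clear denominators; for `n` larger than the degree in `q` of the numerator, the substitution of
`q ^ n` for `a` does not merge monomials. Hence arbitrarily large `n` suffice. -/
theorem eq_zero_of_substitute (f : Coeff)
    (h : ∀ m : ℕ, ∃ n ≥ m, substitute qOne (qOne ^ n) isUnit_qOne_sub f = 0) : f = 0 := by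
  obtain ⟨k, p, hp⟩ := IsLocalization.Away.surj
    (MvPolynomial.X 0 * MvPolynomial.X 1 * (MvPolynomial.X 0 ^ 2 - 1) : MvPolynomial (Fin 2) ℤ) f
  obtain ⟨n, hn, h0⟩ := h (p.degreeOf 0 + 1)
  have h1 := congrArg (substitute qOne (qOne ^ n) isUnit_qOne_sub) hp
  rw [map_mul, h0, zero_mul, substitute_algebraMap] at h1
  have hp0 : p = 0 := by
    refine eq_zero_of_kronecker p n (by omega) (algebraMap_coeffOne_injective ?_)
    rw [map_zero, h1]
    have : (algebraMap (Polynomial ℤ) CoeffOne).comp (MvPolynomial.eval₂Hom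
        (Int.castRingHom (Polynomial ℤ)) ![Polynomial.X, Polynomial.X ^ n]) =
        MvPolynomial.eval₂Hom (Int.castRingHom CoeffOne)
          ![(qOne : CoeffOne), ((qOne ^ n : CoeffOneˣ) : CoeffOne)] := by
      refine MvPolynomial.ringHom_ext (fun r => by simp) fun i => ?_
      fin_cases i <;> simp [coe_qOne]
    exact congrArg (fun g : MvPolynomial (Fin 2) ℤ →+* CoeffOne => g p) this
  rw [hp0, map_zero] at hp
  exact ((isUnit_coeff.pow k).mul_left_eq_zero).1 hp

/-! ### Existence and uniqueness of the MOY polynomial -/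

theorem moy_circle (c : Bool) : ((q : Coeff) - ↑q⁻¹) * (((a : Coeff) - ↑a⁻¹) * ↑z⁻¹) =
    (a : Coeff) - ↑a⁻¹ + if c = bar c then (q : Coeff) - ↑q⁻¹ else 0 := by
  rw [if_neg (by cases c <;> decide), add_zero, ← coe_z, mul_left_comm, Units.mul_inv, mul_one]

theorem VertexModel.isInvariant {K : Type} [CommRing K] (q : Kˣ) (N : ℕ) :
    ∃ F : Layers (LPiece Bool) → K, IsInvariant F q (fun _ => q ^ N)
      (fun _ => ∑ i ∈ Finset.range N, (VertexModel.mu q N i : K)) true := by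
  refine ⟨_, (VertexModel.isSkein (q := q) (N := N)).isInvariant (v₀ := Pi.single [] 1)
    (ε := LinearMap.proj []) ?_ ?_ ?_ true⟩
  · intro x w
    simp
  · simp
  · intro c
    refine (VertexModel.circle c _).trans ?_
    simp

/-- The substitutions of all powers of `q` for `a`. -/
noncomputable def specialize : Coeff →+* (ℕ → CoeffOne) :=
  RingHom.pi fun n => substitute qOne (qOne ^ n) isUnit_qOne_sub

theorem specialize_injective : Function.Injective specialize := by
  rw [injective_iff_map_eq_zero]
  intro f hf
  exact eq_zero_of_substitute f fun m => ⟨m, le_rfl, congrFun hf m⟩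

/-- The vertex models for all `N` together have as parameters the images of those of the MOY
polynomial under the injective map `specialize`, so they descend to `Coeff`. -/
theorem exists_isMOY : ∃ R, IsMOY R := by
  choose F hF using fun n => VertexModel.isInvariant qOne n
  have h := IsInvariant.pi hF
  have h' : IsInvariant (fun w i => F i w) (Units.map (specialize : Coeff →* (ℕ → CoeffOne)) q)
      (fun _ => Units.map (specialize : Coeff →* (ℕ → CoeffOne)) a)
      (fun _ => specialize (((a : Coeff) - ↑a⁻¹) * ↑z⁻¹)) true := by
    convert h using 1
    · ext n
      exact (coe_substitute_q qOne (qOne ^ n) isUnit_qOne_sub)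
    · ext c n
      exact (coe_substitute_a qOne (qOne ^ n) isUnit_qOne_sub)
    · ext c n
      refine isUnit_qOne_sub.mul_left_cancel ?_
      rw [VertexModel.sub_mul_sum_mu]
      change _ * substitute qOne (qOne ^ n) isUnit_qOne_sub _ = _
      rw [map_mul, mul_left_comm, substitute_z_mul, mul_one, map_sub, coe_substitute_a,
        coe_substitute_a_inv]
  obtain ⟨G, hG, -⟩ := IsInvariant.descend specialize specialize_injective h' isUnit_q_sub moy_circle
  exact ⟨_, hG.isMOY⟩

theorem isMOY_unique {R R' : ODiagram → Coeff} (h : IsMOY R) (h' : IsMOY R') : R = R' := by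
  funext D
  rw [← extendO_labelO R, ← extendO_labelO R',
    IsInvariant.unique h.isInvariant h'.isInvariant isUnit_q_sub moy_circle]

theorem isMOY_moy : IsMOY moy := Classical.epsilon_spec exists_isMOY

end KnottedGraph

namespace KnottedGraph
open Labels
namespace TangleRep
variable {K V : Type} [CommRing K] [AddCommGroup V] [Module K V]

/-! ### The sum over orientations -/

/-- The label of the lower left end of a top outward crossing. -/
def lowLabel : Crossing → Bool
  | .slash => false
  | .backslash => true

/-- The weight of the two vertical strands in the resolution of a top outward crossing; the
smoothing with a maximum and a minimum has the opposite weight. -/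
def zSign (q : Kˣ) : Crossing → K
  | .slash => (q : K) - ↑q⁻¹
  | .backslash => -((q : K) - ↑q⁻¹)

/-- The projection to the rows with labels `s` and `t` at position `i`. -/
def proj (X : TangleRep K V Bool) (i : ℕ) (s t : Bool) : Module.End K V :=
  -- The second Reidemeister move makes this the identity on rows with labels `s`, `t`, and
  -- `cross_zero` makes it vanish on the others.
  X.cross i .backslash t s * X.cross i .slash s t

/-- The sum over all orientations of a crossing, and over the resolutions if it is top outward. -/
def crossSum (X : TangleRep K V Bool) (q : Kˣ) (i : ℕ) (k : Crossing) : Module.End K V :=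
  X.cross i k true true + (X.cross i k true false + (X.cross i k false true +
    (X.cross i k false false + zSign q k • (X.proj i (lowLabel k) (!lowLabel k) +
      (-1 : K) • (X.cup i (lowLabel k) * X.cap i (lowLabel k))))))

/-- The representation of unoriented tangles obtained by summation over all edge orientations. -/
def jaeger (X : TangleRep K V Bool) (q : Kˣ) : TangleRep K V Unit where
  deg s := ⨆ y : {y : List Bool // y.length = s.length}, X.deg y.1
  op i
    | .cup _ => X.cup i true + X.cup i false
    | .cap _ => X.cap i true + X.cap i false
    | .cross k _ _ => X.crossSum q i k

variable {X : TangleRep K V Bool} {q : Kˣ} {κ : Bool → Kˣ} {f : V}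

/-- An identity for sums over orientations has to be checked on each row of directions separately,
where most summands vanish. -/
theorem jaeger_induction {s : List Unit} {S T : Module.End K V}
    (h : ∀ y : List Bool, y.length = s.length → ∀ f ∈ X.deg y, S f = T f)
    (hf : f ∈ (jaeger X q).deg s) : S f = T f := by
  have : (jaeger X q).deg s ≤ LinearMap.eqLocus S T :=
    iSup_le fun y v hv => h y.1 y.2 v hv
  exact this hf

theorem mem_jaeger {y : List Bool} {s : List Unit} (h : y.length = s.length) (hf : f ∈ X.deg y) :
    f ∈ (jaeger X q).deg s :=
  Submodule.mem_iSup_of_mem (⟨y, h⟩ : {y : List Bool // y.length = s.length}) hf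

theorem exists_append_of_length {C : Type} {y : List C} {m n : ℕ} (h : y.length = m + n) :
    ∃ u v, y = u ++ v ∧ u.length = m ∧ v.length = n :=
  ⟨y.take m, y.drop m, (List.take_append_drop m y).symm, by simp [h], by simp [h]⟩

theorem isLocal_jaeger (hX : X.IsPlanar) (g : TanglePiece Unit) :
    X.IsLocal (fun i => (jaeger X q).op i g) (Pieces.dom g).length (Pieces.cod g).length := by
  match g with
  | .cup c => exact (hX.isLocal_op (.cup true)).add (hX.isLocal_op (.cup false))
  | .cap c => exact (hX.isLocal_op (.cap true)).add (hX.isLocal_op (.cap false))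
  | .cross k s t =>
    have h := fun s t => hX.isLocal_op (.cross k s t)
    refine (h true true).add ((h true false).add ((h false true).add ((h false false).add
      (IsLocal.smul (IsLocal.add ?_ (IsLocal.smul ?_ _)) _))))
    · exact (hX.isLocal_op (.cross .slash (lowLabel k) (!lowLabel k))).mul
        (hX.isLocal_op (.cross .backslash (!lowLabel k) (lowLabel k)))
    · exact (hX.isLocal_op (.cap (lowLabel k))).mul (hX.isLocal_op (.cup (lowLabel k)))

theorem far_jaeger_left (hX : X.IsPlanar) (g : TanglePiece Unit) {B : ℕ → Module.End K V} {d' : ℕ}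
    (h : ∀ g : TanglePiece Bool, X.Far (fun i => X.op i g) (Pieces.dom g).length
      (Pieces.cod g).length B d') :
    X.Far (fun i => (jaeger X q).op i g) (Pieces.dom g).length (Pieces.cod g).length B d' := by
  match g with
  | .cup c => exact (h (.cup true)).add_left (h (.cup false))
  | .cap c => exact (h (.cap true)).add_left (h (.cap false))
  | .cross k s t =>
    have h' := fun s t => h (.cross k s t)
    refine (h' true true).add_left ((h' true false).add_left ((h' false true).add_left
      ((h' false false).add_left (Far.smul_left (Far.add_left ?_ (Far.smul_left ?_ _)) _))))
    · exact (h (.cross .slash (lowLabel k) (!lowLabel k))).mul_left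
        (h (.cross .backslash (!lowLabel k) (lowLabel k))) (hX.isLocal_op _)
    · exact (h (.cap (lowLabel k))).mul_left (h (.cup (lowLabel k))) (hX.isLocal_op _)

theorem far_jaeger_right (hX : X.IsPlanar) (g : TanglePiece Unit) {A : ℕ → Module.End K V}
    {d e : ℕ}
    (h : ∀ g : TanglePiece Bool, X.Far A d e (fun i => X.op i g) (Pieces.dom g).length) :
    X.Far A d e (fun i => (jaeger X q).op i g) (Pieces.dom g).length := by
  match g with
  | .cup c => exact (h (.cup true)).add_right (h (.cup false))
  | .cap c => exact (h (.cap true)).add_right (h (.cap false))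
  | .cross k s t =>
    have h' := fun s t => h (.cross k s t)
    refine (h' true true).add_right ((h' true false).add_right ((h' false true).add_right
      ((h' false false).add_right (Far.smul_right (Far.add_right ?_ (Far.smul_right ?_ _)) _))))
    · exact (h (.cross .slash (lowLabel k) (!lowLabel k))).mul_right
        (h (.cross .backslash (!lowLabel k) (lowLabel k))) (hX.isLocal_op _)
    · exact (h (.cap (lowLabel k))).mul_right (h (.cup (lowLabel k))) (hX.isLocal_op _)

namespace IsSkein

theorem jaeger_cup (i : ℕ) : (jaeger X q).cup i () f = X.cup i true f + X.cup i false f := rfl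

theorem jaeger_cap (hX : X.IsPlanar) (l r : List Bool) {s t : Bool}
    (hf : f ∈ X.deg (l ++ s :: t :: r)) :
    (jaeger X q).cap l.length () f = if t = !s then X.cap l.length s f else 0 := by
  change X.cap l.length true f + X.cap l.length false f = _
  have h0 : ∀ c, ¬ (s = c ∧ t = !c) → X.cap l.length c f = 0 := fun c h =>
    hX.cap_zero l r c s t hf h
  cases s <;> cases t <;> simp [h0 true, h0 false]

/-- On a fixed row one of the four straight crossings survives; the top outward correction is added
precisely when both strands leave along the upper strand of the crossing. -/
theorem jaeger_cross (hX : X.IsSkein q κ) (l r : List Bool) (k : Crossing) {s t : Bool}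
    (hf : f ∈ X.deg (l ++ s :: t :: r)) :
    (jaeger X q).cross l.length k () () f = X.cross l.length k s t f +
      if s = lowLabel k ∧ t = !lowLabel k then
        zSign q k • (f - X.cup l.length s (X.cap l.length s f)) else 0 := by
  change X.cross l.length k true true f + (X.cross l.length k true false f +
    (X.cross l.length k false true f + (X.cross l.length k false false f + zSign q k •
      (X.cross l.length .backslash (!lowLabel k) (lowLabel k)
        (X.cross l.length .slash (lowLabel k) (!lowLabel k) f) + (-1 : K) •
          X.cup l.length (lowLabel k) (X.cap l.length (lowLabel k) f))))) = _
  have h0 : ∀ k' c d, ¬ (s = c ∧ t = d) → X.cross l.length k' c d f = 0 := fun k' c d h =>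
    hX.cross_zero l r k' c d s t hf h
  have h1 : X.cross l.length k true true f + (X.cross l.length k true false f +
      (X.cross l.length k false true f + X.cross l.length k false false f)) =
      X.cross l.length k s t f := by
    cases s <;> cases t <;> simp [h0]
  rw [← add_assoc (X.cross l.length k false true f), ← add_assoc (X.cross l.length k true false f),
    ← add_assoc (X.cross l.length k true true f), h1]
  congr 1
  by_cases h : s = lowLabel k ∧ t = !lowLabel k
  · rw [if_pos h]
    obtain ⟨rfl, rfl⟩ := h
    rw [hX.inverse_slash l r _ _ hf, neg_one_smul, sub_eq_add_neg]
  · rw [if_neg h, h0 _ _ _ h, hX.cap_zero l r _ s t hf h]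
    simp

theorem isPlanar_jaeger (hX : X.IsSkein q κ) : (jaeger X q).IsPlanar where
  op_mem g l r f hf := by
    have : (jaeger X q).deg (l ++ (Pieces.dom g ++ r)) ≤
        ((jaeger X q).deg (l ++ (Pieces.cod g ++ r))).comap ((jaeger X q).op l.length g) := by
      refine iSup_le ?_
      rintro ⟨y, hy⟩ v hv
      rw [List.length_append, List.length_append] at hy
      obtain ⟨l', y, rfl, hl, hy⟩ := exists_append_of_length hy
      obtain ⟨x, r', rfl, hx, hr⟩ := exists_append_of_length hy
      have h := isLocal_jaeger (q := q) hX.toIsPlanar g l' x r' hx hv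
      rw [hl] at h
      have h2 : X.degSup l' (Pieces.cod g).length r' ≤
          (jaeger X q).deg (l ++ (Pieces.cod g ++ r)) := by
        refine iSup_le ?_
        rintro ⟨y, hy⟩ v hv
        exact mem_jaeger (by simp [hl, hy, hr]) hv
      exact h2 h
    exact this hf
  cap_zero l r c s t f hf h := absurd ⟨rfl, rfl⟩ h
  cross_zero l r k c d s t f hf h := absurd ⟨rfl, rfl⟩ h
  exchange g h l m r x y f hx hy hf := by
    subst hx hy
    refine jaeger_induction (S := (jaeger X q).op (l.length + (Pieces.cod g).length + m.length) h *
      (jaeger X q).op l.length g) (T := (jaeger X q).op l.length g *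
      (jaeger X q).op (l.length + (Pieces.dom g).length + m.length) h) (fun y hy v hv => ?_) hf
    simp only [List.length_append] at hy
    obtain ⟨l', y, rfl, hl, hy⟩ := exists_append_of_length hy
    obtain ⟨x, y, rfl, hx, hy⟩ := exists_append_of_length hy
    obtain ⟨m', y, rfl, hm, hy⟩ := exists_append_of_length hy
    obtain ⟨y, r', rfl, hy, hr⟩ := exists_append_of_length hy
    have := far_jaeger_left (q := q) hX.toIsPlanar g
      (fun g' => far_jaeger_right (q := q) hX.toIsPlanar h fun h' => hX.far_op g' h')
      l' x m' y r' hx hy hv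
    rw [hl, hm] at this
    exact this
  zigzag l r c d f h hf := by
    refine jaeger_induction (S := (jaeger X q).cap l.length c * (jaeger X q).cup (l.length + 1) d)
      (T := 1) (fun y hy v hv => ?_) hf
    simp only [List.length_append, List.length_cons] at hy
    obtain ⟨l', y, rfl, hl, hy⟩ := exists_append_of_length hy
    rw [← hl]
    obtain ⟨b, r', rfl⟩ := List.exists_cons_of_length_eq_add_one hy
    have hv' : v ∈ X.deg ((l' ++ [b]) ++ r') := by simpa using hv
    have m : ∀ o, X.cup (l'.length + 1) o v ∈ X.deg (l' ++ b :: o :: (!o) :: r') := fun o => by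
      simpa using hX.cup_mem (l' ++ [b]) r' (c := o) (d := !o) rfl hv'
    change (jaeger X q).cap l'.length () (X.cup (l'.length + 1) true v +
      X.cup (l'.length + 1) false v) = v
    rw [map_add, jaeger_cap hX.toIsPlanar l' _ (m true), jaeger_cap hX.toIsPlanar l' _ (m false)]
    cases b
    · simpa using hX.zigzag l' r' false true rfl hv
    · simpa using hX.zigzag l' r' true false rfl hv
  zagzig l r c d f h hf := by
    refine jaeger_induction (S := (jaeger X q).cap (l.length + 1) d * (jaeger X q).cup l.length c)
      (T := 1) (fun y hy v hv => ?_) hf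
    simp only [List.length_append, List.length_cons] at hy
    obtain ⟨l', y, rfl, hl, hy⟩ := exists_append_of_length hy
    rw [← hl]
    obtain ⟨b, r', rfl⟩ := List.exists_cons_of_length_eq_add_one hy
    have m : ∀ o, X.cup l'.length o v ∈ X.deg ((l' ++ [o]) ++ (!o) :: b :: r') := fun o => by
      simpa using hX.cup_mem l' (b :: r') (c := o) (d := !o) rfl hv
    have e := fun o => jaeger_cap (q := q) hX.toIsPlanar (l' ++ [o]) r' (m o)
    simp only [List.length_append, List.length_singleton] at e
    change (jaeger X q).cap (l'.length + 1) () (X.cup l'.length true v + X.cup l'.length false v) = v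
    rw [map_add, e, e]
    cases b
    · simpa using hX.zagzig l' r' false true rfl hv
    · simpa using hX.zagzig l' r' true false rfl hv
  crossCup l r k c d s f h hf := by
    refine jaeger_induction (S := (jaeger X q).cross (l.length + 1) k d s *
      (jaeger X q).cup l.length c) (T := (jaeger X q).cross l.length k.flip s c *
      (jaeger X q).cup (l.length + 1) c) (fun y hy v hv => ?_) hf
    simp only [List.length_append, List.length_cons] at hy
    obtain ⟨l', y, rfl, hl, hy⟩ := exists_append_of_length hy
    rw [← hl]
    obtain ⟨b, r', rfl⟩ := List.exists_cons_of_length_eq_add_one hy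
    have hv' : v ∈ X.deg ((l' ++ [b]) ++ r') := by simpa using hv
    have m : ∀ o, X.cup l'.length o v ∈ X.deg ((l' ++ [o]) ++ (!o) :: b :: r') := fun o => by
      simpa using hX.cup_mem l' (b :: r') (c := o) (d := !o) rfl hv
    have m' : ∀ o, X.cup (l'.length + 1) o v ∈ X.deg (l' ++ b :: o :: (!o) :: r') := fun o => by
      simpa using hX.cup_mem (l' ++ [b]) r' (c := o) (d := !o) rfl hv'
    have e := fun o => hX.jaeger_cross (l' ++ [o]) r' k (m o)
    have e' := fun o => hX.jaeger_cross l' ((!o) :: r') k.flip (m' o)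
    have e'' := fun o => hX.crossCup l' r' k o (!o) b rfl hv
    simp only [List.length_append, List.length_singleton] at e
    change (jaeger X q).cross (l'.length + 1) k () () (X.cup l'.length true v +
      X.cup l'.length false v) = (jaeger X q).cross l'.length k.flip () ()
        (X.cup (l'.length + 1) true v + X.cup (l'.length + 1) false v)
    rw [map_add, map_add, e, e, e', e', e'', e'']
    -- A quarter turn exchanges the two smoothings and flips the crossing, which changes `zSign`; so
    -- the corrections on the two sides agree.
    cases b
    · have h1 := hX.zigzag l' r' false true rfl hv
      have h2 := hX.zagzig l' r' false true rfl hv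
      cases k
      · simp [lowLabel, Crossing.flip]
      · simp [lowLabel, zSign, Crossing.flip, h1, h2]
        module
    · have h1 := hX.zigzag l' r' true false rfl hv
      have h2 := hX.zagzig l' r' true false rfl hv
      cases k
      · simp [lowLabel, zSign, Crossing.flip, h1, h2]
        module
      · simp [lowLabel, Crossing.flip]

end IsSkein
end TangleRep
end KnottedGraph

/-! ### Second Reidemeister move, skein relation and kinks for the sum over orientations. -/

namespace KnottedGraph
open Labels
namespace TangleRep
variable {K V : Type} [CommRing K] [AddCommGroup V] [Module K V]
variable {X : TangleRep K V Bool} {q : Kˣ} {κ : Bool → Kˣ} {f : V}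

namespace IsSkein

theorem slash_sub_backslash_of_eq (hX : X.IsSkein q κ) (l r : List Bool) (s : Bool)
    (hf : f ∈ X.deg (l ++ s :: s :: r)) :
    X.cross l.length .backslash s s f = X.cross l.length .slash s s f -
      ((q : K) - ↑q⁻¹) • f := by
  have := hX.skein s s l r hf
  rw [if_pos rfl, if_neg (by cases s <;> decide), sub_zero] at this
  rw [← this, sub_sub_cancel]

theorem slash_sub_backslash_of_ne (hX : X.IsSkein q κ) (l r : List Bool) {s t : Bool}
    (h : t = !s) (hf : f ∈ X.deg (l ++ s :: t :: r)) :
    X.cross l.length .backslash s t f = X.cross l.length .slash s t f +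
      ((q : K) - ↑q⁻¹) • X.cup l.length t (X.cap l.length s f) := by
  have := hX.skein s t l r hf
  rw [if_neg (by subst h; cases s <;> decide), if_pos (show t = bar s from h), zero_sub, smul_neg] at this
  rw [← sub_eq_zero, ← sub_sub, ← neg_sub (X.cross l.length .slash s t f), this, neg_neg, sub_self]

/-- If the first crossing can be top outward, then so can the second. The corrections from both,
rewritten with the skein relation and the kink factors, cancel because these factors are `q` and
`q⁻¹`; this is the role of `hκ`. -/
theorem inverse_jaeger (hX : X.IsSkein q κ) (hκ : κ false = q) (k : Crossing) :
    (jaeger X q).Inverse k () () := by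
  intro l r f hf
  refine jaeger_induction (S := (jaeger X q).cross l.length k.flip () () *
    (jaeger X q).cross l.length k () ()) (T := 1) (fun y hy v hv => ?_) hf
  simp only [List.length_append, List.length_cons] at hy
  obtain ⟨l', y, rfl, hl, hy⟩ := exists_append_of_length hy
  rw [← hl]
  obtain ⟨s, y, rfl⟩ := List.exists_cons_of_length_eq_add_one hy
  obtain ⟨t, r', rfl⟩ := List.exists_cons_of_length_eq_add_one (Nat.succ.inj hy)
  have m := hX.cross_mem (k := k) l' r' hv
  have i := hX.inverse k s t l' r' hv
  change (jaeger X q).cross l'.length k.flip () () ((jaeger X q).cross l'.length k () () v) = v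
  rw [hX.jaeger_cross l' r' k hv]
  by_cases h : s = lowLabel k ∧ t = !lowLabel k
  · obtain ⟨hs, ht⟩ := h
    have hst : t = !s := by rw [hs, ht]
    have m2 : X.cup l'.length s (X.cap l'.length s v) ∈ X.deg (l' ++ s :: t :: r') :=
      hX.cup_mem l' r' hst (hX.cap_mem l' r' hst hv)
    have m3 := hX.cap_mem l' r' hst hv
    have e1 := hX.slash_sub_backslash_of_ne l' r' hst hv
    have e2 := hX.slash_sub_backslash_of_ne l' r' hst m2
    rw [if_pos ⟨hs, ht⟩, map_add, hX.jaeger_cross l' r' k.flip m, map_smul, map_sub,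
      hX.jaeger_cross l' r' k.flip hv, hX.jaeger_cross l' r' k.flip m2, i]
    cases k with
    | slash =>
      obtain rfl : s = false := hs
      obtain rfl : t = true := ht
      have c1 := hX.cap_slash l' r' (c := true) (d := false) rfl hv
      have c2 := hX.cup_backslash l' r' (c := false) (d := true) rfl m3
      simp only [Crossing.flip, lowLabel, zSign, Bool.not_true, and_self, if_true, reduceCtorEq,
        if_false, add_zero, e1, c1, c2, map_smul, hκ, Units.smul_def]
      module
    | backslash =>
      obtain rfl : s = true := hs
      obtain rfl : t = false := ht
      have c1 := hX.cap_backslash l' r' (c := false) (d := true) rfl hv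
      have c2 := hX.cup_slash l' r' (c := true) (d := false) rfl m3
      simp only [Crossing.flip, lowLabel, zSign, Bool.not_false, and_self, if_true, reduceCtorEq,
        if_false, add_zero, c1, c2, map_smul, hκ, Units.smul_def]
      rw [e1]
      module
  · rw [if_neg h, add_zero, hX.jaeger_cross l' r' k.flip m, i, if_neg, add_zero]
    rintro ⟨rfl, rfl⟩
    apply h
    cases k <;> exact ⟨rfl, rfl⟩

/-- For antiparallel strands the oriented relation yields only the smoothing with reversed ends. Of
the two crossings exactly one can be top outward, and its correction, with sign `zSign`, supplies
the other smoothings. For parallel strands there is no correction. -/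
theorem skein_jaeger (hX : X.IsSkein q κ) : (jaeger X q).Skein q () () := by
  intro l r f hf
  rw [if_pos rfl, if_pos rfl]
  refine jaeger_induction (S := (jaeger X q).cross l.length .slash () () -
    (jaeger X q).cross l.length .backslash () ()) (T := ((q : K) - ↑q⁻¹) •
      (1 - (jaeger X q).cup l.length () * (jaeger X q).cap l.length ())) (fun y hy v hv => ?_) hf
  simp only [List.length_append, List.length_cons] at hy
  obtain ⟨l', y, rfl, hl, hy⟩ := exists_append_of_length hy
  rw [← hl]
  obtain ⟨s, y, rfl⟩ := List.exists_cons_of_length_eq_add_one hy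
  obtain ⟨t, r', rfl⟩ := List.exists_cons_of_length_eq_add_one (Nat.succ.inj hy)
  change (jaeger X q).cross l'.length .slash () () v - (jaeger X q).cross l'.length .backslash () () v
    = ((q : K) - ↑q⁻¹) • (v - (jaeger X q).cup l'.length () ((jaeger X q).cap l'.length () v))
  rw [hX.jaeger_cross l' r' .slash hv, hX.jaeger_cross l' r' .backslash hv,
    jaeger_cap hX.toIsPlanar l' r' hv]
  by_cases h : t = !s
  · rw [hX.slash_sub_backslash_of_ne l' r' h hv, if_pos h, jaeger_cup]
    subst h
    cases s <;> simp [lowLabel, zSign] <;> module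
  · obtain rfl : t = s := by cases s <;> cases t <;> simp_all
    rw [hX.slash_sub_backslash_of_eq l' r' _ hv, if_neg h, map_zero]
    cases t <;> simp [lowLabel]

/-- `circle_right` evaluates the circle whose near leg is parallel to the strand. Resolving the
crossing of a circle with twisted legs relates this circle to the one with the opposite orientation.
-/
theorem circle_right_true (hX : X.IsSkein q κ) (hκ : κ false = q) (l r : List Bool)
    (hf : f ∈ X.deg (l ++ false :: r)) :
    ((q : K) - ↑q⁻¹) • X.cap (l.length + 1) true (X.cup (l.length + 1) true f) =
      ((κ true : K) - ↑q⁻¹) • f := by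
  have hl : (l ++ [false]).length = l.length + 1 := by simp
  replace hl := hl.symm
  have e1 := hX.circle_right l r (c := false) (d := true) rfl hf
  rw [if_neg (by decide), add_zero, hκ] at e1
  have hf' : f ∈ X.deg ((l ++ [false]) ++ r) := by simpa using hf
  rw [hl] at e1 ⊢
  generalize l ++ [false] = l' at *
  have m := hX.cup_mem l' r (c := false) (d := true) rfl hf'
  have m2 := hX.cap_mem l' r (c := false) (d := true) rfl m
  have e2 := hX.cup_backslash l' r (c := false) (d := true) rfl hf'
  have e3 := hX.cap_slash l' r (c := true) (d := false) rfl m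
  rw [hX.slash_sub_backslash_of_ne l' r (t := true) rfl m, hκ] at e2
  replace e2 := congrArg (X.cap l'.length true) e2
  rw [map_add, map_smul, ← map_smul, e3, hκ, ← map_smul (X.cup _ _), e1] at e2
  simp only [map_smul, sub_smul, map_sub, Units.smul_def] at e2
  replace e2 : ((q⁻¹ : Kˣ) : K) • X.cap l'.length false (X.cup l'.length false f) =
      ((κ true)⁻¹ : Kˣ).val • X.cap l'.length true (X.cup l'.length true f) := by
    rw [← sub_eq_zero] at e2 ⊢
    rw [← e2]
    abel
  have e4 : X.cap l'.length true (X.cup l'.length true f) =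
      ((κ true : K) * ↑q⁻¹) • X.cap l'.length false (X.cup l'.length false f) := by
    rw [mul_smul, e2, smul_smul, Units.mul_inv, one_smul]
  rw [e4, smul_comm, e1, smul_smul]
  congr 1
  linear_combination (κ true : K) * q.inv_mul - (q⁻¹ : Kˣ).val * (κ true).mul_inv

/-- An upward strand has only its own kink. For a downward strand three terms add up: its kink `q`,
a circle `κ true - q⁻¹`, and the bare strand with coefficient `-(q - q⁻¹)`. The sum is again `κ
true`. -/
theorem kink_jaeger (hX : X.IsSkein q κ) (hκ : κ false = q) (l r : List Unit) (c : Unit)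
    (hf : f ∈ (jaeger X q).deg (l ++ c :: r)) :
    (jaeger X q).cap (l.length + 1) c ((jaeger X q).cross l.length .slash c c
      ((jaeger X q).cup (l.length + 1) c f)) = (κ true : K) • f := by
  refine jaeger_induction (S := (jaeger X q).cap (l.length + 1) c * ((jaeger X q).cross l.length
    .slash c c * (jaeger X q).cup (l.length + 1) c)) (T := (κ true : K) • 1)
    (fun y hy v hv => ?_) hf
  simp only [List.length_append, List.length_cons] at hy
  obtain ⟨l', y, rfl, hl, hy⟩ := exists_append_of_length hy
  rw [← hl]
  obtain ⟨b, r', rfl⟩ := List.exists_cons_of_length_eq_add_one hy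
  have hv' : v ∈ X.deg ((l' ++ [b]) ++ r') := by simpa using hv
  have m : ∀ o, X.cup (l'.length + 1) o v ∈ X.deg (l' ++ b :: o :: (!o) :: r') := fun o => by
    simpa using hX.cup_mem (l' ++ [b]) r' (c := o) (d := !o) rfl hv'
  have m2 : ∀ o, X.cross l'.length .slash b o (X.cup (l'.length + 1) o v) ∈
      X.deg ((l' ++ [o]) ++ b :: (!o) :: r') := fun o => by
    simpa using hX.cross_mem l' ((!o) :: r') (k := .slash) (m o)
  have m3 : ∀ o, X.cup (l'.length + 1) o v ∈ X.deg ((l' ++ [b]) ++ o :: (!o) :: r') := fun o => by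
    simpa using m o
  have e := fun o => hX.jaeger_cross l' ((!o) :: r') .slash (m o)
  have e2 := fun o => jaeger_cap (q := q) hX.toIsPlanar (l' ++ [o]) r' (m2 o)
  have e3 := fun o => jaeger_cap (q := q) hX.toIsPlanar (l' ++ [b]) r' (m3 o)
  simp only [List.length_append, List.length_singleton] at e2 e3
  change (jaeger X q).cap (l'.length + 1) () ((jaeger X q).cross l'.length .slash () ()
    (X.cup (l'.length + 1) true v + X.cup (l'.length + 1) false v)) = (κ true : K) • v
  rw [map_add, e, e]
  cases b
  · have h1 := hX.kink l' r' false hv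
    have h2 := hX.circle_right_true hκ l' r' hv
    have h3 := hX.zigzag l' r' false true rfl hv
    have h4 := hX.zagzig l' r' false true rfl hv
    have h5 := jaeger_cap (q := q) hX.toIsPlanar (l' ++ [false]) r' (s := true) (t := false)
      (f := X.cup l'.length false v)
      (by simpa using hX.cup_mem l' (false :: r') (c := false) (d := true) rfl hv)
    simp only [List.length_append, List.length_singleton, Bool.not_true, if_true] at h5
    rw [hκ] at h1
    simp [lowLabel, zSign, e2, e3, h1, h3, h4, h5, smul_sub, h2]
    module
  · have h1 := hX.kink l' r' true hv
    simp [lowLabel, e2, h1]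

end IsSkein
end TangleRep
end KnottedGraph

/-! ### The third Reidemeister move for the sum over orientations. -/

namespace KnottedGraph
open Labels
namespace TangleRep
variable {K V : Type} [CommRing K] [AddCommGroup V] [Module K V]
variable {X : TangleRep K V Bool} {q : Kˣ} {κ : Bool → Kˣ} {f : V}

namespace IsSkein

theorem cap_cross_cross_left (hX : X.IsSkein q κ) (k : Crossing) {p c d : Bool} (h : d = bar c)
    (hf : f ∈ X.deg [p, c, d]) :
    X.cap 0 c (X.cross 1 k p d (X.cross 0 k p c f)) = X.cap 1 c f := by
  have m1 : X.cross 0 k p c f ∈ X.deg [c, p, d] := hX.cross_mem [] [d] hf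
  have m2 : X.cross 1 k p d (X.cross 0 k p c f) ∈ X.deg [c, d, p] := hX.cross_mem [c] [] m1
  have e : X.cap 1 c (X.cross 0 k.flip c p (X.cross 1 k.flip d p
    (X.cross 1 k p d (X.cross 0 k p c f)))) = X.cap 0 c (X.cross 1 k p d (X.cross 0 k p c f)) :=
    hX.cap_cross_cross [] [] k.flip h m2
  have i1 : X.cross 1 k.flip d p (X.cross 1 k p d (X.cross 0 k p c f)) = X.cross 0 k p c f :=
    hX.inverse k p d [c] [] m1
  have i2 : X.cross 0 k.flip c p (X.cross 0 k p c f) = f := hX.inverse k p c [] [d] hf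
  rw [← e, i1, i2]

theorem cross_cross_cup_right (hX : X.IsSkein q κ) (k : Crossing) {p c d : Bool} (h : d = bar c)
    (hf : f ∈ X.deg [p]) :
    X.cross 1 k p d (X.cross 0 k p c (X.cup 1 c f)) = X.cup 0 c f := by
  have m1 : X.cup 0 c f ∈ X.deg [c, d, p] := hX.cup_mem [] [p] h hf
  have m2 : X.cross 1 k.flip d p (X.cup 0 c f) ∈ X.deg [c, p, d] := hX.cross_mem [c] [] m1
  have e : X.cross 0 k.flip c p (X.cross 1 k.flip d p (X.cup 0 c f)) = X.cup 1 c f :=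
    hX.cross_cross_cup [] [] k.flip h hf
  have i1 := hX.inverse k.flip c p [] [d] m2
  have i2 := hX.inverse k.flip d p [c] [] m1
  rw [Crossing.flip_flip] at i1 i2
  simp only [List.length_nil, List.length_singleton] at i1 i2
  rw [← e, i1, i2]

theorem jaeger_slash_zero (hX : X.IsSkein q κ) {s t : Bool} {r : List Bool}
    (hf : f ∈ X.deg (s :: t :: r)) :
    (jaeger X q).cross 0 .slash () () f = X.cross 0 .slash s t f +
      if s = false ∧ t = true then ((q : K) - ↑q⁻¹) • (f - X.cup 0 false (X.cap 0 false f))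
        else 0 := by
  have := hX.jaeger_cross [] r .slash hf
  rw [List.length_nil] at this
  rw [this]
  cases s <;> cases t <;> rfl

theorem jaeger_slash_one (hX : X.IsSkein q κ) {b s t : Bool} {r : List Bool}
    (hf : f ∈ X.deg (b :: s :: t :: r)) :
    (jaeger X q).cross 1 .slash () () f = X.cross 1 .slash s t f +
      if s = false ∧ t = true then ((q : K) - ↑q⁻¹) • (f - X.cup 1 false (X.cap 1 false f))
        else 0 := by
  have := hX.jaeger_cross [b] r .slash hf
  rw [List.length_singleton] at this
  rw [this]
  cases s <;> cases t <;> rfl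

/-- No crossing can be top outward here, so this is the oriented move. -/
theorem braid_jaeger_monotone (hX : X.IsSkein q κ) {s t u : Bool} (h1 : ¬ (s = false ∧ t = true))
    (h2 : ¬ (s = false ∧ u = true)) (h3 : ¬ (t = false ∧ u = true)) (hf : f ∈ X.deg [s, t, u]) :
    (jaeger X q).cross 0 .slash () () ((jaeger X q).cross 1 .slash () ()
      ((jaeger X q).cross 0 .slash () () f)) = (jaeger X q).cross 1 .slash () ()
        ((jaeger X q).cross 0 .slash () () ((jaeger X q).cross 1 .slash () () f)) := by
  have m1 : X.cross 0 .slash s t f ∈ X.deg [t, s, u] := hX.cross_mem [] [u] hf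
  have m2 : X.cross 1 .slash s u (X.cross 0 .slash s t f) ∈ X.deg [t, u, s] :=
    hX.cross_mem [t] [] m1
  have m3 : X.cross 1 .slash t u f ∈ X.deg [s, u, t] := hX.cross_mem [s] [] hf
  have m4 : X.cross 0 .slash s u (X.cross 1 .slash t u f) ∈ X.deg [u, s, t] :=
    hX.cross_mem [] [t] m3
  rw [hX.jaeger_slash_zero hf, if_neg h1, add_zero, hX.jaeger_slash_one m1, if_neg h2, add_zero,
    hX.jaeger_slash_zero m2, if_neg h3, add_zero, hX.jaeger_slash_one hf, if_neg h3, add_zero,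
    hX.jaeger_slash_zero m3, if_neg h2, add_zero, hX.jaeger_slash_one m4, if_neg h1, add_zero]
  exact hX.braid s t u [] [] hf

/-- Only the two right strands can form a top outward crossing. The correction appears once on each
side, and the remaining strand passes over or under its smoothings. -/
theorem braid_jaeger_tft (hX : X.IsSkein q κ) (hf : f ∈ X.deg [true, false, true]) :
    (jaeger X q).cross 0 .slash () () ((jaeger X q).cross 1 .slash () ()
      ((jaeger X q).cross 0 .slash () () f)) = (jaeger X q).cross 1 .slash () ()
        ((jaeger X q).cross 0 .slash () () ((jaeger X q).cross 1 .slash () () f)) := by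
  have m1 : X.cross 0 .slash true false f ∈ X.deg [false, true, true] := hX.cross_mem [] [true] hf
  have m2 : X.cross 1 .slash true true (X.cross 0 .slash true false f) ∈ X.deg [false, true, true] :=
    hX.cross_mem [false] [] m1
  have m3 : X.cross 1 .slash false true f ∈ X.deg [true, true, false] := hX.cross_mem [true] [] hf
  have m4 : X.cross 0 .slash true true (X.cross 1 .slash false true f) ∈
      X.deg [true, true, false] := hX.cross_mem [] [false] m3
  have m5 : X.cap 1 false f ∈ X.deg [true] := hX.cap_mem [true] [] rfl hf
  have m6 : X.cup 1 false (X.cap 1 false f) ∈ X.deg [true, false, true] :=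
    hX.cup_mem [true] [] rfl m5
  have m7 : X.cross 0 .slash true false (X.cup 1 false (X.cap 1 false f)) ∈
      X.deg [false, true, true] := hX.cross_mem [] [true] m6
  have e1 := hX.cap_cross_cross_left .slash (c := false) (d := true) rfl hf
  have e2 := hX.cross_cross_cup_right .slash (c := false) (d := true) rfl m5
  have e3 : X.cross 0 .slash false true (X.cross 1 .slash true true (X.cross 0 .slash true false f)) =
    X.cross 1 .slash true false (X.cross 0 .slash true true (X.cross 1 .slash false true f)) :=
    hX.braid true false true [] [] hf
  have n : ¬ (true = false ∧ false = true) := by decide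
  have n' : ¬ (true = false ∧ true = true) := by decide
  have p : false = false ∧ true = true := by decide
  rw [hX.jaeger_slash_zero hf, if_neg n, add_zero, hX.jaeger_slash_one m1, if_neg n', add_zero,
    hX.jaeger_slash_zero m2, if_pos p, hX.jaeger_slash_one hf, if_pos p, map_add, map_smul, map_sub,
    hX.jaeger_slash_zero m3, if_neg n', add_zero, hX.jaeger_slash_zero hf, if_neg n, add_zero,
    hX.jaeger_slash_zero m6, if_neg n, add_zero, map_add, map_smul, map_sub,
    hX.jaeger_slash_one m4, if_neg n, add_zero, hX.jaeger_slash_one m1, if_neg n', add_zero,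
    hX.jaeger_slash_one m7, if_neg n', add_zero, e1, e2, e3]

theorem braid_jaeger_ftf (hX : X.IsSkein q κ) (hf : f ∈ X.deg [false, true, false]) :
    (jaeger X q).cross 0 .slash () () ((jaeger X q).cross 1 .slash () ()
      ((jaeger X q).cross 0 .slash () () f)) = (jaeger X q).cross 1 .slash () ()
        ((jaeger X q).cross 0 .slash () () ((jaeger X q).cross 1 .slash () () f)) := by
  have m1 : X.cross 0 .slash false true f ∈ X.deg [true, false, false] :=
    hX.cross_mem [] [false] hf
  have m2 : X.cross 1 .slash false false (X.cross 0 .slash false true f) ∈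
      X.deg [true, false, false] := hX.cross_mem [true] [] m1
  have m3 : X.cross 1 .slash true false f ∈ X.deg [false, false, true] :=
    hX.cross_mem [false] [] hf
  have m4 : X.cross 0 .slash false false (X.cross 1 .slash true false f) ∈
      X.deg [false, false, true] := hX.cross_mem [] [true] m3
  have m5 : X.cap 0 false f ∈ X.deg [false] := hX.cap_mem [] [false] rfl hf
  have m6 : X.cup 0 false (X.cap 0 false f) ∈ X.deg [false, true, false] :=
    hX.cup_mem [] [false] rfl m5
  have m7 : X.cross 1 .slash true false (X.cup 0 false (X.cap 0 false f)) ∈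
      X.deg [false, false, true] := hX.cross_mem [false] [] m6
  have e1 : X.cap 1 false (X.cross 0 .slash false false (X.cross 1 .slash true false f)) =
    X.cap 0 false f := hX.cap_cross_cross [] [] .slash rfl hf
  have e2 : X.cross 0 .slash false false (X.cross 1 .slash true false
    (X.cup 0 false (X.cap 0 false f))) = X.cup 1 false (X.cap 0 false f) :=
    hX.cross_cross_cup [] [] .slash rfl m5
  have e3 : X.cross 0 .slash true false (X.cross 1 .slash false false
      (X.cross 0 .slash false true f)) =
    X.cross 1 .slash false true (X.cross 0 .slash false false (X.cross 1 .slash true false f)) :=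
    hX.braid false true false [] [] hf
  have n : ¬ (true = false ∧ false = true) := by decide
  have n' : ¬ (false = false ∧ false = true) := by decide
  have p : false = false ∧ true = true := by decide
  rw [hX.jaeger_slash_zero hf, if_pos p, map_add, map_smul, map_sub,
    hX.jaeger_slash_one m1, if_neg n', add_zero, hX.jaeger_slash_one hf, if_neg n, add_zero,
    hX.jaeger_slash_one m6, if_neg n, add_zero, map_add, map_smul, map_sub,
    hX.jaeger_slash_zero m2, if_neg n, add_zero, hX.jaeger_slash_zero m3, if_neg n', add_zero,
    hX.jaeger_slash_zero m7, if_neg n', add_zero, hX.jaeger_slash_one m4, if_pos p, e1, e2, e3]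

/-- The left strand can be top outward with both others, so products of corrections occur. The
relations `i1` to `i5` reduce both sides to combinations of the same tangles; the coefficients agree
because the kink factor in `e4` and `c1` is `q`. -/
theorem braid_jaeger_ftt (hX : X.IsSkein q κ) (hκ : κ false = q)
    (hf : f ∈ X.deg [false, true, true]) :
    (jaeger X q).cross 0 .slash () () ((jaeger X q).cross 1 .slash () ()
      ((jaeger X q).cross 0 .slash () () f)) = (jaeger X q).cross 1 .slash () ()
        ((jaeger X q).cross 0 .slash () () ((jaeger X q).cross 1 .slash () () f)) := by
  have n : ¬ (true = false ∧ false = true) := by decide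
  have n' : ¬ (true = false ∧ true = true) := by decide
  have p : false = false ∧ true = true := by decide
  have m1 : X.cross 0 .slash false true f ∈ X.deg [true, false, true] := hX.cross_mem [] [true] hf
  have m2 : X.cross 1 .slash false true (X.cross 0 .slash false true f) ∈
      X.deg [true, true, false] := hX.cross_mem [true] [] m1
  have m3 : X.cap 0 false f ∈ X.deg [true] := hX.cap_mem [] [true] rfl hf
  have m4 : X.cup 0 false (X.cap 0 false f) ∈ X.deg [false, true, true] :=
    hX.cup_mem [] [true] rfl m3
  have m5 : X.cap 1 false (X.cross 0 .slash false true f) ∈ X.deg [true] :=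
    hX.cap_mem [true] [] rfl m1
  have m6 : X.cup 1 false (X.cap 1 false (X.cross 0 .slash false true f)) ∈
      X.deg [true, false, true] := hX.cup_mem [true] [] rfl m5
  have m7 : X.cross 1 .slash true true f ∈ X.deg [false, true, true] := hX.cross_mem [false] [] hf
  have m8 : X.cross 1 .slash true true (X.cup 0 false (X.cap 0 false f)) ∈
      X.deg [false, true, true] := hX.cross_mem [false] [] m4
  have m9 : X.cross 0 .slash false true (X.cross 1 .slash true true f) ∈ X.deg [true, false, true] :=
    hX.cross_mem [] [true] m7
  have m10 : X.cap 0 false (X.cross 1 .slash true true f) ∈ X.deg [true] :=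
    hX.cap_mem [] [true] rfl m7
  have m11 : X.cup 0 false (X.cap 0 false (X.cross 1 .slash true true f)) ∈
      X.deg [false, true, true] := hX.cup_mem [] [true] rfl m10
  have e1 : X.cap 1 false (X.cross 0 .slash false true (X.cross 1 .slash true true f)) =
    X.cap 0 false f := hX.cap_cross_cross [] [] .slash rfl hf
  have e2 : X.cross 0 .slash false true (X.cross 1 .slash true true
    (X.cup 0 false (X.cap 0 false f))) = X.cup 1 false (X.cap 0 false f) :=
    hX.cross_cross_cup [] [] .slash rfl m3
  have e3 : X.cross 0 .slash true true (X.cross 1 .slash false true (X.cross 0 .slash false true f)) =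
    X.cross 1 .slash false true (X.cross 0 .slash false true (X.cross 1 .slash true true f)) :=
    hX.braid false true true [] [] hf
  have e4 : X.cap 0 false (X.cross 1 .slash true true (X.cup 0 false (X.cap 0 false f))) =
      (q : K) • X.cap 0 false f := by
    rw [← hκ]
    exact hX.kink_left_slash [] [] rfl m3
  have c1 : X.cross 0 .slash true false (X.cup 0 true (X.cap 0 false f)) =
      ((q⁻¹ : Kˣ) : K) • X.cup 0 false (X.cap 0 false f) := by
    rw [← hκ]
    exact hX.cup_slash [] [true] rfl m3
  have i1 : X.cross 0 .slash true false (X.cross 0 .slash false true f) = f -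
      (((q : K) - ↑q⁻¹) * ↑q⁻¹) • X.cup 0 false (X.cap 0 false f) := by
    have h1 := hX.inverse_backslash [] [true] false true hf
    have h2 := hX.slash_sub_backslash_of_ne [] [true] (s := false) (t := true) rfl hf
    rw [List.length_nil] at h1 h2
    rw [h2, map_add, map_smul, c1, smul_smul] at h1
    exact eq_sub_of_add_eq h1
  have i2 : X.cross 1 .slash true true (X.cross 1 .slash true true f) = f +
      ((q : K) - ↑q⁻¹) • X.cross 1 .slash true true f := by
    have h1 := hX.inverse_backslash [false] [] true true hf
    have h2 := hX.slash_sub_backslash_of_eq [false] [] true hf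
    rw [List.length_singleton] at h1 h2
    rw [h2, map_sub, map_smul] at h1
    exact sub_eq_iff_eq_add.1 h1
  have i3 : X.cap 1 false (X.cross 0 .slash false true f) =
      X.cap 0 false (X.cross 1 .slash true true f) - ((q : K) - ↑q⁻¹) • X.cap 0 false f := by
    have h1 := hX.crossCap [] [] .backslash false true true rfl hf
    have h2 := hX.slash_sub_backslash_of_eq [false] [] true hf
    rw [List.length_singleton] at h2
    rw [← map_smul, ← map_sub, ← h2]
    exact h1.symm
  -- Turning past the minimum produces a `backslash`, which the skein relation for parallel strands
  -- converts into a `slash`.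
  have i4 : ∀ v ∈ X.deg [true], X.cross 0 .slash true false (X.cup 1 false v) =
      X.cross 1 .slash true true (X.cup 0 false v) - ((q : K) - ↑q⁻¹) • X.cup 0 false v := by
    intro v hv
    have h1 := hX.crossCup [] [] .backslash false true true rfl hv
    have h2 := hX.slash_sub_backslash_of_eq [false] [] true (f := X.cup 0 false v)
      (hX.cup_mem [] [true] rfl hv)
    rw [List.length_singleton] at h2
    rw [← h2]
    exact h1.symm
  have m12 := Submodule.sub_mem _ m10 (Submodule.smul_mem _ ((q : K) - ↑q⁻¹) m3)
  have i5 := i4 _ m12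
  rw [← i3] at i5
  rw [hX.jaeger_slash_zero hf, if_pos p, map_add, map_smul, map_sub,
    hX.jaeger_slash_one m1, if_pos p, hX.jaeger_slash_one hf, if_neg n', add_zero,
    hX.jaeger_slash_one m4, if_neg n', add_zero, map_add, map_add, map_smul, map_sub, map_smul,
    map_sub, hX.jaeger_slash_zero m2, if_neg n', add_zero, hX.jaeger_slash_zero m1, if_neg n,
    add_zero, hX.jaeger_slash_zero m6, if_neg n, add_zero, hX.jaeger_slash_zero m7, if_pos p,
    hX.jaeger_slash_zero m8, if_pos p, map_add, map_smul, map_sub, hX.jaeger_slash_one m9, if_pos p,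
    hX.jaeger_slash_one m7, if_neg n', add_zero, hX.jaeger_slash_one m11, if_neg n', add_zero,
    e1, e2, e3, e4, i5, i1, i2, i3]
  simp only [map_sub, map_smul]
  module

/-- The situation of `braid_jaeger_ftt` reflected: now the right strand can be top outward with both
others. -/
theorem braid_jaeger_fft (hX : X.IsSkein q κ) (hκ : κ false = q)
    (hf : f ∈ X.deg [false, false, true]) :
    (jaeger X q).cross 0 .slash () () ((jaeger X q).cross 1 .slash () ()
      ((jaeger X q).cross 0 .slash () () f)) = (jaeger X q).cross 1 .slash () ()
        ((jaeger X q).cross 0 .slash () () ((jaeger X q).cross 1 .slash () () f)) := by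
  have n : ¬ (true = false ∧ false = true) := by decide
  have n' : ¬ (false = false ∧ false = true) := by decide
  have p : false = false ∧ true = true := by decide
  have m1 : X.cross 0 .slash false false f ∈ X.deg [false, false, true] :=
    hX.cross_mem [] [true] hf
  have m2 : X.cross 1 .slash false true (X.cross 0 .slash false false f) ∈
      X.deg [false, true, false] := hX.cross_mem [false] [] m1
  have m3 : X.cap 1 false f ∈ X.deg [false] := hX.cap_mem [false] [] rfl hf
  have m4 : X.cup 1 false (X.cap 1 false f) ∈ X.deg [false, false, true] :=
    hX.cup_mem [false] [] rfl m3
  have m5 : X.cap 1 false (X.cross 0 .slash false false f) ∈ X.deg [false] :=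
    hX.cap_mem [false] [] rfl m1
  have m6 : X.cup 1 false (X.cap 1 false (X.cross 0 .slash false false f)) ∈
      X.deg [false, false, true] := hX.cup_mem [false] [] rfl m5
  have m7 : X.cross 1 .slash false true f ∈ X.deg [false, true, false] :=
    hX.cross_mem [false] [] hf
  have m8 : X.cross 0 .slash false false (X.cup 1 false (X.cap 1 false f)) ∈
      X.deg [false, false, true] := hX.cross_mem [] [true] m4
  have m9 : X.cross 0 .slash false true (X.cross 1 .slash false true f) ∈
      X.deg [true, false, false] := hX.cross_mem [] [false] m7
  have m10 : X.cap 0 false (X.cross 1 .slash false true f) ∈ X.deg [false] :=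
    hX.cap_mem [] [false] rfl m7
  have m11 : X.cup 0 false (X.cap 0 false (X.cross 1 .slash false true f)) ∈
      X.deg [false, true, false] := hX.cup_mem [] [false] rfl m10
  have e1 := hX.cap_cross_cross_left .slash (c := false) (d := true) rfl hf
  have e2 := hX.cross_cross_cup_right .slash (c := false) (d := true) rfl m3
  have e3 : X.cross 0 .slash false true (X.cross 1 .slash false true
      (X.cross 0 .slash false false f)) =
    X.cross 1 .slash false false (X.cross 0 .slash false true (X.cross 1 .slash false true f)) :=
    hX.braid false false true [] [] hf
  have e4 : X.cap 1 false (X.cross 0 .slash false false (X.cup 1 false (X.cap 1 false f))) =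
      (q : K) • X.cap 1 false f := by
    rw [← hκ]
    exact hX.kink [] [] false m3
  have c1 : X.cross 1 .slash true false (X.cup 1 true (X.cap 1 false f)) =
      ((q⁻¹ : Kˣ) : K) • X.cup 1 false (X.cap 1 false f) := by
    rw [← hκ]
    exact hX.cup_slash [false] [] rfl m3
  have i1 : X.cross 1 .slash true false (X.cross 1 .slash false true f) = f -
      (((q : K) - ↑q⁻¹) * ↑q⁻¹) • X.cup 1 false (X.cap 1 false f) := by
    have h1 := hX.inverse_backslash [false] [] false true hf
    have h2 := hX.slash_sub_backslash_of_ne [false] [] (s := false) (t := true) rfl hf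
    rw [List.length_singleton] at h1 h2
    rw [h2, map_add, map_smul, c1, smul_smul] at h1
    exact eq_sub_of_add_eq h1
  have i2 : X.cross 0 .slash false false (X.cross 0 .slash false false f) = f +
      ((q : K) - ↑q⁻¹) • X.cross 0 .slash false false f := by
    have h1 := hX.inverse_backslash [] [true] false false hf
    have h2 := hX.slash_sub_backslash_of_eq [] [true] false hf
    rw [List.length_nil] at h1 h2
    rw [h2, map_sub, map_smul] at h1
    exact sub_eq_iff_eq_add.1 h1
  have i3 : X.cap 0 false (X.cross 1 .slash false true f) =
      X.cap 1 false (X.cross 0 .slash false false f) - ((q : K) - ↑q⁻¹) • X.cap 1 false f := by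
    have h1 := hX.crossCap [] [] .slash false true false rfl hf
    have h2 := hX.slash_sub_backslash_of_eq [] [true] false hf
    rw [List.length_nil] at h2
    rw [← map_smul, ← map_sub, ← h2]
    exact h1
  have i4 : ∀ v ∈ X.deg [false], X.cross 1 .slash true false (X.cup 0 false v) =
      X.cross 0 .slash false false (X.cup 1 false v) - ((q : K) - ↑q⁻¹) • X.cup 1 false v := by
    intro v hv
    have h1 := hX.crossCup [] [] .slash false true false rfl hv
    have h2 := hX.slash_sub_backslash_of_eq [] [true] false (f := X.cup 1 false v)
      (hX.cup_mem [false] [] rfl hv)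
    rw [List.length_nil] at h2
    rw [← h2]
    exact h1
  have m12 := Submodule.sub_mem _ m5 (Submodule.smul_mem _ ((q : K) - ↑q⁻¹) m3)
  have i5 := i4 _ m12
  rw [← i3] at i5
  rw [hX.jaeger_slash_zero hf, if_neg n', add_zero, hX.jaeger_slash_one m1, if_pos p, map_add,
    map_smul, map_sub, hX.jaeger_slash_zero m2, if_pos p, hX.jaeger_slash_zero m1, if_neg n',
    add_zero, hX.jaeger_slash_zero m6, if_neg n', add_zero, hX.jaeger_slash_one hf, if_pos p,
    map_add, map_smul, map_sub, hX.jaeger_slash_zero m7, if_pos p, hX.jaeger_slash_zero hf,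
    if_neg n', add_zero, hX.jaeger_slash_zero m4, if_neg n', add_zero, map_add, map_add, map_smul,
    map_smul, map_sub, map_sub, hX.jaeger_slash_one m9, if_neg n', add_zero,
    hX.jaeger_slash_one m7, if_neg n, add_zero, hX.jaeger_slash_one m11, if_neg n, add_zero,
    hX.jaeger_slash_one m1, if_pos p, hX.jaeger_slash_one m8, if_pos p,
    e1, e2, e3, e4, i5, i1, i2, i3]
  simp only [map_sub, map_smul]
  module

theorem braid_jaeger (hX : X.IsSkein q κ) (hκ : κ false = q) :
    (jaeger X q).Braid .slash () () () := by
  intro l r f hf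
  refine jaeger_induction (S := (jaeger X q).cross l.length .slash () () *
    ((jaeger X q).cross (l.length + 1) .slash () () * (jaeger X q).cross l.length .slash () ()))
    (T := (jaeger X q).cross (l.length + 1) .slash () () * ((jaeger X q).cross l.length .slash () ()
      * (jaeger X q).cross (l.length + 1) .slash () ())) (fun y hy v hv => ?_) hf
  simp only [List.length_append, List.length_cons] at hy
  obtain ⟨l', y, rfl, hl, hy⟩ := exists_append_of_length hy
  rw [← hl]
  obtain ⟨s, y, rfl⟩ := List.exists_cons_of_length_eq_add_one hy
  obtain ⟨t, y, rfl⟩ := List.exists_cons_of_length_eq_add_one (Nat.succ.inj hy)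
  obtain ⟨u, r', rfl⟩ := List.exists_cons_of_length_eq_add_one (Nat.succ.inj (Nat.succ.inj hy))
  have hY := hX.shift l' r'
  replace hv : v ∈ (X.shift l' r').deg [s, t, u] := hv
  change (jaeger (X.shift l' r') q).cross 0 .slash () () ((jaeger (X.shift l' r') q).cross 1 .slash
    () () ((jaeger (X.shift l' r') q).cross 0 .slash () () v)) =
      (jaeger (X.shift l' r') q).cross 1 .slash () () ((jaeger (X.shift l' r') q).cross 0 .slash
        () () ((jaeger (X.shift l' r') q).cross 1 .slash () () v))
  cases s <;> cases t <;> cases u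
  · exact hY.braid_jaeger_monotone (by decide) (by decide) (by decide) hv
  · exact hY.braid_jaeger_fft hκ hv
  · exact hY.braid_jaeger_ftf hv
  · exact hY.braid_jaeger_ftt hκ hv
  · exact hY.braid_jaeger_monotone (by decide) (by decide) (by decide) hv
  · exact hY.braid_jaeger_tft hv
  · exact hY.braid_jaeger_monotone (by decide) (by decide) (by decide) hv
  · exact hY.braid_jaeger_monotone (by decide) (by decide) (by decide) hv

theorem jaeger (hX : X.IsSkein q κ) (hκ : κ false = q) :
    (jaeger X q).IsSkein q (fun _ => κ true) :=
  hX.isPlanar_jaeger.isSkein () (fun k _ _ => hX.inverse_jaeger hκ k) (hX.braid_jaeger hκ)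
    hX.skein_jaeger fun l r c _ hf => hX.kink_jaeger hκ l r c hf

end IsSkein
end TangleRep
end KnottedGraph

namespace KnottedGraph
open Labels
namespace TangleRep
variable {K V : Type} [CommRing K] [AddCommGroup V] [Module K V]
variable {X : TangleRep K V Bool} {q x : Kˣ} {κ : Bool → Kˣ} {f : V}

/-! ### Scaling by the rotation number -/

/-- The contribution of a piece to the rotation number. -/
def turning : TanglePiece Bool → ℤ
  | .cup o => if o = false then 1 else 0
  | .cap o => if o = true then -1 else 0
  | .cross _ _ _ => 0

/-- The representation in which a diagram is multiplied by a power of `x` with the rotation number. -/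
def scale (X : TangleRep K V Bool) (x : Kˣ) : TangleRep K V Bool where
  deg := X.deg
  op i g := ((x ^ turning g : Kˣ) : K) • X.op i g

theorem scale_apply (i : ℕ) (g : TanglePiece Bool) :
    (X.scale x).op i g f = ((x ^ turning g : Kˣ) : K) • X.op i g f := rfl

theorem scale_cross (i : ℕ) (k : Crossing) (s t : Bool) :
    (X.scale x).cross i k s t = X.cross i k s t := by
  change ((x ^ (0 : ℤ) : Kˣ) : K) • X.cross i k s t = X.cross i k s t
  rw [zpow_zero, Units.val_one, one_smul]

/-- Hence neither straightening a zigzag nor replacing antiparallel strands by their reversing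
smoothing changes the power of `x`. -/
theorem turning_cup_add_cap (c : Bool) :
    turning (.cap c) + turning (.cup !c) = 0 := by cases c <;> rfl

theorem IsPlanar.scale (hX : X.IsPlanar) : (X.scale x).IsPlanar where
  op_mem g l r f hf := Submodule.smul_mem _ _ (hX.op_mem g l r hf)
  cap_zero l r c s t f hf h := by
    rw [scale_apply, hX.cap_zero l r c s t hf h, smul_zero]
  cross_zero l r k c d s t f hf h := by
    rw [scale_apply, hX.cross_zero l r k c d s t hf h, smul_zero]
  exchange g h l m r y z f hy hz hf := by
    simp only [scale_apply, map_smul]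
    rw [hX.exchange g h l m r hy hz hf, smul_comm]
  zigzag l r c d f h hf := by
    subst h
    rw [scale_apply, scale_apply, map_smul, smul_smul, ← Units.val_mul, ← zpow_add,
      hX.zigzag l r c _ rfl hf]
    change ((x ^ (turning (.cap c) + turning (.cup !c)) : Kˣ) : K) • f = f
    rw [turning_cup_add_cap, zpow_zero, Units.val_one, one_smul]
  zagzig l r c d f h hf := by
    subst h
    rw [scale_apply, scale_apply, map_smul, smul_smul, ← Units.val_mul, ← zpow_add,
      hX.zagzig l r _ d rfl hf]
    change ((x ^ (turning (.cap d) + turning (.cup !d)) : Kˣ) : K) • f = f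
    rw [turning_cup_add_cap, zpow_zero, Units.val_one, one_smul]
  crossCup l r k c d s f h hf := by
    simp only [scale_cross, scale_apply, map_smul]
    rw [hX.crossCup l r k c d s h hf]

theorem cap_scale_cup (c : Bool) (i j : ℕ) (S : Module.End K V) :
    (X.scale x).cap i c (S ((X.scale x).cup j c f)) =
      ((x ^ (if c then (-1 : ℤ) else 1) : Kˣ) : K) • X.cap i c (S (X.cup j c f)) := by
  rw [scale_apply, scale_apply, map_smul, map_smul, smul_smul, ← Units.val_mul, ← zpow_add]
  cases c <;> rfl

/-- A kink makes a full turn, clockwise for the label `true` and counterclockwise for `false`. All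
other relations preserve the rotation number, so only the kink factors change. -/
theorem IsSkein.scale (hX : X.IsSkein q κ) :
    (X.scale x).IsSkein q (fun c => κ c * x ^ (if c then (-1 : ℤ) else 1)) := by
  refine hX.toIsPlanar.scale.isSkein true ?_ ?_ ?_ ?_
  · intro k s t l r f hf
    rw [scale_cross, scale_cross]
    exact hX.inverse k s t l r hf
  · intro l r f hf
    simp only [scale_cross]
    exact hX.braid true true true l r hf
  · intro l r f hf
    have := hX.skein true true l r hf
    rw [if_pos rfl, if_neg (by decide)] at this ⊢
    simpa only [scale_cross] using this
  · intro l r c f hf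
    rw [cap_scale_cup c, scale_cross, hX.kink l r c hf, smul_smul, Units.val_mul, mul_comm]

theorem scale_vert (i : ℕ) (s t : Bool) : (X.scale x).vert q i s t = X.vert q i s t := by
  have h : ∀ s, (X.scale x).cup i (!s) * (X.scale x).cap i s = X.cup i (!s) * X.cap i s := by
    intro s
    change (((x ^ turning (.cup !s) : Kˣ) : K) • X.cup i (!s)) *
      (((x ^ turning (.cap s) : Kˣ) : K) • X.cap i s) = _
    rw [smul_mul_smul_comm, ← Units.val_mul, ← zpow_add, add_comm, turning_cup_add_cap, zpow_zero,
      Units.val_one, one_smul]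
  have h' : (if t = bar s then (X.scale x).cup i t * (X.scale x).cap i s else 0) =
      if t = bar s then X.cup i t * X.cap i s else 0 := by
    by_cases ht : t = bar s
    · rw [if_pos ht, if_pos ht]
      subst ht
      exact h s
    · rw [if_neg ht, if_neg ht]
  rw [vert, vert, h', scale_cross]

theorem scale_word (w : Layers OPiece) :
    (X.scale x).word q (labelO w) = ((x ^ (w.map fun y => y.2.turning).sum : Kˣ) : K) •
      X.word q (labelO w) := by
  induction w with
  | nil => simp [labelO, word]
  | cons y w ih =>
    have h : (X.scale x).opL q y.1 y.2.label = ((x ^ y.2.turning : Kˣ) : K) •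
        X.opL q y.1 y.2.label := by
      obtain ⟨i, _ | _ | _ | _⟩ := y
      · rfl
      · rfl
      · rfl
      · change (X.scale x).vert q i _ _ = ((x ^ (0 : ℤ) : Kˣ) : K) • X.vert q i _ _
        rw [scale_vert, zpow_zero, Units.val_one, one_smul]
    change (X.scale x).word q (labelO w) * (X.scale x).opL q y.1 y.2.label = _ •
      (X.word q (labelO w) * X.opL q y.1 y.2.label)
    rw [ih, h, smul_mul_smul_comm, List.map_cons, List.sum_cons, ← Units.val_mul, ← zpow_add,
      add_comm]

end TangleRep
end KnottedGraph

namespace KnottedGraph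
open Labels

/-! ### The edge orientations of layered diagrams -/

/-- The edge orientations of a piece. -/
def Piece.lifts : Piece → Finset EPiece
  | .cup => Finset.univ.image EPiece.cup
  | .cap => Finset.univ.image EPiece.cap
  | .cross k => Finset.univ.image fun p : (Bool × Bool) × Bool × Bool =>
      EPiece.cross k p.1.1 p.1.2 p.2.1 p.2.2
  | .vert => Finset.univ.image fun p : (Bool × Bool) × Bool × Bool =>
      EPiece.vert p.1.1 p.1.2 p.2.1 p.2.2

theorem Piece.mem_lifts {g : Piece} {e : EPiece} : e ∈ g.lifts ↔ e.forget = g := by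
  cases g <;> cases e <;> simp [Piece.lifts, EPiece.forget, eq_comm, -Bool.exists_bool,
    -Prod.exists]
  · exact fun _ => ⟨((_, _), (_, _)), rfl, rfl, rfl, rfl⟩
  · exact ⟨((_, _), (_, _)), rfl, rfl, rfl, rfl⟩

/-- The edge orientations of a sequence of layers. -/
def lifts : Layers Piece → Finset (Layers EPiece)
  | [] => {[]}
  | y :: w => (y.2.lifts ×ˢ lifts w).image fun p => (y.1, p.1) :: p.2

theorem mem_lifts {w : Layers Piece} {l : Layers EPiece} :
    l ∈ lifts w ↔ (l.map fun x => (x.1, x.2.forget)) = w := by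
  induction w generalizing l with
  | nil => simp [lifts]
  | cons y w ih =>
    cases l with
    | nil => simp [lifts]
    | cons x l =>
      obtain ⟨i, e⟩ := x
      obtain ⟨j, g⟩ := y
      simp only [lifts, Finset.mem_image, Finset.mem_product,
        List.cons.injEq, Prod.mk.injEq, List.map_cons, ← ih, ← Piece.mem_lifts, Prod.exists]
      constructor
      · rintro ⟨e', l', ⟨h1, h2⟩, ⟨rfl, rfl⟩, rfl⟩
        exact ⟨⟨rfl, h1⟩, h2⟩
      · rintro ⟨⟨rfl, h1⟩, h2⟩
        exact ⟨e, l, ⟨h1, h2⟩, ⟨rfl, rfl⟩, rfl⟩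

theorem sum_lifts_cons {V : Type*} [AddCommMonoid V] (y : ℕ × Piece) (w : Layers Piece)
    (φ : Layers EPiece → V) :
    ∑ l ∈ lifts (y :: w), φ l = ∑ e ∈ y.2.lifts, ∑ l ∈ lifts w, φ ((y.1, e) :: l) := by
  rw [lifts, Finset.sum_image, Finset.sum_product]
  rintro ⟨_, _⟩ - ⟨_, _⟩ - h
  simpa using h

/-- The edge orientations of consecutive layers fit together from the row `s` on, and are balanced and
admissible. -/
def IsState : Layers EPiece → List Bool → Prop
  | [], _ => True
  | x :: l, s => x.2.Balanced ∧ ¬ x.2.TopInward ∧ ∃ t, Step x s t ∧ IsState l t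

theorem isState_iff {l : Layers EPiece} {s : List Bool} :
    IsState l s ↔ (∃ t, Runs l s t) ∧ (∀ x ∈ l, x.2.Balanced) ∧ ∀ x ∈ l, ¬ x.2.TopInward := by
  induction l generalizing s with
  | nil => simp [IsState, Runs]
  | cons x l ih =>
    simp only [IsState, ih, Runs, List.forall_mem_cons]
    constructor
    · rintro ⟨h1, h2, r, h3, ⟨t, h4⟩, h5, h6⟩
      exact ⟨⟨t, r, h3, h4⟩, ⟨h1, h5⟩, h2, h6⟩
    · rintro ⟨⟨t, r, h3, h4⟩, ⟨h1, h5⟩, h2, h6⟩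
      exact ⟨h1, h2, r, h3, ⟨t, h4⟩, h5, h6⟩

theorem Step.forget {x : ℕ × EPiece} {s t : List Bool} (h : Step x s t) :
    Step (x.1, x.2.forget) (s.map fun _ => ()) (t.map fun _ => ()) := by
  obtain ⟨l, r, h1, rfl, rfl⟩ := h
  refine ⟨l.map fun _ => (), r.map fun _ => (), by simpa using h1, ?_, ?_⟩ <;>
    cases x.2 <;> simp [Pieces.dom, Pieces.cod, EPiece.forget]

theorem Runs.forget {l : Layers EPiece} {s t : List Bool} (h : Runs l s t) :
    Runs (l.map fun x => (x.1, x.2.forget)) (s.map fun _ => ()) (t.map fun _ => ()) := by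
  induction l generalizing s with
  | nil => exact congrArg _ h
  | cons x l ih =>
    obtain ⟨r, h1, h2⟩ := h
    exact ⟨_, h1.forget, ih h2⟩

theorem sum_turn {p : Prop} [Decidable p] {V : Type*} [AddCommMonoid V] (h : p)
    (φ : (p → Turn) → V) : ∑ c, φ c = φ (fun _ => .left) + φ fun _ => .right := by
  have : Unique p := ⟨⟨h⟩, fun _ => rfl⟩
  rw [← Equiv.sum_comp (Equiv.funUnique p Turn).symm φ]
  exact Finset.sum_pair (by decide)

theorem sum_turn_of_not {p : Prop} [Decidable p] {V : Type*} [AddCommMonoid V] (h : ¬ p)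
    (φ : (p → Turn) → V) : ∑ c, φ c = φ fun h' => absurd h' h :=
  Fintype.sum_eq_single _ fun _ hc => absurd (funext fun h' => absurd h' h) hc

namespace TangleRep
variable {K V : Type} [CommRing K] [AddCommGroup V] [Module K V]
variable {X : TangleRep K V Bool} {q : Kˣ} {κ : Bool → Kˣ} {f : V}

/-- The sum over the resolutions of a layer. -/
def layerSum (X : TangleRep K V Bool) (q : Kˣ) (i : ℕ) (e : EPiece) : Module.End K V :=
  ∑ c : e.Resolvable → Turn, localWeight q e c • X.word q (labelO (resolvePiece i e c))

/-- The sum over the resolutions of a sequence of layers. -/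
def stateOp (X : TangleRep K V Bool) (q : Kˣ) : Layers EPiece → Module.End K V
  | [] => 1
  | x :: l => stateOp X q l * X.layerSum q x.1 x.2

theorem resolveLayers_cons (x : ℕ × EPiece) (l : Layers EPiece)
    (ς : (k : Fin (l.length + 1)) → ((x :: l).get k).2.Resolvable → Turn) :
    AdmissibleOrientation.resolveLayers (x :: l) ς = resolvePiece x.1 x.2 (ς 0) ++
      AdmissibleOrientation.resolveLayers l fun k => ς k.succ := by
  unfold AdmissibleOrientation.resolveLayers
  simp only [List.length_cons, List.ofFn_succ, List.flatten_cons]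
  rfl

/-- Distributivity: the product of the sums over the layers is the sum over all resolutions, and the
weights multiply. -/
theorem stateOp_eq (l : Layers EPiece) :
    X.stateOp q l = ∑ ς : (k : Fin l.length) → (l.get k).2.Resolvable → Turn,
      (∏ k, localWeight q (l.get k).2 (ς k)) •
        X.word q (labelO (AdmissibleOrientation.resolveLayers l ς)) := by
  induction l with
  | nil =>
    have : Unique ((k : Fin ([] : Layers EPiece).length) →
        (([] : Layers EPiece).get k).2.Resolvable → Turn) :=
      ⟨⟨fun k => k.elim0⟩, fun _ => funext fun k => k.elim0⟩
    rw [Fintype.sum_unique]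
    simp [stateOp, AdmissibleOrientation.resolveLayers, labelO, word]
  | cons x l ih =>
    rw [stateOp, ih, layerSum, Finset.sum_mul_sum, Finset.sum_comm, ← Fintype.sum_prod_type']
    refine Fintype.sum_equiv (Fin.consEquiv fun k : Fin (l.length + 1) =>
        ((x :: l).get k).2.Resolvable → Turn) _ _ fun p => ?_
    rw [smul_mul_smul_comm, ← word_append, ← labelO_append, mul_comm]
    refine congrArg₂ (fun (b : K) (v : Layers OPiece) => b • X.word q (labelO v))
      ?_ ?_
    · exact (Fin.prod_univ_succ (fun k : Fin (l.length + 1) => localWeight q ((x :: l).get k).2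
        ((Fin.cons p.1 p.2 : (k : Fin (l.length + 1)) → ((x :: l).get k).2.Resolvable → Turn) k))).symm
    · exact (resolveLayers_cons x l (Fin.cons p.1 p.2)).symm

theorem word_mem_of_runs (hX : X.IsPlanar) {w : Layers OPiece} {s t : List Bool} (h : Runs w s t)
    (hf : f ∈ X.deg s) : X.word q (labelO w) f ∈ X.deg t :=
  IsSkein.word_mem hX (runs_labelO.2 h) hf

theorem layerSum_mem (hX : X.IsPlanar) {x : ℕ × EPiece} {s t : List Bool} (h : Step x s t)
    (hb : x.2.Balanced) (ha : ¬ x.2.TopInward) (hf : f ∈ X.deg s) :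
    X.layerSum q x.1 x.2 f ∈ X.deg t := by
  rw [layerSum, LinearMap.sum_apply]
  exact Submodule.sum_mem _ fun c _ => Submodule.smul_mem _ _
    (word_mem_of_runs hX (runs_resolvePiece h hb ha c) hf)

end TangleRep
end KnottedGraph

/-! ### The sum over orientations as a sum over states. -/

namespace KnottedGraph
open Labels
namespace TangleRep
variable {K V : Type} [CommRing K] [AddCommGroup V] [Module K V]
variable {X : TangleRep K V Bool} {q : Kˣ} {κ : Bool → Kˣ} {f : V}

theorem exists_step {i : ℕ} {e : EPiece} {s : List Bool} :
    (∃ t, Step (i, e) s t) ↔ ∃ l r : List Bool, l.length = i ∧ s = l ++ Pieces.dom e ++ r :=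
  ⟨fun ⟨_, l, r, h1, h2, _⟩ => ⟨l, r, h1, h2⟩, fun ⟨l, r, h1, h2⟩ => ⟨_, l, r, h1, h2, rfl⟩⟩

theorem exists_step_pair {e : EPiece} {l r : List Bool} {s t s' t' : Bool}
    (h : Pieces.dom e = [s', t']) :
    (∃ u, Step (l.length, e) (l ++ s :: t :: r) u) ↔ s' = s ∧ t' = t := by
  rw [exists_step, h]
  constructor
  · rintro ⟨l', r', h1, h2⟩
    rw [List.append_assoc] at h2
    have := List.append_inj_right h2 h1.symm
    simp only [List.cons_append, List.nil_append, List.cons.injEq] at this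
    exact ⟨this.1.symm, this.2.1.symm⟩
  · rintro ⟨rfl, rfl⟩
    exact ⟨l, r, rfl, by simp⟩

theorem layerSum_of_not_resolvable {e : EPiece} (h : ¬ e.Resolvable) (i : ℕ) {g : OPiece}
    (hg : ∀ c, resolvePiece i e c = [(i, g)]) (hw : ∀ c, localWeight q e c = 1) :
    X.layerSum q i e f = X.opL q i g.label f := by
  rw [layerSum, sum_turn_of_not h, hg, hw, one_smul]
  rfl

theorem word_smooth (i : ℕ) (sw nw : Bool) (t : Turn) : X.word q (labelO (smooth i sw nw t)) f =
    if (t = .left ↔ sw = true) then f else X.cup i nw (X.cap i sw f) := by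
  unfold smooth
  split_ifs <;> rfl

/-- Whether a left turn gives vertical strands depends on the direction of the south-western end,
hence the sign; it is `zSign` at a top outward crossing. -/
theorem layerSum_cross {k : Crossing} {sw se nw ne : Bool} (i : ℕ)
    (h : (EPiece.cross k sw se nw ne).Resolvable) :
    X.layerSum q i (.cross k sw se nw ne) f =
      (if sw then -((q : K) - ↑q⁻¹) else (q : K) - ↑q⁻¹) • (f - X.cup i nw (X.cap i sw f)) := by
  rw [layerSum, sum_turn h]
  simp only [resolvePiece, localWeight, dif_pos h, LinearMap.add_apply, LinearMap.smul_apply,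
    word_smooth]
  cases sw <;> simp <;> module

theorem layerSum_vert {sw se nw ne : Bool} (i : ℕ) (h : (EPiece.vert sw se nw ne).Resolvable) :
    X.layerSum q i (.vert sw se nw ne) f =
      (if sw then (q : K) else ↑q⁻¹) • f +
        (if sw then (↑q⁻¹ : K) else q) • X.cup i nw (X.cap i sw f) := by
  rw [layerSum, sum_turn h]
  simp only [resolvePiece, localWeight, dif_pos h, LinearMap.add_apply, LinearMap.smul_apply,
    word_smooth]
  cases sw <;> simp [add_comm]

open Classical in
/-- A layer operates as the sum of its edge orientations. -/
theorem IsSkein.jaeger_opL (hX : X.IsSkein q κ) {x : ℕ × Piece} {s : List Bool} {t : List Unit}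
    (hs : Step x (s.map fun _ => ()) t) (hf : f ∈ X.deg s) :
    (TangleRep.jaeger X q).opL q x.1 x.2.label f = ∑ e ∈ x.2.lifts,
      if e.Balanced ∧ ¬ e.TopInward ∧ ∃ t, Step (x.1, e) s t then X.layerSum q x.1 e f else 0 := by
  obtain ⟨i, g⟩ := x
  obtain ⟨l', r', rfl, h, -⟩ := hs
  have hlen := congrArg List.length h
  simp only [List.length_map, List.length_append, List.append_assoc] at hlen
  obtain ⟨l, y, rfl, hl, hy⟩ := exists_append_of_length hlen
  obtain ⟨x, r, rfl, hx, -⟩ := exists_append_of_length hy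
  simp only [← hl]
  clear h hlen hy hl
  cases g with
  | cup =>
    have h1 : ∀ o, ∃ t, Step (l.length, EPiece.cup o) (l ++ (x ++ r)) t := fun o =>
      exists_step.2 ⟨l, x ++ r, rfl, by simp [Pieces.dom]⟩
    have h0 : ∀ o, ¬ (EPiece.cup o).Resolvable := fun o h => h.elim id id
    have h2 : ∀ o, X.layerSum q l.length (.cup o) f = X.cup l.length o f := fun o =>
      layerSum_of_not_resolvable (h0 o) _ (fun _ => rfl) (fun _ => rfl)
    rw [Piece.lifts, Finset.sum_image (by rintro _ - _ - h; cases h; rfl), Fintype.sum_bool]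
    simp only [h1, h2, EPiece.Balanced, EPiece.TopInward, not_false_eq_true, and_self, if_true]
    rfl
  | cap =>
    obtain ⟨s, t, rfl⟩ := List.length_eq_two.1 hx
    have h1 : ∀ o, (∃ u, Step (l.length, EPiece.cap o) (l ++ ([s, t] ++ r)) u) ↔ o = s ∧ (!o) = t :=
      fun o => exists_step_pair rfl
    have h0 : ∀ o, ¬ (EPiece.cap o).Resolvable := fun o h => h.elim id id
    have h2 : ∀ o, X.layerSum q l.length (.cap o) f = X.cap l.length o f := fun o =>
      layerSum_of_not_resolvable (h0 o) _ (fun _ => rfl) (fun _ => rfl)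
    rw [Piece.lifts, Finset.sum_image (by rintro _ - _ - h; cases h; rfl), Fintype.sum_bool]
    simp only [h1, h2, EPiece.Balanced, EPiece.TopInward, not_false_eq_true, true_and]
    refine (jaeger_cap (q := q) hX.toIsPlanar l r hf).trans ?_
    cases s <;> cases t <;> simp
  | cross k =>
    obtain ⟨s, t, rfl⟩ := List.length_eq_two.1 hx
    have h1 : ∀ k sw se nw ne, (∃ u, Step (l.length, EPiece.cross k sw se nw ne)
      (l ++ ([s, t] ++ r)) u) ↔ sw = s ∧ se = t := fun _ _ _ _ _ => exists_step_pair rfl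
    have h2 : ∀ s t, ¬ (EPiece.cross k s t t s).Resolvable := by
      intro s t
      cases k <;> cases s <;> cases t <;>
        simp [EPiece.Resolvable, EPiece.TopOutward, EPiece.NonCrossingLike]
    have h3 : ∀ s t, X.layerSum q l.length (.cross k s t t s) f = X.cross l.length k s t f :=
      fun s t => layerSum_of_not_resolvable (h2 s t) _ (fun _ => dif_neg (h2 s t))
        (fun _ => dif_neg (h2 s t))
    have h4 : X.layerSum q l.length (.cross k (lowLabel k) (!lowLabel k) (lowLabel k)
        (!lowLabel k)) f = zSign q k • (f - X.cup l.length (lowLabel k)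
          (X.cap l.length (lowLabel k) f)) := by
      rw [layerSum_cross]
      · cases k <;> rfl
      · cases k <;> simp [lowLabel, EPiece.Resolvable, EPiece.TopOutward]
    rw [Piece.lifts, Finset.sum_image (by
      rintro ⟨⟨_, _⟩, _, _⟩ - ⟨⟨_, _⟩, _, _⟩ - h; cases h; rfl)]
    simp only [Fintype.sum_prod_type, Fintype.sum_bool, h1]
    refine (hX.jaeger_cross l r k hf).trans ?_
    cases k <;> simp only [lowLabel, Bool.not_true, Bool.not_false] at h4 <;> cases s <;> cases t <;>
      simp [EPiece.Balanced, EPiece.TopInward, h3, h4, lowLabel, add_comm]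
  | vert =>
    obtain ⟨s, t, rfl⟩ := List.length_eq_two.1 hx
    have h1 : ∀ sw se nw ne, (∃ u, Step (l.length, EPiece.vert sw se nw ne)
      (l ++ ([s, t] ++ r)) u) ↔ sw = s ∧ se = t := fun _ _ _ _ => exists_step_pair rfl
    have h2 : ∀ s t, ¬ (EPiece.vert s t t s).Resolvable := by
      intro s t
      cases s <;> cases t <;>
        simp [EPiece.Resolvable, EPiece.TopOutward, EPiece.NonCrossingLike]
    have h3 : ∀ s t, X.layerSum q l.length (.vert s t t s) f = X.vert q l.length s t f :=
      fun s t => layerSum_of_not_resolvable (h2 s t) _ (fun _ => dif_neg (h2 s t))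
        (fun _ => dif_neg (h2 s t))
    have h4 : ∀ s, X.layerSum q l.length (.vert s (!s) s (!s)) f =
      (if s then (q : K) else ↑q⁻¹) • f +
        (if s then (↑q⁻¹ : K) else q) • X.cup l.length s (X.cap l.length s f) := by
      intro s
      rw [layerSum_vert]
      cases s <;> simp [EPiece.Resolvable, EPiece.NonCrossingLike]
    have h5 := h4 true
    have h6 := h4 false
    rw [Piece.lifts, Finset.sum_image (by
      rintro ⟨⟨_, _⟩, _, _⟩ - ⟨⟨_, _⟩, _, _⟩ - h; cases h; rfl)]
    simp only [Fintype.sum_prod_type, Fintype.sum_bool, h1]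
    -- The unoriented vertex relation is split by orientations. Beside the oriented vertex there
    -- remain the two smoothings with weights `q` and `q⁻¹` of a non-crossing-like vertex; on the
    -- row `false`, `true` the correction of the crossing interchanges these weights.
    refine (vert_apply (X := TangleRep.jaeger X q) _ () ()).trans ?_
    have e1 := jaeger_cap (q := q) hX.toIsPlanar l r hf
    have e2 := hX.jaeger_cross l r .slash hf
    rw [if_pos rfl, if_pos rfl, e1, e2]
    simp only [Bool.not_true, Bool.not_false, if_true, Bool.false_eq_true, if_false] at h5 h6
    cases s <;> cases t <;>
      simp [EPiece.Balanced, EPiece.TopInward, h3, lowLabel, zSign, h5, h6, vert_apply, jaeger_cup, bar]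
        <;> module

open Classical in
/-- A sequence of layers operates as the sum over its states. -/
theorem IsSkein.jaeger_word (hX : X.IsSkein q κ) {w : Layers Piece} {s : List Bool} {t : List Unit}
    (hw : Runs w (s.map fun _ => ()) t) (hf : f ∈ X.deg s) :
    (TangleRep.jaeger X q).word q (labelU w) f =
      ∑ l ∈ lifts w, if IsState l s then X.stateOp q l f else 0 := by
  induction w generalizing s f with
  | nil => simp [labelU, word, lifts, IsState, stateOp]
  | cons x w ih =>
    obtain ⟨r, h1, h2⟩ := hw
    rw [sum_lifts_cons]
    change (TangleRep.jaeger X q).word q (labelU w)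
      ((TangleRep.jaeger X q).opL q x.1 x.2.label f) = _
    rw [hX.jaeger_opL h1 hf, map_sum]
    refine Finset.sum_congr rfl fun e he => ?_
    by_cases h : e.Balanced ∧ ¬ e.TopInward ∧ ∃ t, Step (x.1, e) s t
    · obtain ⟨hb, ha, u, hu⟩ := h
      have hr : r = u.map fun _ => () := by
        refine h1.right_unique ?_
        have := hu.forget
        rwa [Piece.mem_lifts.1 he] at this
      rw [if_pos ⟨hb, ha, u, hu⟩, ih (hr ▸ h2) (layerSum_mem hX.toIsPlanar hu hb ha hf)]
      refine Finset.sum_congr rfl fun l _ => ?_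
      have : IsState ((x.1, e) :: l) s ↔ IsState l u :=
        ⟨fun ⟨_, _, u', h', h''⟩ => h'.right_unique hu ▸ h'', fun h' => ⟨hb, ha, u, hu, h'⟩⟩
      simp only [this]
      rfl
    · rw [if_neg h, map_zero]
      refine (Finset.sum_eq_zero fun l _ => if_neg ?_).symm
      rintro ⟨hb, ha, u, hu, -⟩
      exact h ⟨hb, ha, u, hu⟩

end TangleRep
end KnottedGraph

namespace KnottedGraph
open Labels

/-! ### Compositions of substitutions -/

section
variable {S T : Type} [CommRing S] [CommRing T]

theorem eq_substitute (φ : Coeff →+* S) (x y : Sˣ) (h : IsUnit ((x : S) - ↑x⁻¹))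
    (hq : φ q = x) (ha : φ a = y) : φ = substitute x y h := by
  refine IsLocalization.ringHom_ext (Submonoid.powers (MvPolynomial.X 0 * MvPolynomial.X 1 *
    (MvPolynomial.X 0 ^ 2 - 1) : MvPolynomial (Fin 2) ℤ)) ?_
  refine MvPolynomial.ringHom_ext (fun n => by simp) fun i => ?_
  fin_cases i
  · change φ (algebraMap _ Coeff (MvPolynomial.X 0)) =
      substitute x y h (algebraMap _ Coeff (MvPolynomial.X 0))
    have e : algebraMap (MvPolynomial (Fin 2) ℤ) Coeff (MvPolynomial.X 0) = (q : Coeff) := rfl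
    rw [e, hq, coe_substitute_q]
  · change φ (algebraMap _ Coeff (MvPolynomial.X 1)) =
      substitute x y h (algebraMap _ Coeff (MvPolynomial.X 1))
    have e : algebraMap (MvPolynomial (Fin 2) ℤ) Coeff (MvPolynomial.X 1) = (a : Coeff) := rfl
    rw [e, ha, coe_substitute_a]

theorem substitute_substitute (x y : Sˣ) (h : IsUnit ((x : S) - ↑x⁻¹)) (f : Coeff) :
    substitute x y h (substitute q (a ^ 2 * q⁻¹) isUnit_q_sub f) =
      substitute x (y ^ 2 * x⁻¹) h f := by
  have h1 : ((substitute x y h).comp (substitute q (a ^ 2 * q⁻¹) isUnit_q_sub)) q = x := by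
    rw [RingHom.comp_apply, coe_substitute_q, coe_substitute_q]
  have h2 : ((substitute x y h).comp (substitute q (a ^ 2 * q⁻¹) isUnit_q_sub)) a =
      (y ^ 2 * x⁻¹ : Sˣ) := by
    rw [RingHom.comp_apply, coe_substitute_a, Units.val_mul, map_mul, Units.val_pow_eq_pow_val,
      map_pow, coe_substitute_a, coe_substitute_q_inv, Units.val_mul, Units.val_pow_eq_pow_val]
  rw [← eq_substitute _ x (y ^ 2 * x⁻¹) h h1 h2, RingHom.comp_apply]

/-- Followed by `a = q ^ (m + 1)`, this substitution sends `a` to `q ^ (2 * m + 1)`, and the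
exponents are arbitrarily large. -/
theorem substitute_injective : Function.Injective (substitute q (a ^ 2 * q⁻¹) isUnit_q_sub) := by
  rw [injective_iff_map_eq_zero]
  intro f hf
  refine eq_zero_of_substitute f fun m => ⟨2 * m + 1, by omega, ?_⟩
  have h := congrArg (substitute qOne (qOne ^ (m + 1)) isUnit_qOne_sub) hf
  rw [substitute_substitute, map_zero] at h
  convert h using 3
  rw [eq_mul_inv_iff_mul_eq, ← pow_succ, ← pow_mul]
  congr 1
  omega

theorem map_localWeight (φ : S →+* T) (x : Sˣ) (e : EPiece) (c : e.Resolvable → Turn) :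
    φ (localWeight x e c) = localWeight (Units.map (φ : S →* T) x) e c := by
  cases e with
  | cup | cap => exact map_one φ
  | cross k sw se nw ne =>
    simp only [localWeight]
    split_ifs with hr
    · cases c hr
      exacts [(map_add φ _ _).trans (congrArg (· + _) (map_neg φ _)), map_sub φ _ _]
    · exact map_one φ
  | vert sw se nw ne =>
    simp only [localWeight]
    split_ifs with hr
    · cases c hr <;> rfl
    · exact map_one φ

end

theorem kauffmanVogel_circle (c : Unit) :
    ((q : Coeff) - ↑q⁻¹) * (((a : Coeff) - ↑a⁻¹) * ↑z⁻¹ + 1) =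
      (a : Coeff) - ↑a⁻¹ + if c = bar c then (q : Coeff) - ↑q⁻¹ else 0 := by
  rw [if_pos rfl, mul_add, ← coe_z, mul_left_comm, Units.mul_inv, mul_one, mul_one]

theorem isKauffmanVogel_unique {P P' : Diagram → Coeff} (h : IsKauffmanVogel P)
    (h' : IsKauffmanVogel P') : P = P' := by
  funext D
  rw [← extendU_labelU P, ← extendU_labelU P',
    IsInvariant.unique h.isInvariant h'.isInvariant isUnit_q_sub kauffmanVogel_circle]

/-! ### The generalized Jaeger formula -/

/-- The MOY polynomial of oriented tangles, multiplied by a power of `a⁻¹ q` with the rotation number. -/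
noncomputable def moyRep : TangleRep Coeff (Layers (LPiece Bool) → Coeff) Bool :=
  (functionalRep (extendO moy)).scale (a⁻¹ * q)

/-- The scaling `a⁻¹ * q` is chosen so that the kink factor for `false` becomes `q`, as
`IsSkein.jaeger` demands; for `true` it becomes `a ^ 2 * q⁻¹`. -/
theorem isSkein_moyRep : moyRep.IsSkein q
    (fun c => a * (a⁻¹ * q) ^ (if c then (-1 : ℤ) else 1)) :=
  isMOY_moy.isInvariant.isSkein.scale

theorem mul_zpow_neg_one {G : Type} [CommGroup G] (a q : G) :
    a * (a⁻¹ * q) ^ (-1 : ℤ) = a ^ 2 * q⁻¹ := by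
  rw [zpow_neg_one, mul_inv, inv_inv, sq, mul_assoc]

theorem mul_zpow_one {G : Type} [CommGroup G] (a q : G) : a * (a⁻¹ * q) ^ (1 : ℤ) = q := by
  rw [zpow_one, mul_inv_cancel_left]

theorem isSkein_jaeger_moyRep :
    (TangleRep.jaeger moyRep q).IsSkein q (fun _ => a ^ 2 * q⁻¹) := by
  have h := isSkein_moyRep.jaeger (mul_zpow_one a q)
  rw [if_pos rfl, mul_zpow_neg_one] at h
  exact h

/-- The right-hand side of the Jaeger formula. -/
noncomputable def jaegerSum : Layers (LPiece Unit) → Coeff :=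
  (TangleRep.jaeger moyRep q).closedValue q (extendO moy) (LinearMap.proj [])

theorem isInvariant_jaegerSum : IsInvariant jaegerSum q (fun _ => a ^ 2 * q⁻¹)
    (fun _ => ((a ^ 2 * q⁻¹ : Coeffˣ) - ↑(a ^ 2 * q⁻¹ : Coeffˣ)⁻¹ : Coeff) * ↑z⁻¹ + 1) () := by
  have hR := isMOY_moy.isInvariant
  have m : ∀ o, moyRep.cup 0 o (extendO moy) ∈ moyRep.deg [o, !o] := fun o =>
    isSkein_moyRep.toIsPlanar.cup_mem [] [] rfl mem_functionalRep_nil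
  have e : ∀ o, (TangleRep.jaeger moyRep q).cap 0 () (moyRep.cup 0 o (extendO moy)) =
      (((a⁻¹ * q) ^ (if o then (-1 : ℤ) else 1) : Coeffˣ) : Coeff) •
        ((((a : Coeff) - ↑a⁻¹) * ↑z⁻¹) • extendO moy) := by
    intro o
    refine (TangleRep.IsSkein.jaeger_cap (q := q) isSkein_moyRep.toIsPlanar [] [] (m o)).trans ?_
    rw [if_pos rfl, ← hR.circle_op isUnit_q_sub moy_circle o]
    exact TangleRep.cap_scale_cup o 0 0 1
  refine isSkein_jaeger_moyRep.isInvariant ?_ ?_ ?_ ()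
  · exact TangleRep.mem_jaeger (y := []) rfl mem_functionalRep_nil
  · exact hR.empty
  · intro c
    change (LinearMap.proj [] : (Layers (LPiece Bool) → Coeff) →ₗ[Coeff] Coeff)
      ((TangleRep.jaeger moyRep q).cap 0 () (moyRep.cup 0 true (extendO moy) +
        moyRep.cup 0 false (extendO moy))) = _
    rw [map_add, e, e, map_add, map_smul, map_smul, map_smul, map_smul]
    have h1 : (LinearMap.proj [] : (Layers (LPiece Bool) → Coeff) →ₗ[Coeff] Coeff)
      (extendO moy) = 1 := hR.empty
    rw [h1]
    have hz : ((q : Coeff) - ↑q⁻¹) * ↑z⁻¹ = 1 := by rw [← coe_z, Units.mul_inv]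
    have ha : (a : Coeff) * ↑a⁻¹ = 1 := Units.mul_inv a
    simp only [if_true, Bool.false_eq_true, if_false, zpow_neg_one, zpow_one, mul_inv, inv_inv,
      Units.val_mul, smul_eq_mul, mul_one, Units.val_pow_eq_pow_val, ← inv_pow]
    -- The two orientations of the circle have weights `a * q⁻¹` and `a⁻¹ * q`. In the product of
    -- their sum with `a - a⁻¹` the mixed terms give `q - q⁻¹`, which accounts for the summand `1`.
    linear_combination hz + (↑q - ↑q⁻¹) * ↑z⁻¹ * ha

/-- The parameters of `jaegerSum` are the images of the Kauffman–Vogel parameters under an injective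
substitution. Thus `descend` gives the polynomial and, at the same time, its relation to the state
sum. -/
theorem exists_kauffmanVogel : ∃ P, IsKauffmanVogel P ∧
    ∀ D, substitute q (a ^ 2 * q⁻¹) isUnit_q_sub (P D) = jaegerSum (labelU D.1) := by
  have h : IsInvariant jaegerSum
      (Units.map (substitute q (a ^ 2 * q⁻¹) isUnit_q_sub : Coeff →* Coeff) q)
      (fun _ => Units.map (substitute q (a ^ 2 * q⁻¹) isUnit_q_sub : Coeff →* Coeff) a)
      (fun _ => substitute q (a ^ 2 * q⁻¹) isUnit_q_sub (((a : Coeff) - ↑a⁻¹) * ↑z⁻¹ + 1)) () := by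
    have hz : substitute q (a ^ 2 * q⁻¹) isUnit_q_sub (↑z⁻¹ : Coeff) = ↑z⁻¹ := by
      refine z.isUnit.mul_left_cancel ?_
      rw [Units.mul_inv, coe_z]
      exact substitute_z_mul _ _ _
    rw [substitute_q, substitute_a]
    simp only [map_add, map_mul, map_sub, map_one, hz, coe_substitute_a, coe_substitute_a_inv]
    exact isInvariant_jaegerSum
  obtain ⟨G, hG, e⟩ := IsInvariant.descend _ substitute_injective h isUnit_q_sub
    kauffmanVogel_circle
  exact ⟨_, hG.isKauffmanVogel, fun D => e _⟩

theorem isKauffmanVogel_kauffmanVogel : IsKauffmanVogel kauffmanVogel := by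
  obtain ⟨P, hP, -⟩ := exists_kauffmanVogel
  exact Classical.epsilon_spec ⟨P, hP⟩

theorem substitute_kauffmanVogel (D : Diagram) :
    substitute q (a ^ 2 * q⁻¹) isUnit_q_sub (kauffmanVogel D) = jaegerSum (labelU D.1) := by
  obtain ⟨P, hP, e⟩ := exists_kauffmanVogel
  rw [isKauffmanVogel_unique isKauffmanVogel_kauffmanVogel hP, e]

/-- Scaling collects the turning of all layers into the rotation number, and the unscaled word
evaluates to the MOY polynomial. -/
theorem proj_moyRep_word (D : ODiagram) :
    moyRep.word q (labelO D.1) (extendO moy) [] =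
      (((a⁻¹ * q) ^ rot D : Coeffˣ) : Coeff) * moy D := by
  have h : (functionalRep (extendO moy)).word q (labelO D.1) (extendO moy) =
      precompose (labelO D.1) (extendO moy) :=
    isMOY_moy.isInvariant.word_eq_precompose (runs_labelO.2 D.2) mem_functionalRep_nil
  rw [moyRep, TangleRep.scale_word, LinearMap.smul_apply, h]
  change _ * extendO moy (labelO D.1 ++ []) = _
  rw [List.append_nil, extendO_labelO]
  rfl

open Classical in
theorem jaegerSum_labelU (D : Diagram) : jaegerSum (labelU D.1) =
    ∑ ρ : AdmissibleOrientation D, ∑ ς : ρ.Resolution,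
      (((a⁻¹ * q) ^ rot (ρ.resolve ς) : Coeffˣ) : Coeff) * ρ.weight q ς * moy (ρ.resolve ς) := by
  have h0 : extendO moy ∈ moyRep.deg [] := mem_functionalRep_nil
  rw [jaegerSum, TangleRep.closedValue_of_runs (runs_labelU.2 D.2),
    isSkein_moyRep.jaeger_word (s := []) D.2 h0, ← Finset.sum_filter, map_sum]
  symm
  refine Finset.sum_nbij (fun ρ => ρ.layers) ?_ ?_ ?_ ?_
  · intro ρ _
    exact Finset.mem_filter.2 ⟨mem_lifts.2 ρ.forget_eq,
      isState_iff.2 ⟨⟨_, ρ.closed⟩, ρ.balanced, ρ.admissible⟩⟩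
  · rintro ⟨⟩ - ⟨⟩ - h
    simpa using h
  · intro l hl
    obtain ⟨h1, h2⟩ := Finset.mem_filter.1 hl
    obtain ⟨⟨t, h3⟩, h4, h5⟩ := isState_iff.1 h2
    have h6 := h3.forget
    rw [mem_lifts.1 h1] at h6
    -- The last row of a state is empty since the underlying unoriented diagram is closed.
    have h7 := List.map_eq_nil_iff.1 (h6.right_unique D.2)
    exact ⟨⟨l, h7 ▸ h3, mem_lifts.1 h1, h4, h5⟩, Finset.mem_coe.2 (Finset.mem_univ _), rfl⟩
  · intro ρ _
    rw [TangleRep.stateOp_eq, LinearMap.sum_apply, map_sum]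
    refine Finset.sum_congr rfl fun ς _ => ?_
    rw [LinearMap.smul_apply, map_smul, smul_eq_mul, mul_right_comm, mul_comm]
    exact congrArg _ (proj_moyRep_word (ρ.resolve ς)).symm

theorem jaeger_formula (D : Diagram) :
    substitute q (a ^ 2 * q⁻¹) isUnit_q_sub (kauffmanVogel D) =
      ∑ ρ : AdmissibleOrientation D, ∑ ς : ρ.Resolution,
        (((a⁻¹ * q) ^ rot (ρ.resolve ς) : Coeffˣ) : Coeff) * ρ.weight q ς *
          moy (ρ.resolve ς) :=
  (substitute_kauffmanVogel D).trans (jaegerSum_labelU D)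

/-- Under `a = q ^ N` the element `a ^ 2 * q⁻¹` becomes `q ^ (2 * N - 1)`, the value of `a` for `M =
2 * N`, and `a⁻¹ * q` becomes `q ^ (1 - N)`. -/
theorem jaeger_formula_special (D : Diagram) (N : ℕ) :
    soKauffmanVogel (2 * N) D =
      ∑ ρ : AdmissibleOrientation D, ∑ ς : ρ.Resolution,
        ((qOne ^ (-((N : ℤ) - 1) * rot (ρ.resolve ς)) : CoeffOneˣ) : CoeffOne) *
          ρ.weight qOne ς * slMOY N (ρ.resolve ς) := by
  have h := congrArg (substitute qOne (qOne ^ N) isUnit_qOne_sub) (jaeger_formula D)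
  have hu : (qOne ^ N) ^ 2 * qOne⁻¹ = qOne ^ (((2 * N : ℕ) : ℤ) - 1) := by
    rw [zpow_sub_one, zpow_natCast, ← pow_mul, mul_comm N]
  rw [substitute_substitute, hu] at h
  refine h.trans ?_
  rw [map_sum]
  refine Finset.sum_congr rfl fun ρ _ => ?_
  rw [map_sum]
  refine Finset.sum_congr rfl fun ς _ => ?_
  rw [map_mul, map_mul]
  congr 2
  · have e : Units.map (substitute qOne (qOne ^ N) isUnit_qOne_sub : Coeff →* CoeffOne)
        ((a⁻¹ * q) ^ rot (ρ.resolve ς)) = qOne ^ (-((N : ℤ) - 1) * rot (ρ.resolve ς)) := by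
      rw [map_zpow, map_mul, map_inv, substitute_q, substitute_a, zpow_mul]
      congr 1
      rw [neg_sub, zpow_sub, zpow_one, zpow_natCast]
      exact mul_comm _ _
    exact congrArg Units.val e
  · rw [AdmissibleOrientation.weight, map_prod]
    refine Finset.prod_congr rfl fun k _ => ?_
    rw [map_localWeight, substitute_q]

end KnottedGraph

open KnottedGraph
theorem mainTheorem1 :
    (∃! P : Diagram → Coeff, IsKauffmanVogel P) ∧
    (∃! R : ODiagram → Coeff, IsMOY R) ∧
    ∀ D : Diagram,
      substitute q (a ^ 2 * q⁻¹) isUnit_q_sub (kauffmanVogel D) =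
        ∑ ρ : AdmissibleOrientation D, ∑ ς : ρ.Resolution,
          (((a⁻¹ * q) ^ rot (ρ.resolve ς) : Coeffˣ) : Coeff) * ρ.weight q ς *
            moy (ρ.resolve ς) ∧
      ∀ N : ℕ, 1 ≤ N →
        soKauffmanVogel (2 * N) D =
          ∑ ρ : AdmissibleOrientation D, ∑ ς : ρ.Resolution,
            ((qOne ^ (-((N : ℤ) - 1) * rot (ρ.resolve ς)) : CoeffOneˣ) : CoeffOne) *
              ρ.weight qOne ς * slMOY N (ρ.resolve ς) := by
  refine ⟨⟨kauffmanVogel, isKauffmanVogel_kauffmanVogel,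
    fun P hP => isKauffmanVogel_unique hP isKauffmanVogel_kauffmanVogel⟩,
    ⟨moy, isMOY_moy, fun R hR => isMOY_unique hR isMOY_moy⟩, fun D => ⟨jaeger_formula D,
      fun N _ => jaeger_formula_special D N⟩⟩
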